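/- **Conventions.** All algebras are complex. Let $\mathcal G$ be a locally compact Hausdorff groupoid with unit space $U$, range and source maps $r,s$, and a (left) Haar system $(\lambda^u)_{u\in U}$ (Radon measures of full support on the fibres $\mathcal G^u=r^{-1}(u)$, continuous in $u$ and left invariant). A $\mathcal G$-Banach algebra $B$ is an upper semi-continuous field $(B_u)_{u\in U}$ of Banach algebras with an isometric isomorphism $\alpha\colon s^*B\to r^*B$ of fields of Banach algebras such that $\alpha_{\gamma\gamma'}=\alpha_\gamma\alpha_{\gamma'}$. The space $\Gamma_c(\mathcal G,r^*B)$ of compactly supported continuous sections is an algebra for $(f*g)(\gamma)=\int_{\mathcal G^{r(\gamma)}}f(\delta)\,\alpha_\delta\bigl(g(\delta^{-1}\gamma)\bigr)\,d\lambda^{r(\gamma)}(\delta)$. An unconditional completion $\mathcal A(\mathcal G)$ of $C_c(\mathcal G)$ is given by a (semi-)norm $\|\cdot\|_{\mathcal A}$ on $C_c(\mathcal G)$ that is submultiplicative for convolution and such that $|\varphi_1|\le|\varphi_2|$ pointwise implies $\|\varphi_1\|_{\mathcal A}\le\|\varphi_2\|_{\mathcal A}$. For non-negative bounded $\varphi$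 with compact support put $\|\varphi\|_{\mathcal A}=\inf\{\|\psi\|_{\mathcal A}:\psi\in C_c(\mathcal G),\ \psi\ge\varphi\}$. The Banach algebra $\mathcal A(\mathcal G,B)$ is the Hausdorff completion of $\Gamma_c(\mathcal G,r^*B)$ for the semi-norm $\|f\|=\bigl\|\gamma\mapsto\|f(\gamma)\|\bigr\|_{\mathcal A}$. For a locally compact Hausdorff space $X$ and a Banach algebra $A$ let $AX=C_0(X,A)$ and $SA=C_0(\mathbb R,A)$. Let $BX$ be the $\mathcal G$-Banach algebra with fibres $C_0(X,B_u)$ (the push-forward to $U$ of the pullback of $B$ to $U\times X$) and pointwise action, and let $SB=B\mathbb R$. A $C_0(X)$-Banach algebra is a Banach algebra $A$ that is a non-degenerate Banach $C_0(X)$-module with $C_0(X)$-bilinear product; its fibre at $x\in X$ is $A_x=A/\overline{C_0(X\setminus\{x\})A}$ with the quotient norm. A homomorphism of Banach algebras is *full* if it is contractive, preserves the spectral radius of every element, and has dense range. $K_n$, $n\in\mathbb N_0$, is topological K-theory of Banach algebras: $K_0$ is defined by idempotents and $K_1$ by invertibles over the unitalisation, and $K_{n+1}(A)=K_n(SA)$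 for $n\ge1$. **Statement.** Let $\mathcal A(\mathcal G)$ be an unconditional completion of $C_c(\mathcal G)$ and $B$ a $\mathcal G$-Banach algebra. 1. Let $X$ be a locally compact Hausdorff space. Then $\mathcal A(\mathcal G,BX)$, with $(\chi f)(\gamma)=\chi\cdot f(\gamma)$ for $\chi\in C_0(X)$, $f\in\Gamma_c(\mathcal G,r^*BX)$, and $\mathcal A(\mathcal G,B)X$ are $C_0(X)$-Banach algebras, and there is a (unique) homomorphism $$\iota\colon\mathcal A(\mathcal G,BX)\to\mathcal A(\mathcal G,B)X,\qquad \iota(f)(x)=\bigl[\gamma\mapsto f(\gamma)(x)\bigr]\quad(f\in\Gamma_c(\mathcal G,r^*BX),\ x\in X).$$ It is contractive, $C_0(X)$-linear, and an isometric isomorphism on the fibres: for each $x\in X$ it induces an isometric isomorphism $\mathcal A(\mathcal G,BX)_x\cong(\mathcal A(\mathcal G,B)X)_x$. If $X$ is second countable, then $\iota$ is full, and $\iota_*\colon K_n(\mathcal A(\mathcal G,BX))\to K_n(\mathcal A(\mathcal G,B)X)$ is an isomorphism for all $n\in\mathbb N_0$. 2. For $X=\mathbb R$ this gives, for all $n\in\mathbb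 N_0$, $$K_n(\mathcal A(\mathcal G,SB))\cong K_n(S\mathcal A(\mathcal G,B))\cong K_{n+1}(\mathcal A(\mathcal G,B)),$$ the first isomorphism being $\iota_*$. 3. The same holds for a locally compact Hausdorff group $G$ with a left Haar measure, an unconditional completion $\mathcal A(G)$ of $C_c(G)$, and a $G$-Banach algebra $B$ (a Banach algebra with a strongly continuous action of $G$ by isometric automorphisms). -/

import Mathlib

open CategoryTheory MeasureTheory Topology Filter
open scoped CompactlySupported ZeroAtInfty

set_option linter.all false

noncomputable section

namespace BanachGroupoid

universe u w v

/-! ### Locally compact groupoids and Haar systems -/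

/-- The arrow space of a groupoid with unit space `U`. An arrow `γ : x ⟶ y` has source `s(γ) = x`
and range `r(γ) = y`, so that the product `γ γ'` of groupoid theory is `γ' ≫ γ`. -/
structure Arr (U : Type u) [Groupoid.{w} U] where
  {src tgt : U}
  hom : src ⟶ tgt

/-- The range fibre `𝒢ˣ = {γ | r(γ) = x}`. -/
structure Fib {U : Type u} [Groupoid.{w} U] (x : U) where
  {src : U}
  hom : src ⟶ x

/-- Composable pairs of arrows. -/
structure Composable (U : Type u) [Groupoid.{w} U] where
  {x y z : U}
  fst : x ⟶ y
  snd : y ⟶ z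

/-- Pairs of arrows having the same range. -/
structure FibPair (U : Type u) [Groupoid.{w} U] where
  {x : U}
  fst : Fib x
  snd : Fib x

section Basic

variable {U : Type u} [Groupoid.{w} U]

/-- An element of a range fibre, as an arrow. -/
def Fib.toArr {x : U} (a : Fib x) : Arr U := ⟨a.hom⟩

/-- Left translation `𝒢ˣ → 𝒢ʸ`, `a ↦ γ a` by an arrow `γ` from `x` to `y`. -/
def Fib.translate {x y : U} (γ : x ⟶ y) (a : Fib x) : Fib y := ⟨a.hom ≫ γ⟩

/-- The arrow `a⁻¹ c`, for arrows `a`, `c` with the same range. -/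
def Fib.ldiv {x : U} (a c : Fib x) : Arr U := ⟨c.hom ≫ Groupoid.inv a.hom⟩

lemma exists_fib {x : U} (γ : Arr U) (h : γ.tgt = x) : ∃ a : Fib x, a.toArr = γ := by
  subst h
  exact ⟨⟨γ.hom⟩, rfl⟩

end Basic

section Topology

variable {U : Type u} [Groupoid.{w} U] [TopologicalSpace (Arr U)]

instance (x : U) : TopologicalSpace (Fib x) :=
  TopologicalSpace.induced Fib.toArr inferInstance

instance (x : U) : MeasurableSpace (Fib x) := borel _

instance (x : U) : BorelSpace (Fib x) := ⟨rfl⟩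

instance : TopologicalSpace (Composable U) :=
  TopologicalSpace.induced (fun p => ((⟨p.fst⟩, ⟨p.snd⟩) : Arr U × Arr U)) inferInstance

instance : TopologicalSpace (FibPair U) :=
  TopologicalSpace.induced (fun p => (p.fst.toArr, p.snd.toArr)) inferInstance

end Topology

/-- A topological groupoid: range, source, units, inversion and multiplication are continuous
(the set of composable pairs carries the subspace topology of `𝒢 × 𝒢`). -/
class IsTopologicalGroupoid (U : Type u) [Groupoid.{w} U] [TopologicalSpace U]
    [TopologicalSpace (Arr U)] : Prop where
  continuous_src : Continuous (fun γ : Arr U => γ.src)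
  continuous_tgt : Continuous (fun γ : Arr U => γ.tgt)
  continuous_id : Continuous (fun x : U => (⟨𝟙 x⟩ : Arr U))
  continuous_inv : Continuous (fun γ : Arr U => (⟨Groupoid.inv γ.hom⟩ : Arr U))
  continuous_comp : Continuous (fun p : Composable U => (⟨p.fst ≫ p.snd⟩ : Arr U))

/-- A (left) Haar system: Radon measures `λˣ` on the range fibres, of full support, depending
continuously on `x` and invariant under left translation. -/
structure HaarSystem (U : Type u) [Groupoid.{w} U] [TopologicalSpace U]
    [TopologicalSpace (Arr U)] where
  measure : ∀ x : U, Measure (Fib x)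
  regular : ∀ x, (measure x).Regular
  full_support : ∀ x, (measure x).IsOpenPosMeasure
  continuous_integral : ∀ f : C_c(Arr U, ℝ), Continuous fun x => ∫ a, f (Fib.toArr a) ∂measure x
  map_translate : ∀ {x y : U} (γ : x ⟶ y), (measure x).map (Fib.translate γ) = measure y

section TopLemmas

variable {U : Type u} [Groupoid.{w} U] [TopologicalSpace U] [TopologicalSpace (Arr U)]

lemma continuous_toArr (x : U) : Continuous (Fib.toArr : Fib x → Arr U) := continuous_induced_dom

lemma continuous_mk_fib {Z : Type*} [TopologicalSpace Z] {x : U} {f : Z → Fib x}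
    (h : Continuous fun z => (f z).toArr) : Continuous f := continuous_induced_rng.2 h

lemma continuous_fibPair_fst : Continuous (fun p : FibPair U => p.fst.toArr) :=
  continuous_fst.comp (continuous_induced_dom (f := fun p : FibPair U =>
    (p.fst.toArr, p.snd.toArr)))

lemma continuous_fibPair_snd : Continuous (fun p : FibPair U => p.snd.toArr) :=
  continuous_snd.comp (continuous_induced_dom (f := fun p : FibPair U =>
    (p.fst.toArr, p.snd.toArr)))

variable [IsTopologicalGroupoid U]

lemma continuous_fibPair_x : Continuous (fun p : FibPair U => p.x) :=
  IsTopologicalGroupoid.continuous_tgt.comp continuous_fibPair_snd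

lemma continuous_ldiv : Continuous (fun p : FibPair U => Fib.ldiv p.fst p.snd) := by
  have h : Continuous (fun p : FibPair U =>
      (⟨p.snd.hom, Groupoid.inv p.fst.hom⟩ : Composable U)) :=
    continuous_induced_rng.2 (continuous_fibPair_snd.prodMk
      (IsTopologicalGroupoid.continuous_inv.comp continuous_fibPair_fst))
  exact IsTopologicalGroupoid.continuous_comp.comp h

lemma continuous_translate {x y : U} (γ : x ⟶ y) : Continuous (Fib.translate γ) := by
  apply continuous_mk_fib
  have h : Continuous (fun a : Fib x => (⟨a.hom, γ⟩ : Composable U)) :=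
    continuous_induced_rng.2 ((continuous_toArr x).prodMk
      (continuous_const (y := (⟨γ⟩ : Arr U))))
  exact IsTopologicalGroupoid.continuous_comp.comp h

lemma t2_units [T2Space (Arr U)] : T2Space U :=
  T2Space.of_injective_continuous (f := fun x : U => (⟨𝟙 x⟩ : Arr U))
    (fun _ _ h => congrArg Arr.src h) IsTopologicalGroupoid.continuous_id

lemma toArr_injective (x : U) : Function.Injective (Fib.toArr : Fib x → Arr U) := by
  rintro ⟨a⟩ ⟨b⟩ h
  simp only [Fib.toArr, Arr.mk.injEq] at h
  obtain ⟨rfl, -, h⟩ := h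
  cases h
  rfl

lemma isClosedEmbedding_toArr [T2Space (Arr U)] (x : U) :
    IsClosedEmbedding (Fib.toArr : Fib x → Arr U) := by
  have : T2Space U := t2_units
  refine ⟨⟨⟨rfl⟩, toArr_injective x⟩, ?_⟩
  have : Set.range (Fib.toArr : Fib x → Arr U) = {γ | γ.tgt = x} := by
    ext γ
    constructor
    · rintro ⟨a, rfl⟩
      rfl
    · rintro rfl
      exact ⟨⟨γ.hom⟩, rfl⟩
  rw [this]
  exact isClosed_eq IsTopologicalGroupoid.continuous_tgt continuous_const

lemma isCompact_mul [T2Space (Arr U)] {K L : Set (Arr U)} (hK : IsCompact K) (hL : IsCompact L) :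
    IsCompact {γ : Arr U | ∃ (x : U) (a c : Fib x), c.toArr = γ ∧ a.toArr ∈ K ∧ Fib.ldiv a c ∈ L} := by
  have : T2Space U := t2_units
  have hemb : IsClosedEmbedding (fun p : Composable U => ((⟨p.fst⟩, ⟨p.snd⟩) : Arr U × Arr U)) := by
    refine ⟨⟨⟨rfl⟩, ?_⟩, ?_⟩
    · rintro ⟨a, b⟩ ⟨c, d⟩ h
      simp only [Prod.mk.injEq, Arr.mk.injEq] at h
      obtain ⟨⟨rfl, rfl, h1⟩, -, rfl, h2⟩ := h
      cases h1
      cases h2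
      rfl
    · have : Set.range (fun p : Composable U => ((⟨p.fst⟩, ⟨p.snd⟩) : Arr U × Arr U))
          = {q | q.1.tgt = q.2.src} := by
        ext ⟨⟨a⟩, ⟨b⟩⟩
        constructor
        · rintro ⟨p, hp⟩
          have h1 := congrArg (fun q : Arr U × Arr U => q.1.tgt) hp
          have h2 := congrArg (fun q : Arr U × Arr U => q.2.src) hp
          exact h1.symm.trans h2
        · intro h
          simp only [Set.mem_ofPred_eq] at h
          subst h
          exact ⟨⟨a, b⟩, rfl⟩
      rw [this]
      exact isClosed_eq (IsTopologicalGroupoid.continuous_tgt.comp continuous_fst)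
        (IsTopologicalGroupoid.continuous_src.comp continuous_snd)
  have hc := (hemb.isCompact_preimage (hL.prod hK)).image
    (IsTopologicalGroupoid.continuous_comp (U := U))
  convert hc using 1
  ext γ
  constructor
  · rintro ⟨x, a, c, rfl, ha, hd⟩
    refine ⟨⟨c.hom ≫ Groupoid.inv a.hom, a.hom⟩, ⟨hd, ha⟩, ?_⟩
    simp [Fib.toArr]
  · rintro ⟨p, ⟨h1, h2⟩, rfl⟩
    refine ⟨p.z, ⟨p.snd⟩, ⟨p.fst ≫ p.snd⟩, rfl, h2, ?_⟩
    have : Fib.ldiv (⟨p.snd⟩ : Fib p.z) ⟨p.fst ≫ p.snd⟩ = (⟨p.fst⟩ : Arr U) := by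
      simp [Fib.ldiv]
    rw [this]
    exact h1

end TopLemmas

/-! ### Upper semi-continuous fields of Banach algebras and groupoid Banach algebras -/

/-- An upper semi-continuous field of (complex) Banach algebras over `X`: a family of Banach
algebras together with the space of its continuous sections. -/
structure BanachAlgebraField (X : Type u) [TopologicalSpace X] where
  fib : X → Type v
  [ring : ∀ x, NonUnitalNormedRing (fib x)]
  [space : ∀ x, NormedSpace ℂ (fib x)]
  [tower : ∀ x, IsScalarTower ℂ (fib x) (fib x)]
  [comm : ∀ x, SMulCommClass ℂ (fib x) (fib x)]
  [complete : ∀ x, CompleteSpace (fib x)]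
  /-- the continuous sections -/
  sections : Submodule ℂ (∀ x, fib x)
  dense_eval : ∀ x, Dense {b : fib x | ∃ ξ ∈ sections, ξ x = b}
  usc_norm : ∀ ξ ∈ sections, UpperSemicontinuous fun x => ‖ξ x‖
  /-- a section which can be locally uniformly approximated by continuous sections is continuous -/
  mem_of_local : ∀ ξ : ∀ x, fib x,
    (∀ x₀, ∀ ε > 0, ∃ η ∈ sections, ∀ᶠ x in 𝓝 x₀, ‖ξ x - η x‖ < ε) → ξ ∈ sections
  mul_mem : ∀ ξ ∈ sections, ∀ η ∈ sections, (fun x => ξ x * η x) ∈ sections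

attribute [instance] BanachAlgebraField.ring BanachAlgebraField.space BanachAlgebraField.tower
  BanachAlgebraField.comm BanachAlgebraField.complete

namespace BanachAlgebraField

variable {X : Type u} [TopologicalSpace X] (B : BanachAlgebraField.{u, v} X)

/-- The continuous sections of the pullback field `p^*B` along `p : Z → X`: those which are locally
uniform limits of pullbacks of continuous sections of `B`. -/
def IsPullbackSection {Z : Type*} [TopologicalSpace Z] (p : Z → X) (F : ∀ z, B.fib (p z)) : Prop :=
  ∀ z₀, ∀ ε > 0, ∃ ξ ∈ B.sections, ∀ᶠ z in 𝓝 z₀, ‖F z - ξ (p z)‖ < ε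

variable {B}

lemma exists_section_near (x : X) (b : B.fib x) {ε : ℝ} (hε : 0 < ε) :
    ∃ ξ ∈ B.sections, ‖b - ξ x‖ < ε := by
  obtain ⟨_, h, ξ, hξ, rfl⟩ := Metric.dense_iff.1 (B.dense_eval x) b ε hε
  refine ⟨ξ, hξ, ?_⟩
  rw [← dist_eq_norm, dist_comm]
  exact h

variable {Z : Type*} [TopologicalSpace Z] {p : Z → X}

lemma isPullbackSection_of_mem {ξ : ∀ x, B.fib x} (hξ : ξ ∈ B.sections) (p : Z → X) :
    B.IsPullbackSection p (fun z => ξ (p z)) := fun z₀ ε hε =>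
  ⟨ξ, hξ, Eventually.of_forall fun z => by simpa using hε⟩

namespace IsPullbackSection

lemma add {F G : ∀ z, B.fib (p z)} (hF : B.IsPullbackSection p F) (hG : B.IsPullbackSection p G) :
    B.IsPullbackSection p (fun z => F z + G z) := by
  intro z₀ ε hε
  obtain ⟨ξ, hξ, h1⟩ := hF z₀ (ε / 2) (half_pos hε)
  obtain ⟨η, hη, h2⟩ := hG z₀ (ε / 2) (half_pos hε)
  refine ⟨ξ + η, B.sections.add_mem hξ hη, ?_⟩
  filter_upwards [h1, h2] with z h1 h2
  calc ‖F z + G z - (ξ + η) (p z)‖ = ‖(F z - ξ (p z)) + (G z - η (p z))‖ := by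
        congr 1; simp only [Pi.add_apply]; abel
    _ ≤ _ := norm_add_le _ _
    _ < ε := by linarith

lemma const_smul {F : ∀ z, B.fib (p z)} (hF : B.IsPullbackSection p F) (c : ℂ) :
    B.IsPullbackSection p (fun z => c • F z) := by
  intro z₀ ε hε
  have hc : 0 < ‖c‖ + 1 := by positivity
  obtain ⟨ξ, hξ, h1⟩ := hF z₀ (ε / (‖c‖ + 1)) (by positivity)
  refine ⟨c • ξ, B.sections.smul_mem c hξ, ?_⟩
  filter_upwards [h1] with z h1
  rw [Pi.smul_apply, ← smul_sub, norm_smul]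
  rw [lt_div_iff₀ hc] at h1
  nlinarith [norm_nonneg (F z - ξ (p z)), norm_nonneg c]

lemma zero (p : Z → X) : B.IsPullbackSection p (fun _ => 0) :=
  isPullbackSection_of_mem B.sections.zero_mem p

lemma sub {F G : ∀ z, B.fib (p z)} (hF : B.IsPullbackSection p F) (hG : B.IsPullbackSection p G) :
    B.IsPullbackSection p (fun z => F z - G z) := by
  have := hF.add (hG.const_smul (-1))
  simpa [sub_eq_add_neg] using this

lemma sum {ι : Type*} (s : Finset ι) {F : ι → ∀ z, B.fib (p z)}
    (hF : ∀ i ∈ s, B.IsPullbackSection p (F i)) :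
    B.IsPullbackSection p (fun z => ∑ i ∈ s, F i z) := by
  classical
  induction s using Finset.induction_on with
  | empty => simpa using zero p
  | insert a s ha ih =>
    simp only [Finset.sum_insert ha]
    exact (hF a (Finset.mem_insert_self _ _)).add
      (ih fun i hi => hF i (Finset.mem_insert_of_mem hi))

lemma comp {F : ∀ z, B.fib (p z)} (hF : B.IsPullbackSection p F)
    {W : Type*} [TopologicalSpace W] {q : W → Z} (hq : Continuous q) :
    B.IsPullbackSection (fun w => p (q w)) (fun w => F (q w)) := by
  intro w ε hε
  obtain ⟨ξ, hξ, h⟩ := hF (q w) ε hε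
  exact ⟨ξ, hξ, hq.continuousAt.eventually h⟩

lemma norm_lt {F : ∀ z, B.fib (p z)} (hF : B.IsPullbackSection p F) (hp : Continuous p)
    {z₀ : Z} {c : ℝ} (h : ‖F z₀‖ < c) : ∀ᶠ z in 𝓝 z₀, ‖F z‖ < c := by
  set ε := (c - ‖F z₀‖) / 3 with hεd
  have hε : 0 < ε := by rw [hεd]; linarith
  obtain ⟨ξ, hξ, h1⟩ := hF z₀ ε hε
  have h2 : ‖ξ (p z₀)‖ < c - ε := by
    have := h1.self_of_nhds
    have h3 : ‖ξ (p z₀)‖ ≤ ‖F z₀‖ + ‖F z₀ - ξ (p z₀)‖ := by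
      have := norm_sub_le (F z₀) (F z₀ - ξ (p z₀))
      simpa using this
    linarith
  have h3 := hp.continuousAt.eventually (B.usc_norm ξ hξ (p z₀) _ h2)
  filter_upwards [h1, h3] with z h1 h3
  have h4 : ‖F z‖ ≤ ‖F z - ξ (p z)‖ + ‖ξ (p z)‖ := by
    have := norm_add_le (F z - ξ (p z)) (ξ (p z))
    simpa using this
  linarith

lemma of_local {F : ∀ z, B.fib (p z)} (h : ∀ z₀, ∀ ε > 0, ∃ G : ∀ z, B.fib (p z),
    B.IsPullbackSection p G ∧ ∀ᶠ z in 𝓝 z₀, ‖F z - G z‖ < ε) : B.IsPullbackSection p F := by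
  intro z₀ ε hε
  obtain ⟨G, hG, h1⟩ := h z₀ (ε / 2) (half_pos hε)
  obtain ⟨ξ, hξ, h2⟩ := hG z₀ (ε / 2) (half_pos hε)
  refine ⟨ξ, hξ, ?_⟩
  filter_upwards [h1, h2] with z h1 h2
  have := norm_sub_le_norm_sub_add_norm_sub (F z) (G z) (ξ (p z))
  linarith

lemma mul {F G : ∀ z, B.fib (p z)} (hF : B.IsPullbackSection p F) (hG : B.IsPullbackSection p G)
    (hp : Continuous p) : B.IsPullbackSection p (fun z => F z * G z) := by
  intro z₀ ε hε
  set M := ‖F z₀‖ + ‖G z₀‖ + 2 with hM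
  have hM0 : 0 < M := by positivity
  set δ := min 1 (ε / (2 * M)) with hδd
  have hδ : 0 < δ := by positivity
  obtain ⟨ξ, hξ, h1⟩ := hF z₀ δ hδ
  obtain ⟨η, hη, h2⟩ := hG z₀ δ hδ
  have h3 := hF.norm_lt hp (z₀ := z₀) (c := M - 1) (by rw [hM]; linarith [norm_nonneg (G z₀)])
  have h4 := hG.norm_lt hp (z₀ := z₀) (c := M - 1) (by rw [hM]; linarith [norm_nonneg (F z₀)])
  refine ⟨fun x => ξ x * η x, B.mul_mem ξ hξ η hη, ?_⟩
  filter_upwards [h1, h2, h3, h4] with z h1 h2 h3 h4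
  have hη' : ‖η (p z)‖ ≤ M := by
    have := norm_sub_le (G z) (G z - η (p z))
    have h5 : δ ≤ 1 := min_le_left _ _
    rw [sub_sub_cancel] at this
    linarith
  have h5 : δ * (2 * M) ≤ ε := by
    have : δ ≤ ε / (2 * M) := min_le_right _ _
    rwa [le_div_iff₀ (by positivity)] at this
  have h6 : F z * G z - ξ (p z) * η (p z)
      = F z * (G z - η (p z)) + (F z - ξ (p z)) * η (p z) := by
    rw [mul_sub, sub_mul]; abel
  calc ‖F z * G z - ξ (p z) * η (p z)‖
      ≤ ‖F z * (G z - η (p z))‖ + ‖(F z - ξ (p z)) * η (p z)‖ := by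
        rw [h6]; exact norm_add_le _ _
    _ ≤ ‖F z‖ * ‖G z - η (p z)‖ + ‖F z - ξ (p z)‖ * ‖η (p z)‖ :=
        add_le_add (norm_mul_le _ _) (norm_mul_le _ _)
    _ < ε := by
        nlinarith [norm_nonneg (F z), norm_nonneg (G z - η (p z)), norm_nonneg (F z - ξ (p z)),
          norm_nonneg (η (p z))]

lemma smul {F : ∀ z, B.fib (p z)} (hF : B.IsPullbackSection p F) (hp : Continuous p)
    {φ : Z → ℂ} (hφ : Continuous φ) : B.IsPullbackSection p (fun z => φ z • F z) := by
  apply of_local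
  intro z₀ ε hε
  refine ⟨fun z => φ z₀ • F z, hF.const_smul _, ?_⟩
  set M := ‖F z₀‖ + 1 with hM
  have hM0 : 0 < M := by positivity
  have h1 := hF.norm_lt hp (z₀ := z₀) (c := M) (by rw [hM]; linarith)
  have h2 := Metric.tendsto_nhds.1 (hφ.tendsto z₀) (ε / M) (by positivity)
  filter_upwards [h1, h2] with z h1 h2
  rw [← sub_smul, norm_smul, ← dist_eq_norm]
  rw [lt_div_iff₀ hM0] at h2
  nlinarith [norm_nonneg (F z), dist_nonneg (x := φ z) (y := φ z₀)]

lemma continuous {x : X} {F : Z → B.fib x} (hF : B.IsPullbackSection (fun _ : Z => x) F) :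
    Continuous F := by
  rw [continuous_iff_continuousAt]
  intro z₀
  rw [ContinuousAt, Metric.tendsto_nhds]
  intro ε hε
  obtain ⟨ξ, hξ, h⟩ := hF z₀ (ε / 2) (half_pos hε)
  have h0 := h.self_of_nhds
  filter_upwards [h] with z hz
  rw [dist_eq_norm]
  have := norm_sub_le_norm_sub_add_norm_sub (F z) (ξ x) (F z₀)
  rw [norm_sub_rev (ξ x)] at this
  linarith

end IsPullbackSection

lemma mem_sections_iff {ξ : ∀ x, B.fib x} :
    ξ ∈ B.sections ↔ B.IsPullbackSection (fun x => x) ξ :=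
  ⟨fun h => isPullbackSection_of_mem h _, fun h => B.mem_of_local ξ h⟩

end BanachAlgebraField

/-- A Banach algebra with an action of the groupoid: an upper semi-continuous field `B` of Banach
algebras over the unit space with an isometric isomorphism `α : s^*B → r^*B` of fields of Banach
algebras such that `α_{γγ'} = α_γ α_{γ'}`. -/
structure GBanachAlgebra (U : Type u) [Groupoid.{w} U] [TopologicalSpace U]
    [TopologicalSpace (Arr U)] extends BanachAlgebraField.{u, v} U where
  act : ∀ {x y : U}, (x ⟶ y) → (fib x ≃ₗᵢ[ℂ] fib y)
  act_mul : ∀ {x y : U} (γ : x ⟶ y) (b c : fib x), act γ (b * c) = act γ b * act γ c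
  act_comp : ∀ {x y z : U} (γ : x ⟶ y) (δ : y ⟶ z) (b : fib x), act (γ ≫ δ) b = act δ (act γ b)
  act_continuous : ∀ ξ : ∀ γ : Arr U, fib γ.src,
    toBanachAlgebraField.IsPullbackSection (fun γ : Arr U => γ.src) ξ →
    toBanachAlgebraField.IsPullbackSection (fun γ : Arr U => γ.tgt) fun γ => act γ.hom (ξ γ)

section Act

variable {U : Type u} [Groupoid.{w} U] [TopologicalSpace U] [TopologicalSpace (Arr U)]
  {B : GBanachAlgebra.{u, w, v} U}

lemma GBanachAlgebra.act_isPullbackSection {Z : Type*} [TopologicalSpace Z] {q : Z → Arr U}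
    (hq : Continuous q) {F : ∀ z, B.fib (q z).src}
    (hF : B.IsPullbackSection (fun z => (q z).src) F) :
    B.IsPullbackSection (fun z => (q z).tgt) (fun z => B.act (q z).hom (F z)) := by
  apply BanachAlgebraField.IsPullbackSection.of_local
  intro z₀ ε hε
  obtain ⟨ξ, hξ, h⟩ := hF z₀ ε hε
  refine ⟨fun z => B.act (q z).hom (ξ (q z).src),
    (B.act_continuous (fun γ => ξ γ.src)
      (BanachAlgebraField.isPullbackSection_of_mem hξ _)).comp hq, ?_⟩
  filter_upwards [h] with z hz
  rw [← map_sub, LinearIsometryEquiv.norm_map]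
  exact hz

end Act

/-! ### Sections with compact support and the convolution product -/

section Convolution

variable {U : Type u} [Groupoid.{w} U] [TopologicalSpace U] [TopologicalSpace (Arr U)]

/-- `Γ_c(𝒢, r^*B)`: continuous sections of `r^*B` with compact support. -/
def GammaC (B : GBanachAlgebra.{u, w, v} U) : Submodule ℂ (∀ γ : Arr U, B.fib γ.tgt) where
  carrier := {f | B.IsPullbackSection (fun γ : Arr U => γ.tgt) f ∧
    ∃ K : Set (Arr U), IsCompact K ∧ ∀ γ ∉ K, f γ = 0}
  add_mem' := by
    rintro f g ⟨hf, K, hK, hfK⟩ ⟨hg, L, hL, hgL⟩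
    refine ⟨hf.add hg, K ∪ L, hK.union hL, fun γ hγ => ?_⟩
    rw [Set.mem_union, not_or] at hγ
    simp [hfK γ hγ.1, hgL γ hγ.2]
  zero_mem' := ⟨BanachAlgebraField.IsPullbackSection.zero _, ∅, isCompact_empty, fun _ _ => rfl⟩
  smul_mem' := by
    rintro c f ⟨hf, K, hK, hfK⟩
    exact ⟨hf.const_smul c, K, hK, fun γ hγ => by simp [hfK γ hγ]⟩

/-- The integrand `a ↦ f(a) α_a(g(a⁻¹c))` of the convolution product at `c`. -/
def convIntegrand (B : GBanachAlgebra.{u, w, v} U) (f g : ∀ γ : Arr U, B.fib γ.tgt) {x : U}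
    (a c : Fib x) : B.fib x :=
  f ⟨a.hom⟩ * B.act a.hom (g ⟨c.hom ≫ Groupoid.inv a.hom⟩)

/-- The convolution product `(f * g)(γ) = ∫_{𝒢^{r(γ)}} f(a) α_a(g(a⁻¹γ)) dλ^{r(γ)}(a)`. -/
def convFun (lam : HaarSystem U) (B : GBanachAlgebra.{u, w, v} U)
    (f g : ∀ γ : Arr U, B.fib γ.tgt) (γ : Arr U) : B.fib γ.tgt :=
  ∫ a : Fib γ.tgt, convIntegrand B f g a ⟨γ.hom⟩ ∂lam.measure γ.tgt

variable [IsTopologicalGroupoid U] {B : GBanachAlgebra.{u, w, v} U}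

lemma convIntegrand_isPullbackSection {f g : ∀ γ : Arr U, B.fib γ.tgt}
    (hf : B.IsPullbackSection (fun γ : Arr U => γ.tgt) f)
    (hg : B.IsPullbackSection (fun γ : Arr U => γ.tgt) g) :
    B.IsPullbackSection (fun p : FibPair U => p.x)
      (fun p => convIntegrand B f g p.fst p.snd) := by
  have h1 : B.IsPullbackSection (fun p : FibPair U => p.x) (fun p => f ⟨p.fst.hom⟩) :=
    hf.comp continuous_fibPair_fst
  have h2 : B.IsPullbackSection (fun p : FibPair U => p.fst.src)
      (fun p => g ⟨p.snd.hom ≫ Groupoid.inv p.fst.hom⟩) := hg.comp continuous_ldiv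
  have h3 : B.IsPullbackSection (fun p : FibPair U => p.x) (fun p => B.act p.fst.hom
      (g ⟨p.snd.hom ≫ Groupoid.inv p.fst.hom⟩)) :=
    GBanachAlgebra.act_isPullbackSection continuous_fibPair_fst h2
  exact h1.mul h3 continuous_fibPair_x

lemma continuous_fibPair_mk {Z : Type*} [TopologicalSpace Z] {x : U} {a c : Z → Fib x}
    (ha : Continuous a) (hc : Continuous c) :
    Continuous (fun z => (⟨a z, c z⟩ : FibPair U)) :=
  continuous_induced_rng.2
    (((continuous_toArr x).comp ha).prodMk ((continuous_toArr x).comp hc))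

lemma continuous_fibPair_fun {F : ∀ p : FibPair U, B.fib p.x}
    (hF : B.IsPullbackSection (fun p : FibPair U => p.x) F) (x : U) :
    Continuous (Y := B.fib x) (fun q : Fib x × Fib x => F ⟨q.1, q.2⟩) :=
  BanachAlgebraField.IsPullbackSection.continuous (x := x)
    (hF.comp (continuous_fibPair_mk continuous_fst continuous_snd))

instance (lam : HaarSystem U) (x : U) : (lam.measure x).Regular := lam.regular x

instance (lam : HaarSystem U) (x : U) : (lam.measure x).IsOpenPosMeasure := lam.full_support x

variable [T2Space (Arr U)]

instance (x : U) : T2Space (Fib x) := (isClosedEmbedding_toArr x).isEmbedding.t2Space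

lemma integrable_fib (lam : HaarSystem U) {x : U} {E : Type*} [NormedAddCommGroup E]
    {F : Fib x → E} (hF : Continuous F) {K : Set (Arr U)} (hK : IsCompact K)
    (h0 : ∀ a, Fib.toArr a ∉ K → F a = 0) : Integrable F (lam.measure x) := by
  apply hF.integrable_of_hasCompactSupport
  exact HasCompactSupport.intro ((isClosedEmbedding_toArr x).isCompact_preimage hK)
    fun a ha => h0 a ha

variable [LocallyCompactSpace (Arr U)]

/-- Integration of a section over the range fibres yields a section. -/
lemma integral_isPullbackSection (lam : HaarSystem U) {F : ∀ p : FibPair U, B.fib p.x}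
    (hF : B.IsPullbackSection (fun p : FibPair U => p.x) F) {K : Set (Arr U)} (hK : IsCompact K)
    (h0 : ∀ p : FibPair U, p.fst.toArr ∉ K → F p = 0) :
    B.IsPullbackSection (fun γ : Arr U => γ.tgt)
      (fun γ => ∫ a : Fib γ.tgt, F ⟨a, ⟨γ.hom⟩⟩ ∂lam.measure γ.tgt) := by
  have : T2Space U := t2_units
  apply BanachAlgebraField.IsPullbackSection.of_local
  intro c₀ ε hε
  -- a cut-off function
  obtain ⟨φ₀, hφ₀K, -, hφ₀c, hφ₀⟩ :=
    exists_continuous_one_zero_of_isCompact hK (isClosed_empty (X := Arr U)) (Set.disjoint_empty _)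
  let φc : C_c(Arr U, ℝ) := ⟨φ₀, hφ₀c⟩
  set M := (∫ a, φ₀ (Fib.toArr a) ∂lam.measure c₀.tgt) + 1 with hM
  have hM0 : 0 < M := by
    have : 0 ≤ ∫ a, φ₀ (Fib.toArr a) ∂lam.measure c₀.tgt :=
      integral_nonneg fun a => (hφ₀ _).1
    linarith
  have hMev : ∀ᶠ c : Arr U in 𝓝 c₀, ∫ a, φ₀ (Fib.toArr a) ∂lam.measure c.tgt < M := by
    have h1 : Continuous fun c : Arr U => ∫ a, φc (Fib.toArr a) ∂lam.measure c.tgt :=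
      (lam.continuous_integral φc).comp IsTopologicalGroupoid.continuous_tgt
    exact h1.continuousAt.eventually_lt_const (by rw [hM]; exact lt_add_one _)
  set δ := ε / (2 * M) with hδd
  have hδ : 0 < δ := by positivity
  -- local approximation
  have key : ∀ a : Arr U, ∃ ξ ∈ B.sections, ∃ V : Set (Arr U), IsOpen V ∧ a ∈ V ∧
      ∀ᶠ c : Arr U in 𝓝 c₀, ∀ b : Fib c.tgt, b.toArr ∈ V → ‖F ⟨b, ⟨c.hom⟩⟩ - ξ c.tgt‖ < δ := by
    intro a
    by_cases hac : a.tgt = c₀.tgt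
    · obtain ⟨a, rfl⟩ := exists_fib a hac
      obtain ⟨ξ, hξ, h⟩ := hF ⟨a, ⟨c₀.hom⟩⟩ δ hδ
      rw [nhds_induced, eventually_comap] at h
      rw [nhds_prod_eq] at h
      obtain ⟨P, hP, Q, hQ, hPQ⟩ := eventually_prod_iff.1 h
      obtain ⟨V, hVP, hV, haV⟩ := eventually_nhds_iff.1 hP
      refine ⟨ξ, hξ, V, hV, haV, ?_⟩
      filter_upwards [hQ] with c hc b hb
      exact hPQ (hVP _ hb) hc ⟨b, ⟨c.hom⟩⟩ rfl
    · obtain ⟨S, T, hS, hT, haS, hcT, hST⟩ := t2_separation hac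
      refine ⟨0, B.sections.zero_mem, (fun γ : Arr U => γ.tgt) ⁻¹' S,
        hS.preimage IsTopologicalGroupoid.continuous_tgt, haS, ?_⟩
      have : ∀ᶠ c : Arr U in 𝓝 c₀, c.tgt ∈ T :=
        IsTopologicalGroupoid.continuous_tgt.continuousAt.eventually (hT.mem_nhds hcT)
      filter_upwards [this] with c hc b hb
      exact absurd hc (Set.disjoint_left.1 hST hb)
  choose ξ hξ V hV haV hev using key
  obtain ⟨t, htK⟩ := hK.elim_finite_subcover V hV
    (fun a _ => Set.mem_iUnion.2 ⟨a, haV a⟩)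
  obtain ⟨ρ, hρV, hρc⟩ := PartitionOfUnity.exists_isSubordinate_of_locallyFinite_t2space hK
    (fun i : t => V i) (fun i => hV i) (locallyFinite_of_finite _) (by
      intro a ha
      obtain ⟨i, hi, hai⟩ := Set.mem_iUnion₂.1 (htK ha)
      exact Set.mem_iUnion.2 ⟨⟨i, hi⟩, hai⟩)
  have hρ1 : ∀ a ∈ K, ∑ i, ρ i a = 1 := fun a ha => by
    rw [← finsum_eq_sum_of_fintype]; exact ρ.sum_eq_one ha
  have hρle : ∀ a, ∑ i, ρ i a ≤ 1 := fun a => by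
    rw [← finsum_eq_sum_of_fintype]; exact ρ.sum_le_one a
  let ψ : t → C_c(Arr U, ℝ) := fun i =>
    ⟨⟨fun a => φ₀ a * ρ i a, by fun_prop⟩, hφ₀c.mul_right⟩
  have hψint : ∀ i (x : U), Integrable (fun a : Fib x => ψ i a.toArr) (lam.measure x) :=
    fun i x => integrable_fib lam ((ψ i).continuous.comp (continuous_toArr x))
      (ψ i).hasCompactSupport.isCompact (fun a ha => image_eq_zero_of_notMem_tsupport ha)
  refine ⟨fun γ => ∑ i, ((∫ a, ψ i (Fib.toArr a) ∂lam.measure γ.tgt : ℝ) : ℂ) • ξ i γ.tgt,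
    BanachAlgebraField.IsPullbackSection.sum _ fun i _ =>
      (BanachAlgebraField.isPullbackSection_of_mem (hξ i) _).smul
        IsTopologicalGroupoid.continuous_tgt
        (Complex.continuous_ofReal.comp ((lam.continuous_integral (ψ i)).comp
          IsTopologicalGroupoid.continuous_tgt)), ?_⟩
  filter_upwards [hMev, eventually_all.2 (fun i : t => hev i)] with c hcM hc
  have hFc : Continuous (Y := B.fib c.tgt) (fun a : Fib c.tgt => F ⟨a, ⟨c.hom⟩⟩) :=
    (continuous_fibPair_fun hF c.tgt).comp (continuous_id.prodMk continuous_const)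
  have hFint : Integrable (ε := B.fib c.tgt) (fun a : Fib c.tgt => F ⟨a, ⟨c.hom⟩⟩) (lam.measure c.tgt) :=
    integrable_fib lam hFc hK fun a ha => h0 _ ha
  have e1 : ∑ i, ((∫ a, ψ i (Fib.toArr a) ∂lam.measure c.tgt : ℝ) : ℂ) • ξ i c.tgt
      = ∫ a : Fib c.tgt, ∑ i, ((ψ i a.toArr : ℝ) : ℂ) • ξ i c.tgt ∂lam.measure c.tgt := by
    refine Eq.trans (Finset.sum_congr rfl fun i _ => ?_) (integral_finset_sum Finset.univ
      (f := fun (i : t) (a : Fib c.tgt) => ((ψ i a.toArr : ℝ) : ℂ) • ξ i c.tgt) fun i _ =>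
      ((hψint i c.tgt).ofReal (𝕜 := ℂ)).smul_const (ξ i c.tgt)).symm
    rw [integral_smul_const]
    congr 1
    exact (integral_ofReal (𝕜 := ℂ)).symm
  have hint2 : Integrable (fun a : Fib c.tgt => ∑ i, ((ψ i a.toArr : ℝ) : ℂ) • ξ i c.tgt)
      (lam.measure c.tgt) :=
    integrable_finset_sum _ fun i _ => ((hψint i c.tgt).ofReal (𝕜 := ℂ)).smul_const _
  have hφint : Integrable (fun a : Fib c.tgt => φ₀ a.toArr) (lam.measure c.tgt) :=
    integrable_fib lam (φ₀.continuous.comp (continuous_toArr _)) hφ₀c.isCompact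
      (fun a ha => image_eq_zero_of_notMem_tsupport ha)
  rw [e1, ← integral_sub hFint hint2]
  have hbound : ∀ a : Fib c.tgt,
      ‖F ⟨a, ⟨c.hom⟩⟩ - ∑ i, ((ψ i a.toArr : ℝ) : ℂ) • ξ i c.tgt‖ ≤ δ * φ₀ a.toArr := by
    intro a
    have e2 : F ⟨a, ⟨c.hom⟩⟩ = ∑ i, ((ψ i a.toArr : ℝ) : ℂ) • F ⟨a, ⟨c.hom⟩⟩ := by
      by_cases ha : a.toArr ∈ K
      · rw [← Finset.sum_smul, ← Complex.ofReal_sum]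
        have : ∑ i, ψ i a.toArr = 1 := by
          change ∑ i, φ₀ a.toArr * ρ i a.toArr = 1
          rw [← Finset.mul_sum, hρ1 _ ha, hφ₀K ha]
          simp
        rw [this]
        simp
      · have : F ⟨a, ⟨c.hom⟩⟩ = 0 := h0 _ ha
        simp [this]
    calc ‖F ⟨a, ⟨c.hom⟩⟩ - ∑ i, ((ψ i a.toArr : ℝ) : ℂ) • ξ i c.tgt‖
        = ‖∑ i, ((ψ i a.toArr : ℝ) : ℂ) • (F ⟨a, ⟨c.hom⟩⟩ - ξ i c.tgt)‖ := by
          congr 1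
          simp only [smul_sub, Finset.sum_sub_distrib]
          rw [← e2]
      _ ≤ ∑ i, ‖((ψ i a.toArr : ℝ) : ℂ) • (F ⟨a, ⟨c.hom⟩⟩ - ξ i c.tgt)‖ := norm_sum_le _ _
      _ ≤ ∑ i, ψ i a.toArr * δ := by
          refine Finset.sum_le_sum fun i _ => ?_
          have hψ0 : 0 ≤ ψ i a.toArr := mul_nonneg (hφ₀ _).1 (ρ.nonneg i _)
          rw [norm_smul, Complex.norm_real, Real.norm_of_nonneg hψ0]
          by_cases ha : a.toArr ∈ V i
          · exact mul_le_mul_of_nonneg_left (hc i a ha).le hψ0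
          · have : ψ i a.toArr = 0 := by
              change φ₀ a.toArr * ρ i a.toArr = 0
              rw [image_eq_zero_of_notMem_tsupport (fun h => ha (hρV i h)), mul_zero]
            simp [this]
      _ = δ * (φ₀ a.toArr * ∑ i, ρ i a.toArr) := by
          have hψ : ∀ i, ψ i a.toArr = φ₀ a.toArr * ρ i a.toArr := fun i => rfl
          simp only [hψ]
          rw [← Finset.sum_mul, ← Finset.mul_sum, mul_comm]
      _ ≤ δ * φ₀ a.toArr :=
          mul_le_mul_of_nonneg_left (mul_le_of_le_one_right (hφ₀ _).1 (hρle _)) hδ.le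
  refine lt_of_le_of_lt (norm_integral_le_of_norm_le (hφint.const_mul δ)
    (Eventually.of_forall hbound)) ?_
  calc ∫ a : Fib c.tgt, δ * φ₀ a.toArr ∂lam.measure c.tgt
      = δ * ∫ a : Fib c.tgt, φ₀ a.toArr ∂lam.measure c.tgt := integral_const_mul _ _
    _ ≤ δ * M := mul_le_mul_of_nonneg_left hcM.le hδ.le
    _ = ε / 2 := by rw [hδd]; field_simp
    _ < ε := half_lt_self hε

lemma convFun_mem (lam : HaarSystem U) {f g : ∀ γ : Arr U, B.fib γ.tgt} (hf : f ∈ GammaC B)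
    (hg : g ∈ GammaC B) : convFun lam B f g ∈ GammaC B := by
  obtain ⟨hf, K, hK, hfK⟩ := hf
  obtain ⟨hg, L, hL, hgL⟩ := hg
  refine ⟨integral_isPullbackSection lam (convIntegrand_isPullbackSection hf hg) hK
    (fun p hp => ?_), _, isCompact_mul hK hL, fun γ hγ => ?_⟩
  · rw [convIntegrand, show f ⟨p.fst.hom⟩ = 0 from hfK _ hp, zero_mul]
  · rw [convFun]
    have : ∀ a : Fib γ.tgt, convIntegrand B f g a ⟨γ.hom⟩ = 0 := by
      intro a
      by_cases ha : a.toArr ∈ K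
      · have : Fib.ldiv a ⟨γ.hom⟩ ∉ L := fun h => hγ ⟨γ.tgt, a, ⟨γ.hom⟩, rfl, ha, h⟩
        rw [convIntegrand, show g ⟨γ.hom ≫ Groupoid.inv a.hom⟩ = 0 from hgL _ this, map_zero,
          mul_zero]
      · rw [convIntegrand, show f ⟨a.hom⟩ = 0 from hfK _ ha, zero_mul]
    simp [this]

/-- The convolution product on `Γ_c(𝒢, r^*B)`. -/
def conv (lam : HaarSystem U) (f g : GammaC B) : GammaC B :=
  ⟨convFun lam B f g, convFun_mem lam f.2 g.2⟩

end Convolution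

section Algebra

variable {U : Type u} [Groupoid.{w} U] [TopologicalSpace U] [TopologicalSpace (Arr U)]
  [IsTopologicalGroupoid U] [T2Space (Arr U)] {B : GBanachAlgebra.{u, w, v} U}

lemma continuous_convIntegrand {f g : ∀ γ : Arr U, B.fib γ.tgt} (hf : f ∈ GammaC B)
    (hg : g ∈ GammaC B) {x : U} (c : Fib x) : Continuous (fun a => convIntegrand B f g a c) :=
  (continuous_fibPair_fun (convIntegrand_isPullbackSection hf.1 hg.1) x).comp
    (continuous_id.prodMk continuous_const)

lemma integrable_convIntegrand (lam : HaarSystem U) {f g : ∀ γ : Arr U, B.fib γ.tgt}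
    (hf : f ∈ GammaC B) (hg : g ∈ GammaC B) {x : U} (c : Fib x) :
    Integrable (fun a => convIntegrand B f g a c) (lam.measure x) := by
  obtain ⟨K, hK, hfK⟩ := hf.2
  refine integrable_fib lam (continuous_convIntegrand hf hg c) hK fun a ha => ?_
  rw [convIntegrand, show f ⟨a.hom⟩ = 0 from hfK _ ha, zero_mul]

/-- Left invariance of the Haar system for continuous functions with compact support. -/
lemma integral_translate (lam : HaarSystem U) {x y : U} (γ : x ⟶ y) {E : Type*}
    [NormedAddCommGroup E] [NormedSpace ℝ E] {F : Fib y → E}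
    (hF : Integrable F (lam.measure y)) :
    ∫ d, F (Fib.translate γ d) ∂lam.measure x = ∫ a, F a ∂lam.measure y := by
  rw [← lam.map_translate γ] at hF ⊢
  exact (integral_map (continuous_translate γ).measurable.aemeasurable hF.1).symm

variable [LocallyCompactSpace (Arr U)]

lemma conv_assoc (lam : HaarSystem U) (f g h : GammaC B) :
    conv lam (conv lam f g) h = conv lam f (conv lam g h) := by
  apply Subtype.ext
  funext γ
  obtain ⟨K, hK, hfK⟩ := f.2.2
  obtain ⟨L, hL, hgL⟩ := g.2.2
  set x := γ.tgt with hx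
  let c : Fib x := ⟨γ.hom⟩
  let T : Fib x → B.fib x := fun a => B.act a.hom (h.1 ⟨c.hom ≫ Groupoid.inv a.hom⟩)
  let H : Fib x → Fib x → B.fib x := fun b a => convIntegrand B f.1 g.1 b a * T a
  have hT : Continuous T := by
    have h2 : B.IsPullbackSection (fun p : FibPair U => p.fst.src)
        (fun p => h.1 ⟨p.snd.hom ≫ Groupoid.inv p.fst.hom⟩) := h.2.1.comp continuous_ldiv
    have h3 : B.IsPullbackSection (fun p : FibPair U => p.x) (fun p => B.act p.fst.hom
        (h.1 ⟨p.snd.hom ≫ Groupoid.inv p.fst.hom⟩)) :=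
      GBanachAlgebra.act_isPullbackSection continuous_fibPair_fst h2
    exact (continuous_fibPair_fun h3 x).comp (continuous_id.prodMk continuous_const)
  have hH : Continuous (Function.uncurry H) :=
    (continuous_fibPair_fun (convIntegrand_isPullbackSection f.2.1 g.2.1) x).mul
      (hT.comp continuous_snd)
  have hK' := (isClosedEmbedding_toArr x).isCompact_preimage hK
  have hL' := (isClosedEmbedding_toArr x).isCompact_preimage (isCompact_mul hK hL)
  have hH0 : ∀ b a, ¬ (b.toArr ∈ K ∧ Fib.ldiv b a ∈ L) → H b a = 0 := by
    intro b a hba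
    by_cases hb : b.toArr ∈ K
    · have : g.1 ⟨a.hom ≫ Groupoid.inv b.hom⟩ = 0 := hgL _ fun h => hba ⟨hb, h⟩
      simp only [H, convIntegrand, this, map_zero, mul_zero, zero_mul]
    · have : f.1 ⟨b.hom⟩ = 0 := hfK _ hb
      simp only [H, convIntegrand, this, zero_mul]
  have hHc : HasCompactSupport (Function.uncurry H) := by
    refine HasCompactSupport.intro (hK'.prod hL') fun q hq => hH0 q.1 q.2 fun h => hq ⟨h.1, ?_⟩
    exact ⟨x, q.1, q.2, rfl, h.1, h.2⟩
  have hHint : ∀ b, Integrable (H b) (lam.measure x) := fun b => by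
    refine integrable_fib lam (hH.comp (continuous_const.prodMk continuous_id))
      (isCompact_mul hK hL) fun a ha => hH0 b a fun h => ha ⟨x, b, a, rfl, h.1, h.2⟩
  have hleft : (conv lam (conv lam f g) h).1 γ
      = ∫ a, ∫ b, H b a ∂lam.measure x ∂lam.measure x := by
    refine integral_congr_ae (Eventually.of_forall fun a => ?_)
    exact (((ContinuousLinearMap.mul ℂ (B.fib x)).flip (T a)).integral_comp_comm
      (integrable_convIntegrand lam f.2 g.2 a)).symm
  have hright : (conv lam f (conv lam g h)).1 γ
      = ∫ b, ∫ a, H b a ∂lam.measure x ∂lam.measure x := by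
    refine integral_congr_ae (Eventually.of_forall fun b => ?_)
    refine Eq.trans ?_ (integral_translate lam b.hom (hHint b))
    have e := (((ContinuousLinearMap.mul ℂ (B.fib x)) (f.1 ⟨b.hom⟩)).comp
      (B.act b.hom).toContinuousLinearEquiv.toContinuousLinearMap).integral_comp_comm
      (integrable_convIntegrand lam g.2 h.2 (⟨c.hom ≫ Groupoid.inv b.hom⟩ : Fib b.src))
    refine Eq.trans e.symm (integral_congr_ae (Eventually.of_forall fun d => ?_))
    change f.1 ⟨b.hom⟩ * B.act b.hom (g.1 ⟨d.hom⟩ * B.act d.hom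
        (h.1 ⟨(c.hom ≫ Groupoid.inv b.hom) ≫ Groupoid.inv d.hom⟩))
      = f.1 ⟨b.hom⟩ * B.act b.hom (g.1 ⟨(d.hom ≫ b.hom) ≫ Groupoid.inv b.hom⟩) *
        B.act (d.hom ≫ b.hom) (h.1 ⟨c.hom ≫ Groupoid.inv (d.hom ≫ b.hom)⟩)
    have e1 : (d.hom ≫ b.hom) ≫ Groupoid.inv b.hom = d.hom := by simp
    have e2 : c.hom ≫ Groupoid.inv (d.hom ≫ b.hom)
        = (c.hom ≫ Groupoid.inv b.hom) ≫ Groupoid.inv d.hom := by simp [Groupoid.inv_eq_inv]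
    rw [e1, e2, B.act_comp, B.act_mul, mul_assoc]
  rw [hleft, hright]
  exact (integral_integral_swap_of_hasCompactSupport hH hHc).symm

lemma conv_add (lam : HaarSystem U) (f g h : GammaC B) :
    conv lam f (g + h) = conv lam f g + conv lam f h := by
  apply Subtype.ext
  funext γ
  refine Eq.trans (integral_congr_ae (Eventually.of_forall fun a => ?_))
    (integral_add (integrable_convIntegrand lam f.2 g.2 _) (integrable_convIntegrand lam f.2 h.2 _))
  simp [convIntegrand, mul_add]

lemma add_conv (lam : HaarSystem U) (f g h : GammaC B) :
    conv lam (f + g) h = conv lam f h + conv lam g h := by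
  apply Subtype.ext
  funext γ
  refine Eq.trans (integral_congr_ae (Eventually.of_forall fun a => ?_))
    (integral_add (integrable_convIntegrand lam f.2 h.2 _) (integrable_convIntegrand lam g.2 h.2 _))
  simp [convIntegrand, add_mul]

lemma smul_conv (lam : HaarSystem U) (r : ℂ) (f g : GammaC B) :
    conv lam (r • f) g = r • conv lam f g := by
  apply Subtype.ext
  funext γ
  refine Eq.trans (integral_congr_ae (Eventually.of_forall fun a => ?_)) (integral_smul r _)
  simp [convIntegrand, smul_mul_assoc]

lemma conv_smul (lam : HaarSystem U) (r : ℂ) (f g : GammaC B) :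
    conv lam f (r • g) = r • conv lam f g := by
  apply Subtype.ext
  funext γ
  refine Eq.trans (integral_congr_ae (Eventually.of_forall fun a => ?_)) (integral_smul r _)
  simp [convIntegrand, mul_smul_comm]

end Algebra

/-! ### Unconditional completions -/

section Unconditional

variable {U : Type u} [Groupoid.{w} U] [TopologicalSpace U] [TopologicalSpace (Arr U)]

lemma continuous_of_local {Z : Type*} [TopologicalSpace Z] {F : Z → ℂ}
    (h : ∀ z₀, ∀ ε > 0, ∃ G : Z → ℂ, Continuous G ∧ ∀ᶠ z in 𝓝 z₀, ‖F z - G z‖ < ε) :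
    Continuous F := by
  refine continuous_iff_continuousAt.2 fun x => Metric.tendsto_nhds.2 fun ε hε => ?_
  obtain ⟨η, hη, h1⟩ := h x (ε / 3) (by positivity)
  have h2 := Metric.tendsto_nhds.1 (hη.tendsto x) (ε / 3) (by positivity)
  have h3 := h1.self_of_nhds
  filter_upwards [h1, h2] with y h1 h2
  rw [dist_eq_norm] at h2 ⊢
  have e : F y - F x = (F y - η y) + (η y - η x) - (F x - η x) := by ring
  have e2 := norm_sub_le ((F y - η y) + (η y - η x)) (F x - η x)
  have e3 := norm_add_le (F y - η y) (η y - η x)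
  rw [e]
  linarith

/-- The trivial `𝒢`-Banach algebra `ℂ`. -/
def scalarField (U : Type u) [Groupoid.{w} U] [TopologicalSpace U] [TopologicalSpace (Arr U)]
    [IsTopologicalGroupoid U] : GBanachAlgebra.{u, w, 0} U where
  fib _ := ℂ
  sections :=
    { carrier := {f | Continuous f}
      add_mem' := fun hf hg => hf.add hg
      zero_mem' := continuous_const
      smul_mem' := fun c _ hf => hf.const_smul c }
  dense_eval x := by
    exact fun b => subset_closure ⟨fun _ => b, continuous_const, rfl⟩
  usc_norm ξ hξ := (Continuous.norm hξ).upperSemicontinuous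
  mem_of_local ξ h := continuous_of_local h
  mul_mem ξ hξ η hη := Continuous.mul hξ hη
  act _ := LinearIsometryEquiv.refl ℂ ℂ
  act_mul _ _ _ := rfl
  act_comp _ _ _ := rfl
  act_continuous ξ h := by
    have hc : Continuous ξ := continuous_of_local fun z₀ ε hε => by
      obtain ⟨η, hη, h1⟩ := h z₀ ε hε
      exact ⟨fun γ => η γ.src, Continuous.comp hη IsTopologicalGroupoid.continuous_src, h1⟩
    intro z₀ ε hε
    refine ⟨fun _ => ξ z₀, continuous_const, ?_⟩
    filter_upwards [Metric.tendsto_nhds.1 (hc.tendsto z₀) ε hε] with z hz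
    rwa [dist_eq_norm] at hz

variable [IsTopologicalGroupoid U]

lemma scalarField_continuous {Z : Type*} [TopologicalSpace Z] {p : Z → U} (hp : Continuous p)
    {F : Z → ℂ} (h : (scalarField U).IsPullbackSection p F) : Continuous F :=
  continuous_of_local fun z₀ ε hε => by
    obtain ⟨η, hη, h1⟩ := h z₀ ε hε
    exact ⟨fun z => η (p z), Continuous.comp hη hp, h1⟩

lemma scalarField_mem (f : C_c(Arr U, ℂ)) : (f : Arr U → ℂ) ∈ GammaC (scalarField U) := by
  refine ⟨fun z₀ ε hε => ⟨fun _ => f z₀, continuous_const, ?_⟩, tsupport f,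
    f.hasCompactSupport.isCompact, fun γ hγ => image_eq_zero_of_notMem_tsupport hγ⟩
  filter_upwards [Metric.tendsto_nhds.1 (f.continuous.tendsto z₀) ε hε] with z hz
  rwa [dist_eq_norm] at hz

variable [T2Space (Arr U)] [LocallyCompactSpace (Arr U)]

/-- The convolution product of `C_c(𝒢)`: `(f * g)(γ) = ∫_{𝒢^{r(γ)}} f(a) g(a⁻¹γ) dλ^{r(γ)}(a)`. -/
def HaarSystem.convC (lam : HaarSystem U) (f g : C_c(Arr U, ℂ)) : C_c(Arr U, ℂ) where
  toFun γ := ∫ a : Fib γ.tgt, f a.toArr * g (Fib.ldiv a ⟨γ.hom⟩) ∂lam.measure γ.tgt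
  continuous_toFun := scalarField_continuous IsTopologicalGroupoid.continuous_tgt
    (convFun_mem lam (scalarField_mem f) (scalarField_mem g)).1
  hasCompactSupport' := by
    obtain ⟨K, hK, h⟩ := (convFun_mem lam (scalarField_mem f) (scalarField_mem g)).2
    exact HasCompactSupport.intro hK h

/-- An unconditional (semi-)norm on `C_c(𝒢)`: it is submultiplicative for the convolution product
and `‖f‖` depends monotonically on the function `|f|`. -/
structure UnconditionalNorm (lam : HaarSystem U) where
  toSeminorm : Seminorm ℂ C_c(Arr U, ℂ)
  mono : ∀ f g : C_c(Arr U, ℂ), (∀ γ, ‖f γ‖ ≤ ‖g γ‖) → toSeminorm f ≤ toSeminorm g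
  conv_le : ∀ f g : C_c(Arr U, ℂ),
    toSeminorm (lam.convC f g) ≤ toSeminorm f * toSeminorm g

namespace UnconditionalNorm

variable {lam : HaarSystem U} (N : UnconditionalNorm lam)

/-- The functions in `C_c(𝒢)` which dominate `φ` pointwise. -/
def dominating (φ : Arr U → ℝ) : Set C_c(Arr U, ℂ) :=
  {ψ | ∀ γ, (ψ γ).im = 0 ∧ φ γ ≤ (ψ γ).re}

/-- The extension `‖φ‖ = inf {‖ψ‖ : ψ ∈ C_c(𝒢), ψ ≥ φ}` to non-negative bounded functions with
compact support. -/
def ext (φ : Arr U → ℝ) : ℝ := sInf (N.toSeminorm '' dominating φ)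

/-- The semi-norm `‖f‖ = ‖γ ↦ ‖f(γ)‖‖` on `Γ_c(𝒢, r^*B)`. -/
def sectionNorm {B : GBanachAlgebra.{u, w, v} U} (f : GammaC B) : ℝ := N.ext fun γ => ‖f.1 γ‖

lemma ext_le {φ : Arr U → ℝ} {ψ : C_c(Arr U, ℂ)} (h : ψ ∈ dominating φ) :
    N.ext φ ≤ N.toSeminorm ψ :=
  csInf_le ⟨0, by rintro _ ⟨ψ, -, rfl⟩; exact apply_nonneg _ _⟩ ⟨ψ, h, rfl⟩

lemma ext_nonneg (φ : Arr U → ℝ) : 0 ≤ N.ext φ :=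
  Real.sInf_nonneg (by rintro _ ⟨ψ, -, rfl⟩; exact apply_nonneg _ _)

lemma exists_lt {φ : Arr U → ℝ} (h : (dominating φ).Nonempty) {c : ℝ} (hc : N.ext φ < c) :
    ∃ ψ ∈ dominating φ, N.toSeminorm ψ < c := by
  obtain ⟨_, ⟨ψ, hψ, rfl⟩, h⟩ := exists_lt_of_csInf_lt (h.image _) hc
  exact ⟨ψ, hψ, h⟩

end UnconditionalNorm

lemma gammaC_exists_bound {B : GBanachAlgebra.{u, w, v} U} (f : GammaC B) :
    ∃ C : ℝ, 0 ≤ C ∧ ∀ γ, ‖f.1 γ‖ ≤ C := by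
  obtain ⟨K, hK, h0⟩ := f.2.2
  have h := fun γ : Arr U => f.2.1.norm_lt IsTopologicalGroupoid.continuous_tgt
    (z₀ := γ) (lt_add_one ‖f.1 γ‖)
  choose V hV hVo hmem using fun γ => eventually_nhds_iff.1 (h γ)
  obtain ⟨t, ht⟩ := hK.elim_finite_subcover V hVo (fun a _ => Set.mem_iUnion.2 ⟨a, hmem a⟩)
  have hpos : ∀ i ∈ t, 0 ≤ ‖f.1 i‖ + 1 := fun i _ => by positivity
  refine ⟨∑ i ∈ t, (‖f.1 i‖ + 1), Finset.sum_nonneg hpos, fun γ => ?_⟩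
  by_cases hγ : γ ∈ K
  · obtain ⟨i, hi, hγi⟩ := Set.mem_iUnion₂.1 (ht hγ)
    exact (hV i γ hγi).le.trans (Finset.single_le_sum hpos hi)
  · rw [h0 γ hγ, norm_zero]
    exact Finset.sum_nonneg hpos

lemma dominating_nonempty {B : GBanachAlgebra.{u, w, v} U} (f : GammaC B) :
    (UnconditionalNorm.dominating fun γ => ‖f.1 γ‖).Nonempty := by
  obtain ⟨C, hC, hf⟩ := gammaC_exists_bound f
  obtain ⟨K, hK, h0⟩ := f.2.2
  obtain ⟨φ₀, hφ₀K, -, hφ₀c, hφ₀⟩ :=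
    exists_continuous_one_zero_of_isCompact hK (isClosed_empty (X := Arr U)) (Set.disjoint_empty _)
  refine ⟨⟨⟨fun γ => ((C * φ₀ γ : ℝ) : ℂ), by fun_prop⟩, ?_⟩, fun γ => ⟨Complex.ofReal_im _, ?_⟩⟩
  · exact (hφ₀c.mul_left (f := fun _ => C)).comp_left (g := fun r : ℝ => (r : ℂ)) rfl
  · change ‖f.1 γ‖ ≤ ((C * φ₀ γ : ℝ) : ℂ).re
    rw [Complex.ofReal_re]
    by_cases hγ : γ ∈ K
    · rw [hφ₀K hγ]
      simpa using hf γ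
    · rw [h0 γ hγ, norm_zero]
      exact mul_nonneg hC (hφ₀ γ).1

namespace UnconditionalNorm

variable {lam : HaarSystem U} (N : UnconditionalNorm lam) {B : GBanachAlgebra.{u, w, v} U}

lemma sectionNorm_zero : N.sectionNorm (0 : GammaC B) = 0 := by
  refine le_antisymm ?_ (N.ext_nonneg _)
  refine (N.ext_le (ψ := 0) fun γ => ⟨rfl, ?_⟩).trans (map_zero _).le
  simp

lemma sectionNorm_add_le (f g : GammaC B) :
    N.sectionNorm (f + g) ≤ N.sectionNorm f + N.sectionNorm g := by
  refine le_of_forall_pos_le_add fun ε hε => ?_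
  obtain ⟨ψ₁, h₁, hn₁⟩ := N.exists_lt (dominating_nonempty f) (lt_add_of_pos_right _ (half_pos hε))
  obtain ⟨ψ₂, h₂, hn₂⟩ := N.exists_lt (dominating_nonempty g) (lt_add_of_pos_right _ (half_pos hε))
  have h : ψ₁ + ψ₂ ∈ dominating fun γ => ‖(f + g).1 γ‖ := fun γ => by
    refine ⟨by simp [(h₁ γ).1, (h₂ γ).1], ?_⟩
    simpa using (norm_add_le _ _).trans (add_le_add (h₁ γ).2 (h₂ γ).2)
  have := (N.ext_le h).trans (map_add_le_add _ ψ₁ ψ₂)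
  change N.ext _ ≤ N.ext _ + N.ext _ + ε
  linarith

lemma sectionNorm_smul_le (c : ℂ) (f : GammaC B) :
    N.sectionNorm (c • f) ≤ ‖c‖ * N.sectionNorm f := by
  refine le_mul_of_forall_lt₀ fun a ha b hb => ?_
  obtain ⟨ψ, h, hn⟩ := N.exists_lt (dominating_nonempty f) hb
  have h' : ((‖c‖ : ℝ) : ℂ) • ψ ∈ dominating fun γ => ‖(c • f).1 γ‖ := fun γ => by
    refine ⟨by simp [(h γ).1], ?_⟩
    simpa [norm_smul] using mul_le_mul_of_nonneg_left (h γ).2 (norm_nonneg c)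
  refine (N.ext_le h').trans ?_
  rw [map_smul_eq_mul, Complex.norm_real, norm_norm]
  exact mul_le_mul ha.le hn.le (apply_nonneg _ _) ((norm_nonneg c).trans ha.le)

lemma sectionNorm_conv_le (f g : GammaC B) :
    N.sectionNorm (conv lam f g) ≤ N.sectionNorm f * N.sectionNorm g := by
  refine le_mul_of_forall_lt₀ fun a ha b hb => ?_
  obtain ⟨ψ₁, h₁, hn₁⟩ := N.exists_lt (dominating_nonempty f) ha
  obtain ⟨ψ₂, h₂, hn₂⟩ := N.exists_lt (dominating_nonempty g) hb
  have h : lam.convC ψ₁ ψ₂ ∈ dominating fun γ => ‖(conv lam f g).1 γ‖ := fun γ => by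
    have hi := integrable_convIntegrand lam (scalarField_mem ψ₁) (scalarField_mem ψ₂)
      (⟨γ.hom⟩ : Fib γ.tgt)
    have e : ∀ a : Fib γ.tgt, convIntegrand (scalarField U) ψ₁ ψ₂ a ⟨γ.hom⟩
        = (((ψ₁ a.toArr).re * (ψ₂ (Fib.ldiv a ⟨γ.hom⟩)).re : ℝ) : ℂ) := by
      intro a
      change ψ₁ a.toArr * ψ₂ (Fib.ldiv a ⟨γ.hom⟩) = _
      apply Complex.ext
      · simp [(h₁ a.toArr).1]
      · simp [(h₁ a.toArr).1, (h₂ (Fib.ldiv a ⟨γ.hom⟩)).1]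
    have e' : lam.convC ψ₁ ψ₂ γ = ((∫ a : Fib γ.tgt,
        (ψ₁ a.toArr).re * (ψ₂ (Fib.ldiv a ⟨γ.hom⟩)).re ∂lam.measure γ.tgt : ℝ) : ℂ) := by
      rw [← integral_complex_ofReal]
      exact integral_congr_ae (Eventually.of_forall e)
    rw [e']
    refine ⟨Complex.ofReal_im _, ?_⟩
    rw [Complex.ofReal_re]
    have hi' : Integrable (fun a : Fib γ.tgt =>
        (ψ₁ a.toArr).re * (ψ₂ (Fib.ldiv a ⟨γ.hom⟩)).re) (lam.measure γ.tgt) := by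
      have hi2 : Integrable (fun a : Fib γ.tgt => ψ₁ a.toArr * ψ₂ (Fib.ldiv a ⟨γ.hom⟩))
        (lam.measure γ.tgt) := hi
      have := hi2.re
      refine this.congr (Eventually.of_forall fun a => ?_)
      exact (congrArg Complex.re (e a)).trans (Complex.ofReal_re _)
    refine norm_integral_le_of_norm_le hi' (Eventually.of_forall fun a => ?_)
    refine (norm_mul_le _ _).trans ?_
    rw [LinearIsometryEquiv.norm_map]
    exact mul_le_mul (h₁ a.toArr).2 (h₂ (Fib.ldiv a ⟨γ.hom⟩)).2 (norm_nonneg _)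
      ((norm_nonneg _).trans (h₁ a.toArr).2)
  refine (N.ext_le h).trans ((N.conv_le _ _).trans ?_)
  exact mul_le_mul hn₁.le hn₂.le (apply_nonneg _ _) ((N.ext_nonneg _).trans ha.le)

end UnconditionalNorm

/-- `Γ_c(𝒢, r^*B)` with the convolution product and the semi-norm coming from an unconditional
norm. -/
def PreAlg {lam : HaarSystem U} (_ : UnconditionalNorm lam) (B : GBanachAlgebra.{u, w, v} U) :
    Type (max u w v) := GammaC B

section PreAlg

variable {lam : HaarSystem U} (N : UnconditionalNorm lam) (B : GBanachAlgebra.{u, w, v} U)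

instance : AddCommGroup (PreAlg N B) := inferInstanceAs (AddCommGroup (GammaC B))

instance : Module ℂ (PreAlg N B) := inferInstanceAs (Module ℂ (GammaC B))

instance : SeminormedAddCommGroup (PreAlg N B) :=
  AddGroupSeminorm.toSeminormedAddCommGroup
    { toFun := fun f => N.sectionNorm (B := B) f
      map_zero' := N.sectionNorm_zero
      add_le' := N.sectionNorm_add_le
      neg' := fun f => by
        refine congrArg N.ext (funext fun γ => ?_)
        exact norm_neg ((show GammaC B from f).1 γ) }

instance : NonUnitalSeminormedRing (PreAlg N B) where
  mul f g := conv lam (B := B) f g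
  left_distrib := conv_add lam
  right_distrib := add_conv lam
  zero_mul f := by
    have := smul_conv lam 0 (0 : GammaC B) f
    rwa [zero_smul, zero_smul] at this
  mul_zero f := by
    have := conv_smul lam 0 f (0 : GammaC B)
    rwa [zero_smul, zero_smul] at this
  mul_assoc := conv_assoc lam
  norm_mul_le := N.sectionNorm_conv_le
  dist_eq := SeminormedAddCommGroup.dist_eq

instance : NormedSpace ℂ (PreAlg N B) where
  norm_smul_le := N.sectionNorm_smul_le

instance : IsScalarTower ℂ (PreAlg N B) (PreAlg N B) := ⟨fun r f g => smul_conv lam r f g⟩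

instance : SMulCommClass ℂ (PreAlg N B) (PreAlg N B) := ⟨fun r f g => (conv_smul lam r f g).symm⟩

end PreAlg

end Unconditional

/-! ### Banach algebras and the completion `𝒜(𝒢, B)` -/

/-- A (complex, not necessarily unital) Banach algebra. -/
structure BanachAlg : Type (v + 1) where
  carrier : Type v
  [ring : NonUnitalNormedRing carrier]
  [space : NormedSpace ℂ carrier]
  [tower : IsScalarTower ℂ carrier carrier]
  [comm : SMulCommClass ℂ carrier carrier]
  [complete : CompleteSpace carrier]

attribute [instance] BanachAlg.ring BanachAlg.space BanachAlg.tower BanachAlg.comm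
  BanachAlg.complete

instance : CoeSort BanachAlg.{v} (Type v) := ⟨BanachAlg.carrier⟩

/-- Continuous homomorphisms of Banach algebras. -/
structure BanachAlg.Hom (A : BanachAlg.{v}) (B : BanachAlg.{w}) where
  toHom : A →ₙₐ[ℂ] B
  cont : Continuous toHom

/-- `C₀(X, A)`, with the pointwise product and the supremum norm. -/
def BanachAlg.C0 (X : Type u) [TopologicalSpace X] (A : BanachAlg.{v}) : BanachAlg.{max u v} where
  carrier := C₀(X, A)

/-- The suspension `S A = C₀(ℝ, A)`. -/
def BanachAlg.S (A : BanachAlg.{v}) : BanachAlg.{v} := A.C0 ℝ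

section Completion

variable (R : Type*) [NonUnitalSeminormedRing R]

/-- The multiplication of the completion, as the continuous extension of that of `R`. -/
instance completionMul : Mul (UniformSpace.Completion R) :=
  ⟨Function.curry <| (UniformSpace.Completion.isDenseInducing_coe.prodMap
    UniformSpace.Completion.isDenseInducing_coe).extend
      ((fun r : R => (r : UniformSpace.Completion R)) ∘ Function.uncurry (· * ·))⟩

variable {R}

lemma completion_coe_mul (a b : R) :
    ((a * b : R) : UniformSpace.Completion R) = (a : UniformSpace.Completion R) * b :=
  ((UniformSpace.Completion.isDenseInducing_coe.prodMap
    UniformSpace.Completion.isDenseInducing_coe).extend_eq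
      ((UniformSpace.Completion.continuous_coe R).comp (@continuous_mul R _ _ _)) (a, b)).symm

instance : ContinuousMul (UniformSpace.Completion R) where
  continuous_mul := by
    let m := (AddMonoidHom.mul : R →+ R →+ R).compr₂ UniformSpace.Completion.toCompl
    have : Continuous fun p : R × R => m p.1 p.2 :=
      (UniformSpace.Completion.continuous_coe R).comp continuous_mul
    have di : IsDenseInducing (UniformSpace.Completion.toCompl : R → UniformSpace.Completion R) :=
      UniformSpace.Completion.isDenseInducing_coe
    exact (di.extend_Z_bilin di this :)

/-- The completion of a semi-normed ring is a Banach ring. -/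
@[reducible] def completionRing : NonUnitalNormedRing (UniformSpace.Completion R) where
  __ := (inferInstance : NormedAddCommGroup (UniformSpace.Completion R))
  __ := completionMul R
  zero_mul a :=
    UniformSpace.Completion.induction_on a (isClosed_eq (by fun_prop) continuous_const)
      fun a => by
        rw [← UniformSpace.Completion.coe_zero, ← completion_coe_mul, zero_mul]
  mul_zero a :=
    UniformSpace.Completion.induction_on a (isClosed_eq (by fun_prop) continuous_const)
      fun a => by
        rw [← UniformSpace.Completion.coe_zero, ← completion_coe_mul, mul_zero]
  mul_assoc a b c :=
    UniformSpace.Completion.induction_on₃ a b c (isClosed_eq (by fun_prop) (by fun_prop))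
      fun a b c => by
        rw [← completion_coe_mul, ← completion_coe_mul, ← completion_coe_mul,
          ← completion_coe_mul, mul_assoc]
  left_distrib a b c :=
    UniformSpace.Completion.induction_on₃ a b c (isClosed_eq (by fun_prop) (by fun_prop))
      fun a b c => by
        rw [← UniformSpace.Completion.coe_add, ← completion_coe_mul, ← completion_coe_mul,
          ← completion_coe_mul, ← UniformSpace.Completion.coe_add, mul_add]
  right_distrib a b c :=
    UniformSpace.Completion.induction_on₃ a b c (isClosed_eq (by fun_prop) (by fun_prop))
      fun a b c => by
        rw [← UniformSpace.Completion.coe_add, ← completion_coe_mul, ← completion_coe_mul,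
          ← completion_coe_mul, ← UniformSpace.Completion.coe_add, add_mul]
  norm_mul_le a b :=
    UniformSpace.Completion.induction_on₂ a b (isClosed_le (by fun_prop) (by fun_prop))
      fun a b => by
        rw [← completion_coe_mul]
        simp only [UniformSpace.Completion.norm_coe]
        exact norm_mul_le a b

end Completion

section UncAlg

variable {U : Type u} [Groupoid.{w} U] [TopologicalSpace U] [TopologicalSpace (Arr U)]
  [IsTopologicalGroupoid U] [T2Space (Arr U)] [LocallyCompactSpace (Arr U)]
  {lam : HaarSystem U}

/-- The Banach algebra `𝒜(𝒢, B)`: the Hausdorff completion of `Γ_c(𝒢, r^*B)`. -/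
def UnconditionalNorm.algebra (N : UnconditionalNorm lam) (B : GBanachAlgebra.{u, w, v} U) :
    BanachAlg.{max u w v} where
  carrier := UniformSpace.Completion (PreAlg N B)
  ring := completionRing
  space := inferInstanceAs (NormedSpace ℂ (UniformSpace.Completion (PreAlg N B)))
  tower := ⟨fun r a b => by
    refine UniformSpace.Completion.induction_on₂ (α := PreAlg N B) a b ?_ fun a b => ?_
    · exact isClosed_eq (((continuous_const_smul r).comp continuous_fst).mul continuous_snd)
        ((continuous_const_smul r).comp (continuous_fst.mul continuous_snd))
    · change (r • (a : UniformSpace.Completion (PreAlg N B))) * (b : UniformSpace.Completion _)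
        = r • ((a : UniformSpace.Completion (PreAlg N B)) * (b : UniformSpace.Completion _))
      rw [← UniformSpace.Completion.coe_smul, ← completion_coe_mul, ← completion_coe_mul,
        ← UniformSpace.Completion.coe_smul, smul_mul_assoc]⟩
  comm := ⟨fun r a b => by
    refine UniformSpace.Completion.induction_on₂ (α := PreAlg N B) a b ?_ fun a b => ?_
    · exact isClosed_eq ((continuous_const_smul r).comp (continuous_fst.mul continuous_snd))
        (continuous_fst.mul ((continuous_const_smul r).comp continuous_snd))
    · change r • ((a : UniformSpace.Completion (PreAlg N B)) * (b : UniformSpace.Completion _))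
        = (a : UniformSpace.Completion (PreAlg N B)) * (r • (b : UniformSpace.Completion _))
      rw [← UniformSpace.Completion.coe_smul, ← completion_coe_mul, ← completion_coe_mul,
        ← UniformSpace.Completion.coe_smul, mul_smul_comm]⟩
  complete := inferInstanceAs (CompleteSpace (UniformSpace.Completion (PreAlg N B)))

/-- The canonical map `Γ_c(𝒢, r^*B) → 𝒜(𝒢, B)`. -/
def UnconditionalNorm.toAlgebra (N : UnconditionalNorm lam) {B : GBanachAlgebra.{u, w, v} U}
    (f : GammaC B) : N.algebra B :=
  UniformSpace.Completion.coe' (show PreAlg N B from f)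

lemma UnconditionalNorm.toAlgebra_conv (N : UnconditionalNorm lam) {B : GBanachAlgebra.{u, w, v} U}
    (f g : GammaC B) : N.toAlgebra (conv lam f g) = N.toAlgebra f * N.toAlgebra g :=
  completion_coe_mul (R := PreAlg N B) f g

lemma UnconditionalNorm.norm_toAlgebra (N : UnconditionalNorm lam) {B : GBanachAlgebra.{u, w, v} U}
    (f : GammaC B) : ‖N.toAlgebra f‖ = N.sectionNorm f :=
  UniformSpace.Completion.norm_coe (E := PreAlg N B) f

lemma UnconditionalNorm.denseRange_toAlgebra (N : UnconditionalNorm lam)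
    {B : GBanachAlgebra.{u, w, v} U} :
    DenseRange (N.toAlgebra : GammaC B → N.algebra B) :=
  UniformSpace.Completion.denseRange_coe (α := PreAlg N B)

end UncAlg

/-! ### The field `BX = C₀(X, B)` -/

section ExtC0

variable {E F : Type*} {X : Type*} [TopologicalSpace X]

/-- The elementary tensor `χ ⊗ b : x ↦ χ(x) b`. -/
def tens [NormedAddCommGroup E] [NormedSpace ℂ E] (χ : C₀(X, ℂ)) (b : E) : C₀(X, E) where
  toFun x := χ x • b
  continuous_toFun := by fun_prop
  zero_at_infty' := by
    have := (zero_at_infty χ).smul_const b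
    rwa [zero_smul] at this

lemma c0_norm_le [NormedAddCommGroup E] (f : C₀(X, E)) {c : ℝ} (hc : 0 ≤ c)
    (h : ∀ x, ‖f x‖ ≤ c) : ‖f‖ ≤ c := by
  rw [← ZeroAtInftyContinuousMap.norm_toBCF_eq_norm]
  exact (BoundedContinuousFunction.norm_le hc).2 h

lemma c0_norm_apply_le [NormedAddCommGroup E] (f : C₀(X, E)) (x : X) : ‖f x‖ ≤ ‖f‖ := by
  rw [← ZeroAtInftyContinuousMap.norm_toBCF_eq_norm]
  exact f.toBCF.norm_coe_le_norm x

lemma c0_exists_compact [NormedAddCommGroup E] (f : C₀(X, E)) {ε : ℝ} (hε : 0 < ε) :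
    ∃ K : Set X, IsCompact K ∧ ∀ x ∉ K, ‖f x‖ < ε := by
  have h := Metric.tendsto_nhds.1 (zero_at_infty f) ε hε
  obtain ⟨K, hK, h⟩ := mem_cocompact.1 h
  exact ⟨K, hK, fun x hx => by simpa using h hx⟩

/-- The isometry `C₀(X, E) ≃ C₀(X, F)` induced by an isometry `E ≃ F`. -/
def c0Map [NormedAddCommGroup E] [NormedSpace ℂ E] [NormedAddCommGroup F] [NormedSpace ℂ F]
    (X : Type*) [TopologicalSpace X] (e : E ≃ₗᵢ[ℂ] F) : C₀(X, E) ≃ₗᵢ[ℂ] C₀(X, F) where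
  toFun h := ⟨⟨fun x => e (h x), by fun_prop⟩, by
    have := (e.continuous.tendsto 0).comp (zero_at_infty h)
    rwa [map_zero] at this⟩
  invFun h := ⟨⟨fun x => e.symm (h x), by fun_prop⟩, by
    have := (e.symm.continuous.tendsto 0).comp (zero_at_infty h)
    rwa [map_zero] at this⟩
  map_add' h k := by ext x; exact map_add e _ _
  map_smul' c h := by ext x; exact map_smul e c _
  left_inv h := by ext x; exact e.symm_apply_apply _
  right_inv h := by ext x; exact e.apply_symm_apply _
  norm_map' h := by
    apply le_antisymm
    · exact c0_norm_le _ (norm_nonneg _) fun x =>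
        (e.norm_map (h x)).le.trans (c0_norm_apply_le h x)
    · exact c0_norm_le _ (norm_nonneg _) fun x => (e.norm_map (h x)).ge.trans
        (c0_norm_apply_le (⟨⟨fun x => e (h x), by fun_prop⟩, _⟩ : C₀(X, F)) x)

end ExtC0

namespace BanachAlgebraField

variable {Y : Type u} [TopologicalSpace Y] (B : BanachAlgebraField.{u, v} Y)
variable {X : Type*} [TopologicalSpace X] {Z : Type*} [TopologicalSpace Z] {p : Z → Y}

/-- A family `F(z) ∈ C₀(X, B_{p(z)})` is continuous if `(z, x) ↦ F(z)(x)` is a continuous section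
of the pullback of `B` to `Z × X` which vanishes at infinity in the direction of `X`, locally
uniformly in `z`. -/
def IsC0Section (p : Z → Y) (F : ∀ z, C₀(X, B.fib (p z))) : Prop :=
  B.IsPullbackSection (fun q : Z × X => p q.1) (fun q => F q.1 q.2) ∧
    ∀ z₀, ∀ ε > 0, ∃ K : Set X, IsCompact K ∧ ∀ᶠ z in 𝓝 z₀, ∀ x ∉ K, ‖F z x‖ < ε

variable {B}

namespace IsC0Section

lemma add {F G : ∀ z, C₀(X, B.fib (p z))} (hF : B.IsC0Section p F) (hG : B.IsC0Section p G) :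
    B.IsC0Section p (fun z => F z + G z) := by
  refine ⟨hF.1.add hG.1, fun z₀ ε hε => ?_⟩
  obtain ⟨K, hK, h1⟩ := hF.2 z₀ (ε / 2) (half_pos hε)
  obtain ⟨L, hL, h2⟩ := hG.2 z₀ (ε / 2) (half_pos hε)
  refine ⟨K ∪ L, hK.union hL, ?_⟩
  filter_upwards [h1, h2] with z h1 h2 x hx
  rw [Set.mem_union, not_or] at hx
  have := norm_add_le (F z x) (G z x)
  have := h1 x hx.1
  have := h2 x hx.2
  rw [ZeroAtInftyContinuousMap.add_apply]
  linarith

lemma zero (p : Z → Y) : B.IsC0Section (X := X) p (fun _ => 0) :=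
  ⟨IsPullbackSection.zero _, fun z₀ ε hε => ⟨∅, isCompact_empty,
    Eventually.of_forall fun z x _ => by simpa using hε⟩⟩

lemma const_smul {F : ∀ z, C₀(X, B.fib (p z))} (hF : B.IsC0Section p F) (c : ℂ) :
    B.IsC0Section p (fun z => c • F z) := by
  refine ⟨hF.1.const_smul c, fun z₀ ε hε => ?_⟩
  have hc : 0 < ‖c‖ + 1 := by positivity
  obtain ⟨K, hK, h1⟩ := hF.2 z₀ (ε / (‖c‖ + 1)) (by positivity)
  refine ⟨K, hK, ?_⟩
  filter_upwards [h1] with z h1 x hx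
  have h2 := h1 x hx
  rw [lt_div_iff₀ hc] at h2
  rw [ZeroAtInftyContinuousMap.smul_apply, norm_smul]
  nlinarith [norm_nonneg (F z x), norm_nonneg c]

lemma sub {F G : ∀ z, C₀(X, B.fib (p z))} (hF : B.IsC0Section p F) (hG : B.IsC0Section p G) :
    B.IsC0Section p (fun z => F z - G z) := by
  have := hF.add (hG.const_smul (-1))
  simpa [sub_eq_add_neg] using this

lemma sum {ι : Type*} (s : Finset ι) {F : ι → ∀ z, C₀(X, B.fib (p z))}
    (hF : ∀ i ∈ s, B.IsC0Section p (F i)) : B.IsC0Section p (fun z => ∑ i ∈ s, F i z) := by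
  classical
  induction s using Finset.induction_on with
  | empty => simpa using zero p
  | insert a s ha ih =>
    simp only [Finset.sum_insert ha]
    exact (hF a (Finset.mem_insert_self _ _)).add
      (ih fun i hi => hF i (Finset.mem_insert_of_mem hi))

lemma comp {F : ∀ z, C₀(X, B.fib (p z))} (hF : B.IsC0Section p F)
    {W : Type*} [TopologicalSpace W] {q : W → Z} (hq : Continuous q) :
    B.IsC0Section (fun w => p (q w)) (fun w => F (q w)) := by
  refine ⟨hF.1.comp (q := fun r : W × X => (q r.1, r.2)) (by fun_prop), fun w₀ ε hε => ?_⟩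
  obtain ⟨K, hK, h⟩ := hF.2 (q w₀) ε hε
  exact ⟨K, hK, hq.continuousAt.eventually h⟩

lemma mul {F G : ∀ z, C₀(X, B.fib (p z))} (hF : B.IsC0Section p F) (hG : B.IsC0Section p G)
    (hp : Continuous p) : B.IsC0Section p (fun z => F z * G z) := by
  refine ⟨hF.1.mul hG.1 (hp.comp continuous_fst), fun z₀ ε hε => ?_⟩
  obtain ⟨K, hK, h1⟩ := hF.2 z₀ (min 1 ε) (by positivity)
  obtain ⟨L, hL, h2⟩ := hG.2 z₀ (min 1 ε) (by positivity)
  refine ⟨K ∪ L, hK.union hL, ?_⟩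
  filter_upwards [h1, h2] with z h1 h2 x hx
  rw [Set.mem_union, not_or] at hx
  have h3 := lt_min_iff.1 (h1 x hx.1)
  have h4 := lt_min_iff.1 (h2 x hx.2)
  rw [ZeroAtInftyContinuousMap.mul_apply]
  have := norm_mul_le (F z x) (G z x)
  nlinarith [norm_nonneg (F z x), norm_nonneg (G z x)]

lemma of_local {F : ∀ z, C₀(X, B.fib (p z))} (h : ∀ z₀, ∀ ε > 0,
    ∃ G : ∀ z, C₀(X, B.fib (p z)), B.IsC0Section p G ∧ ∀ᶠ z in 𝓝 z₀, ‖F z - G z‖ < ε) :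
    B.IsC0Section p F := by
  refine ⟨IsPullbackSection.of_local fun q₀ ε hε => ?_, fun z₀ ε hε => ?_⟩
  · obtain ⟨G, hG, h1⟩ := h q₀.1 ε hε
    refine ⟨fun q => G q.1 q.2, hG.1, ?_⟩
    filter_upwards [continuous_fst.continuousAt.eventually h1] with q hq
    exact lt_of_le_of_lt (c0_norm_apply_le (F q.1 - G q.1) q.2) hq
  · obtain ⟨G, hG, h1⟩ := h z₀ (ε / 2) (half_pos hε)
    obtain ⟨K, hK, h2⟩ := hG.2 z₀ (ε / 2) (half_pos hε)
    refine ⟨K, hK, ?_⟩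
    filter_upwards [h1, h2] with z h1 h2 x hx
    have h3 := (c0_norm_apply_le (F z - G z) x).trans_lt h1
    have h4 := h2 x hx
    rw [ZeroAtInftyContinuousMap.sub_apply] at h3
    have h5 : ‖F z x‖ ≤ ‖F z x - G z x‖ + ‖G z x‖ := by
      have := norm_add_le (F z x - G z x) (G z x)
      simpa using this
    linarith

lemma norm_lt {F : ∀ z, C₀(X, B.fib (p z))} (hF : B.IsC0Section p F) (hp : Continuous p)
    {z₀ : Z} {c : ℝ} (h : ‖F z₀‖ < c) : ∀ᶠ z in 𝓝 z₀, ‖F z‖ < c := by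
  obtain ⟨c', h1, h2⟩ := exists_between h
  have hc' : 0 < c' := (norm_nonneg _).trans_lt h1
  obtain ⟨K, hK, hKz⟩ := hF.2 z₀ c' hc'
  have h3 : ∀ᶠ z in 𝓝 z₀, ∀ x ∈ K, ‖F z x‖ < c' :=
    hK.eventually_forall_of_forall_eventually fun x _ =>
      hF.1.norm_lt (hp.comp continuous_fst) (z₀ := (z₀, x))
        ((c0_norm_apply_le (F z₀) x).trans_lt h1)
  filter_upwards [hKz, h3] with z h4 h5
  refine (c0_norm_le _ hc'.le fun x => ?_).trans_lt h2
  by_cases hx : x ∈ K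
  · exact (h5 x hx).le
  · exact (h4 x hx).le

end IsC0Section

lemma isC0Section_tens (χ : C₀(X, ℂ)) {ξ : ∀ y, B.fib y} (hξ : ξ ∈ B.sections) :
    B.IsC0Section (fun y => y) (fun y => tens χ (ξ y)) := by
  refine ⟨((isPullbackSection_of_mem hξ (fun q : Y × X => q.1))).smul continuous_fst
    (χ.continuous.comp continuous_snd), fun y₀ ε hε => ?_⟩
  have hM : 0 < ‖ξ y₀‖ + 1 := by positivity
  obtain ⟨K, hK, h⟩ := c0_exists_compact χ (ε := ε / (‖ξ y₀‖ + 1)) (by positivity)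
  refine ⟨K, hK, ?_⟩
  filter_upwards [(isPullbackSection_of_mem hξ (fun y => y)).norm_lt continuous_id
    (lt_add_one ‖ξ y₀‖)] with y hy x hx
  have h1 := h x hx
  rw [lt_div_iff₀ hM] at h1
  change ‖χ x • ξ y‖ < ε
  rw [norm_smul]
  nlinarith [norm_nonneg (χ x), norm_nonneg (ξ y)]

lemma exists_c0Section_near [T2Space X] [LocallyCompactSpace X] (y : Y) (h : C₀(X, B.fib y))
    {ε : ℝ} (hε : 0 < ε) : ∃ σ : ∀ y, C₀(X, B.fib y),
      B.IsC0Section (fun y => y) σ ∧ ‖h - σ y‖ < ε := by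
  obtain ⟨K, hK, hK0⟩ := c0_exists_compact h (half_pos hε)
  choose ξ hξ hnear using fun x : X => exists_section_near (B := B) y (h x) (half_pos hε)
  have hV : ∀ x, IsOpen {x' : X | ‖h x' - ξ x y‖ < ε / 2} := fun x =>
    isOpen_lt (by fun_prop) continuous_const
  obtain ⟨t, ht⟩ := hK.elim_finite_subcover _ hV (fun x _ => Set.mem_iUnion.2 ⟨x, hnear x⟩)
  obtain ⟨ρ, hρV, hρc⟩ := PartitionOfUnity.exists_isSubordinate_of_locallyFinite_t2space hK
    (fun i : t => {x' : X | ‖h x' - ξ i y‖ < ε / 2}) (fun i => hV i) (locallyFinite_of_finite _)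
    (by
      intro a ha
      obtain ⟨i, hi, hai⟩ := Set.mem_iUnion₂.1 (ht ha)
      exact Set.mem_iUnion.2 ⟨⟨i, hi⟩, hai⟩)
  have hρ1 : ∀ a ∈ K, ∑ i, ρ i a = 1 := fun a ha => by
    rw [← finsum_eq_sum_of_fintype]; exact ρ.sum_eq_one ha
  have hρle : ∀ a, ∑ i, ρ i a ≤ 1 := fun a => by
    rw [← finsum_eq_sum_of_fintype]; exact ρ.sum_le_one a
  let χ : t → C₀(X, ℂ) := fun i => ⟨⟨fun x => ((ρ i x : ℝ) : ℂ), by fun_prop⟩,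
    ((hρc i).comp_left (g := fun r : ℝ => (r : ℂ)) rfl).is_zero_at_infty⟩
  refine ⟨fun y => ∑ i, tens (χ i) (ξ i y),
    IsC0Section.sum _ fun i _ => isC0Section_tens (χ i) (hξ i), ?_⟩
  refine (c0_norm_le _ (half_pos hε).le fun x => ?_).trans_lt (half_lt_self hε)
  have hsum : (∑ i, tens (χ i) (ξ i y)) x = ∑ i, ((ρ i x : ℝ) : ℂ) • ξ i y := by
    have : ∀ s : Finset t, (∑ i ∈ s, tens (χ i) (ξ i y)) x = ∑ i ∈ s, ((ρ i x : ℝ) : ℂ) • ξ i y := by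
      intro s
      classical
      induction s using Finset.induction_on with
      | empty => rfl
      | insert a s ha ih =>
        rw [Finset.sum_insert ha, Finset.sum_insert ha, ZeroAtInftyContinuousMap.add_apply, ih]
        rfl
    exact this _
  rw [ZeroAtInftyContinuousMap.sub_apply, hsum]
  have e : h x - ∑ i, ((ρ i x : ℝ) : ℂ) • ξ i y
      = ((1 - ∑ i, ρ i x : ℝ) : ℂ) • h x + ∑ i, ((ρ i x : ℝ) : ℂ) • (h x - ξ i y) := by
    simp only [smul_sub, Finset.sum_sub_distrib, ← Finset.sum_smul, Complex.ofReal_sub,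
      Complex.ofReal_sum, Complex.ofReal_one, sub_smul, one_smul]
    abel
  have h1 : ‖((1 - ∑ i, ρ i x : ℝ) : ℂ) • h x‖ ≤ (1 - ∑ i, ρ i x) * (ε / 2) := by
    rw [norm_smul, Complex.norm_real, Real.norm_of_nonneg (sub_nonneg.2 (hρle x))]
    by_cases hx : x ∈ K
    · rw [hρ1 x hx]
      simp
    · exact mul_le_mul_of_nonneg_left (hK0 x hx).le (sub_nonneg.2 (hρle x))
  have h2 : ‖∑ i, ((ρ i x : ℝ) : ℂ) • (h x - ξ i y)‖ ≤ ∑ i, ρ i x * (ε / 2) := by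
    refine (norm_sum_le _ _).trans (Finset.sum_le_sum fun i _ => ?_)
    rw [norm_smul, Complex.norm_real, Real.norm_of_nonneg (ρ.nonneg i x)]
    by_cases hx : ‖h x - ξ i y‖ < ε / 2
    · exact mul_le_mul_of_nonneg_left hx.le (ρ.nonneg i x)
    · rw [image_eq_zero_of_notMem_tsupport (fun h => hx (hρV i h))]
      simp
  rw [← Finset.sum_mul] at h2
  rw [e]
  refine (norm_add_le _ _).trans ?_
  linarith

/-- The field `BX` with fibres `C₀(X, B_y)`: the pushforward along `Y × X → Y` of the pullback of
`B` to `Y × X`. -/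
def extC0 (B : BanachAlgebraField.{u, v} Y) (X : Type w) [TopologicalSpace X] [T2Space X]
    [LocallyCompactSpace X] : BanachAlgebraField.{u, max w v} Y where
  fib y := C₀(X, B.fib y)
  sections :=
    { carrier := {σ | B.IsC0Section (fun y => y) σ}
      add_mem' := IsC0Section.add
      zero_mem' := IsC0Section.zero (B := B) (X := X) (fun y : Y => y)
      smul_mem' := fun c _ h => h.const_smul c }
  dense_eval y := Metric.dense_iff.2 fun h ε hε => by
    obtain ⟨σ, hσ, hn⟩ := exists_c0Section_near y h hε
    refine ⟨σ y, ?_, σ, hσ, rfl⟩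
    rwa [Metric.mem_ball, dist_comm, dist_eq_norm]
  usc_norm σ hσ y c hc := hσ.norm_lt continuous_id hc
  mem_of_local σ h := IsC0Section.of_local h
  mul_mem σ hσ τ hτ := hσ.mul hτ continuous_id

lemma extC0_isPullbackSection_iff {X : Type w} [TopologicalSpace X] [T2Space X]
    [LocallyCompactSpace X] (hp : Continuous p) {F : ∀ z, C₀(X, B.fib (p z))} :
    (B.extC0 X).IsPullbackSection p F ↔ B.IsC0Section p F := by
  constructor
  · intro h
    refine IsC0Section.of_local fun z₀ ε hε => ?_
    obtain ⟨η, hη, h1⟩ := h z₀ ε hε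
    exact ⟨fun z => η (p z), IsC0Section.comp (p := fun y : Y => y) hη hp, h1⟩
  · intro h z₀ ε hε
    obtain ⟨η, hη, h1⟩ := exists_c0Section_near (p z₀) (F z₀) hε
    exact ⟨η, hη, (h.sub (IsC0Section.comp (p := fun y : Y => y) hη hp)).norm_lt hp h1⟩

end BanachAlgebraField

section ExtGroupoid

variable {U : Type u} [Groupoid.{w} U] [TopologicalSpace U] [TopologicalSpace (Arr U)]
  [IsTopologicalGroupoid U]

/-- The `𝒢`-Banach algebra `BX`, with the action `(γ h)(x) = γ (h(x))` on the fibres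
`C₀(X, B_y)`. -/
def GBanachAlgebra.extC0 (B : GBanachAlgebra.{u, w, v} U) (X : Type*) [TopologicalSpace X]
    [T2Space X] [LocallyCompactSpace X] : GBanachAlgebra U where
  toBanachAlgebraField := B.toBanachAlgebraField.extC0 X
  act γ := c0Map X (B.act γ)
  act_mul γ b c := ZeroAtInftyContinuousMap.ext fun x =>
    B.act_mul γ ((show C₀(X, _) from b) x) ((show C₀(X, _) from c) x)
  act_comp γ δ b := ZeroAtInftyContinuousMap.ext fun x =>
    B.act_comp γ δ ((show C₀(X, _) from b) x)
  act_continuous ξ hξ := by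
    have h := (BanachAlgebraField.extC0_isPullbackSection_iff
      (B := B.toBanachAlgebraField) (X := X) IsTopologicalGroupoid.continuous_src).1 hξ
    refine (BanachAlgebraField.extC0_isPullbackSection_iff
      (B := B.toBanachAlgebraField) (X := X) IsTopologicalGroupoid.continuous_tgt).2
      ⟨GBanachAlgebra.act_isPullbackSection (q := fun r : Arr U × X => r.1) continuous_fst h.1,
        fun γ₀ ε hε => ?_⟩
    obtain ⟨K, hK, h1⟩ := h.2 γ₀ ε hε
    refine ⟨K, hK, ?_⟩
    filter_upwards [h1] with γ h1 x hx
    exact ((B.act γ.hom).norm_map _).le.trans_lt (h1 x hx)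

end ExtGroupoid

/-! ### Topological K-theory of Banach algebras -/

section KTheory

open Matrix

section RingK

variable (R : Type u) [Ring R]

/-- Idempotent matrices over `R`, of all sizes. -/
def K0Gen : Type u := Σ n : ℕ, {e : Matrix (Fin n) (Fin n) R // e * e = e}

/-- The block sum `a ⊕ b` of two square matrices. -/
def blockSum {R : Type u} [Ring R] {m n : ℕ} (a : Matrix (Fin m) (Fin m) R)
    (b : Matrix (Fin n) (Fin n) R) : Matrix (Fin (m + n)) (Fin (m + n)) R :=
  Matrix.reindex finSumFinEquiv finSumFinEquiv (Matrix.fromBlocks a 0 0 b)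

/-- The relations defining `K₀(R)`: (Murray-von Neumann) equivalent idempotents are identified, and
the block sum of idempotents becomes the addition. -/
inductive K0Rel : FreeAbelianGroup (K0Gen R) → Prop
  | equiv {m n : ℕ} (e : {e : Matrix (Fin m) (Fin m) R // e * e = e})
      (f : {f : Matrix (Fin n) (Fin n) R // f * f = f})
      (a : Matrix (Fin m) (Fin n) R) (b : Matrix (Fin n) (Fin m) R)
      (hab : a * b = e.1) (hba : b * a = f.1) :
      K0Rel (FreeAbelianGroup.of ⟨m, e⟩ - FreeAbelianGroup.of ⟨n, f⟩)
  | sum {m n : ℕ} (e : {e : Matrix (Fin m) (Fin m) R // e * e = e})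
      (f : {f : Matrix (Fin n) (Fin n) R // f * f = f})
      (g : {g : Matrix (Fin (m + n)) (Fin (m + n)) R // g * g = g})
      (hg : g.1 = blockSum e.1 f.1) :
      K0Rel (FreeAbelianGroup.of ⟨m + n, g⟩ - FreeAbelianGroup.of ⟨m, e⟩ -
        FreeAbelianGroup.of ⟨n, f⟩)

/-- `K₀` of a unital ring: the Grothendieck group of the monoid of equivalence classes of
idempotent matrices. -/
def RingK0 : Type u := FreeAbelianGroup (K0Gen R) ⧸ AddSubgroup.closure {z | K0Rel R z}

instance : AddCommGroup (RingK0 R) :=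
  inferInstanceAs (AddCommGroup (_ ⧸ AddSubgroup.closure {z | K0Rel R z}))

/-- Invertible matrices over `R`, of all sizes. -/
def K1Gen : Type u := Σ n : ℕ, (Matrix (Fin n) (Fin n) R)ˣ

/-- The relations defining `K₁(R) = π₀(GL_∞(R))`: the matrix product becomes the addition, `g` and
`g ⊕ 1` are identified, and so are invertible matrices in the same path component. -/
inductive K1Rel [TopologicalSpace R] : FreeAbelianGroup (K1Gen R) → Prop
  | mul {n : ℕ} (g h : (Matrix (Fin n) (Fin n) R)ˣ) :
      K1Rel (FreeAbelianGroup.of ⟨n, g * h⟩ - FreeAbelianGroup.of ⟨n, g⟩ -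
        FreeAbelianGroup.of ⟨n, h⟩)
  | stab {m n : ℕ} (g : (Matrix (Fin m) (Fin m) R)ˣ)
      (g' : (Matrix (Fin (m + n)) (Fin (m + n)) R)ˣ)
      (h : g'.1 = blockSum g.1 (1 : Matrix (Fin n) (Fin n) R)) :
      K1Rel (FreeAbelianGroup.of ⟨m + n, g'⟩ - FreeAbelianGroup.of ⟨m, g⟩)
  | homotopy {n : ℕ} (g h : (Matrix (Fin n) (Fin n) R)ˣ) (hgh : Joined g h) :
      K1Rel (FreeAbelianGroup.of ⟨n, g⟩ - FreeAbelianGroup.of ⟨n, h⟩)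

/-- Topological `K₁` of a unital topological ring: path components of `GL_∞(R)`. -/
def RingK1 [TopologicalSpace R] : Type u :=
  FreeAbelianGroup (K1Gen R) ⧸ AddSubgroup.closure {z | K1Rel R z}

instance [TopologicalSpace R] : AddCommGroup (RingK1 R) :=
  inferInstanceAs (AddCommGroup (_ ⧸ AddSubgroup.closure {z | K1Rel R z}))

variable {R} {S : Type v} [Ring S]

lemma blockSum_map (φ : R →+* S) {m n : ℕ} (a : Matrix (Fin m) (Fin m) R)
    (b : Matrix (Fin n) (Fin n) R) :
    (blockSum a b).map φ = blockSum (a.map φ) (b.map φ) := by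
  change ((Matrix.fromBlocks a 0 0 b).map φ).submatrix _ _ = _
  rw [Matrix.fromBlocks_map]
  have h1 : (0 : Matrix (Fin m) (Fin n) R).map φ = 0 := Matrix.map_zero _ (map_zero φ)
  have h2 : (0 : Matrix (Fin n) (Fin m) R).map φ = 0 := Matrix.map_zero _ (map_zero φ)
  rw [h1, h2]
  rfl

/-- The map on idempotent matrices induced by a ring homomorphism. -/
def K0Gen.map (φ : R →+* S) (e : K0Gen R) : K0Gen S :=
  ⟨e.1, e.2.1.map φ, by rw [← Matrix.map_mul, e.2.2]⟩

/-- The homomorphism `K₀(R) → K₀(S)` induced by a ring homomorphism. -/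
def RingK0.map (φ : R →+* S) : RingK0 R →+ RingK0 S :=
  QuotientAddGroup.map _ _ (FreeAbelianGroup.map (K0Gen.map φ)) <| by
    rw [AddSubgroup.closure_le]
    rintro z (⟨e, f, a, b, hab, hba⟩ | ⟨e, f, g, hg⟩) <;>
      refine AddSubgroup.subset_closure ?_
    · simp only [map_sub, FreeAbelianGroup.map_of_apply]
      exact K0Rel.equiv _ _ (a.map φ) (b.map φ) (by rw [← Matrix.map_mul, hab])
        (by rw [← Matrix.map_mul, hba])
    · simp only [map_sub, FreeAbelianGroup.map_of_apply]
      refine K0Rel.sum _ _ _ ?_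
      change g.1.map φ = _
      rw [hg, blockSum_map]

/-- The map on invertible matrices induced by a ring homomorphism. -/
def K1Gen.map (φ : R →+* S) (g : K1Gen R) : K1Gen S :=
  ⟨g.1, Units.map (φ.mapMatrix (m := Fin g.1)).toMonoidHom g.2⟩

/-- The homomorphism `K₁(R) → K₁(S)` induced by a continuous ring homomorphism. -/
def RingK1.map [TopologicalSpace R] [TopologicalSpace S] (φ : R →+* S) (hφ : Continuous φ) :
    RingK1 R →+ RingK1 S :=
  QuotientAddGroup.map _ _ (FreeAbelianGroup.map (K1Gen.map φ)) <| by
    rw [AddSubgroup.closure_le]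
    rintro z (⟨g, h⟩ | ⟨g, g', h⟩ | ⟨g, h, hgh⟩) <;>
      refine AddSubgroup.subset_closure ?_
    · simp only [map_sub, FreeAbelianGroup.map_of_apply]
      have := K1Rel.mul (Units.map (φ.mapMatrix).toMonoidHom g)
        (Units.map (φ.mapMatrix).toMonoidHom h)
      rw [← map_mul] at this
      exact this
    · simp only [map_sub, FreeAbelianGroup.map_of_apply]
      refine K1Rel.stab _ _ ?_
      change g'.1.map φ = blockSum (g.1.map φ) 1
      rw [h, blockSum_map, Matrix.map_one _ (map_zero φ) (map_one φ)]
    · simp only [map_sub, FreeAbelianGroup.map_of_apply]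
      refine K1Rel.homotopy _ _ ?_
      exact hgh.map (Continuous.units_map _ (Continuous.matrix_map continuous_id hφ))

lemma K0Gen.map_map {T : Type w} [Ring T] (ψ : S →+* T) (φ : R →+* S) (e : K0Gen R) :
    K0Gen.map ψ (K0Gen.map φ e) = K0Gen.map (ψ.comp φ) e := rfl

lemma RingK0.map_map {T : Type w} [Ring T] (ψ : S →+* T) (φ : R →+* S) (z : RingK0 R) :
    RingK0.map ψ (RingK0.map φ z) = RingK0.map (ψ.comp φ) z := by
  obtain ⟨z, rfl⟩ := QuotientAddGroup.mk_surjective z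
  refine congrArg QuotientAddGroup.mk ?_
  exact (FreeAbelianGroup.map_comp_apply (f := K0Gen.map φ) (g := K0Gen.map ψ) z).symm

lemma RingK1.map_map [TopologicalSpace R] [TopologicalSpace S] {T : Type w} [Ring T]
    [TopologicalSpace T] (ψ : S →+* T) (hψ : Continuous ψ) (φ : R →+* S) (hφ : Continuous φ)
    (z : RingK1 R) :
    RingK1.map ψ hψ (RingK1.map φ hφ z) = RingK1.map (ψ.comp φ) (hψ.comp hφ) z := by
  obtain ⟨z, rfl⟩ := QuotientAddGroup.mk_surjective z
  refine congrArg QuotientAddGroup.mk ?_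
  exact (FreeAbelianGroup.map_comp_apply (f := K1Gen.map φ) (g := K1Gen.map ψ) z).symm

end RingK

/-- The unitalisation `A ⊕ ℂ` of a Banach algebra, with the sum-norm. -/
abbrev BanachAlg.Plus (A : BanachAlg.{v}) : Type v := WithLp 1 (Unitization ℂ A)

/-- The augmentation `A ⊕ ℂ → ℂ`. -/
def BanachAlg.aug (A : BanachAlg.{v}) : A.Plus →+* ℂ :=
  ((Unitization.fstHom ℂ A).comp
    (WithLp.unitizationAlgEquiv (𝕜 := ℂ) (A := A) ℂ).toAlgHom).toRingHom

lemma BanachAlg.continuous_aug (A : BanachAlg.{v}) : Continuous A.aug :=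
  (AddMonoidHomClass.continuous_of_bound A.aug 1 fun x => by
    rw [one_mul, WithLp.unitization_norm_def]
    exact le_add_of_nonneg_right (norm_nonneg _))

namespace BanachAlg

variable {A : BanachAlg.{v}} {B : BanachAlg.{w}}

/-- The homomorphism of the unitalisations induced by a homomorphism of Banach algebras. -/
def Hom.plus (φ : A.Hom B) : A.Plus →+* B.Plus :=
  ((WithLp.unitizationAlgEquiv (𝕜 := ℂ) (A := B) ℂ).symm.toAlgHom.comp
    ((Unitization.lift ((Unitization.inrNonUnitalAlgHom ℂ B).comp φ.toHom)).comp
      (WithLp.unitizationAlgEquiv (𝕜 := ℂ) (A := A) ℂ).toAlgHom)).toRingHom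

lemma Hom.exists_bound (φ : A.Hom B) : ∃ C : ℝ, 0 ≤ C ∧ ∀ a, ‖φ.toHom a‖ ≤ C * ‖a‖ := by
  let L : A →L[ℂ] B := ⟨(φ.toHom : A →ₗ[ℂ] B), φ.cont⟩
  exact ⟨‖L‖, norm_nonneg _, L.le_opNorm⟩

lemma Hom.continuous_plus (φ : A.Hom B) : Continuous φ.plus := by
  obtain ⟨C, hC, h⟩ := φ.exists_bound
  refine AddMonoidHomClass.continuous_of_bound φ.plus (1 + C) fun x => ?_
  rw [WithLp.unitization_norm_def, WithLp.unitization_norm_def]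
  have h1 : (WithLp.ofLp (φ.plus x)).fst = (WithLp.ofLp x).fst := by
    simp [Hom.plus, Unitization.lift, Unitization.algebraMap_eq_inl]
  have h2 : (WithLp.ofLp (φ.plus x)).snd = φ.toHom (WithLp.ofLp x).snd := by
    simp [Hom.plus, Unitization.lift, Unitization.algebraMap_eq_inl]
  rw [h1, h2]
  have := h (WithLp.ofLp x).snd
  nlinarith [norm_nonneg (WithLp.ofLp x).fst, norm_nonneg (WithLp.ofLp x).snd]

lemma Hom.aug_comp_plus (φ : A.Hom B) : B.aug.comp φ.plus = A.aug := by
  ext x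
  change (WithLp.ofLp (φ.plus x)).fst = (WithLp.ofLp x).fst
  simp [Hom.plus, Unitization.lift, Unitization.algebraMap_eq_inl]

variable (A) in
/-- `K₀(A)`, the kernel of `K₀(A ⊕ ℂ) → K₀(ℂ)`. -/
def K0 : AddSubgroup (RingK0 A.Plus) := (RingK0.map A.aug).ker

variable (A) in
/-- `K₁(A)`, the kernel of `K₁(A ⊕ ℂ) → K₁(ℂ)`. -/
def K1 : AddSubgroup (RingK1 A.Plus) := (RingK1.map A.aug A.continuous_aug).ker

/-- The map `K₀(A) → K₀(B)`. -/
def Hom.K0 (φ : A.Hom B) : A.K0 →+ B.K0 :=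
  ((RingK0.map φ.plus).comp A.K0.subtype).codRestrict B.K0 fun z => by
    change RingK0.map B.aug (RingK0.map φ.plus z.1) = 0
    rw [RingK0.map_map, φ.aug_comp_plus]
    exact z.2

/-- The map `K₁(A) → K₁(B)`. -/
def Hom.K1 (φ : A.Hom B) : A.K1 →+ B.K1 :=
  ((RingK1.map φ.plus φ.continuous_plus).comp A.K1.subtype).codRestrict B.K1 fun z => by
    change RingK1.map B.aug B.continuous_aug (RingK1.map φ.plus φ.continuous_plus z.1) = 0
    rw [RingK1.map_map]
    simp only [φ.aug_comp_plus]
    exact z.2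

/-- The suspension of a homomorphism. -/
def Hom.S (φ : A.Hom B) : A.S.Hom B.S where
  toHom :=
    { toFun := fun (h : C₀(ℝ, A)) => (⟨⟨fun x => φ.toHom (h x), φ.cont.comp h.continuous⟩, by
        have := (φ.cont.tendsto 0).comp (zero_at_infty h)
        rwa [map_zero] at this⟩ : C₀(ℝ, B))
      map_smul' := fun c h => ZeroAtInftyContinuousMap.ext fun x =>
        map_smul φ.toHom c ((show C₀(ℝ, A) from h) x)
      map_zero' := ZeroAtInftyContinuousMap.ext fun x => map_zero φ.toHom
      map_add' := fun h k => ZeroAtInftyContinuousMap.ext fun x =>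
        map_add φ.toHom ((show C₀(ℝ, A) from h) x) ((show C₀(ℝ, A) from k) x)
      map_mul' := fun h k => ZeroAtInftyContinuousMap.ext fun x =>
        map_mul φ.toHom ((show C₀(ℝ, A) from h) x) ((show C₀(ℝ, A) from k) x) }
  cont := by
    obtain ⟨C, hC, h⟩ := φ.exists_bound
    refine AddMonoidHomClass.continuous_of_bound _ C fun f => ?_
    exact c0_norm_le _ (mul_nonneg hC (norm_nonneg _)) fun x => (h _).trans
      (mul_le_mul_of_nonneg_left (c0_norm_apply_le (show C₀(ℝ, A) from f) x) hC)

/-- The topological K-groups `K_n(A)`, `n ∈ ℕ`, of a Banach algebra: `K₀` is defined through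
idempotents, `K₁` through invertible elements, and `K_{n+1}(A) = K_n(S A)` for `n ≥ 1`. -/
def K : ℕ → BanachAlg.{v} → AddCommGrpCat.{v}
  | 0, A => AddCommGrpCat.of A.K0
  | 1, A => AddCommGrpCat.of A.K1
  | n + 2, A => K (n + 1) A.S

/-- The map `φ_* : K_n(A) → K_n(B)`. -/
def Hom.K : ∀ (n : ℕ) {A : BanachAlg.{v}} {B : BanachAlg.{w}}, A.Hom B →
    (BanachAlg.K n A →+ BanachAlg.K n B)
  | 0, _, _, φ => φ.K0
  | 1, _, _, φ => φ.K1
  | n + 2, _, _, φ => Hom.K (n + 1) φ.S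

end BanachAlg

end KTheory

/-! ### `C₀(X)`-Banach algebras and their fibres -/

section C0Structure

variable {X : Type u} [TopologicalSpace X]

/-- The product `χ h : x ↦ χ(x) h(x)` of `χ ∈ C₀(X)` and `h ∈ C₀(X, E)`. -/
def c0Smul {E : Type*} [NormedAddCommGroup E] [NormedSpace ℂ E] (χ : C₀(X, ℂ)) (h : C₀(X, E)) :
    C₀(X, E) where
  toFun x := χ x • h x
  continuous_toFun := by fun_prop
  zero_at_infty' := by
    have := (zero_at_infty χ).smul (zero_at_infty h)
    rwa [zero_smul] at this

/-- The canonical action of `C₀(X)` on `C₀(X, A)`. -/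
def BanachAlg.C0.act (X : Type u) [TopologicalSpace X] (A : BanachAlg.{v}) (χ : C₀(X, ℂ))
    (h : A.C0 X) : A.C0 X :=
  c0Smul χ (show C₀(X, A) from h)

/-- The value of an element of `C₀(X, A)` at the point `x`. -/
def BanachAlg.C0.eval {A : BanachAlg.{v}} (h : A.C0 X) (x : X) : A := (show C₀(X, A) from h) x

/-- A `C₀(X)`-Banach algebra: a Banach algebra `A` with the structure of a non-degenerate Banach
`C₀(X)`-module, given by `act : C₀(X) × A → A`, for which the product of `A` is
`C₀(X)`-bilinear. -/
structure IsC0BanachAlgebra (X : Type u) [TopologicalSpace X] (A : BanachAlg.{v})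
    (act : C₀(X, ℂ) → A → A) : Prop where
  act_add : ∀ χ a b, act χ (a + b) = act χ a + act χ b
  act_smul : ∀ χ (c : ℂ) a, act χ (c • a) = c • act χ a
  add_act : ∀ χ ψ a, act (χ + ψ) a = act χ a + act ψ a
  smul_act : ∀ (c : ℂ) χ a, act (c • χ) a = c • act χ a
  mul_act : ∀ χ ψ a, act (χ * ψ) a = act χ (act ψ a)
  norm_act_le : ∀ χ a, ‖act χ a‖ ≤ ‖χ‖ * ‖a‖
  nondegenerate : Dense (Submodule.span ℂ {b : A | ∃ χ a, act χ a = b} : Set A)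
  act_mul_left : ∀ χ a b, act χ (a * b) = act χ a * b
  act_mul_right : ∀ χ a b, act χ (a * b) = a * act χ b

/-- The closed subspace `C₀(X \ {x}) A` of a `C₀(X)`-Banach algebra `A`. -/
def fibreIdeal {A : BanachAlg.{v}} (act : C₀(X, ℂ) → A → A) (x : X) : Submodule ℂ A :=
  (Submodule.span ℂ {b : A | ∃ χ a, χ x = 0 ∧ act χ a = b}).topologicalClosure

/-- The fibre `A_x = A / C₀(X \ {x}) A` of a `C₀(X)`-Banach algebra, with the quotient norm. -/
abbrev Fibre {A : BanachAlg.{v}} (act : C₀(X, ℂ) → A → A) (x : X) : Type v :=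
  A ⧸ fibreIdeal act x

/-- A homomorphism `φ : A → A'` is an isometric isomorphism on the fibres: for all `x ∈ X`, it
induces an isometric isomorphism `A_x ≅ A'_x`. -/
def IsIsometricOnFibres {A : BanachAlg.{v}} {A' : BanachAlg.{w}} (act : C₀(X, ℂ) → A → A)
    (act' : C₀(X, ℂ) → A' → A') (φ : A.Hom A') : Prop :=
  ∀ x : X, ∃ Φ : Fibre act x ≃ₗᵢ[ℂ] Fibre act' x,
    ∀ a : A, Φ ((fibreIdeal act x).mkQ a) = (fibreIdeal act' x).mkQ (φ.toHom a)

/-- `C₀(X)`-linear contractive homomorphisms. -/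
structure BanachAlg.Hom.IsC0Hom {A : BanachAlg.{v}} {A' : BanachAlg.{w}} (act : C₀(X, ℂ) → A → A)
    (act' : C₀(X, ℂ) → A' → A') (φ : A.Hom A') : Prop where
  norm_le : ∀ a, ‖φ.toHom a‖ ≤ ‖a‖
  map_act : ∀ χ a, φ.toHom (act χ a) = act' χ (φ.toHom a)

/-- The spectral radius `ρ_A(a)` of an element of a Banach algebra. -/
def BanachAlg.rho {A : BanachAlg.{v}} (a : A) : ENNReal := spectralRadius ℂ (a : Unitization ℂ A)

/-- Full homomorphisms: contractive homomorphisms with dense range that preserve the spectral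
radius. -/
structure BanachAlg.Hom.IsFull {A : BanachAlg.{v}} {A' : BanachAlg.{w}} (φ : A.Hom A') :
    Prop where
  norm_le : ∀ a, ‖φ.toHom a‖ ≤ ‖a‖
  isoradial : ∀ a, BanachAlg.rho (φ.toHom a) = BanachAlg.rho a
  dense_range : DenseRange φ.toHom

end C0Structure

section C0Groupoid

variable {U : Type u} [Groupoid.{w} U] [TopologicalSpace U] [TopologicalSpace (Arr U)]
  [IsTopologicalGroupoid U] {B : GBanachAlgebra.{u, w, v} U}
  {X : Type*} [TopologicalSpace X] [T2Space X] [LocallyCompactSpace X]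

/-- The product `χ f : γ ↦ χ f(γ)` of `χ ∈ C₀(X)` and `f ∈ Γ_c(𝒢, r^*BX)`. -/
def GammaC.c0Smul (χ : C₀(X, ℂ)) (f : GammaC (B.extC0 X)) : GammaC (B.extC0 X) :=
  ⟨fun γ => BanachGroupoid.c0Smul χ (show C₀(X, B.fib γ.tgt) from f.1 γ), by
    obtain ⟨hf, K, hK, h0⟩ := f.2
    have h := (BanachAlgebraField.extC0_isPullbackSection_iff
      (B := B.toBanachAlgebraField) (X := X) IsTopologicalGroupoid.continuous_tgt).1 hf
    refine ⟨(BanachAlgebraField.extC0_isPullbackSection_iff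
      (B := B.toBanachAlgebraField) (X := X) IsTopologicalGroupoid.continuous_tgt).2
      ⟨h.1.smul (IsTopologicalGroupoid.continuous_tgt.comp continuous_fst)
        (χ.continuous.comp continuous_snd), fun γ₀ ε hε => ?_⟩, K, hK, fun γ hγ => ?_⟩
    · have hc : 0 < ‖χ‖ + 1 := by positivity
      obtain ⟨L, hL, h1⟩ := h.2 γ₀ (ε / (‖χ‖ + 1)) (by positivity)
      refine ⟨L, hL, ?_⟩
      filter_upwards [h1] with γ h1 x hx
      have h2 := h1 x hx
      rw [lt_div_iff₀ hc] at h2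
      have h3 := c0_norm_apply_le χ x
      change ‖χ x • (show C₀(X, B.fib γ.tgt) from f.1 γ) x‖ < ε
      rw [norm_smul]
      nlinarith [norm_nonneg ((show C₀(X, B.fib γ.tgt) from f.1 γ) x), norm_nonneg (χ x)]
    · refine ZeroAtInftyContinuousMap.ext fun x => ?_
      change χ x • (show C₀(X, B.fib γ.tgt) from f.1 γ) x = 0
      rw [h0 γ hγ]
      exact smul_zero _⟩

/-- The evaluation `Γ_c(𝒢, r^*BX) → Γ_c(𝒢, r^*B)` at the point `x ∈ X`. -/
def GammaC.eval (x : X) (f : GammaC (B.extC0 X)) : GammaC B :=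
  ⟨fun γ => (show C₀(X, B.fib γ.tgt) from f.1 γ) x, by
    obtain ⟨hf, K, hK, h0⟩ := f.2
    have h := (BanachAlgebraField.extC0_isPullbackSection_iff
      (B := B.toBanachAlgebraField) (X := X) IsTopologicalGroupoid.continuous_tgt).1 hf
    refine ⟨h.1.comp (q := fun γ => (γ, x)) (by fun_prop), K, hK, fun γ hγ => ?_⟩
    exact congrArg (fun k : C₀(X, B.fib γ.tgt) => k x) (h0 γ hγ)⟩

variable [T2Space (Arr U)] [LocallyCompactSpace (Arr U)] {lam : HaarSystem U}
  (N : UnconditionalNorm lam)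

lemma UnconditionalNorm.sectionNorm_c0Smul_le (χ : C₀(X, ℂ)) (f : GammaC (B.extC0 X)) :
    N.sectionNorm (GammaC.c0Smul χ f) ≤ ‖χ‖ * N.sectionNorm f := by
  refine le_mul_of_forall_lt₀ fun a ha b hb => ?_
  obtain ⟨ψ, h, hn⟩ := N.exists_lt (dominating_nonempty f) hb
  have h' : ((‖χ‖ : ℝ) : ℂ) • ψ ∈ dominating fun γ => ‖(GammaC.c0Smul χ f).1 γ‖ := fun γ => by
    refine ⟨by simp [(h γ).1], ?_⟩
    have h1 : ‖(GammaC.c0Smul χ f).1 γ‖ ≤ ‖χ‖ * ‖f.1 γ‖ :=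
      c0_norm_le _ (by positivity) fun x => by
        change ‖χ x • (show C₀(X, B.fib γ.tgt) from f.1 γ) x‖ ≤ _
        rw [norm_smul]
        exact mul_le_mul (c0_norm_apply_le χ x)
          (c0_norm_apply_le (show C₀(X, B.fib γ.tgt) from f.1 γ) x) (norm_nonneg _) (norm_nonneg _)
    have h2 := h1.trans (mul_le_mul_of_nonneg_left (h γ).2 (norm_nonneg χ))
    simpa using h2
  refine (N.ext_le h').trans ?_
  rw [map_smul_eq_mul, Complex.norm_real, norm_norm]
  exact mul_le_mul ha.le hn.le (apply_nonneg _ _) ((norm_nonneg χ).trans ha.le)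

/-- The multiplication by `χ ∈ C₀(X)`, as a bounded operator of the semi-normed space
`Γ_c(𝒢, r^*BX)`. -/
def UnconditionalNorm.c0Lin (χ : C₀(X, ℂ)) :
    PreAlg N (B.extC0 X) →L[ℂ] PreAlg N (B.extC0 X) :=
  LinearMap.mkContinuous
    { toFun := fun f => GammaC.c0Smul χ (show GammaC (B.extC0 X) from f)
      map_add' := fun f g => Subtype.ext <| funext fun γ =>
        ZeroAtInftyContinuousMap.ext fun x => smul_add (χ x) _ _
      map_smul' := fun c f => Subtype.ext <| funext fun γ =>
        ZeroAtInftyContinuousMap.ext fun x => smul_comm (χ x) c _ } ‖χ‖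
    (N.sectionNorm_c0Smul_le χ)

/-- The canonical action of `C₀(X)` on `𝒜(𝒢, BX)`: the continuous extension of the pointwise
multiplication `(χ f)(γ) = χ f(γ)` on `Γ_c(𝒢, r^*BX)`. -/
def UnconditionalNorm.c0Act (χ : C₀(X, ℂ)) (a : N.algebra (B.extC0 X)) : N.algebra (B.extC0 X) :=
  UniformSpace.Completion.map (N.c0Lin (B := B) χ) a

lemma UnconditionalNorm.c0Act_toAlgebra (χ : C₀(X, ℂ)) (f : GammaC (B.extC0 X)) :
    N.c0Act χ (N.toAlgebra f) = N.toAlgebra (GammaC.c0Smul χ f) :=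
  UniformSpace.Completion.map_coe (N.c0Lin (B := B) χ).uniformContinuous
    (show PreAlg N (B.extC0 X) from f)

/-- The canonical homomorphism `ι : 𝒜(𝒢, BX) → 𝒜(𝒢, B)X = C₀(X, 𝒜(𝒢, B))`, determined by
`ι(f)(x) = (γ ↦ f(γ)(x))` for `f ∈ Γ_c(𝒢, r^*BX)`. -/
def UnconditionalNorm.IsCanonical
    (ι : (N.algebra (B.extC0 X)).Hom ((N.algebra B).C0 X)) : Prop :=
  ∀ (f : GammaC (B.extC0 X)) (x : X),
    BanachAlg.C0.eval (ι.toHom (N.toAlgebra f)) x = N.toAlgebra (GammaC.eval x f)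

end C0Groupoid

/-! ### Groups, as groupoids with one object -/

section Groups

/-- A `G`-Banach algebra, for a topological group `G`: a Banach algebra with a strongly continuous
action of `G` by isometric automorphisms. -/
structure GroupBanachAlgebra (G : Type u) [Group G] [TopologicalSpace G] extends
    BanachAlg.{v} where
  act : G → (carrier ≃ₗᵢ[ℂ] carrier)
  act_algebra_mul : ∀ g (b c : carrier), act g (b * c) = act g b * act g c
  act_mul : ∀ g h (b : carrier), act (g * h) b = act g (act h b)
  act_continuous : ∀ b : carrier, Continuous fun g => act g b

/-- An unconditional (semi-)norm on `C_c(G)`, for a group `G` with Haar measure `μ`: it is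
submultiplicative for the convolution `(f * g)(s) = ∫ f(t) g(t⁻¹s) dμ(t)` and depends monotonically
on the absolute value. -/
structure GroupUnconditionalNorm {G : Type u} [Group G] [TopologicalSpace G] [MeasurableSpace G]
    (μ : Measure G) where
  toSeminorm : Seminorm ℂ C_c(G, ℂ)
  mono : ∀ f g : C_c(G, ℂ), (∀ s, ‖f s‖ ≤ ‖g s‖) → toSeminorm f ≤ toSeminorm g
  conv_le : ∀ f g h : C_c(G, ℂ), (∀ s, h s = ∫ t, f t * g (t⁻¹ * s) ∂μ) →
    toSeminorm h ≤ toSeminorm f * toSeminorm g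

variable (G : Type u) [Group G] [TopologicalSpace G]

instance : TopologicalSpace (SingleObj G) := ⊤

/-- The arrows of the one-object groupoid are the elements of the group. -/
def arrEquiv : Arr (SingleObj G) ≃ G where
  toFun γ := γ.hom
  invFun g := @Arr.mk (SingleObj G) _ (SingleObj.star G) (SingleObj.star G) g
  left_inv _ := rfl
  right_inv _ := rfl

instance : TopologicalSpace (Arr (SingleObj G)) :=
  TopologicalSpace.induced (arrEquiv G) inferInstance

/-- The homeomorphism between the arrow space of the one-object groupoid and the group. -/
def arrHomeo : Arr (SingleObj G) ≃ₜ G :=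
  (arrEquiv G).toHomeomorphOfIsInducing ⟨rfl⟩

instance [IsTopologicalGroup G] : IsTopologicalGroupoid (SingleObj G) where
  continuous_src := continuous_top
  continuous_tgt := continuous_top
  continuous_id := continuous_induced_rng.2 continuous_const
  continuous_inv := continuous_induced_rng.2 (continuous_inv.comp (arrHomeo G).continuous)
  continuous_comp := continuous_induced_rng.2 <| by
    have h : Continuous fun p : Composable (SingleObj G) =>
        ((⟨p.fst⟩, ⟨p.snd⟩) : Arr (SingleObj G) × Arr (SingleObj G)) := continuous_induced_dom
    exact ((arrHomeo G).continuous.comp h.snd).mul ((arrHomeo G).continuous.comp h.fst)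

instance [T2Space G] : T2Space (Arr (SingleObj G)) := (arrHomeo G).symm.t2Space

instance [LocallyCompactSpace G] : LocallyCompactSpace (Arr (SingleObj G)) :=
  (arrHomeo G).isOpenEmbedding.locallyCompactSpace

/-- The range fibre of the one-object groupoid is the group. -/
def fibHomeo (x : SingleObj G) : Fib x ≃ₜ G :=
  Equiv.toHomeomorphOfIsInducing
    { toFun := fun a => (a.hom : G)
      invFun := fun g => @Fib.mk (SingleObj G) _ x (SingleObj.star G) g
      left_inv := fun _ => rfl
      right_inv := fun _ => rfl } ⟨by
        change TopologicalSpace.induced _ (TopologicalSpace.induced _ _) = _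
        rw [induced_compose]
        rfl⟩

variable {G} [IsTopologicalGroup G] [MeasurableSpace G] [BorelSpace G]

/-- The Haar system of the one-object groupoid given by a Haar measure. -/
def HaarSystem.ofHaar (μ : Measure G) [μ.IsHaarMeasure] [μ.Regular] : HaarSystem (SingleObj G) where
  measure x := μ.map (fibHomeo G x).symm
  regular x := Measure.Regular.map (fibHomeo G x).symm
  full_support x := (fibHomeo G x).symm.continuous.isOpenPosMeasure_map (fibHomeo G x).symm.surjective
  continuous_integral f := continuous_of_const fun x y => rfl
  map_translate {x y} γ := by
    have h1 : Measurable (Fib.translate γ) := (continuous_translate γ).measurable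
    have h2 : Measurable (fibHomeo G x).symm := (fibHomeo G x).symm.continuous.measurable
    have h3 : Measurable (fibHomeo G y).symm := (fibHomeo G y).symm.continuous.measurable
    have h4 : Measurable fun g : G => (show G from γ) * g := measurable_const_mul _
    rw [Measure.map_map h1 h2]
    calc μ.map (Fib.translate γ ∘ (fibHomeo G x).symm)
        = μ.map ((fibHomeo G y).symm ∘ fun g : G => (show G from γ) * g) := rfl
      _ = (μ.map fun g : G => (show G from γ) * g).map (fibHomeo G y).symm :=
          (Measure.map_map h3 h4).symm
      _ = _ := by rw [map_mul_left_eq_self]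

/-- An unconditional norm on `C_c(G)`, as an unconditional norm on `C_c(𝒢)` for the one-object
groupoid `𝒢`. -/
def GroupUnconditionalNorm.toGroupoid {μ : Measure G} [μ.IsHaarMeasure] [μ.Regular] [T2Space G]
    [LocallyCompactSpace G] (N : GroupUnconditionalNorm μ) :
    UnconditionalNorm (HaarSystem.ofHaar μ) where
  toSeminorm := N.toSeminorm.comp (CompactlySupportedContinuousMap.compLinearMap
    ⟨(arrHomeo G).symm, (arrHomeo G).symm.isClosedEmbedding.tendsto_cocompact⟩)
  mono f g h := N.mono _ _ fun s => h _
  conv_le f g := N.conv_le _ _ _ fun s => by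
    change ∫ a, f a.toArr * g (Fib.ldiv a _) ∂(μ.map (fibHomeo G _).symm) = _
    rw [(fibHomeo G _).symm.isClosedEmbedding.measurableEmbedding.integral_map]
    rfl

/-- A `G`-Banach algebra, as a Banach algebra with an action of the one-object groupoid. -/
def GroupBanachAlgebra.toGroupoid (B : GroupBanachAlgebra.{u, v} G) :
    GBanachAlgebra.{0, u, v} (SingleObj G) where
  fib _ := B.carrier
  sections := ⊤
  dense_eval x := fun b => subset_closure ⟨fun _ => b, trivial, rfl⟩
  usc_norm ξ _ x c hc := Eventually.of_forall fun _ => hc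
  mem_of_local _ _ := trivial
  mul_mem _ _ _ _ := trivial
  act γ := B.act γ
  act_mul γ := B.act_algebra_mul γ
  act_comp γ δ b := B.act_mul δ γ b
  act_continuous ξ h := by
    intro γ₀ ε hε
    obtain ⟨η, -, h1⟩ := h γ₀ (ε / 4) (by positivity)
    have h0 := h1.self_of_nhds
    have h2 := Metric.tendsto_nhds.1 (((B.act_continuous (η γ₀.src)).comp
      (arrHomeo G).continuous).tendsto γ₀) (ε / 4) (by positivity)
    refine ⟨fun _ => B.act γ₀.hom (η γ₀.src), trivial, ?_⟩
    filter_upwards [h1, h2] with γ h1 h2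
    change ‖(B.act γ.hom (ξ γ) : B.carrier) - B.act γ₀.hom (η γ₀.src)‖ < ε
    rw [dist_eq_norm] at h2
    have h3 : ‖B.act γ.hom (ξ γ) - B.act γ.hom (η γ₀.src)‖ < ε / 4 := by
      rw [← map_sub, LinearIsometryEquiv.norm_map]
      exact h1
    have h4 := norm_sub_le_norm_sub_add_norm_sub (B.act γ.hom (ξ γ)) (B.act γ.hom (η γ₀.src))
      (B.act γ₀.hom (η γ₀.src))
    have h5 : ‖B.act γ.hom (η γ₀.src) - B.act γ₀.hom (η γ₀.src)‖ < ε / 4 := h2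
    linarith

end Groups

end BanachGroupoid

end

open BanachGroupoid

open CategoryTheory MeasureTheory Topology Filter
open scoped CompactlySupported ZeroAtInfty

set_option linter.all false

noncomputable section

namespace BanachGroupoid

universe u w v

/-! ### Powers and the spectral radius in Banach algebras without unit -/

/-! The algebras `𝒜(𝒢, BX)` and `C₀(X, 𝒜(𝒢, B))` carry different norms in general, but locally over
`X` these norms agree. Let `f` be a section with compact support and `x` a point. By upper
semi-continuity on the support, a function that dominates `γ ↦ ‖f(γ)(x)‖` also dominates `γ ↦
‖f(γ)(y)‖`, up to a small error, for all `y` near `x`. So `f`, multiplied by a cut-off function near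
`x`, has norm hardly above that of its value at `x` (`exists_sectionNorm_c0Smul_lt`,
`exists_local_norm_lt`). This gives the continuity of `x ↦ ι(f)(x)` and the isometry on the fibres
(`norm_fibre_eq`); surjectivity on the fibres follows because elementary tensors lie in the range of
`ι`.

The spectral radius is a local quantity as well. In a `C₀(X)`-Banach algebra, if near each point
some power `a ^ (k + 1)` has local norm below `r ^ (k + 1)`, then `ρ(a) ≤ r` (`rho_le_of_local`): a
partition of unity handles a compact part of `X`, and far out `a` itself is small. If `ρ(ι(a)) < r`,
a power of `ι(a)` is small in norm, hence the same power of `a` is small locally, and so `ρ(a) ≤ r`.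
Thus `ι` is full.

An isoradial homomorphism with dense range, extended to the unitalisations, detects invertible
elements (`Hom.IsIsoradial.isDenseSpectral`). This passes to matrices by Gauss elimination near the
identity (`IsDenseSpectral.mapMatrix`). Path components of invertible matrices then correspond by an
open-closed argument, idempotents lift up to similarity by means of a power series for the square
root of `1 - 4t`, and equivalences of idempotents descend by approximation. This gives bijections on
`K₀` and `K₁`. Higher K-groups are reached by suspension, which preserves isoradiality by the same
local principle.

For `K₀(SA) ≅ K₁(A)`, the unitalisation of `SA` is regarded as an algebra of loops. An idempotent
matrix of loops is, as a path, conjugate to its constant scalar part by an invertible path `w`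
starting at `1`; on the range of the scalar part, `w 1` is the monodromy, an invertible matrix over
the unitalisation of `A`. Conversely, Whitehead's path from `1` to `g ⊕ g⁻¹` conjugates `1 ⊕ 0` into
a loop with monodromy `g`. On the kernels of the augmentations the two constructions are inverse to
each other (`loopEquiv`). -/

/-- The power `a ^ (n + 1)` in a semigroup. -/
def succPow {M : Type*} [Mul M] (a : M) : ℕ → M
  | 0 => a
  | n + 1 => succPow a n * a

lemma succPow_add {M : Type*} [Semigroup M] (a : M) (m n : ℕ) :
    succPow a (m + n + 1) = succPow a m * succPow a n := by
  induction n with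
  | zero => rfl
  | succ n ih => rw [← add_assoc, succPow, ih, succPow, mul_assoc]

lemma map_succPow {F M N : Type*} [Mul M] [Mul N] [FunLike F M N] [MulHomClass F M N] (f : F)
    (a : M) (n : ℕ) : f (succPow a n) = succPow (f a) n := by
  induction n with
  | zero => rfl
  | succ n ih => rw [succPow, map_mul, ih, succPow]

namespace BanachAlg

variable {A : BanachAlg.{v}} {B : BanachAlg.{w}}

/-- The inclusion of a Banach algebra into its unitalisation. -/
def toPlus (a : A) : A.Plus := WithLp.toLp 1 (a : Unitization ℂ A)

lemma norm_toPlus (a : A) : ‖toPlus a‖ = ‖a‖ := WithLp.unitization_norm_inr (𝕜 := ℂ) a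

lemma toPlus_succPow (a : A) (n : ℕ) : toPlus (succPow a n) = toPlus a ^ (n + 1) := by
  induction n with
  | zero => simp [succPow]
  | succ n ih =>
    rw [pow_succ, ← ih]
    exact congrArg (WithLp.toLp 1) (Unitization.inr_mul ℂ (succPow a n) a)

/-- `rho` refers to the unitalisation without a chosen norm; `A.Plus` is the same algebra with a
complete norm, so that Gelfand's formula applies. -/
lemma rho_eq (a : A) : rho a = spectralRadius ℂ (toPlus a) := by
  have h : spectrum ℂ (toPlus a) = spectrum ℂ (a : Unitization ℂ A) :=
    (AlgEquiv.spectrum_eq (WithLp.unitizationAlgEquiv (𝕜 := ℂ) (A := A) ℂ) (toPlus a)).symm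
  simp only [rho, spectralRadius, h]

instance : NormOneClass A.Plus := ⟨by
  rw [WithLp.unitization_norm_def]
  change ‖(1 : Unitization ℂ A).fst‖ + ‖(1 : Unitization ℂ A).snd‖ = 1
  simp⟩

end BanachAlg

/-- A power of norm less than `r ^ (n + 1)` bounds the spectral radius. -/
lemma spectralRadius_lt_of_norm_pow {R : Type*} [NormedRing R] [NormedAlgebra ℂ R]
    [CompleteSpace R] [NormOneClass R] {x : R} {r : ℝ} {n : ℕ} (h : ‖x ^ (n + 1)‖ < r ^ (n + 1))
    (hr : 0 < r) : spectralRadius ℂ x < ENNReal.ofReal r := by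
  refine (spectrum.spectralRadius_le_pow_nnnorm_pow_one_div ℂ x n).trans_lt ?_
  have h1 : (‖x ^ (n + 1)‖₊ : ENNReal) < ENNReal.ofReal r ^ (n + 1) := by
    rw [← ENNReal.ofReal_pow hr.le, ← enorm_eq_nnnorm, ← ofReal_norm_eq_enorm]
    exact (ENNReal.ofReal_lt_ofReal_iff (by positivity)).2 h
  have hn : (0 : ℝ) < 1 / (n + 1) := by positivity
  have h2 := ENNReal.rpow_lt_rpow h1 hn
  rw [← ENNReal.rpow_natCast, ← ENNReal.rpow_mul] at h2
  have h3 : ((n + 1 : ℕ) : ℝ) * (1 / (n + 1)) = 1 := by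
    push_cast
    field_simp
  rw [h3, ENNReal.rpow_one] at h2
  simpa using h2

/-- Gelfand's formula: `‖x ^ n‖ ^ (1 / n)` converges to the spectral radius. -/
lemma exists_norm_pow_lt {R : Type*} [NormedRing R] [NormedAlgebra ℂ R]
    [CompleteSpace R] {x : R} {r : ℝ} (h : spectralRadius ℂ x < ENNReal.ofReal r) :
    ∀ᶠ n : ℕ in atTop, ‖x ^ n‖ < r ^ n := by
  have h1 := (spectrum.pow_norm_pow_one_div_tendsto_nhds_spectralRadius x).eventually_lt_const h
  filter_upwards [h1, eventually_gt_atTop 0] with n hn hn0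
  have h2 := (ENNReal.ofReal_lt_ofReal_iff_of_nonneg (by positivity)).1 hn
  have h3 := pow_lt_pow_left₀ h2 (by positivity) hn0.ne'
  rwa [← Real.rpow_natCast, ← Real.rpow_mul (norm_nonneg _), one_div,
    inv_mul_cancel₀ (by positivity), Real.rpow_one] at h3

namespace BanachAlg

variable {A : BanachAlg.{v}} {B : BanachAlg.{w}}

/-- A bound on the spectral radius becomes one strict norm inequality for one power. In this form it
can be tested at the points of `X` and localised. -/
lemma rho_lt_iff {a : A} {r : ℝ} (hr : 0 < r) :
    rho a < ENNReal.ofReal r ↔ ∃ n, ‖succPow a n‖ < r ^ (n + 1) := by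
  rw [rho_eq]
  constructor
  · intro h
    obtain ⟨n, hn⟩ := eventually_atTop.1 (exists_norm_pow_lt h)
    refine ⟨n, ?_⟩
    rw [← norm_toPlus, toPlus_succPow]
    exact hn _ (Nat.le_succ n)
  · rintro ⟨n, hn⟩
    rw [← norm_toPlus, toPlus_succPow] at hn
    exact spectralRadius_lt_of_norm_pow hn hr

/-- The constant `C` is absorbed on passing from `r` to any larger `s'`, since `C * (r / s') ^ n`
tends to zero. -/
lemma rho_le_of_bound {a : A} {r C : ℝ} (hr : 0 < r) (h : ∀ n, ‖succPow a n‖ ≤ C * r ^ (n + 1)) :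
    rho a ≤ ENNReal.ofReal r := by
  refine le_of_forall_gt fun s hs => ?_
  obtain ⟨s', h1, h2⟩ := exists_between hs
  have hs' : s' ≠ ⊤ := h2.ne_top
  lift s' to NNReal using hs'
  refine lt_trans ?_ h2
  rw [← ENNReal.ofReal_coe_nnreal] at h1 ⊢
  have hrs := (ENNReal.ofReal_lt_ofReal_iff_of_nonneg hr.le).1 h1
  rw [rho_lt_iff (hr.trans hrs)]
  have ht : Tendsto (fun n : ℕ => C * (r / s') ^ n) atTop (𝓝 (C * 0)) :=
    (tendsto_pow_atTop_nhds_zero_of_lt_one (by positivity)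
      ((div_lt_one (hr.trans hrs)).2 hrs)).const_mul C
  rw [mul_zero] at ht
  obtain ⟨n, hn⟩ := eventually_atTop.1 (ht.eventually_lt_const one_pos)
  refine ⟨n, (h n).trans_lt ?_⟩
  have h3 := hn (n + 1) (Nat.le_succ n)
  have hpos : (0 : ℝ) < s' ^ (n + 1) := pow_pos (hr.trans hrs) _
  rwa [div_pow, ← mul_div_assoc, div_lt_one hpos] at h3

lemma Hom.plus_toPlus (φ : A.Hom B) (a : A) : φ.plus (toPlus a) = toPlus (φ.toHom a) := by
  change WithLp.toLp 1 _ = WithLp.toLp 1 _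
  simp [toPlus, Unitization.lift, WithLp.unitizationAlgEquiv]

/-- A unital homomorphism can only shrink the spectrum. -/
lemma Hom.rho_le (φ : A.Hom B) (a : A) : rho (φ.toHom a) ≤ rho a := by
  let Φ : Unitization ℂ A →ₐ[ℂ] Unitization ℂ B :=
    Unitization.lift ((Unitization.inrNonUnitalAlgHom ℂ B).comp φ.toHom)
  have h : Φ (a : Unitization ℂ A) = (φ.toHom a : Unitization ℂ B) := by
    simp [Φ, Unitization.lift]
  rw [rho, ← h]
  exact iSup_le_iSup_of_subset (AlgHom.spectrum_apply_subset Φ _)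

/-- To prove that a homomorphism preserves the spectral radius, it suffices to show that it does
not decrease it. -/
lemma Hom.rho_eq_of_le (φ : A.Hom B) (a : A)
    (h : ∀ r : ℝ, 0 < r → rho (φ.toHom a) < ENNReal.ofReal r → rho a ≤ ENNReal.ofReal r) :
    rho (φ.toHom a) = rho a := by
  refine le_antisymm (φ.rho_le a) (le_of_forall_gt fun s hs => ?_)
  obtain ⟨s', h1, h2⟩ := exists_between hs
  lift s' to NNReal using h2.ne_top
  rw [← ENNReal.ofReal_coe_nnreal] at h1 h2
  refine (h s' ?_ h1).trans_lt h2
  exact_mod_cast (bot_le.trans_lt h1 : (0 : ENNReal) < _) |> ENNReal.ofReal_pos.1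

end BanachAlg

/-! ### Cut-off functions and `C₀(X)`-Banach algebras -/

section Cutoff

variable {X : Type*} [TopologicalSpace X]

/-- A real function with compact support, as an element of `C₀(X)`. -/
def cutoff (f : C(X, ℝ)) (hf : HasCompactSupport f) : C₀(X, ℂ) :=
  ⟨⟨fun x => (f x : ℂ), by fun_prop⟩, (hf.comp_left (g := fun r : ℝ => (r : ℂ)) rfl).is_zero_at_infty⟩

lemma norm_cutoff_apply_le {f : C(X, ℝ)} {hf : HasCompactSupport f} {x : X}
    (h : f x ∈ Set.Icc (0 : ℝ) 1) : ‖cutoff f hf x‖ ≤ 1 := by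
  change ‖((f x : ℝ) : ℂ)‖ ≤ 1
  rw [Complex.norm_real, Real.norm_of_nonneg h.1]
  exact h.2

/-- A function in `C₀(X)` of norm at most one which is one on a compact set and is supported in an
open neighbourhood. -/
lemma exists_cutoff [T2Space X] [LocallyCompactSpace X] {K V : Set X} (hK : IsCompact K)
    (hV : IsOpen V) (hKV : K ⊆ V) : ∃ (η : C₀(X, ℂ)) (L : Set X), IsCompact L ∧
      (∀ x ∈ K, η x = 1) ∧ (∀ x ∉ L, η x = 0) ∧ (∀ x ∉ V, η x = 0) ∧ ∀ x, ‖η x‖ ≤ 1 := by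
  obtain ⟨f, h1, h0, hc, h01⟩ := exists_continuous_one_zero_of_isCompact hK hV.isClosed_compl
    (Set.disjoint_compl_right_iff_subset.2 hKV)
  refine ⟨cutoff f hc, tsupport f, hc, fun x hx => ?_, fun x hx => ?_, fun x hx => ?_,
    fun x => norm_cutoff_apply_le (h01 x)⟩
  · change ((f x : ℝ) : ℂ) = 1
    rw [h1 hx]
    simp
  · change ((f x : ℝ) : ℂ) = 0
    rw [image_eq_zero_of_notMem_tsupport hx]
    simp
  · change ((f x : ℝ) : ℂ) = 0
    rw [h0 hx]
    simp

/-- A function in `C₀(X)` of norm at most one which is one near a point and is supported in a given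
neighbourhood. -/
lemma exists_cutoff_nhds [T2Space X] [LocallyCompactSpace X] {x : X} {V : Set X} (hV : V ∈ 𝓝 x) :
    ∃ χ : C₀(X, ℂ), (∀ᶠ y in 𝓝 x, χ y = 1) ∧ (∀ y ∉ V, χ y = 0) ∧ ∀ y, ‖χ y‖ ≤ 1 := by
  obtain ⟨K, hK, hKV, hKc⟩ := local_compact_nhds (interior_mem_nhds.2 hV)
  obtain ⟨χ, -, -, h1, -, h0, hn⟩ := exists_cutoff hKc isOpen_interior hKV
  exact ⟨χ, Filter.eventually_of_mem hK h1, fun y hy => h0 y fun h => hy (interior_subset h), hn⟩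

lemma c0_mul_eq_left {ρ χ : C₀(X, ℂ)} (h : ∀ x, ρ x ≠ 0 → χ x = 1) : ρ * χ = ρ := by
  ext x
  by_cases hx : ρ x = 0
  · simp [hx]
  · simp [h x hx]

/-- A finite partition of unity on a compact set, subordinate to an open cover. -/
lemma exists_partition [T2Space X] [LocallyCompactSpace X] {K : Set X} (hK : IsCompact K)
    {V : X → Set X} (hV : ∀ x ∈ K, V x ∈ 𝓝 x) : ∃ (t : Finset X) (ρ : t → C₀(X, ℂ)),
      (∀ (i : t) x, ρ i x ≠ 0 → x ∈ V i) ∧ (∀ x ∈ K, ∑ i, ρ i x = 1) ∧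
      ∀ x, ‖1 - ∑ i, ρ i x‖ + ∑ i, ‖ρ i x‖ ≤ 1 := by
  have key : ∃ t : Finset X, K ⊆ ⋃ x ∈ t, interior (V x) :=
    let ⟨t, _, ht⟩ := hK.elim_nhds_subcover (fun x => interior (V x))
      fun x hx => interior_mem_nhds.2 (hV x hx)
    ⟨t, ht⟩
  obtain ⟨t, ht⟩ := key
  obtain ⟨ρ, hρV, hρc⟩ := PartitionOfUnity.exists_isSubordinate_of_locallyFinite_t2space hK
    (fun i : t => interior (V i)) (fun i => isOpen_interior) (locallyFinite_of_finite _) (by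
      intro a ha
      obtain ⟨i, hi, hai⟩ := Set.mem_iUnion₂.1 (ht ha)
      exact Set.mem_iUnion.2 ⟨⟨i, hi⟩, hai⟩)
  have hle : ∀ a, ∑ i, ρ i a ≤ 1 := fun a => by
    rw [← finsum_eq_sum_of_fintype]; exact ρ.sum_le_one a
  have hs : ∀ x, ∑ i, cutoff (ρ i) (hρc i) x = ((∑ i, ρ i x : ℝ) : ℂ) := fun x => by
    rw [Complex.ofReal_sum]
    rfl
  refine ⟨t, fun i => cutoff (ρ i) (hρc i), fun i x hx => ?_, fun x hx => ?_, fun x => ?_⟩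
  · refine interior_subset (hρV i (subset_tsupport _ fun h => hx ?_))
    change ((ρ i x : ℝ) : ℂ) = 0
    rw [h, Complex.ofReal_zero]
  · rw [hs, ← finsum_eq_sum_of_fintype, ρ.sum_eq_one hx, Complex.ofReal_one]
  -- All weights are non-negative with sum at most one, so the quantity to be bounded is exactly
  -- one.
  · have h : ∀ i, ‖cutoff (ρ i) (hρc i) x‖ = ρ i x := fun i => by
      change ‖((ρ i x : ℝ) : ℂ)‖ = _
      rw [Complex.norm_real, Real.norm_of_nonneg (ρ.nonneg i x)]
    rw [hs, ← Complex.ofReal_one, ← Complex.ofReal_sub, Complex.norm_real,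
      Real.norm_of_nonneg (sub_nonneg.2 (hle x)), Finset.sum_congr rfl fun i _ => h i]
    linarith

lemma c0_sum_apply {E ι : Type*} [NormedAddCommGroup E] (s : Finset ι) (f : ι → C₀(X, E)) (x : X) :
    (∑ i ∈ s, f i) x = ∑ i ∈ s, f i x := by
  classical
  induction s using Finset.induction_on with
  | empty => rfl
  | insert a s ha ih =>
    rw [Finset.sum_insert ha, Finset.sum_insert ha, ZeroAtInftyContinuousMap.add_apply, ih]

/-- A subspace of `C₀(X, E)` which contains the elementary tensors `χ ⊗ d`, where `d` runs through
a dense subset, is dense. -/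
lemma dense_of_tens_mem [T2Space X] [LocallyCompactSpace X] {E : Type*} [NormedAddCommGroup E]
    [NormedSpace ℂ E] {W : Set E} (hW : Dense W) {S : Submodule ℂ C₀(X, E)}
    (hS : ∀ χ : C₀(X, ℂ), ∀ d ∈ W, tens χ d ∈ S) : Dense (S : Set C₀(X, E)) := by
  refine Metric.dense_iff.2 fun h ε hε => ?_
  obtain ⟨K, hK, hK0⟩ := c0_exists_compact h (half_pos hε)
  have hnear : ∀ x, ∃ d ∈ W, ‖h x - d‖ < ε / 2 := fun x => by
    obtain ⟨d, hd, hdW⟩ := Metric.dense_iff.1 hW (h x) _ (half_pos hε)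
    exact ⟨d, hdW, by rwa [← dist_eq_norm, dist_comm]⟩
  choose d hd hn using hnear
  obtain ⟨t, ρ, hρV, hρ1, hρ⟩ := exists_partition hK (V := fun x => {x' | ‖h x' - d x‖ < ε / 2})
    fun x _ => (isOpen_lt (by fun_prop) continuous_const).mem_nhds (hn x)
  refine ⟨∑ i, tens (ρ i) (d i), ?_, S.sum_mem fun i _ => hS _ _ (hd i)⟩
  rw [Metric.mem_ball, dist_comm, dist_eq_norm]
  refine (c0_norm_le _ (half_pos hε).le fun x => ?_).trans_lt (half_lt_self hε)
  rw [ZeroAtInftyContinuousMap.sub_apply, c0_sum_apply]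
  change ‖h x - ∑ i, ρ i x • d i‖ ≤ _
  have h2 : ∀ i, ‖ρ i x • (h x - d i)‖ ≤ ‖ρ i x‖ * (ε / 2) := fun i => by
    rw [norm_smul]
    by_cases hx : ρ i x = 0
    · simp [hx]
    · exact mul_le_mul_of_nonneg_left (hρV i x hx).le (norm_nonneg _)
  have h3 : ‖∑ i, ρ i x • (h x - d i)‖ ≤ (∑ i, ‖ρ i x‖) * (ε / 2) := by
    rw [Finset.sum_mul]
    exact (norm_sum_le _ _).trans (Finset.sum_le_sum fun i _ => h2 i)
  -- The error is a combination with weights of total mass at most one: `h x - d i` is small where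
  -- `ρ i` does not vanish, and the first term survives only off `K`, where `h` is small.
  have e : h x - ∑ i, ρ i x • d i
      = (1 - ∑ i, ρ i x) • h x + ∑ i, ρ i x • (h x - d i) := by
    simp only [smul_sub, Finset.sum_sub_distrib, ← Finset.sum_smul, sub_smul, one_smul]
    abel
  by_cases hx : x ∈ K
  · rw [e, hρ1 x hx, sub_self, zero_smul, zero_add]
    refine h3.trans (mul_le_of_le_one_left (half_pos hε).le ?_)
    linarith [hρ x, norm_nonneg (1 - ∑ i, ρ i x)]
  · rw [e]
    refine (norm_add_le _ _).trans ?_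
    rw [norm_smul]
    have := mul_le_mul_of_nonneg_left (hK0 x hx).le (norm_nonneg (1 - ∑ i, ρ i x))
    nlinarith [hρ x]

end Cutoff

/-! ### Approximate units and local spectral radii in `C₀(X)`-Banach algebras. -/

namespace IsC0BanachAlgebra

variable {X : Type*} [TopologicalSpace X] {A : BanachAlg.{v}} {act : C₀(X, ℂ) → A → A}
  (hA : IsC0BanachAlgebra X A act)

include hA

lemma act_sub (χ : C₀(X, ℂ)) (a b : A) : act χ (a - b) = act χ a - act χ b := by
  rw [sub_eq_add_neg, hA.act_add, ← neg_one_smul ℂ, hA.act_smul, neg_one_smul, ← sub_eq_add_neg]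

lemma sub_act (χ ψ : C₀(X, ℂ)) (a : A) : act (χ - ψ) a = act χ a - act ψ a := by
  rw [sub_eq_add_neg, hA.add_act, ← neg_one_smul ℂ, hA.smul_act, neg_one_smul, ← sub_eq_add_neg]

lemma act_zero (χ : C₀(X, ℂ)) : act χ 0 = 0 := by
  have := hA.act_sub χ 0 0
  rwa [sub_zero, sub_self] at this

lemma norm_act_le_of_le {χ : C₀(X, ℂ)} (hχ : ∀ x, ‖χ x‖ ≤ 1) (a : A) : ‖act χ a‖ ≤ ‖a‖ :=
  (hA.norm_act_le χ a).trans
    (mul_le_of_le_one_left (norm_nonneg _) (c0_norm_le _ zero_le_one hχ))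

lemma sum_act {ι : Type*} (s : Finset ι) (χ : ι → C₀(X, ℂ)) (a : A) :
    act (∑ i ∈ s, χ i) a = ∑ i ∈ s, act (χ i) a := by
  classical
  induction s using Finset.induction_on with
  | empty =>
    have := hA.smul_act 0 0 a
    simpa using this
  | insert a s ha ih => rw [Finset.sum_insert ha, Finset.sum_insert ha, hA.add_act, ih]

/-- Cut-off functions form an approximate unit. -/
lemma exists_compact_approx (a : A) {ε : ℝ} (hε : 0 < ε) : ∃ K : Set X, IsCompact K ∧
    ∀ η : C₀(X, ℂ), (∀ x ∈ K, η x = 1) → (∀ x, ‖η x‖ ≤ 1) → ‖a - act η a‖ < ε := by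
  -- The property is stable under linear combinations, so it needs checking only for elements `χ a`;
  -- contractivity of `act η` carries it from the span to its closure.
  let P : A → Prop := fun a => ∀ ε > 0, ∃ K : Set X, IsCompact K ∧
    ∀ η : C₀(X, ℂ), (∀ x ∈ K, η x = 1) → (∀ x, ‖η x‖ ≤ 1) → ‖a - act η a‖ < ε
  have h1 : ∀ a ∈ Submodule.span ℂ {b : A | ∃ χ a, act χ a = b}, P a := fun a ha => by
    induction ha using Submodule.span_induction with
    | mem b hb =>
      obtain ⟨χ, a, rfl⟩ := hb
      intro ε hε
      -- Off `K` only the pointwise bound `‖χ - η χ‖ ≤ 2 ‖χ‖` is available, which costs one factor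
      -- two; the other makes the final estimate `ε / 2`, hence strict.
      obtain ⟨K, hK, h⟩ := c0_exists_compact χ (ε := ε / (4 * (‖a‖ + 1))) (by positivity)
      refine ⟨K, hK, fun η hη1 hη => ?_⟩
      rw [← hA.mul_act, ← hA.sub_act]
      refine (hA.norm_act_le _ _).trans_lt ?_
      have h2 : ‖χ - η * χ‖ ≤ ε / (2 * (‖a‖ + 1)) := c0_norm_le _ (by positivity) fun x => by
        change ‖χ x - η x * χ x‖ ≤ _
        by_cases hx : x ∈ K
        · rw [hη1 x hx, one_mul, sub_self, norm_zero]
          positivity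
        · have h3 := norm_sub_le (χ x) (η x * χ x)
          rw [norm_mul] at h3
          have h4 : ‖η x‖ * ‖χ x‖ ≤ ‖χ x‖ := mul_le_of_le_one_left (norm_nonneg _) (hη x)
          have h5 : ε / (2 * (‖a‖ + 1)) = ε / (4 * (‖a‖ + 1)) + ε / (4 * (‖a‖ + 1)) := by
            field_simp
            norm_num
          have := h x hx
          linarith
      calc ‖χ - η * χ‖ * ‖a‖ ≤ ε / (2 * (‖a‖ + 1)) * (‖a‖ + 1) :=
            mul_le_mul h2 (by linarith) (norm_nonneg _) (by positivity)
        _ = ε / 2 := by field_simp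
        _ < ε := half_lt_self hε
    | zero =>
      exact fun ε hε => ⟨∅, isCompact_empty, fun η _ _ => by simpa [hA.act_zero] using hε⟩
    | add a b _ _ ha hb =>
      intro ε hε
      obtain ⟨K, hK, h⟩ := ha _ (half_pos hε)
      obtain ⟨L, hL, h'⟩ := hb _ (half_pos hε)
      refine ⟨K ∪ L, hK.union hL, fun η h1 h2 => ?_⟩
      have e : a + b - act η (a + b) = (a - act η a) + (b - act η b) := by
        rw [hA.act_add]; abel
      have := h η (fun x hx => h1 x (Or.inl hx)) h2
      have := h' η (fun x hx => h1 x (Or.inr hx)) h2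
      rw [e]
      refine (norm_add_le _ _).trans_lt ?_
      linarith
    | smul c a _ ha =>
      intro ε hε
      obtain ⟨K, hK, h⟩ := ha (ε / (‖c‖ + 1)) (by positivity)
      refine ⟨K, hK, fun η h1 h2 => ?_⟩
      have h3 := h η h1 h2
      rw [lt_div_iff₀ (by positivity)] at h3
      rw [hA.act_smul, ← smul_sub, norm_smul]
      nlinarith [norm_nonneg (a - act η a), norm_nonneg c]
  obtain ⟨b, hb, hbs⟩ := Metric.dense_iff.1 hA.nondegenerate a (ε / 4) (by positivity)
  obtain ⟨K, hK, h⟩ := h1 b hbs (ε / 4) (by positivity)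
  refine ⟨K, hK, fun η h2 h3 => ?_⟩
  rw [Metric.mem_ball, dist_comm, dist_eq_norm] at hb
  have h4 := h η h2 h3
  have e : a - act η a = (a - b) + (b - act η b) - act η (a - b) := by
    rw [hA.act_sub]; abel
  have h5 := hA.norm_act_le_of_le h3 (a - b)
  rw [e]
  refine (norm_sub_le _ _).trans_lt ?_
  have := norm_add_le (a - b) (b - act η b)
  linarith

/-- A local bound for a power of `a` bounds the localised powers of `a`. -/
lemma exists_bound_of_local {a : A} {r : ℝ} (hr : 0 < r) {k : ℕ} {χ ρ : C₀(X, ℂ)}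
    (h : ‖act χ (succPow a k)‖ < r ^ (k + 1)) (hρ : ∀ x, ρ x ≠ 0 → χ x = 1) :
    ∃ C : ℝ, ∀ n, ‖act ρ (succPow a n)‖ ≤ C * r ^ (n + 1) := by
  set c : ℕ → ℝ := fun j => ‖act ρ (succPow a j)‖ / r ^ (j + 1) with hc
  have hc0 : ∀ j, 0 ≤ c j := fun j => by positivity
  -- The constant has to cover only the first `k + 1` powers: each further block of `k + 1` factors
  -- contributes at most `r ^ (k + 1)`.
  refine ⟨∑ j ∈ Finset.range (k + 1), c j, fun n => ?_⟩
  induction n using Nat.strong_induction_on with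
  | _ n ih =>
    by_cases hn : n < k + 1
    · have h1 := Finset.single_le_sum (fun j _ => hc0 j) (Finset.mem_range.2 hn)
      rwa [hc, div_le_iff₀ (by positivity)] at h1
    · obtain ⟨m, rfl⟩ : ∃ m, n = k + m + 1 := ⟨n - (k + 1), by omega⟩
      -- Since `ρ = χ ρ`, the cut-off splits over the product: `χ` goes to the first `k + 1` factors
      -- and `ρ` to the rest.
      have e : act ρ (succPow a (k + m + 1)) = act χ (succPow a k) * act ρ (succPow a m) := by
        rw [succPow_add, ← hA.act_mul_left, ← hA.act_mul_right, ← hA.mul_act, mul_comm χ, c0_mul_eq_left hρ]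
      have h1 := ih m (by omega)
      rw [e]
      calc _ ≤ ‖act χ (succPow a k)‖ * ‖act ρ (succPow a m)‖ := norm_mul_le _ _
        _ ≤ r ^ (k + 1) * ((∑ j ∈ Finset.range (k + 1), c j) * r ^ (m + 1)) :=
            mul_le_mul h.le h1 (norm_nonneg _) (by positivity)
        _ = _ := by ring

/-- In a `C₀(X)`-Banach algebra, the spectral radius is bounded by local spectral radii. -/
theorem rho_le_of_local [T2Space X] [LocallyCompactSpace X] {a : A} {r : ℝ} (hr : 0 < r)
    (h : ∀ x, ∃ k, ∃ χ : C₀(X, ℂ), (∀ᶠ y in 𝓝 x, χ y = 1) ∧ ‖act χ (succPow a k)‖ < r ^ (k + 1)) :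
    BanachAlg.rho a ≤ ENNReal.ofReal r := by
  -- Far out in `X` the element is small: `b`, which remains after cutting off by `η`, has norm
  -- below `r`. On the compact set `L`, off which `η` vanishes, finitely many local estimates
  -- suffice.
  obtain ⟨K, hK, hη⟩ := hA.exists_compact_approx a hr
  obtain ⟨η, L, hL, hη1, hη0, -, hηn⟩ := exists_cutoff hK isOpen_univ (Set.subset_univ _)
  set b := a - act η a with hb
  have hbr : ‖b‖ < r := hη η hη1 hηn
  choose k χ hχ hk using h
  obtain ⟨t, ρ, hρV, hρ1, hρ⟩ := exists_partition hL (V := fun x => {y | χ x y = 1})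
    fun x _ => hχ x
  choose C hC using fun i : t => hA.exists_bound_of_local hr (hk i) (hρV i)
  have hση : (∑ i, ρ i) * η = η := by
    rw [mul_comm]
    refine c0_mul_eq_left fun x hx => ?_
    rw [c0_sum_apply]
    exact hρ1 x (by_contra fun hxL => hx (hη0 x hxL))
  -- The factor `1 - ∑ ρ i` annihilates `η`; after multiplication by it, the powers of `a` and of
  -- `b` coincide.
  have key : ∀ n, succPow a n - act (∑ i, ρ i) (succPow a n)
      = succPow b n - act (∑ i, ρ i) (succPow b n) := by
    intro n
    induction n with
    | zero =>
      simp only [succPow, hb, hA.act_sub, ← hA.mul_act, hση]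
      abel
    | succ n ih =>
      have e : ∀ c : A, succPow c (n + 1) - act (∑ i, ρ i) (succPow c (n + 1))
          = (succPow c n - act (∑ i, ρ i) (succPow c n)) * c := fun c => by
        rw [succPow, hA.act_mul_left, sub_mul]
      rw [e, e, ← ih, hb, mul_sub, ← hA.act_mul_right, hA.act_mul_left η, hA.act_sub η,
        ← hA.mul_act, mul_comm η, hση, sub_self, zero_mul, sub_zero]
  have hbn : ∀ n, ‖succPow b n‖ ≤ r ^ (n + 1) := fun n => by
    induction n with
    | zero => simpa [succPow] using hbr.le
    | succ n ih =>
      rw [succPow, pow_succ _ (n + 1)]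
      exact (norm_mul_le _ _).trans (mul_le_mul ih hbr.le (norm_nonneg _) (by positivity))
  have hρle : ∀ x, ‖(∑ i, ρ i) x‖ ≤ 1 := fun x => by
    rw [c0_sum_apply]
    refine (norm_sum_le _ _).trans ?_
    linarith [hρ x, norm_nonneg (1 - ∑ i, ρ i x)]
  -- The `C i` bound the parts cut out by the partition; the `2` comes from `succPow b n` and its
  -- product with `∑ ρ i`, both of norm at most `r ^ (n + 1)`.
  refine BanachAlg.rho_le_of_bound (C := (∑ i, C i) + 2) hr fun n => ?_
  have e : succPow a n = (∑ i, act (ρ i) (succPow a n))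
      + (succPow b n - act (∑ i, ρ i) (succPow b n)) := by
    rw [← key, ← hA.sum_act]; abel
  have h1 : ‖∑ i, act (ρ i) (succPow a n)‖ ≤ (∑ i, C i) * r ^ (n + 1) := by
    rw [Finset.sum_mul]
    exact (norm_sum_le _ _).trans (Finset.sum_le_sum fun i _ => hC i n)
  have h2 := norm_sub_le (succPow b n) (act (∑ i, ρ i) (succPow b n))
  have h3 := hA.norm_act_le_of_le hρle (succPow b n)
  have h4 := hbn n
  have h5 := norm_add_le (∑ i, act (ρ i) (succPow a n))
    (succPow b n - act (∑ i, ρ i) (succPow b n))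
  rw [← e] at h5
  linarith

end IsC0BanachAlgebra

/-! ### The `C₀(X)`-Banach algebra `C₀(X, A)` -/

namespace BanachAlg

variable {X : Type*} [TopologicalSpace X] [T2Space X] [LocallyCompactSpace X]
  {A : BanachAlg.{v}} {B : BanachAlg.{w}}

variable (X A) in
lemma isC0BanachAlgebra_C0 : IsC0BanachAlgebra X (A.C0 X) (C0.act X A) where
  act_add χ a b := ZeroAtInftyContinuousMap.ext fun x => smul_add (χ x) _ _
  act_smul χ c a := ZeroAtInftyContinuousMap.ext fun x => smul_comm (χ x) c _
  add_act χ ψ a := ZeroAtInftyContinuousMap.ext fun x => add_smul (χ x) (ψ x) _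
  smul_act c χ a := ZeroAtInftyContinuousMap.ext fun x => smul_assoc c (χ x) _
  mul_act χ ψ a := ZeroAtInftyContinuousMap.ext fun x => mul_smul (χ x) (ψ x) _
  norm_act_le χ a := c0_norm_le _ (by positivity) fun x => by
    change ‖χ x • (show C₀(X, A) from a) x‖ ≤ _
    rw [norm_smul]
    exact mul_le_mul (c0_norm_apply_le χ x) (c0_norm_apply_le (show C₀(X, A) from a) x)
      (norm_nonneg _) (norm_nonneg _)
  nondegenerate := by
    refine Metric.dense_iff.2 fun h ε hε => ?_
    obtain ⟨K, hK, hK0⟩ := c0_exists_compact (show C₀(X, A) from h) (ε := ε / 4) (by positivity)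
    obtain ⟨η, -, -, h1, -, -, hn⟩ := exists_cutoff hK isOpen_univ (Set.subset_univ _)
    refine ⟨C0.act X A η h, ?_, Submodule.subset_span ⟨η, h, rfl⟩⟩
    rw [Metric.mem_ball, dist_comm, dist_eq_norm]
    refine (c0_norm_le (show C₀(X, A) from h - C0.act X A η h) (c := ε / 2) (by positivity)
      fun x => ?_).trans_lt (half_lt_self hε)
    change ‖(show C₀(X, A) from h) x - η x • (show C₀(X, A) from h) x‖ ≤ ε / 2
    by_cases hx : x ∈ K
    · rw [h1 x hx, one_smul, sub_self, norm_zero]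
      positivity
    · have h2 := norm_sub_le ((show C₀(X, A) from h) x) (η x • (show C₀(X, A) from h) x)
      rw [norm_smul] at h2
      nlinarith [hn x, hK0 x hx, norm_nonneg ((show C₀(X, A) from h) x)]
  act_mul_left χ a b := ZeroAtInftyContinuousMap.ext fun x => (smul_mul_assoc (χ x) _ _).symm
  act_mul_right χ a b := ZeroAtInftyContinuousMap.ext fun x => (mul_smul_comm (χ x) _ _).symm

lemma C0.eval_succPow (h : A.C0 X) (x : X) (n : ℕ) :
    C0.eval (succPow h n) x = succPow (C0.eval h x) n := by
  induction n with
  | zero => rfl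
  | succ n ih =>
    rw [succPow, succPow, ← ih]
    rfl

/-- The local norm of an element of `C₀(X, A)` is the norm of its value. -/
lemma C0.exists_local_norm_lt (h : A.C0 X) (x : X) {c : ℝ} (hc : ‖C0.eval h x‖ < c) :
    ∃ χ : C₀(X, ℂ), (∀ᶠ y in 𝓝 x, χ y = 1) ∧ ‖C0.act X A χ h‖ < c := by
  obtain ⟨c', h1, h2⟩ := exists_between hc
  have hV : {y | ‖(show C₀(X, A) from h) y‖ < c'} ∈ 𝓝 x :=
    (isOpen_lt (by fun_prop) continuous_const).mem_nhds h1
  obtain ⟨χ, hχ1, hχ0, hχ⟩ := exists_cutoff_nhds hV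
  refine ⟨χ, hχ1, (c0_norm_le _ ((norm_nonneg _).trans h1.le) fun y => ?_).trans_lt h2⟩
  change ‖χ y • (show C₀(X, A) from h) y‖ ≤ c'
  rw [norm_smul]
  by_cases hy : ‖(show C₀(X, A) from h) y‖ < c'
  · nlinarith [hχ y, norm_nonneg (χ y), norm_nonneg ((show C₀(X, A) from h) y)]
  · rw [hχ0 y hy, norm_zero, zero_mul]
    exact (norm_nonneg _).trans h1.le

/-- The homomorphism preserves spectral radii and has dense range. -/
structure Hom.IsIsoradial (φ : A.Hom B) : Prop where
  isoradial : ∀ a, rho (φ.toHom a) = rho a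
  dense_range : DenseRange φ.toHom

/-- Suspensions of isoradial homomorphisms with dense range are isoradial with dense range. -/
lemma Hom.IsIsoradial.suspension {φ : A.Hom B} (hφ : φ.IsIsoradial) : φ.S.IsIsoradial where
  isoradial h := by
    refine φ.S.rho_eq_of_le h fun r hr hlt => ?_
    obtain ⟨k, hk⟩ := (rho_lt_iff hr).1 hlt
    -- A power of the image that is small in supremum norm is small at `x`. Isoradiality of `φ`
    -- turns this into a small power of `h x`, possibly with another exponent, and smallness at `x`
    -- is smallness near `x`.
    refine (isC0BanachAlgebra_C0 ℝ A).rho_le_of_local hr fun x => ?_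
    have h1 : rho (φ.toHom (C0.eval h x)) < ENNReal.ofReal r := by
      refine (rho_lt_iff hr).2 ⟨k, lt_of_le_of_lt ?_ hk⟩
      have e := C0.eval_succPow (A := B) (φ.S.toHom h) x k
      change _ = succPow (φ.toHom (C0.eval h x)) k at e
      rw [← e]
      exact c0_norm_apply_le (show C₀(ℝ, B) from succPow (φ.S.toHom h) k) x
    rw [hφ.isoradial] at h1
    obtain ⟨m, hm⟩ := (rho_lt_iff hr).1 h1
    exact ⟨m, C0.exists_local_norm_lt (A := A) _ x
      ((congrArg norm (C0.eval_succPow (A := A) (X := ℝ) h x m)).trans_lt hm)⟩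
  dense_range := by
    let S : Submodule ℂ C₀(ℝ, B) := LinearMap.range (φ.S.toHom : A.S →ₗ[ℂ] B.S)
    refine dense_of_tens_mem (S := S) (W := Set.range φ.toHom) hφ.dense_range ?_
    rintro χ _ ⟨a, rfl⟩
    refine ⟨(show C₀(ℝ, A) from tens χ a), ZeroAtInftyContinuousMap.ext fun x => ?_⟩
    exact map_smul φ.toHom (χ x) a

end BanachAlg

/-! ### The canonical homomorphism `ι` -/

section Canonical

variable {U : Type u} [Groupoid.{w} U] [TopologicalSpace U] [TopologicalSpace (Arr U)]
  [IsTopologicalGroupoid U] {B : GBanachAlgebra.{u, w, v} U}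
  {X : Type*} [TopologicalSpace X] [T2Space X] [LocallyCompactSpace X]

namespace GammaC

/-- The value `f(γ)(x)` of `f ∈ Γ_c(𝒢, r^*BX)`. -/
def val (f : GammaC (B.extC0 X)) (γ : Arr U) (x : X) : B.fib γ.tgt :=
  (show C₀(X, B.fib γ.tgt) from f.1 γ) x

lemma isC0Section (f : GammaC (B.extC0 X)) :
    B.IsC0Section (X := X) (fun γ : Arr U => γ.tgt)
      (fun γ => (show C₀(X, B.fib γ.tgt) from f.1 γ)) :=
  (BanachAlgebraField.extC0_isPullbackSection_iff
    (B := B.toBanachAlgebraField) (X := X) IsTopologicalGroupoid.continuous_tgt).1 f.2.1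

lemma norm_val_le (f : GammaC (B.extC0 X)) (γ : Arr U) (x : X) : ‖GammaC.val f γ x‖ ≤ ‖f.1 γ‖ :=
  c0_norm_apply_le (show C₀(X, B.fib γ.tgt) from f.1 γ) x

/-- The section `γ ↦ χ ⊗ f(γ)` of `r^*BX`. -/
def tens (χ : C₀(X, ℂ)) (f : GammaC B) : GammaC (B.extC0 X) :=
  ⟨fun γ => BanachGroupoid.tens χ (f.1 γ), by
    obtain ⟨hf, K, hK, h0⟩ := f.2
    refine ⟨(BanachAlgebraField.extC0_isPullbackSection_iff
      (B := B.toBanachAlgebraField) (X := X) IsTopologicalGroupoid.continuous_tgt).2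
      ⟨(hf.comp (q := fun q : Arr U × X => q.1) continuous_fst).smul
        (IsTopologicalGroupoid.continuous_tgt.comp continuous_fst)
        (χ.continuous.comp continuous_snd), fun γ₀ ε hε => ?_⟩, K, hK, fun γ hγ => ?_⟩
    · have hM : 0 < ‖f.1 γ₀‖ + 1 := by positivity
      obtain ⟨L, hL, h⟩ := c0_exists_compact χ (ε := ε / (‖f.1 γ₀‖ + 1)) (by positivity)
      refine ⟨L, hL, ?_⟩
      filter_upwards [hf.norm_lt IsTopologicalGroupoid.continuous_tgt
        (lt_add_one ‖f.1 γ₀‖)] with γ hγ x hx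
      have h1 := h x hx
      rw [lt_div_iff₀ hM] at h1
      change ‖χ x • f.1 γ‖ < ε
      rw [norm_smul]
      nlinarith [norm_nonneg (χ x), norm_nonneg (f.1 γ)]
    · refine ZeroAtInftyContinuousMap.ext fun x => ?_
      change χ x • f.1 γ = 0
      rw [h0 γ hγ, smul_zero]⟩

/-- The values of a section with compact support vanish at infinity, uniformly. -/
lemma exists_compact_norm_lt (f : GammaC (B.extC0 X)) {ε : ℝ} (hε : 0 < ε) :
    ∃ L : Set X, IsCompact L ∧ ∀ x ∉ L, ∀ γ, ‖GammaC.val f γ x‖ < ε := by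
  obtain ⟨K, hK, h0⟩ := f.2.2
  choose L hL hev using fun γ => (GammaC.isC0Section f).2 γ ε hε
  obtain ⟨t, -, ht⟩ := hK.elim_nhds_subcover _ fun γ _ => hev γ
  refine ⟨⋃ γ ∈ t, L γ, t.isCompact_biUnion fun γ _ => hL γ, fun x hx γ => ?_⟩
  by_cases hγ : γ ∈ K
  · obtain ⟨γ', hγ', h⟩ := Set.mem_iUnion₂.1 (ht hγ)
    exact h x fun hxL => hx (Set.mem_iUnion₂.2 ⟨γ', hγ', hxL⟩)
  · have : GammaC.val f γ x = 0 := congrArg (fun k : C₀(X, B.fib γ.tgt) => k x) (h0 γ hγ)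
    rw [this, norm_zero]
    exact hε

/-- Upper semi-continuity of the norm of the values, uniformly on compact sets. -/
lemma eventually_norm_lt (f : GammaC (B.extC0 X)) {K : Set (Arr U)} (hK : IsCompact K) {x₀ : X}
    {ψ : Arr U → ℝ} (hψ : Continuous ψ) (h : ∀ γ ∈ K, ‖GammaC.val f γ x₀‖ ≤ ψ γ) {δ : ℝ} (hδ : 0 < δ) :
    ∀ᶠ x in 𝓝 x₀, ∀ γ ∈ K, ‖GammaC.val f γ x‖ < ψ γ + δ := by
  refine hK.eventually_forall_of_forall_eventually fun γ₀ hγ₀ => ?_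
  have h1 := (GammaC.isC0Section f).1.norm_lt (IsTopologicalGroupoid.continuous_tgt.comp continuous_fst)
    (z₀ := (γ₀, x₀)) (c := ψ γ₀ + δ / 2) (lt_of_le_of_lt (h γ₀ hγ₀) (by linarith))
  have h2 : ∀ᶠ p : Arr U × X in 𝓝 (γ₀, x₀), ψ γ₀ - δ / 2 < ψ p.1 :=
    (hψ.comp continuous_fst).continuousAt.eventually_const_lt (by
      change _ < ψ γ₀
      linarith)
  have h3 : Tendsto (fun p : X × Arr U => (p.2, p.1)) (𝓝 (x₀, γ₀)) (𝓝 (γ₀, x₀)) :=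
    continuous_swap.tendsto (x₀, γ₀)
  filter_upwards [h3.eventually h1, h3.eventually h2] with p hp1 hp2
  have : ‖GammaC.val f p.2 p.1‖ < ψ γ₀ + δ / 2 := hp1
  linarith

lemma eval_c0Smul (x : X) (χ : C₀(X, ℂ)) (f : GammaC (B.extC0 X)) :
    eval x (c0Smul χ f) = χ x • eval x f := rfl

variable [T2Space (Arr U)] [LocallyCompactSpace (Arr U)] {lam : HaarSystem U}

/-- Evaluation at `x` is a bounded operator on each fibre `C₀(X, B_u)` and so commutes with the
integral. -/
lemma eval_conv (x : X) (f g : GammaC (B.extC0 X)) :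
    eval x (conv lam f g) = conv lam (eval x f) (eval x g) := by
  apply Subtype.ext
  funext γ
  let ev : C₀(X, B.fib γ.tgt) →L[ℂ] B.fib γ.tgt := LinearMap.mkContinuous
    { toFun := fun h => h x
      map_add' := fun _ _ => rfl
      map_smul' := fun _ _ => rfl } 1 fun h => by
        rw [one_mul]
        exact c0_norm_apply_le h x
  exact (ev.integral_comp_comm (integrable_convIntegrand lam f.2 g.2 (⟨γ.hom⟩ : Fib γ.tgt))).symm

/-- At a point `x` the function `χ` becomes the scalar `χ x`, so `eval_conv` reduces the claim to
bilinearity of the convolution product. -/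
lemma c0Smul_conv_left (χ : C₀(X, ℂ)) (f g : GammaC (B.extC0 X)) :
    c0Smul χ (conv lam f g) = conv lam (c0Smul χ f) g := by
  apply Subtype.ext
  funext γ
  refine ZeroAtInftyContinuousMap.ext fun x => ?_
  have h := fun f g : GammaC (B.extC0 X) => congrArg (fun k : GammaC B => k.1 γ)
    (eval_conv (lam := lam) x f g)
  refine Eq.trans ?_ (h (c0Smul χ f) g).symm
  rw [eval_c0Smul, smul_conv, ← eval_conv]
  rfl

lemma c0Smul_conv_right (χ : C₀(X, ℂ)) (f g : GammaC (B.extC0 X)) :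
    c0Smul χ (conv lam f g) = conv lam f (c0Smul χ g) := by
  apply Subtype.ext
  funext γ
  refine ZeroAtInftyContinuousMap.ext fun x => ?_
  have h := fun f g : GammaC (B.extC0 X) => congrArg (fun k : GammaC B => k.1 γ)
    (eval_conv (lam := lam) x f g)
  refine Eq.trans ?_ (h f (c0Smul χ g)).symm
  rw [eval_c0Smul, conv_smul, ← eval_conv]
  rfl

end GammaC

variable [T2Space (Arr U)] [LocallyCompactSpace (Arr U)] {lam : HaarSystem U}

/-- A cut-off function for a compact set of arrows. -/
lemma exists_arr_cutoff {K : Set (Arr U)} (hK : IsCompact K) :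
    ∃ φ : C_c(Arr U, ℂ), (∀ γ, (φ γ).im = 0 ∧ 0 ≤ (φ γ).re) ∧ ∀ γ ∈ K, φ γ = 1 := by
  obtain ⟨φ₀, hφ₀K, -, hφ₀c, hφ₀⟩ :=
    exists_continuous_one_zero_of_isCompact hK (isClosed_empty (X := Arr U)) (Set.disjoint_empty _)
  refine ⟨⟨⟨fun γ => (φ₀ γ : ℂ), by fun_prop⟩, hφ₀c.comp_left (g := fun r : ℝ => (r : ℂ)) rfl⟩,
    fun γ => ⟨Complex.ofReal_im _, (hφ₀ γ).1⟩, fun γ hγ => ?_⟩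
  change ((φ₀ γ : ℝ) : ℂ) = 1
  rw [hφ₀K hγ]
  simp

/-! ### Local norm estimates and the construction of `ι`. -/

namespace UnconditionalNorm

variable (N : UnconditionalNorm lam)

lemma toAlgebra_add (f g : GammaC B) : N.toAlgebra (f + g) = N.toAlgebra f + N.toAlgebra g :=
  UniformSpace.Completion.coe_add (α := PreAlg N B) f g

lemma toAlgebra_smul (c : ℂ) (f : GammaC B) : N.toAlgebra (c • f) = c • N.toAlgebra f :=
  UniformSpace.Completion.coe_smul (X := PreAlg N B) c f

lemma toAlgebra_sub (f g : GammaC B) : N.toAlgebra (f - g) = N.toAlgebra f - N.toAlgebra g :=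
  UniformSpace.Completion.coe_sub (α := PreAlg N B) f g

/-- A section with values of norm at most `ε` and support in `K` has norm at most `ε ‖φ‖`, if
`φ` is one on `K`. -/
lemma sectionNorm_le {f : GammaC B} {K : Set (Arr U)} (h0 : ∀ γ ∉ K, f.1 γ = 0)
    {ψ φ : C_c(Arr U, ℂ)} (hψ : ∀ γ, (ψ γ).im = 0 ∧ 0 ≤ (ψ γ).re)
    (hφ : ∀ γ, (φ γ).im = 0 ∧ 0 ≤ (φ γ).re) (hφ1 : ∀ γ ∈ K, φ γ = 1) {ε : ℝ} (hε : 0 ≤ ε)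
    (h : ∀ γ ∈ K, ‖f.1 γ‖ ≤ (ψ γ).re + ε) :
    N.sectionNorm f ≤ N.toSeminorm ψ + ε * N.toSeminorm φ := by
  have hd : ψ + (ε : ℂ) • φ ∈ dominating fun γ => ‖f.1 γ‖ := fun γ => by
    refine ⟨by simp [(hψ γ).1, (hφ γ).1], ?_⟩
    have e : ((ψ + (ε : ℂ) • φ) γ).re = (ψ γ).re + ε * (φ γ).re := by simp
    rw [e]
    by_cases hγ : γ ∈ K
    · rw [hφ1 γ hγ]
      simpa using h γ hγ
    · change ‖f.1 γ‖ ≤ _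
      rw [h0 γ hγ, norm_zero]
      have := mul_nonneg hε (hφ γ).2
      linarith [(hψ γ).2]
  refine (N.ext_le hd).trans ((map_add_le_add _ _ _).trans ?_)
  rw [map_smul_eq_mul, Complex.norm_real, Real.norm_of_nonneg hε]

lemma sectionNorm_eval_le (x : X) (f : GammaC (B.extC0 X)) :
    N.sectionNorm (GammaC.eval x f) ≤ N.sectionNorm f := by
  refine le_of_forall_gt fun c hc => ?_
  obtain ⟨ψ, hψ, hn⟩ := N.exists_lt (dominating_nonempty f) hc
  exact (N.ext_le fun γ => ⟨(hψ γ).1, (GammaC.norm_val_le f γ x).trans (hψ γ).2⟩).trans_lt hn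

/-- The local norm of a section at `x` is the norm of its value. -/
lemma exists_sectionNorm_c0Smul_lt (f : GammaC (B.extC0 X)) (x : X) {c : ℝ}
    (hc : N.sectionNorm (GammaC.eval x f) < c) :
    ∃ χ : C₀(X, ℂ), (∀ᶠ y in 𝓝 x, χ y = 1) ∧ (∀ y, ‖χ y‖ ≤ 1) ∧
      N.sectionNorm (GammaC.c0Smul χ f) < c := by
  obtain ⟨K, hK, h0⟩ := f.2.2
  obtain ⟨φ, hφ, hφ1⟩ := exists_arr_cutoff hK
  obtain ⟨ψ, hψ, hn⟩ := N.exists_lt (dominating_nonempty _) hc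
  have hψ0 : ∀ γ, (ψ γ).im = 0 ∧ 0 ≤ (ψ γ).re := fun γ =>
    ⟨(hψ γ).1, (norm_nonneg _).trans (hψ γ).2⟩
  have hM : 0 ≤ N.toSeminorm φ := apply_nonneg _ _
  -- Chosen so that `N.toSeminorm ψ + δ * N.toSeminorm φ` stays below `c`; the `+ 1` covers the case
  -- `N.toSeminorm φ = 0`.
  set δ := (c - N.toSeminorm ψ) / (N.toSeminorm φ + 1) with hδd
  have hδ : 0 < δ := div_pos (sub_pos.2 hn) (by positivity)
  have hδ2 : δ * (N.toSeminorm φ + 1) = c - N.toSeminorm ψ := by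
    rw [hδd]
    field_simp
  -- The cut-off lives over those `y` for which the one function `ψ`, enlarged by `δ`, dominates `γ
  -- ↦ ‖f(γ)(y)‖` on all of `K`.
  obtain ⟨χ, hχ1, hχ0, hχ⟩ := exists_cutoff_nhds (GammaC.eventually_norm_lt f hK (x₀ := x)
    (ψ := fun γ => (ψ γ).re) (by fun_prop) (fun γ _ => (hψ γ).2) hδ)
  refine ⟨χ, hχ1, hχ, ?_⟩
  have h := N.sectionNorm_le (f := GammaC.c0Smul χ f) (K := K) (fun γ hγ => by
      refine ZeroAtInftyContinuousMap.ext fun y => ?_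
      change χ y • (show C₀(X, B.fib γ.tgt) from f.1 γ) y = 0
      rw [h0 γ hγ]
      exact smul_zero _) hψ0 hφ hφ1 hδ.le (fun γ hγ => by
      refine c0_norm_le (show C₀(X, B.fib γ.tgt) from _) (by linarith [(hψ0 γ).2]) fun y => ?_
      change ‖χ y • GammaC.val f γ y‖ ≤ _
      rw [norm_smul]
      by_cases hy : ∀ γ ∈ K, ‖GammaC.val f γ y‖ < (ψ γ).re + δ
      · exact (mul_le_of_le_one_left (norm_nonneg _) (hχ y)).trans (hy γ hγ).le
      · rw [hχ0 y hy, norm_zero, zero_mul]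
        linarith [(hψ0 γ).2])
  nlinarith

/-- Compact support in `𝒢` makes `f(γ)(x)` small outside a compact subset of `X`, uniformly in `γ`.
The first conclusion lets `ι(f)` vanish at infinity, the second gives nondegeneracy of the
`C₀(X)`-module. -/
lemma exists_compact_sectionNorm_eval_lt (f : GammaC (B.extC0 X)) {ε : ℝ} (hε : 0 < ε) :
    ∃ L : Set X, IsCompact L ∧ (∀ x ∉ L, N.sectionNorm (GammaC.eval x f) < ε) ∧
      ∀ χ : C₀(X, ℂ), (∀ x ∈ L, χ x = 1) → (∀ x, ‖χ x‖ ≤ 1) →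
        N.sectionNorm (f - GammaC.c0Smul χ f) < ε := by
  obtain ⟨K, hK, h0⟩ := f.2.2
  obtain ⟨φ, hφ, hφ1⟩ := exists_arr_cutoff hK
  have hM : 0 ≤ N.toSeminorm φ := apply_nonneg _ _
  -- The factor two serves the second claim, where `1 - χ` is bounded only by two off `L`.
  set δ := ε / (2 * (N.toSeminorm φ + 1)) with hδd
  have hδ : 0 < δ := by positivity
  have hδ2 : 2 * δ * (N.toSeminorm φ + 1) = ε := by
    rw [hδd]
    field_simp
  obtain ⟨L, hL, hf⟩ := GammaC.exists_compact_norm_lt f hδ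
  have hz : ∀ γ, ((0 : C_c(Arr U, ℂ)) γ).im = 0 ∧ 0 ≤ ((0 : C_c(Arr U, ℂ)) γ).re := by simp
  have h0' : ∀ γ ∉ K, ∀ x, GammaC.val f γ x = 0 := fun γ hγ x =>
    congrArg (fun k : C₀(X, B.fib γ.tgt) => k x) (h0 γ hγ)
  refine ⟨L, hL, fun x hx => ?_, fun χ h1 hχ => ?_⟩
  · have h := N.sectionNorm_le (f := GammaC.eval x f) (K := K) (fun γ hγ => h0' γ hγ x) hz hφ hφ1
      hδ.le (fun γ _ => by
        simp only [CompactlySupportedContinuousMap.zero_apply, Complex.zero_re, zero_add]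
        exact (hf x hx γ).le)
    rw [map_zero] at h
    nlinarith
  · have h := N.sectionNorm_le (f := f - GammaC.c0Smul χ f) (K := K) (fun γ hγ => by
        refine ZeroAtInftyContinuousMap.ext fun y => ?_
        change GammaC.val f γ y - χ y • GammaC.val f γ y = 0
        rw [h0' γ hγ, smul_zero, sub_zero]) hz hφ hφ1 (ε := 2 * δ) (by positivity) (fun γ hγ => by
        simp only [CompactlySupportedContinuousMap.zero_apply, Complex.zero_re, zero_add]
        refine c0_norm_le (show C₀(X, B.fib γ.tgt) from _) (by positivity) fun y => ?_
        change ‖GammaC.val f γ y - χ y • GammaC.val f γ y‖ ≤ _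
        by_cases hy : y ∈ L
        · rw [h1 y hy, one_smul, sub_self, norm_zero]
          positivity
        · have h2 := norm_sub_le (GammaC.val f γ y) (χ y • GammaC.val f γ y)
          rw [norm_smul] at h2
          nlinarith [hχ y, hf y hy γ, norm_nonneg (GammaC.val f γ y)])
    rw [map_zero] at h
    nlinarith

/-- The value `x ↦ [γ ↦ f(γ)(x)]` of the canonical homomorphism on a section. -/
def evalC0 (f : GammaC (B.extC0 X)) : C₀(X, N.algebra B) where
  toFun x := N.toAlgebra (GammaC.eval x f)
  continuous_toFun := by
    refine continuous_iff_continuousAt.2 fun x₀ => Metric.tendsto_nhds.2 fun ε hε => ?_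
    obtain ⟨χ', h1, -⟩ := exists_cutoff_nhds (x := x₀) (V := Set.univ) Filter.univ_mem
    -- Near `x₀` the section is compared with the one that is constant in `x` with the value of `f`
    -- at `x₀`. The difference `g` vanishes at `x₀`, so its local norm there is arbitrarily small,
    -- and this controls all nearby `x` at once.
    set g := f - GammaC.tens χ' (GammaC.eval x₀ f) with hg
    have hg0 : GammaC.eval x₀ g = 0 := by
      change GammaC.eval x₀ f - χ' x₀ • GammaC.eval x₀ f = 0
      rw [h1.self_of_nhds, one_smul, sub_self]
    obtain ⟨χ, h2, -, h3⟩ := N.exists_sectionNorm_c0Smul_lt g x₀ (c := ε) (by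
      rw [hg0, N.sectionNorm_zero]
      exact hε)
    filter_upwards [h1, h2] with x hx hx'
    have e : GammaC.eval x (GammaC.c0Smul χ g) = GammaC.eval x f - GammaC.eval x₀ f := by
      change χ x • (GammaC.eval x f - χ' x • GammaC.eval x₀ f) = _
      rw [hx, hx', one_smul, one_smul]
    rw [dist_eq_norm, ← N.toAlgebra_sub, N.norm_toAlgebra, ← e]
    exact (N.sectionNorm_eval_le x _).trans_lt h3
  zero_at_infty' := by
    refine Metric.tendsto_nhds.2 fun ε hε => ?_
    obtain ⟨L, hL, h, -⟩ := N.exists_compact_sectionNorm_eval_lt f hε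
    filter_upwards [hL.compl_mem_cocompact] with x hx
    rw [dist_zero_right, N.norm_toAlgebra]
    exact h x hx


lemma norm_evalC0_le (f : GammaC (B.extC0 X)) : ‖N.evalC0 f‖ ≤ N.sectionNorm f :=
  c0_norm_le _ (N.ext_nonneg _) fun x => by
    change ‖N.toAlgebra (GammaC.eval x f)‖ ≤ _
    rw [N.norm_toAlgebra]
    exact N.sectionNorm_eval_le x f

variable (B X) in
/-- The canonical homomorphism on sections, as a bounded operator. -/
def evalC0Lin : PreAlg N (B.extC0 X) →L[ℂ] C₀(X, N.algebra B) :=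
  LinearMap.mkContinuous
    { toFun := fun f => N.evalC0 (show GammaC (B.extC0 X) from f)
      map_add' := fun f g => ZeroAtInftyContinuousMap.ext fun x =>
        N.toAlgebra_add (GammaC.eval x (show GammaC (B.extC0 X) from f)) (GammaC.eval x g)
      map_smul' := fun c f => ZeroAtInftyContinuousMap.ext fun x =>
        N.toAlgebra_smul c (GammaC.eval x (show GammaC (B.extC0 X) from f)) } 1
    fun f => by
      rw [one_mul]
      exact N.norm_evalC0_le f

variable (B X) in
/-- The underlying map of the canonical homomorphism. -/
def canonicalFun (a : N.algebra (B.extC0 X)) : (N.algebra B).C0 X :=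
  UniformSpace.Completion.extension (α := PreAlg N (B.extC0 X)) (N.evalC0Lin B X) a

lemma continuous_canonicalFun : Continuous (N.canonicalFun B X) :=
  UniformSpace.Completion.continuous_extension

lemma canonicalFun_toAlgebra (f : GammaC (B.extC0 X)) :
    N.canonicalFun B X (N.toAlgebra f) = (show (N.algebra B).C0 X from N.evalC0 f) :=
  UniformSpace.Completion.extension_coe (N.evalC0Lin B X).uniformContinuous
    (show PreAlg N (B.extC0 X) from f)

variable (B X) in
/-- The canonical homomorphism `ι : 𝒜(𝒢, BX) → C₀(X, 𝒜(𝒢, B))`. -/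
def canonicalHom : (N.algebra (B.extC0 X)).Hom ((N.algebra B).C0 X) where
  toHom :=
    { toFun := N.canonicalFun B X
      map_smul' := fun c a => N.denseRange_toAlgebra.induction_on a
        (isClosed_eq (N.continuous_canonicalFun.comp (continuous_const_smul c))
          ((continuous_const_smul c).comp N.continuous_canonicalFun)) fun f => by
        rw [← N.toAlgebra_smul, N.canonicalFun_toAlgebra, N.canonicalFun_toAlgebra]
        exact (N.evalC0Lin B X).map_smul c f
      map_zero' := by
        refine (N.canonicalFun_toAlgebra 0).trans ?_
        exact (N.evalC0Lin B X).map_zero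
      map_add' := fun a b => N.denseRange_toAlgebra.induction_on₂
        (isClosed_eq (N.continuous_canonicalFun.comp (continuous_fst.add continuous_snd))
          ((N.continuous_canonicalFun.comp continuous_fst).add
            (N.continuous_canonicalFun.comp continuous_snd))) (fun f g => by
        rw [← N.toAlgebra_add, N.canonicalFun_toAlgebra, N.canonicalFun_toAlgebra,
          N.canonicalFun_toAlgebra]
        exact (N.evalC0Lin B X).map_add f g) a b
      map_mul' := fun a b => N.denseRange_toAlgebra.induction_on₂
        (isClosed_eq (N.continuous_canonicalFun.comp (continuous_fst.mul continuous_snd))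
          ((N.continuous_canonicalFun.comp continuous_fst).mul
            (N.continuous_canonicalFun.comp continuous_snd))) (fun f g => by
        rw [← N.toAlgebra_conv, N.canonicalFun_toAlgebra, N.canonicalFun_toAlgebra,
          N.canonicalFun_toAlgebra]
        refine ZeroAtInftyContinuousMap.ext fun x => ?_
        change N.toAlgebra (GammaC.eval x (conv lam f g))
          = N.toAlgebra (GammaC.eval x f) * N.toAlgebra (GammaC.eval x g)
        rw [GammaC.eval_conv, N.toAlgebra_conv]) a b }
  cont := N.continuous_canonicalFun

lemma isCanonical_canonicalHom : N.IsCanonical (N.canonicalHom B X) := fun f x =>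
  congrArg (fun h => BanachAlg.C0.eval h x) (N.canonicalFun_toAlgebra f)

lemma norm_canonicalFun_le (a : N.algebra (B.extC0 X)) : ‖N.canonicalFun B X a‖ ≤ ‖a‖ :=
  N.denseRange_toAlgebra.induction_on a
    (isClosed_le N.continuous_canonicalFun.norm continuous_norm) fun f => by
    rw [N.canonicalFun_toAlgebra, N.norm_toAlgebra]
    exact N.norm_evalC0_le f

lemma continuous_c0Act (χ : C₀(X, ℂ)) : Continuous (N.c0Act (B := B) χ) :=
  UniformSpace.Completion.continuous_map

lemma canonicalFun_c0Act (χ : C₀(X, ℂ)) (a : N.algebra (B.extC0 X)) :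
    N.canonicalFun B X (N.c0Act χ a) = BanachAlg.C0.act X (N.algebra B) χ (N.canonicalFun B X a) := by
  refine N.denseRange_toAlgebra.induction_on a (isClosed_eq
    (N.continuous_canonicalFun.comp (N.continuous_c0Act χ)) ?_) fun f => ?_
  · refine Continuous.comp ?_ N.continuous_canonicalFun
    refine AddMonoidHomClass.continuous_of_bound (AddMonoidHom.mk' (BanachAlg.C0.act X _ χ)
      ((N.algebra B).isC0BanachAlgebra_C0 X |>.act_add χ)) ‖χ‖ fun h => ?_
    exact ((N.algebra B).isC0BanachAlgebra_C0 X).norm_act_le χ h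
  · rw [N.c0Act_toAlgebra, N.canonicalFun_toAlgebra, N.canonicalFun_toAlgebra]
    exact ZeroAtInftyContinuousMap.ext fun x => N.toAlgebra_smul (χ x) (GammaC.eval x f)

-- The identities and the norm bound hold for sections and extend to the completion by continuity;
-- nondegeneracy holds because suitable cut-off functions almost fix each section.
variable (B X) in
lemma isC0BanachAlgebra : IsC0BanachAlgebra X (N.algebra (B.extC0 X)) N.c0Act where
  act_add χ a b := N.denseRange_toAlgebra.induction_on₂
    (isClosed_eq ((N.continuous_c0Act χ).comp (continuous_fst.add continuous_snd))
      (((N.continuous_c0Act χ).comp continuous_fst).add ((N.continuous_c0Act χ).comp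
        continuous_snd))) (fun f g => by
    rw [← N.toAlgebra_add, N.c0Act_toAlgebra, N.c0Act_toAlgebra, N.c0Act_toAlgebra,
      ← N.toAlgebra_add]
    congr 1
    exact Subtype.ext <| funext fun γ => ZeroAtInftyContinuousMap.ext fun x =>
      smul_add (χ x) _ _) a b
  act_smul χ c a := N.denseRange_toAlgebra.induction_on a
    (isClosed_eq ((N.continuous_c0Act χ).comp (continuous_const_smul c))
      ((continuous_const_smul c).comp (N.continuous_c0Act χ))) fun f => by
    rw [← N.toAlgebra_smul, N.c0Act_toAlgebra, N.c0Act_toAlgebra, ← N.toAlgebra_smul]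
    congr 1
    exact Subtype.ext <| funext fun γ => ZeroAtInftyContinuousMap.ext fun x =>
      smul_comm (χ x) c _
  add_act χ ψ a := N.denseRange_toAlgebra.induction_on a
    (isClosed_eq (N.continuous_c0Act _) ((N.continuous_c0Act χ).add (N.continuous_c0Act ψ)))
    fun f => by
    rw [N.c0Act_toAlgebra, N.c0Act_toAlgebra, N.c0Act_toAlgebra, ← N.toAlgebra_add]
    congr 1
    exact Subtype.ext <| funext fun γ => ZeroAtInftyContinuousMap.ext fun x =>
      add_smul (χ x) (ψ x) _
  smul_act c χ a := N.denseRange_toAlgebra.induction_on a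
    (isClosed_eq (N.continuous_c0Act _) ((continuous_const_smul c).comp (N.continuous_c0Act χ)))
    fun f => by
    rw [N.c0Act_toAlgebra, N.c0Act_toAlgebra, ← N.toAlgebra_smul]
    congr 1
    exact Subtype.ext <| funext fun γ => ZeroAtInftyContinuousMap.ext fun x =>
      smul_assoc c (χ x) _
  mul_act χ ψ a := N.denseRange_toAlgebra.induction_on a
    (isClosed_eq (N.continuous_c0Act _) ((N.continuous_c0Act χ).comp (N.continuous_c0Act ψ)))
    fun f => by
    rw [N.c0Act_toAlgebra, N.c0Act_toAlgebra, N.c0Act_toAlgebra]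
    congr 1
    exact Subtype.ext <| funext fun γ => ZeroAtInftyContinuousMap.ext fun x =>
      mul_smul (χ x) (ψ x) _
  norm_act_le χ a := N.denseRange_toAlgebra.induction_on a
    (isClosed_le (N.continuous_c0Act χ).norm (continuous_const.mul continuous_norm))
    fun f => by
    rw [N.c0Act_toAlgebra, N.norm_toAlgebra, N.norm_toAlgebra]
    exact N.sectionNorm_c0Smul_le χ f
  nondegenerate := by
    refine Metric.dense_iff.2 fun a ε hε => ?_
    obtain ⟨f, hf⟩ := N.denseRange_toAlgebra.exists_dist_lt a (half_pos hε)
    obtain ⟨L, hL, -, h⟩ := N.exists_compact_sectionNorm_eval_lt f (half_pos hε)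
    obtain ⟨χ, -, -, h1, -, -, hχ⟩ := exists_cutoff hL isOpen_univ (Set.subset_univ _)
    refine ⟨N.c0Act χ (N.toAlgebra f), ?_, Submodule.subset_span ⟨χ, _, rfl⟩⟩
    have h2 := h χ h1 hχ
    rw [← N.norm_toAlgebra, N.toAlgebra_sub, ← N.c0Act_toAlgebra, ← dist_eq_norm] at h2
    have h3 := dist_triangle a (N.toAlgebra f) (N.c0Act χ (N.toAlgebra f))
    rw [Metric.mem_ball, dist_comm]
    linarith
  act_mul_left χ a b := N.denseRange_toAlgebra.induction_on₂
    (isClosed_eq ((N.continuous_c0Act χ).comp (continuous_fst.mul continuous_snd))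
      (((N.continuous_c0Act χ).comp continuous_fst).mul continuous_snd)) (fun f g => by
    rw [← N.toAlgebra_conv, N.c0Act_toAlgebra, N.c0Act_toAlgebra, ← N.toAlgebra_conv,
      GammaC.c0Smul_conv_left]) a b
  act_mul_right χ a b := N.denseRange_toAlgebra.induction_on₂
    (isClosed_eq ((N.continuous_c0Act χ).comp (continuous_fst.mul continuous_snd))
      (continuous_fst.mul ((N.continuous_c0Act χ).comp continuous_snd))) (fun f g => by
    rw [← N.toAlgebra_conv, N.c0Act_toAlgebra, N.c0Act_toAlgebra, ← N.toAlgebra_conv,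
      GammaC.c0Smul_conv_right]) a b


/-- The local norm of an element of `𝒜(𝒢, BX)` at `x` is the norm of its image under `ι`. -/
lemma exists_local_norm_lt (a : N.algebra (B.extC0 X)) (x : X) {c : ℝ}
    (hc : ‖BanachAlg.C0.eval (N.canonicalFun B X a) x‖ < c) :
    ∃ χ : C₀(X, ℂ), (∀ᶠ y in 𝓝 x, χ y = 1) ∧ ‖N.c0Act χ a‖ < c := by
  -- One third each: passing from `a` to `f` costs `ε` in the value at `x`, the local norm of `f`
  -- may exceed the resulting bound by less than another `ε`, and passing back to `a` costs the
  -- last.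
  set ε := (c - ‖BanachAlg.C0.eval (N.canonicalFun B X a) x‖) / 3 with hεd
  have hε : 0 < ε := div_pos (sub_pos.2 hc) three_pos
  obtain ⟨f, hf⟩ := N.denseRange_toAlgebra.exists_dist_lt a hε
  rw [dist_eq_norm] at hf
  have h1 : ‖BanachAlg.C0.eval (N.canonicalFun B X (N.toAlgebra f)) x‖
      ≤ ‖BanachAlg.C0.eval (N.canonicalFun B X a) x‖ + ε := by
    have h2 := (c0_norm_apply_le (show C₀(X, N.algebra B) from
      (N.canonicalHom B X).toHom (a - N.toAlgebra f)) x).trans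
      ((N.norm_canonicalFun_le _).trans hf.le)
    rw [map_sub] at h2
    have h3 := norm_sub_le (BanachAlg.C0.eval (N.canonicalFun B X a) x)
      (BanachAlg.C0.eval (N.canonicalFun B X a) x
        - BanachAlg.C0.eval (N.canonicalFun B X (N.toAlgebra f)) x)
    rw [sub_sub_cancel] at h3
    exact h3.trans (add_le_add le_rfl h2)
  rw [N.canonicalFun_toAlgebra] at h1
  change ‖N.toAlgebra (GammaC.eval x f)‖ ≤ _ at h1
  rw [N.norm_toAlgebra] at h1
  obtain ⟨χ, hχ1, hχ, h4⟩ := N.exists_sectionNorm_c0Smul_lt f x (c := c - ε) (by linarith)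
  refine ⟨χ, hχ1, ?_⟩
  rw [← N.norm_toAlgebra, ← N.c0Act_toAlgebra] at h4
  have h5 := (N.isC0BanachAlgebra B X).norm_act_le_of_le hχ (a - N.toAlgebra f)
  rw [(N.isC0BanachAlgebra B X).act_sub] at h5
  have h6 := norm_add_le (N.c0Act χ a - N.c0Act χ (N.toAlgebra f)) (N.c0Act χ (N.toAlgebra f))
  rw [sub_add_cancel] at h6
  linarith

/-- The sections `χ ⊗ f` are mapped to the elementary tensors `χ ⊗ [f]`, which span a dense
subspace. -/
lemma dense_range_canonicalHom : DenseRange (N.canonicalHom B X).toHom := by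
  let S : Submodule ℂ C₀(X, N.algebra B) :=
    LinearMap.range ((N.canonicalHom B X).toHom : N.algebra (B.extC0 X) →ₗ[ℂ] (N.algebra B).C0 X)
  refine dense_of_tens_mem (S := S) (W := Set.range (N.toAlgebra (B := B)))
    N.denseRange_toAlgebra ?_
  rintro χ _ ⟨f, rfl⟩
  refine ⟨N.toAlgebra (GammaC.tens χ f), (N.canonicalFun_toAlgebra _).trans ?_⟩
  exact ZeroAtInftyContinuousMap.ext fun x => N.toAlgebra_smul (χ x) f

-- If `ρ(ι(a)) < r`, one power `ι(a) ^ (k + 1)` has norm below `r ^ (k + 1)`. The local norm of `a ^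
-- (k + 1)` at `x` is the norm of the value of that power at `x`, so the same `k` works at every
-- point and `rho_le_of_local` gives `ρ(a) ≤ r`.
variable (B X) in
lemma isFull_canonicalHom : (N.canonicalHom B X).IsFull where
  norm_le := N.norm_canonicalFun_le
  dense_range := N.dense_range_canonicalHom
  isoradial a := by
    refine (N.canonicalHom B X).rho_eq_of_le a fun r hr hlt => ?_
    obtain ⟨k, hk⟩ := (BanachAlg.rho_lt_iff hr).1 hlt
    refine (N.isC0BanachAlgebra B X).rho_le_of_local hr fun x => ⟨k, ?_⟩
    refine N.exists_local_norm_lt _ x (lt_of_le_of_lt ?_ hk)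
    rw [← map_succPow]
    exact c0_norm_apply_le (show C₀(X, N.algebra B) from N.canonicalFun B X (succPow a k)) x

variable (B X) in
lemma isC0Hom_canonicalHom :
    (N.canonicalHom B X).IsC0Hom N.c0Act (BanachAlg.C0.act X (N.algebra B)) where
  norm_le := N.norm_canonicalFun_le
  map_act := N.canonicalFun_c0Act

end UnconditionalNorm

end Canonical

/-! ### Fibres -/

section Fibres

variable {X : Type*} [TopologicalSpace X] [T2Space X] [LocallyCompactSpace X]

/-- If the local norm at `x` is given by a contraction `e` which is compatible with the evaluation
at `x`, then so is the norm of the fibre at `x`. -/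
lemma IsC0BanachAlgebra.norm_fibre_eq {A : BanachAlg.{v}} {act : C₀(X, ℂ) → A → A}
    (hA : IsC0BanachAlgebra X A act) {D : Type*} [NormedAddCommGroup D] [NormedSpace ℂ D] {x : X}
    (e : A →ₗ[ℂ] D) (he : ∀ a, ‖e a‖ ≤ ‖a‖) (hact : ∀ χ a, e (act χ a) = χ x • e a)
    (hloc : ∀ a c, ‖e a‖ < c → ∃ χ : C₀(X, ℂ), (∀ᶠ y in 𝓝 x, χ y = 1) ∧ ‖act χ a‖ < c) (a : A) :
    ‖(fibreIdeal act x).mkQ a‖ = ‖e a‖ := by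
  have hec : Continuous e := AddMonoidHomClass.continuous_of_bound e 1 (by simpa using he)
  have hker : ∀ b ∈ fibreIdeal act x, e b = 0 := by
    have h : fibreIdeal act x ≤ LinearMap.ker e := by
      refine Submodule.topologicalClosure_minimal _ (Submodule.span_le.2 ?_)
        (isClosed_eq hec continuous_const)
      rintro _ ⟨χ, a, hχ, rfl⟩
      change e (act χ a) = 0
      rw [hact, hχ, zero_smul]
    exact h
  refine le_antisymm (le_of_forall_gt fun c hc => ?_) ?_
  · obtain ⟨χ, h1, h2⟩ := hloc a c hc
    have h3 : a - act χ a ∈ fibreIdeal act x := by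
      -- `1 - χ` need not vanish at infinity, but `η - η χ` does; it is zero at `x` because `χ x =
      -- 1`, and `(η - η χ) a = η (a - χ a)` approximates `a - χ a`.
      refine Metric.mem_closure_iff.2 fun ε hε => ?_
      obtain ⟨K, hK, h⟩ := hA.exists_compact_approx (a - act χ a) hε
      obtain ⟨η, -, -, hη1, -, -, hη⟩ := exists_cutoff (hK.union (isCompact_singleton (x := x)))
        isOpen_univ (Set.subset_univ _)
      refine ⟨act η (a - act χ a), Submodule.subset_span ⟨η - η * χ, a, ?_, ?_⟩, ?_⟩
      · change η x - η x * χ x = 0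
        rw [h1.self_of_nhds, mul_one, sub_self]
      · rw [hA.sub_act, hA.mul_act, hA.act_sub]
      · rw [dist_eq_norm]
        exact h η (fun y hy => hη1 y (Or.inl hy)) hη
    have h4 : (fibreIdeal act x).mkQ a = (fibreIdeal act x).mkQ (act χ a) := by
      rw [← sub_eq_zero, ← map_sub]
      exact (Submodule.Quotient.mk_eq_zero _).2 h3
    rw [h4]
    exact (Submodule.Quotient.norm_mk_le _ _).trans_lt h2
  · refine le_of_forall_gt fun c hc => ?_
    obtain ⟨b, hb, hbc⟩ := Submodule.Quotient.norm_mk_lt ((fibreIdeal act x).mkQ a)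
      (sub_pos.2 hc)
    have h1 : b - a ∈ fibreIdeal act x := (Submodule.Quotient.eq _).1 hb
    have h2 : e b = e a := by
      rw [← sub_eq_zero, ← map_sub]
      exact hker _ h1
    rw [← h2]
    refine (he b).trans_lt ?_
    linarith

variable {U : Type u} [Groupoid.{w} U] [TopologicalSpace U] [TopologicalSpace (Arr U)]
  [IsTopologicalGroupoid U] {B : GBanachAlgebra.{u, w, v} U}
  [T2Space (Arr U)] [LocallyCompactSpace (Arr U)] {lam : HaarSystem U} (N : UnconditionalNorm lam)

variable (B X) in
lemma UnconditionalNorm.isIsometricOnFibres_canonicalHom :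
    IsIsometricOnFibres N.c0Act (BanachAlg.C0.act X (N.algebra B)) (N.canonicalHom B X) := by
  intro x
  have hA := N.isC0BanachAlgebra B X
  have hA' := (N.algebra B).isC0BanachAlgebra_C0 X
  let ev : (N.algebra B).C0 X →ₗ[ℂ] N.algebra B :=
    { toFun := fun h => BanachAlg.C0.eval h x
      map_add' := fun _ _ => rfl
      map_smul' := fun _ _ => rfl }
  let ι : N.algebra (B.extC0 X) →ₗ[ℂ] (N.algebra B).C0 X := (N.canonicalHom B X).toHom
  -- Both fibre norms are given by the norm of the value of `ι(a)` at `x`, so the map induced on the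
  -- fibres is isometric.
  have h1 := hA.norm_fibre_eq (x := x) (ev ∘ₗ ι)
    (fun a => (c0_norm_apply_le (show C₀(X, N.algebra B) from N.canonicalFun B X a) x).trans
      (N.norm_canonicalFun_le a))
    (fun χ a => by
      change BanachAlg.C0.eval (N.canonicalFun B X (N.c0Act χ a)) x = _
      rw [N.canonicalFun_c0Act]
      rfl)
    (fun a c h => N.exists_local_norm_lt a x h)
  have h2 := hA'.norm_fibre_eq (x := x) ev
    (fun a => c0_norm_apply_le (show C₀(X, N.algebra B) from a) x) (fun χ a => rfl)
    (fun a c h => BanachAlg.C0.exists_local_norm_lt a x h)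
  let I := fibreIdeal (N.c0Act (B := B) (X := X)) x
  let I' := fibreIdeal (BanachAlg.C0.act X (N.algebra B)) x
  have hIc : IsClosed (I : Set (N.algebra (B.extC0 X))) := Submodule.isClosed_topologicalClosure _
  have hI' : IsClosed (I' : Set ((N.algebra B).C0 X)) := Submodule.isClosed_topologicalClosure _
  have hI : I ≤ I'.comap ι := by
    refine Submodule.topologicalClosure_minimal _ (Submodule.span_le.2 ?_)
      (hI'.preimage N.continuous_canonicalFun)
    rintro _ ⟨χ, a, hχ, rfl⟩
    refine Submodule.le_topologicalClosure _ (Submodule.subset_span ⟨χ, N.canonicalFun B X a, hχ, ?_⟩)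
    exact (N.canonicalFun_c0Act χ a).symm
  let Φ : Fibre (N.c0Act (B := B) (X := X)) x →ₗᵢ[ℂ] Fibre (BanachAlg.C0.act X (N.algebra B)) x :=
    { I.mapQ I' ι hI with
      norm_map' := fun q => by
        obtain ⟨a, rfl⟩ := I.mkQ_surjective q
        exact (h2 (ι a)).trans (h1 a).symm }
  -- An isometry defined on a complete space has closed range, and this range is dense because that
  -- of `ι` is.
  have hΦ : Function.Surjective Φ := by
    have hcl : IsClosed (Set.range Φ) := Φ.isometry.isClosedEmbedding.isClosed_range
    have hd : DenseRange Φ := by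
      have h3 : DenseRange (I'.mkQ ∘ (N.canonicalHom B X).toHom) :=
        I'.mkQ_surjective.denseRange.comp N.dense_range_canonicalHom
          (AddMonoidHomClass.continuous_of_bound I'.mkQ 1 fun a => by
            rw [one_mul]
            exact Submodule.Quotient.norm_mk_le _ _)
      refine h3.mono ?_
      rintro _ ⟨a, rfl⟩
      exact ⟨I.mkQ a, rfl⟩
    rw [← Set.range_eq_univ, ← hcl.closure_eq, hd.closure_range]
  exact ⟨LinearIsometryEquiv.ofSurjective Φ hΦ, fun a => rfl⟩

end Fibres

/-! ### Classes of idempotent and invertible matrices in K-theory -/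

section Classes

open Matrix

variable {R : Type u} [Ring R] {S : Type v} [Ring S]
variable {ι κ μ ν : Type*} [Fintype ι] [Fintype κ] [Fintype μ] [Fintype ν]

/-- (Murray-von Neumann) equivalence of idempotent matrices, possibly of different sizes. -/
def MvN (e : Matrix ι ι R) (f : Matrix κ κ R) : Prop :=
  ∃ (a : Matrix ι κ R) (b : Matrix κ ι R), a * b = e ∧ b * a = f

namespace MvN

lemma refl {e : Matrix ι ι R} (he : e * e = e) : MvN e e := ⟨e, e, he, he⟩

lemma symm {e : Matrix ι ι R} {f : Matrix κ κ R} (h : MvN e f) : MvN f e :=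
  let ⟨a, b, h1, h2⟩ := h
  ⟨b, a, h2, h1⟩

/-- `(a * c) * (d * b) = a * f * b = e * e`, which is why the outer matrices have to be idempotent.
-/
lemma trans {e : Matrix ι ι R} {f : Matrix κ κ R} {g : Matrix μ μ R} (he : e * e = e)
    (hg : g * g = g) (h : MvN e f) (h' : MvN f g) : MvN e g := by
  obtain ⟨a, b, rfl, rfl⟩ := h
  obtain ⟨c, d, h1, rfl⟩ := h'
  refine ⟨a * c, d * b, ?_, ?_⟩
  · rw [← he]
    simp only [Matrix.mul_assoc]
    rw [← Matrix.mul_assoc c, h1]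
    simp only [Matrix.mul_assoc]
  · rw [← hg]
    simp only [Matrix.mul_assoc]
    rw [← Matrix.mul_assoc b, ← h1]
    simp only [Matrix.mul_assoc]

lemma fromBlocks {e : Matrix ι ι R} {f : Matrix κ κ R} {e' : Matrix μ μ R} {f' : Matrix ν ν R}
    (h : MvN e e') (h' : MvN f f') :
    MvN (Matrix.fromBlocks e 0 0 f) (Matrix.fromBlocks e' 0 0 f') := by
  obtain ⟨a, b, rfl, rfl⟩ := h
  obtain ⟨c, d, rfl, rfl⟩ := h'
  exact ⟨Matrix.fromBlocks a 0 0 c, Matrix.fromBlocks b 0 0 d,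
    by simp [Matrix.fromBlocks_multiply], by simp [Matrix.fromBlocks_multiply]⟩

lemma submatrix {e : Matrix ι ι R} (he : e * e = e) (σ : κ ≃ ι) : MvN (e.submatrix σ σ) e :=
  ⟨e.submatrix σ id, e.submatrix id σ, by
    rw [Matrix.submatrix_mul _ _ _ _ _ Function.bijective_id |>.symm, he], by
    rw [Matrix.submatrix_mul_equiv, he, Matrix.submatrix_id_id]⟩

end MvN

/-- The class of an idempotent matrix. -/
def k0Fin {n : ℕ} (e : Matrix (Fin n) (Fin n) R) (he : e * e = e) : RingK0 R :=
  QuotientAddGroup.mk (FreeAbelianGroup.of ⟨n, e, he⟩)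

lemma k0Fin_eq {m n : ℕ} {e : Matrix (Fin m) (Fin m) R} {f : Matrix (Fin n) (Fin n) R}
    (he : e * e = e) (hf : f * f = f) (h : MvN e f) : k0Fin e he = k0Fin f hf := by
  obtain ⟨a, b, h1, h2⟩ := h
  rw [← sub_eq_zero]
  exact (QuotientAddGroup.eq_zero_iff _).2 (AddSubgroup.subset_closure
    (K0Rel.equiv ⟨e, he⟩ ⟨f, hf⟩ a b h1 h2))

lemma k0Fin_blockSum {m n : ℕ} {e : Matrix (Fin m) (Fin m) R} {f : Matrix (Fin n) (Fin n) R}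
    (he : e * e = e) (hf : f * f = f) (h : blockSum e f * blockSum e f = blockSum e f) :
    k0Fin (blockSum e f) h = k0Fin e he + k0Fin f hf := by
  rw [← sub_eq_zero, ← sub_sub]
  exact (QuotientAddGroup.eq_zero_iff _).2 (AddSubgroup.subset_closure
    (K0Rel.sum ⟨e, he⟩ ⟨f, hf⟩ ⟨_, h⟩ rfl))

/-- The homomorphism from `K₀` given by a function on idempotent matrices. -/
def RingK0.lift {G : Type*} [AddCommGroup G]
    (F : ∀ {n : ℕ} (e : Matrix (Fin n) (Fin n) R), e * e = e → G)
    (h1 : ∀ {m n : ℕ} {e : Matrix (Fin m) (Fin m) R} {f : Matrix (Fin n) (Fin n) R}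
      (he : e * e = e) (hf : f * f = f), MvN e f → F e he = F f hf)
    (h2 : ∀ {m n : ℕ} {e : Matrix (Fin m) (Fin m) R} {f : Matrix (Fin n) (Fin n) R}
      (he : e * e = e) (hf : f * f = f) (h : blockSum e f * blockSum e f = blockSum e f),
      F (blockSum e f) h = F e he + F f hf) : RingK0 R →+ G :=
  QuotientAddGroup.lift _ (FreeAbelianGroup.lift fun x : K0Gen R => F x.2.1 x.2.2) <| by
    have key := fun x : K0Gen R =>
      FreeAbelianGroup.lift_apply_of (fun x : K0Gen R => F x.2.1 x.2.2) x
    rw [AddSubgroup.closure_le]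
    rintro z (⟨e, f, a, b, hab, hba⟩ | ⟨e, f, ⟨g, hg'⟩, hg⟩)
    · change FreeAbelianGroup.lift _ _ = 0
      rw [map_sub, sub_eq_zero]
      exact (key _).trans ((h1 e.2 f.2 ⟨a, b, hab, hba⟩).trans (key ⟨_, f⟩).symm)
    · change FreeAbelianGroup.lift _ _ = 0
      obtain rfl : g = _ := hg
      rw [map_sub, map_sub, sub_sub, sub_eq_zero]
      exact (key _).trans ((h2 e.2 f.2 hg').trans (congrArg₂ _ (key ⟨_, e⟩).symm (key ⟨_, f⟩).symm))

lemma RingK0.hom_ext {G : Type*} [AddCommGroup G] {f g : RingK0 R →+ G}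
    (h : ∀ (n : ℕ) (e : Matrix (Fin n) (Fin n) R) (he : e * e = e),
      f (k0Fin e he) = g (k0Fin e he)) : f = g :=
  QuotientAddGroup.addMonoidHom_ext _ (FreeAbelianGroup.lift_ext _ _ fun x => h x.1 x.2.1 x.2.2)

lemma map_idem {e : Matrix ι ι R} (he : e * e = e) (φ : R →+* S) :
    e.map φ * e.map φ = e.map φ := by rw [← Matrix.map_mul, he]

lemma submatrix_idem {e : Matrix ι ι R} (he : e * e = e) (σ : κ ≃ ι) :
    e.submatrix σ σ * e.submatrix σ σ = e.submatrix σ σ := by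
  rw [Matrix.submatrix_mul_equiv, he]

lemma fromBlocks_idem {e : Matrix ι ι R} {f : Matrix κ κ R} (he : e * e = e) (hf : f * f = f) :
    fromBlocks e 0 0 f * fromBlocks e 0 0 f = fromBlocks e 0 0 f := by
  simp [Matrix.fromBlocks_multiply, he, hf]

lemma blockSum_eq_submatrix {m n : ℕ} (e : Matrix (Fin m) (Fin m) R)
    (f : Matrix (Fin n) (Fin n) R) : blockSum e f
      = (fromBlocks e 0 0 f).submatrix finSumFinEquiv.symm finSumFinEquiv.symm := rfl

lemma blockSum_idem {m n : ℕ} {e : Matrix (Fin m) (Fin m) R} {f : Matrix (Fin n) (Fin n) R}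
    (he : e * e = e) (hf : f * f = f) : blockSum e f * blockSum e f = blockSum e f :=
  submatrix_idem (fromBlocks_idem he hf) finSumFinEquiv.symm

lemma mvn_blockSum {m n : ℕ} {e : Matrix (Fin m) (Fin m) R} {f : Matrix (Fin n) (Fin n) R}
    (he : e * e = e) (hf : f * f = f) : MvN (blockSum e f) (fromBlocks e 0 0 f) :=
  MvN.submatrix (fromBlocks_idem he hf) finSumFinEquiv.symm

/-- The class of an idempotent matrix, with an arbitrary finite index type. -/
def k0 (e : Matrix ι ι R) (he : e * e = e) : RingK0 R :=
  k0Fin (e.submatrix (Fintype.equivFin ι).symm (Fintype.equivFin ι).symm) (submatrix_idem he _)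

lemma k0_eq_of_mvn {e : Matrix ι ι R} {f : Matrix κ κ R} (he : e * e = e) (hf : f * f = f)
    (h : MvN e f) : k0 e he = k0 f hf :=
  k0Fin_eq _ _ <| ((MvN.submatrix he _).trans (submatrix_idem he _) hf h).trans
    (submatrix_idem he _) (submatrix_idem hf _) (MvN.submatrix hf _).symm

lemma k0_fin {n : ℕ} {e : Matrix (Fin n) (Fin n) R} (he : e * e = e) : k0 e he = k0Fin e he :=
  k0Fin_eq _ _ (MvN.submatrix he _)

lemma k0_fromBlocks {e : Matrix ι ι R} {f : Matrix κ κ R} (he : e * e = e) (hf : f * f = f) :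
    k0 (fromBlocks e 0 0 f) (fromBlocks_idem he hf) = k0 e he + k0 f hf := by
  rw [k0, k0, k0, ← k0Fin_blockSum _ _ (blockSum_idem (submatrix_idem he _) (submatrix_idem hf _))]
  refine k0Fin_eq _ _ ((MvN.submatrix (fromBlocks_idem he hf) _).trans (submatrix_idem
    (fromBlocks_idem he hf) _) (blockSum_idem (submatrix_idem he _) (submatrix_idem hf _)) ?_)
  exact (MvN.fromBlocks (MvN.submatrix he _).symm (MvN.submatrix hf _).symm).trans
    (fromBlocks_idem he hf) (blockSum_idem (submatrix_idem he _) (submatrix_idem hf _))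
    (mvn_blockSum (submatrix_idem he _) (submatrix_idem hf _)).symm

lemma RingK0.map_k0 (φ : R →+* S) {e : Matrix ι ι R} (he : e * e = e) :
    RingK0.map φ (k0 e he) = k0 (e.map φ) (map_idem he φ) := rfl

/-- A ring homomorphism which is bijective on equivalence classes of idempotent matrices is
bijective on `K₀`. -/
theorem RingK0.map_bijective (φ : R →+* S)
    (hs : ∀ (n : ℕ) (e : Matrix (Fin n) (Fin n) S), e * e = e →
      ∃ e' : Matrix (Fin n) (Fin n) R, e' * e' = e' ∧ MvN (e'.map φ) e)
    (hi : ∀ (m n : ℕ) (e : Matrix (Fin m) (Fin m) R) (f : Matrix (Fin n) (Fin n) R),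
      e * e = e → f * f = f → MvN (e.map φ) (f.map φ) → MvN e f) :
    Function.Bijective (RingK0.map φ) := by
  -- The lifts `L` define the inverse: injectivity on equivalence classes makes the class of a lift
  -- invariant under equivalence and additive for block sums.
  choose! L hL hLe using hs
  let ψ : RingK0 S →+ RingK0 R := RingK0.lift (fun {n} e he => k0Fin (L n e) (hL n e he))
    (fun he hf h => k0Fin_eq _ _ <| hi _ _ _ _ (hL _ _ he) (hL _ _ hf) <|
      ((hLe _ _ he).trans (map_idem (hL _ _ he) φ) hf h).trans (map_idem (hL _ _ he) φ)
        (map_idem (hL _ _ hf) φ) (hLe _ _ hf).symm)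
    (fun {m n e f} he hf h => by
      rw [← k0Fin_blockSum _ _ (blockSum_idem (hL _ _ he) (hL _ _ hf))]
      have hb := blockSum_idem (hL _ _ he) (hL _ _ hf)
      refine k0Fin_eq _ _ (hi _ _ _ _ (hL _ _ h) hb ?_)
      rw [blockSum_map]
      have i1 := map_idem (hL _ _ h) φ
      have i2 := map_idem (hL _ _ he) φ
      have i3 := map_idem (hL _ _ hf) φ
      refine (hLe _ _ h).trans i1 (blockSum_idem i2 i3) ?_
      refine (mvn_blockSum he hf).trans h (blockSum_idem i2 i3) ?_
      refine ((hLe _ _ he).symm.fromBlocks (hLe _ _ hf).symm).trans (fromBlocks_idem he hf)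
        (blockSum_idem i2 i3) (mvn_blockSum i2 i3).symm)
  have h1 : ψ.comp (RingK0.map φ) = AddMonoidHom.id _ := RingK0.hom_ext fun n e he =>
    k0Fin_eq _ _ (hi _ _ _ _ (hL _ _ (map_idem he φ)) he (hLe _ _ (map_idem he φ)))
  have h2 : (RingK0.map φ).comp ψ = AddMonoidHom.id _ := RingK0.hom_ext fun n e he =>
    k0Fin_eq _ _ (hLe _ _ he)
  exact ⟨Function.LeftInverse.injective (DFunLike.congr_fun h1),
    Function.RightInverse.surjective (DFunLike.congr_fun h2)⟩

end Classes

/-! ### Classes of invertible matrices in `K₁`. -/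

section UnitClasses

open Matrix

variable {R : Type u} [Ring R] {S : Type v} [Ring S]
variable {ι κ μ : Type*} [Fintype ι] [Fintype κ] [Fintype μ] [DecidableEq ι] [DecidableEq κ]
  [DecidableEq μ]

/-- An invertible matrix with renamed indices. -/
def reindexUnit (σ : ι ≃ κ) (g : (Matrix ι ι R)ˣ) : (Matrix κ κ R)ˣ :=
  ⟨g.1.submatrix σ.symm σ.symm, g.2.submatrix σ.symm σ.symm, by
    rw [Matrix.submatrix_mul_equiv, g.3,
      Matrix.submatrix_one_equiv], by
    rw [Matrix.submatrix_mul_equiv, g.4, Matrix.submatrix_one_equiv]⟩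

/-- The block sum of invertible matrices. -/
def blockUnit (g : (Matrix ι ι R)ˣ) (h : (Matrix κ κ R)ˣ) : (Matrix (ι ⊕ κ) (ι ⊕ κ) R)ˣ :=
  ⟨fromBlocks g.1 0 0 h.1, fromBlocks g.2 0 0 h.2, by simp [fromBlocks_multiply],
    by simp [fromBlocks_multiply]⟩

/-- The image of an invertible matrix under a ring homomorphism. -/
abbrev mapUnit (φ : R →+* S) (g : (Matrix ι ι R)ˣ) : (Matrix ι ι S)ˣ :=
  Units.map (φ.mapMatrix (m := ι)).toMonoidHom g

variable [TopologicalSpace R] [TopologicalSpace S]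

/-- The class of an invertible matrix. -/
def k1Fin {n : ℕ} (g : (Matrix (Fin n) (Fin n) R)ˣ) : RingK1 R :=
  QuotientAddGroup.mk (FreeAbelianGroup.of ⟨n, g⟩)

lemma k1Fin_mul {n : ℕ} (g h : (Matrix (Fin n) (Fin n) R)ˣ) :
    k1Fin (g * h) = k1Fin g + k1Fin h := by
  rw [← sub_eq_zero, ← sub_sub]
  exact (QuotientAddGroup.eq_zero_iff _).2 (AddSubgroup.subset_closure (K1Rel.mul g h))

lemma k1Fin_eq_of_joined {n : ℕ} {g h : (Matrix (Fin n) (Fin n) R)ˣ} (hgh : Joined g h) :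
    k1Fin g = k1Fin h := by
  rw [← sub_eq_zero]
  exact (QuotientAddGroup.eq_zero_iff _).2 (AddSubgroup.subset_closure (K1Rel.homotopy g h hgh))

lemma k1Fin_stab {m n : ℕ} (g : (Matrix (Fin m) (Fin m) R)ˣ)
    (g' : (Matrix (Fin (m + n)) (Fin (m + n)) R)ˣ) (h : g'.1 = blockSum g.1 1) :
    k1Fin g' = k1Fin g := by
  rw [← sub_eq_zero]
  exact (QuotientAddGroup.eq_zero_iff _).2 (AddSubgroup.subset_closure (K1Rel.stab g g' h))

lemma k1Fin_conj {n : ℕ} (s g : (Matrix (Fin n) (Fin n) R)ˣ) : k1Fin (s * g * s⁻¹) = k1Fin g := by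
  have h : k1Fin (s * g * s⁻¹) + k1Fin s = k1Fin s + k1Fin g := by
    rw [← k1Fin_mul, inv_mul_cancel_right, k1Fin_mul]
  rwa [add_comm, add_right_inj] at h

/-- The homomorphism from `K₁` given by a function on invertible matrices. -/
def RingK1.lift {G : Type*} [AddCommGroup G] (F : ∀ {n : ℕ}, (Matrix (Fin n) (Fin n) R)ˣ → G)
    (h1 : ∀ {n : ℕ} (g h : (Matrix (Fin n) (Fin n) R)ˣ), F (g * h) = F g + F h)
    (h2 : ∀ {m n : ℕ} (g : (Matrix (Fin m) (Fin m) R)ˣ)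
      (g' : (Matrix (Fin (m + n)) (Fin (m + n)) R)ˣ), g'.1 = blockSum g.1 1 → F g' = F g)
    (h3 : ∀ {n : ℕ} (g h : (Matrix (Fin n) (Fin n) R)ˣ), Joined g h → F g = F h) :
    RingK1 R →+ G :=
  QuotientAddGroup.lift _ (FreeAbelianGroup.lift fun x : K1Gen R => F x.2) <| by
    have key := fun x : K1Gen R => FreeAbelianGroup.lift_apply_of (fun x : K1Gen R => F x.2) x
    rw [AddSubgroup.closure_le]
    rintro z (⟨g, h⟩ | ⟨g, g', hg⟩ | ⟨g, h, hgh⟩)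
    · change FreeAbelianGroup.lift _ _ = 0
      rw [map_sub, map_sub, sub_sub, sub_eq_zero]
      exact (key _).trans ((h1 _ _).trans (congrArg₂ _ (key ⟨_, g⟩).symm (key ⟨_, h⟩).symm))
    · change FreeAbelianGroup.lift _ _ = 0
      rw [map_sub, sub_eq_zero]
      exact (key _).trans ((h2 _ _ hg).trans (key ⟨_, g⟩).symm)
    · change FreeAbelianGroup.lift _ _ = 0
      rw [map_sub, sub_eq_zero]
      exact (key _).trans ((h3 _ _ hgh).trans (key ⟨_, h⟩).symm)

lemma RingK1.hom_ext {G : Type*} [AddCommGroup G] {f g : RingK1 R →+ G}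
    (h : ∀ (n : ℕ) (x : (Matrix (Fin n) (Fin n) R)ˣ), f (k1Fin x) = g (k1Fin x)) : f = g :=
  QuotientAddGroup.addMonoidHom_ext _ (FreeAbelianGroup.lift_ext _ _ fun x => h x.1 x.2)

/-- The class of an invertible matrix, with an arbitrary finite index type. -/
def k1 (g : (Matrix ι ι R)ˣ) : RingK1 R := k1Fin (reindexUnit (Fintype.equivFin ι) g)

lemma RingK1.map_k1 (φ : R →+* S) (hφ : Continuous φ) (g : (Matrix ι ι R)ˣ) :
    RingK1.map φ hφ (k1 g) = k1 (mapUnit φ g) := by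
  refine congrArg k1Fin (Units.ext rfl)

lemma k1_mul (g h : (Matrix ι ι R)ˣ) : k1 (g * h) = k1 g + k1 h := by
  rw [k1, k1, k1, ← k1Fin_mul]
  exact congrArg k1Fin (Units.ext (Matrix.submatrix_mul_equiv _ _ _ _ _).symm)

lemma k1_one : k1 (1 : (Matrix ι ι R)ˣ) = 0 := by
  have := k1_mul (1 : (Matrix ι ι R)ˣ) 1
  rwa [one_mul, eq_comm, add_eq_left] at this

lemma k1_inv (g : (Matrix ι ι R)ˣ) : k1 g⁻¹ = -k1 g := by
  rw [eq_neg_iff_add_eq_zero, ← k1_mul, inv_mul_cancel, k1_one]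

lemma k1_conj (s g : (Matrix ι ι R)ˣ) : k1 (s * g * s⁻¹) = k1 g := by
  rw [k1_mul, k1_mul, k1_inv]
  abel

lemma joined_reindexUnit (σ : ι ≃ κ) {g h : (Matrix ι ι R)ˣ} (hgh : Joined g h) :
    Joined (reindexUnit σ g) (reindexUnit σ h) := by
  refine hgh.map (f := reindexUnit σ) (Units.continuous_iff.2 ⟨?_, ?_⟩)
  · exact Units.continuous_val.matrix_submatrix _ _
  · exact Units.continuous_coe_inv.matrix_submatrix _ _

lemma joined_blockUnit {g g' : (Matrix ι ι R)ˣ} {h h' : (Matrix κ κ R)ˣ} (hg : Joined g g')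
    (hh : Joined h h') : Joined (blockUnit g h) (blockUnit g' h') := by
  obtain ⟨p⟩ := hg
  obtain ⟨q⟩ := hh
  refine ⟨⟨⟨fun t => blockUnit (p t) (q t), Units.continuous_iff.2 ⟨?_, ?_⟩⟩, by simp, by simp⟩⟩
  · exact (Units.continuous_val.comp p.continuous).matrix_fromBlocks continuous_const
      continuous_const (Units.continuous_val.comp q.continuous)
  · exact (Units.continuous_coe_inv.comp p.continuous).matrix_fromBlocks continuous_const
      continuous_const (Units.continuous_coe_inv.comp q.continuous)

lemma k1_eq_of_joined {g h : (Matrix ι ι R)ˣ} (hgh : Joined g h) : k1 g = k1 h :=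
  k1Fin_eq_of_joined (joined_reindexUnit _ hgh)

/-- The class of an invertible matrix does not depend on the order of the indices. -/
lemma k1_eq_reindex {n : ℕ} (σ : ι ≃ Fin n) (g : (Matrix ι ι R)ˣ) :
    k1 g = k1Fin (reindexUnit σ g) := by
  obtain rfl : n = Fintype.card ι := by simpa using (Fintype.card_congr σ).symm
  -- Two numberings of the indices differ by a permutation, and conjugation by its matrix is
  -- invisible in the abelian group `K₁`.
  let τ : Fin (Fintype.card ι) ≃ Fin (Fintype.card ι) := (Fintype.equivFin ι).symm.trans σ
  let p : (Matrix (Fin (Fintype.card ι)) (Fin (Fintype.card ι)) R)ˣ :=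
    ⟨(1 : Matrix _ _ R).submatrix τ.symm id, (1 : Matrix _ _ R).submatrix id τ.symm, by
      rw [Matrix.submatrix_mul _ _ _ _ _ Function.bijective_id |>.symm, one_mul,
        Matrix.submatrix_one_equiv], by
      rw [Matrix.submatrix_mul_equiv, one_mul, Matrix.submatrix_id_id]⟩
  have h : reindexUnit σ g = p * reindexUnit (Fintype.equivFin ι) g * p⁻¹ := Units.ext <| by
    change _ = (1 : Matrix _ _ R).submatrix τ.symm id *
      g.1.submatrix (Fintype.equivFin ι).symm (Fintype.equivFin ι).symm *
      (1 : Matrix _ _ R).submatrix id τ.symm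
    rw [← Matrix.submatrix_id_id (g.1.submatrix (Fintype.equivFin ι).symm (Fintype.equivFin ι).symm),
      ← Matrix.submatrix_mul _ _ _ _ _ Function.bijective_id, one_mul,
      ← Matrix.submatrix_mul _ _ _ _ _ Function.bijective_id, mul_one]
    ext i j
    simp [reindexUnit, τ]
  rw [h, k1Fin_conj, k1]

lemma k1_fin {n : ℕ} (g : (Matrix (Fin n) (Fin n) R)ˣ) : k1 g = k1Fin g :=
  (k1_eq_reindex (Equiv.refl _) g).trans (congrArg k1Fin (Units.ext rfl))

lemma k1_reindex (σ : ι ≃ κ) (g : (Matrix ι ι R)ˣ) : k1 (reindexUnit σ g) = k1 g :=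
  (k1_eq_reindex (σ.trans (Fintype.equivFin κ)) g).symm

lemma k1_blockUnit_one (g : (Matrix ι ι R)ˣ) : k1 (blockUnit g (1 : (Matrix κ κ R)ˣ)) = k1 g := by
  rw [k1_eq_reindex (((Fintype.equivFin ι).sumCongr (Fintype.equivFin κ)).trans finSumFinEquiv)]
  refine k1Fin_stab _ _ ?_
  rw [blockSum_eq_submatrix]
  change ((fromBlocks g.1 0 0 (1 : Matrix κ κ R)).submatrix
    ((Fintype.equivFin ι).sumCongr (Fintype.equivFin κ)).symm
    ((Fintype.equivFin ι).sumCongr (Fintype.equivFin κ)).symm).submatrix _ _ = _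
  congr 1
  rw [← Matrix.submatrix_one_equiv (Fintype.equivFin κ).symm]
  ext (i | i) (j | j) <;> rfl

lemma k1_blockUnit_one_left (h : (Matrix κ κ R)ˣ) :
    k1 (blockUnit (1 : (Matrix ι ι R)ˣ) h) = k1 h := by
  rw [← k1_blockUnit_one (κ := ι) h, ← k1_reindex (Equiv.sumComm ι κ)]
  congr 1
  apply Units.ext
  ext (i | i) (j | j) <;> rfl

/-- `g ⊕ h = (g ⊕ 1)(1 ⊕ h)`, and stabilisation does not change classes. -/
lemma k1_blockUnit (g : (Matrix ι ι R)ˣ) (h : (Matrix κ κ R)ˣ) :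
    k1 (blockUnit g h) = k1 g + k1 h := by
  rw [← k1_blockUnit_one (κ := κ) g, ← k1_blockUnit_one_left (ι := ι) h, ← k1_mul]
  congr 1
  apply Units.ext
  simp [blockUnit, fromBlocks_multiply]

/-- A continuous ring homomorphism which is bijective on the path components of the groups of
invertible matrices is bijective on `K₁`. -/
theorem RingK1.map_bijective (φ : R →+* S) (hφ : Continuous φ)
    (hm : ∀ n, ContinuousMul (Matrix (Fin n) (Fin n) S)ˣ)
    (hs : ∀ (n : ℕ) (g : (Matrix (Fin n) (Fin n) S)ˣ), ∃ g' : (Matrix (Fin n) (Fin n) R)ˣ,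
      Joined (mapUnit φ g') g)
    (hi : ∀ (n : ℕ) (g h : (Matrix (Fin n) (Fin n) R)ˣ), Joined (mapUnit φ g) (mapUnit φ h) →
      Joined g h) :
    Function.Bijective (RingK1.map φ hφ) := by
  choose L hL using hs
  let ψ : RingK1 S →+ RingK1 R := RingK1.lift (fun {n} g => k1Fin (L n g))
    (fun {n} g h => by
      rw [← k1Fin_mul]
      refine k1Fin_eq_of_joined (hi _ _ _ ((hL _ _).trans ?_))
      rw [show mapUnit φ (L n g * L n h) = mapUnit φ (L n g) * mapUnit φ (L n h) from
        map_mul _ _ _]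
      -- Continuity of the product of units makes the pointwise product of the two paths a path.
      have := hm n
      obtain ⟨p⟩ := hL n g
      obtain ⟨q⟩ := hL n h
      exact ⟨(p.mul q).symm⟩)
    (fun {m n} g g' hg => by
      let x := fun h : (Matrix (Fin m) (Fin m) R)ˣ => reindexUnit finSumFinEquiv
        (blockUnit h (1 : (Matrix (Fin n) (Fin n) R)ˣ))
      rw [← k1Fin_stab (L m g) (x (L m g)) rfl]
      refine k1Fin_eq_of_joined (hi _ _ _ ((hL _ _).trans ?_))
      have h1 : g' = reindexUnit finSumFinEquiv (blockUnit g (1 : (Matrix (Fin n) (Fin n) S)ˣ)) :=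
        Units.ext hg
      have h2 : mapUnit φ (x (L m g)) = reindexUnit finSumFinEquiv
          (blockUnit (mapUnit φ (L m g)) (1 : (Matrix (Fin n) (Fin n) S)ˣ)) := Units.ext <| by
        refine (blockSum_map φ (L m g).1 1).trans ?_
        rw [Matrix.map_one _ (map_zero φ) (map_one φ)]
        rfl
      rw [h1, h2]
      exact joined_reindexUnit _ (joined_blockUnit (hL _ _).symm (Joined.refl _)))
    (fun g h hgh => k1Fin_eq_of_joined (hi _ _ _ ((hL _ _).trans (hgh.trans (hL _ _).symm))))
  have h1 : ψ.comp (RingK1.map φ hφ) = AddMonoidHom.id _ := RingK1.hom_ext fun n g =>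
    k1Fin_eq_of_joined (hi _ _ _ (hL _ _))
  have h2 : (RingK1.map φ hφ).comp ψ = AddMonoidHom.id _ := RingK1.hom_ext fun n g =>
    k1Fin_eq_of_joined (hL _ _)
  exact ⟨Function.LeftInverse.injective (DFunLike.congr_fun h1),
    Function.RightInverse.surjective (DFunLike.congr_fun h2)⟩

end UnitClasses

/-! ### Dense homomorphisms which detect invertibility -/

section DenseSpectral

/-- A continuous homomorphism with dense range which detects invertible elements. -/
structure IsDenseSpectral {R S : Type*} [Ring R] [Ring S] [TopologicalSpace R] [TopologicalSpace S]
    (φ : R →+* S) : Prop where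
  continuous : Continuous φ
  dense : DenseRange φ
  isUnit_of_map : ∀ x, IsUnit (φ x) → IsUnit x

/-! ### Path components of the groups of units. -/

section Components

variable {A : Type*} {B : Type*} [NormedRing A] [NormedRing B] [CompleteSpace A] [CompleteSpace B]

/-- The units of a Banach algebra carry the topology induced from the algebra, so a segment of
invertible elements is already a path of units. -/
lemma joined_units_of_segment {A : Type*} [NormedRing A] [CompleteSpace A] [NormedAlgebra ℂ A]
    {g h : Aˣ} (hs : ∀ s : unitInterval, IsUnit ((1 - ((s : ℝ) : ℂ)) • (g : A) + ((s : ℝ) : ℂ) • (h : A))) :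
    Joined g h := by
  choose p hp using hs
  refine ⟨⟨⟨p, Units.isOpenEmbedding_val.isInducing.continuous_iff.2 ?_⟩, Units.ext ?_, Units.ext ?_⟩⟩
  · have : (Units.val ∘ p) = fun s : unitInterval =>
        (1 - ((s : ℝ) : ℂ)) • (g : A) + ((s : ℝ) : ℂ) • (h : A) := funext hp
    rw [this]
    fun_prop
  · rw [hp]
    simp
  · rw [hp]
    simp

/-- Invertible elements which are mapped into a ball of invertible elements are joined. -/
lemma joined_of_map_mem_ball [NormedAlgebra ℂ A] [NormedAlgebra ℂ B] {φ : A →+* B}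
    (hφc : ∀ (c : ℂ) x, φ (c • x) = c • φ x)
    (hφ : IsDenseSpectral φ) {b : B} {r : ℝ} (hb : ∀ x ∈ Metric.ball b r, IsUnit x) {g h : Aˣ}
    (hg : φ g ∈ Metric.ball b r) (hh : φ h ∈ Metric.ball b r) : Joined g h := by
  refine joined_units_of_segment fun s => hφ.isUnit_of_map _ (hb _ ?_)
  rw [map_add, hφc, hφc]
  have h1 : (1 - ((s : ℝ) : ℂ)) • φ g + ((s : ℝ) : ℂ) • φ h - b
      = (1 - ((s : ℝ) : ℂ)) • (φ g - b) + ((s : ℝ) : ℂ) • (φ h - b) := by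
    simp only [smul_sub, sub_smul, one_smul]
    abel
  rw [Metric.mem_ball, dist_eq_norm] at hg hh ⊢
  rw [h1]
  refine (norm_add_le _ _).trans_lt ?_
  rw [norm_smul, norm_smul, ← Complex.ofReal_one, ← Complex.ofReal_sub, Complex.norm_real,
    Complex.norm_real, Real.norm_of_nonneg (sub_nonneg.2 s.2.2), Real.norm_of_nonneg s.2.1]
  rcases s.2.1.eq_or_lt with h0 | h0
  · rw [← h0]
    simpa using hg
  · have := mul_lt_mul_of_pos_left hh h0
    have := mul_le_mul_of_nonneg_left hg.le (sub_nonneg.2 s.2.2)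
    nlinarith

lemma exists_ball_units (u : Bˣ) : ∃ r > 0, ∀ x ∈ Metric.ball (u : B) r, IsUnit x := by
  obtain ⟨r, hr, h⟩ := Metric.isOpen_iff.1 (Units.isOpen (R := B)) u u.isUnit
  exact ⟨r, hr, fun x hx => h hx⟩

/-- The dense range meets the interior of `V`, and whatever lies over an invertible element is
invertible. -/
lemma IsDenseSpectral.exists_unit_near {φ : A →+* B} (hφ : IsDenseSpectral φ) {b : B} {V : Set B}
    (hV : V ∈ 𝓝 b) (hu : ∀ x ∈ V, IsUnit x) : ∃ z : Aˣ, φ z ∈ V := by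
  obtain ⟨x, hx⟩ := hφ.dense.exists_mem_open isOpen_interior
    ⟨b, mem_interior_iff_mem_nhds.2 hV⟩
  obtain ⟨z, rfl⟩ := hφ.isUnit_of_map _ (hu _ (interior_subset hx))
  exact ⟨z, interior_subset hx⟩

variable [NormedAlgebra ℂ A] [NormedAlgebra ℂ B] {φ : A →+* B}

/-- A ball of units around `g` contains the image of a unit, and a segment inside the ball joins
this image to `g`. -/
lemma IsDenseSpectral.exists_joined (hφ : IsDenseSpectral φ) (g : Bˣ) :
    ∃ g' : Aˣ, Joined (Units.map φ.toMonoidHom g') g := by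
  obtain ⟨r, hr, hb⟩ := exists_ball_units g
  obtain ⟨z, hz⟩ := hφ.exists_unit_near (Metric.ball_mem_nhds _ hr) hb
  refine ⟨z, joined_of_map_mem_ball (φ := RingHom.id B) (fun _ _ => rfl)
    ⟨continuous_id, denseRange_id, fun _ h => h⟩ hb hz (Metric.mem_ball_self hr)⟩

/-- The path downstairs is not lifted. Instead, the set of those `u` such that every unit lying over
a point near `u` is joined to `g` is open and closed; it contains the image of `g`, hence the whole
path. -/
lemma IsDenseSpectral.joined_of_map (hφ : IsDenseSpectral φ)
    (hφc : ∀ (c : ℂ) x, φ (c • x) = c • φ x) {g h : Aˣ}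
    (hgh : Joined (Units.map φ.toMonoidHom g) (Units.map φ.toMonoidHom h)) : Joined g h := by
  let C : Set Bˣ := {u | ∀ᶠ b in 𝓝 (u : B), ∀ z : Aˣ, φ z = b → Joined g z}
  have hCo : IsOpen C := by
    refine isOpen_iff_mem_nhds.2 fun u hu => ?_
    exact Units.continuous_val.continuousAt.eventually (eventually_eventually_nhds.2 hu)
  have hCc : IsClosed C := by
    refine ⟨isOpen_iff_mem_nhds.2 fun u hu => ?_⟩
    obtain ⟨r, hr, hb⟩ := exists_ball_units u
    have hball : ∀ᶠ b in 𝓝 (u : B), b ∈ Metric.ball (u : B) r := Metric.ball_mem_nhds _ hr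
    -- If `u` is not in `C`, some unit over a ball of units around `u` is not joined to `g`. It is
    -- joined to all other units over this ball, so no point near `u` is in `C` either.
    have hz : ∃ z : Aˣ, φ z ∈ Metric.ball (u : B) r ∧ ¬ Joined g z := by
      by_contra! hcon
      refine hu ?_
      filter_upwards [hball] with b hb' z hzb
      exact hcon z (hzb ▸ hb')
    obtain ⟨z, hz, hgz⟩ := hz
    filter_upwards [Units.continuous_val.continuousAt.eventually
      (eventually_eventually_nhds.2 hball)] with u' hu' hu'C
    obtain ⟨z', hz'⟩ := hφ.exists_unit_near (hu'.and hu'C) fun x hx => hb x hx.1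
    exact hgz ((hz'.2 z' rfl).trans (joined_of_map_mem_ball hφc hφ hb hz'.1 hz))
  obtain ⟨p⟩ := hgh
  have h0 : Units.map φ.toMonoidHom g ∈ C := by
    obtain ⟨r, hr, hb⟩ := exists_ball_units (Units.map φ.toMonoidHom g)
    change ∀ᶠ b in 𝓝 (φ g), _
    filter_upwards [Metric.ball_mem_nhds (φ g) hr] with b hb' z hz
    exact joined_of_map_mem_ball hφc hφ hb (Metric.mem_ball_self hr) (hz ▸ hb')
  have h1 : p ⁻¹' C = Set.univ := IsClopen.eq_univ ⟨hCc.preimage p.continuous,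
    hCo.preimage p.continuous⟩ ⟨0, by
      change p 0 ∈ C
      rw [p.source]
      exact h0⟩
  have h2 : Units.map φ.toMonoidHom h ∈ C := by
    have : p 1 ∈ C := (h1 ▸ Set.mem_univ _ : (1 : unitInterval) ∈ p ⁻¹' C)
    rwa [p.target] at this
  exact h2.self_of_nhds h rfl

end Components

/-! ### Lifting of idempotents by a power series. -/

section Idempotents

variable {A : Type*} {B : Type*} [NormedRing A] [NormedRing B] [CompleteSpace A] [CompleteSpace B]
  [NormedAlgebra ℂ A] [NormedAlgebra ℂ B]

/-- The Catalan number is at most the central binomial coefficient, which is one summand of `(1 + 1)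
^ (2 * n)`. It bounds the radius of convergence of the Catalan series from below by `1 / 4`. -/
lemma catalan_le (n : ℕ) : catalan n ≤ 4 ^ n := by
  rw [catalan_eq_centralBinom_div]
  refine (Nat.div_le_self _ _).trans ?_
  have h := Nat.sum_range_choose (2 * n)
  rw [pow_mul] at h
  norm_num at h
  rw [← h]
  exact Finset.single_le_sum (f := fun i => (2 * n).choose i) (fun i _ => Nat.zero_le _)
    (Finset.mem_range.2 (by omega))

/-- The solution `d = ∑ Cₙ tⁿ⁺¹` of `d = t + d²`. -/
lemma exists_catalan_sum {t : A} (ht : spectralRadius ℂ t < ENNReal.ofReal (1 / 8)) :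
    ∃ d : A, HasSum (fun n => (catalan n : ℂ) • t ^ (n + 1)) d ∧ d = t + d * d := by
  have hs : Summable fun n => ‖(catalan n : ℂ) • t ^ (n + 1)‖ := by
    have hg : Summable fun n : ℕ => ((1 : ℝ) / 2) ^ n := summable_geometric_two
    refine hg.of_norm_bounded_eventually_nat ?_
    -- Powers of `t` eventually decay faster than powers of `1 / 8`; against `catalan n ≤ 4 ^ n`
    -- this leaves a geometric series of ratio `1 / 2`.
    have h1 := (tendsto_add_atTop_nat 1).eventually (exists_norm_pow_lt ht)
    filter_upwards [h1] with n hn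
    rw [norm_norm, norm_smul, Complex.norm_natCast]
    have h2 : (catalan n : ℝ) ≤ 4 ^ n := by exact_mod_cast catalan_le n
    calc (catalan n : ℝ) * ‖t ^ (n + 1)‖ ≤ 4 ^ n * (1 / 8) ^ (n + 1) :=
          mul_le_mul h2 hn.le (norm_nonneg _) (by positivity)
      _ = (1 / 2) ^ n * (1 / 8) := by
          rw [pow_succ, ← mul_assoc, ← mul_pow]
          norm_num
      _ ≤ (1 / 2) ^ n := mul_le_of_le_one_right (by positivity) (by norm_num)
  refine ⟨_, hs.of_norm.hasSum, ?_⟩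
  set f : ℕ → A := fun n => (catalan n : ℂ) • t ^ (n + 1) with hf
  have hmul := tsum_mul_tsum_eq_tsum_sum_antidiagonal_of_summable_norm hs hs
  -- The Catalan recursion is the equation `d = t + d * d`, read off coefficient by coefficient.
  have hterm : ∀ n, ∑ kl ∈ Finset.HasAntidiagonal.antidiagonal n, f kl.1 * f kl.2 = f (n + 1) := fun n => by
    have h1 : ∀ kl ∈ Finset.HasAntidiagonal.antidiagonal n, f kl.1 * f kl.2
        = ((catalan kl.1 * catalan kl.2 : ℕ) : ℂ) • t ^ (n + 2) := fun kl hkl => by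
      rw [Finset.HasAntidiagonal.mem_antidiagonal] at hkl
      simp only [hf]
      rw [smul_mul_smul_comm, ← pow_add, Nat.cast_mul]
      congr 2
      omega
    rw [Finset.sum_congr rfl h1, ← Finset.sum_smul, ← Nat.cast_sum, ← catalan_succ']
  rw [hmul]
  rw [tsum_congr hterm, hs.of_norm.tsum_eq_zero_add]
  simp [hf]

/-- As invertibility is detected, the spectrum of `t` lies in that of `φ t`, so a norm bound
downstairs controls the spectral radius upstairs, where no norm bound is available. The factor `‖1‖`
is there because `B` need not have a normalised unit. -/
lemma IsDenseSpectral.spectralRadius_lt {φ : A →ₐ[ℂ] B} (hφ : IsDenseSpectral (φ : A →+* B))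
    {t : A} (ht : ‖φ t‖ * ‖(1 : B)‖ < 1 / 16) : spectralRadius ℂ t < ENNReal.ofReal (1 / 8) := by
  refine lt_of_le_of_lt (b := ENNReal.ofReal (1 / 16)) (iSup₂_le fun k hk => ?_)
    ((ENNReal.ofReal_lt_ofReal_iff (by norm_num)).2 (by norm_num))
  have h1 : k ∈ spectrum ℂ (φ t) := fun h => hk <| hφ.isUnit_of_map _ <| by
    change IsUnit (φ _)
    rwa [map_sub, AlgHom.commutes]
  have h2 := (spectrum.norm_le_norm_mul_of_mem h1).trans ht.le
  refine le_of_eq_of_le ?_ (ENNReal.ofReal_le_ofReal h2)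
  exact (ofReal_norm k).symm

/-- Idempotents lift, up to similarity, along dense homomorphisms which detect invertibility. -/
lemma IsDenseSpectral.exists_idempotent {φ : A →ₐ[ℂ] B} (hφ : IsDenseSpectral (φ : A →+* B))
    {e : B} (he : e * e = e) : ∃ p : A, p * p = p ∧ ∃ v : Bˣ, v * e = φ p * v := by
  -- For `x` with image `y` close to `e`, put `t = x - x * x`. If `r` commutes with `x` and is an
  -- invertible square root of `1 - 4t = (2x - 1)²`, then `q = (2x - 1) r⁻¹` is an involution and
  -- `(1 + q) / 2` an idempotent. The root is `r = 1 - 2d` with `d` the Catalan series of `t`, whose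
  -- convergence needs only a small spectral radius.
  have h2u : IsUnit (2 : B) := by
    have := (IsUnit.mk0 (2 : ℂ) two_ne_zero).map (algebraMap ℂ B)
    rwa [map_ofNat] at this
  obtain ⟨δ, hδ, hball⟩ := exists_ball_units h2u.unit
  obtain ⟨δ', hδ', hball'⟩ := exists_ball_units (1 : Bˣ)
  -- an element `x` whose image `y` is close to `e`
  have hT : Tendsto (fun y : B => ‖y - y * y‖) (𝓝 e) (𝓝 0) := by
    have : Continuous fun y : B => ‖y - y * y‖ := by fun_prop
    simpa [he] using this.tendsto e
  -- The bounds serve, in this order, for the spectral radius of `t`, for the geometric series that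
  -- bounds `φ d`, for the invertibility of `1 - 4T`, and, the last two together, for the
  -- invertibility of `v`.
  have hV : ∀ᶠ y in 𝓝 e, (‖y - y * y‖ * ‖(1 : B)‖ < 1 / 16 ∧ ‖y - y * y‖ < 1 / 8) ∧
      ‖4 * (y - y * y)‖ < δ' ∧ 4 * ‖y - y * y‖ < δ / 2 ∧ ‖2 * ((y - e) * (2 * e - 1))‖ < δ / 2 := by
    have h1 : Tendsto (fun y : B => ‖y - y * y‖ * ‖(1 : B)‖) (𝓝 e) (𝓝 0) := by
      simpa using hT.mul_const ‖(1 : B)‖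
    have h2 : Tendsto (fun y : B => ‖4 * (y - y * y)‖) (𝓝 e) (𝓝 0) := by
      have : Continuous fun y : B => ‖4 * (y - y * y)‖ := by fun_prop
      simpa [he] using this.tendsto e
    have h3 : Tendsto (fun y : B => 4 * ‖y - y * y‖) (𝓝 e) (𝓝 0) := by
      simpa using hT.const_mul 4
    have h4 : Tendsto (fun y : B => ‖2 * ((y - e) * (2 * e - 1))‖) (𝓝 e) (𝓝 0) := by
      have : Continuous fun y : B => ‖2 * ((y - e) * (2 * e - 1))‖ := by fun_prop
      simpa using this.tendsto e
    exact ((h1.eventually_lt_const (by norm_num)).and (hT.eventually_lt_const (by norm_num))).and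
      ((h2.eventually_lt_const hδ').and ((h3.eventually_lt_const (half_pos hδ)).and
        (h4.eventually_lt_const (half_pos hδ))))
  obtain ⟨_, ⟨⟨hT1, hT2⟩, hT3, hT4, hT5⟩, x, rfl⟩ := mem_closure_iff_nhds.1 (hφ.dense e) _ hV
  set y : B := φ x with hy
  change ‖y - y * y‖ * ‖(1 : B)‖ < 1 / 16 at hT1
  change ‖y - y * y‖ < 1 / 8 at hT2
  change ‖4 * (y - y * y)‖ < δ' at hT3
  change 4 * ‖y - y * y‖ < δ / 2 at hT4
  change ‖2 * ((y - e) * (2 * e - 1))‖ < δ / 2 at hT5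
  set T := y - y * y with hTd
  have hφt : φ (x - x * x) = T := by rw [map_sub, map_mul]
  obtain ⟨d, hd, hdd⟩ := exists_catalan_sum (hφ.spectralRadius_lt (t := x - x * x) (by rwa [hφt]))
  -- a square root `r` of `1 - 4 t`
  set r := 1 - 2 * d with hrd
  have hxt : Commute x (x - x * x) := by
    simp [Commute, SemiconjBy, mul_sub, sub_mul, mul_assoc]
  have hxd : Commute x d := by
    refine (hd.mul_left x).unique (?_ : HasSum _ (d * x))
    have : (fun n => x * ((catalan n : ℂ) • (x - x * x) ^ (n + 1)))
        = fun n => ((catalan n : ℂ) • (x - x * x) ^ (n + 1)) * x :=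
      funext fun n => ((hxt.pow_right (n + 1)).smul_right _).eq
    rw [this]
    exact hd.mul_right x
  have hxr : Commute x r := (Commute.one_right x).sub_right
    ((Commute.ofNat_right x 2).mul_right hxd)
  have hrr : r * r = 1 - 4 * (x - x * x) := by
    have : r * r = 1 - 4 * (d - d * d) := by rw [hrd]; noncomm_ring
    rw [this]
    congr 2
    nth_rewrite 1 [hdd]
    abel
  have hrr' : r * r = (2 * x - 1) * (2 * x - 1) := by rw [hrr]; noncomm_ring
  have hru : IsUnit r := by
    refine (((Commute.refl r).isUnit_mul_iff).1 (hφ.isUnit_of_map _ ?_)).1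
    have : φ (r * r) = 1 - 4 * T := by
      rw [hrr, map_sub, map_mul, hφt, map_one, map_ofNat]
    change IsUnit (φ (r * r))
    rw [this]
    refine hball' _ ?_
    rw [Metric.mem_ball, dist_eq_norm]
    simpa using hT3
  clear_value r
  obtain ⟨r, rfl⟩ := hru
  have hxi : Commute x (↑r⁻¹ : A) := hxr.units_inv_right
  have hhalf : (2 : A) * ((1 / 2 : ℂ) • (1 : A)) = 1 := by
    rw [mul_smul_comm, mul_one, ← map_ofNat (algebraMap ℂ A) 2, Algebra.algebraMap_eq_smul_one,
      smul_smul]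
    norm_num
  set c : A := (1 / 2 : ℂ) • (1 : A) with hc
  have hcc : ∀ z : A, z * c = c * z := fun z => by
    rw [hc, mul_smul_comm, smul_mul_assoc, mul_one, one_mul]
  set q : A := (2 * x - 1) * ↑r⁻¹ with hq
  have hqq : q * q = 1 := by
    have h1 : Commute (↑r⁻¹ : A) (2 * x - 1) :=
      (((Commute.ofNat_left 2 _).mul_left hxi).sub_left (Commute.one_left _)).symm
    calc q * q = (2 * x - 1) * (↑r⁻¹ * (2 * x - 1)) * ↑r⁻¹ := by rw [hq]; noncomm_ring
      _ = (2 * x - 1) * (2 * x - 1) * ↑r⁻¹ * ↑r⁻¹ := by rw [h1.eq]; noncomm_ring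
      _ = 1 := by rw [← hrr']; simp [mul_assoc]
  have hp : c * (1 + q) * (c * (1 + q)) = c * (1 + q) := by
    have : c * (1 + q) * (c * (1 + q)) = c * c * (1 + q) * (1 + q) := by
      rw [mul_assoc, ← mul_assoc (1 + q), hcc]
      noncomm_ring
    have h2 : (1 + q) * (1 + q) = 2 * (1 + q) := by
      have : (1 + q) * (1 + q) = 1 + 2 * q + q * q := by noncomm_ring
      rw [this, hqq]
      noncomm_ring
    rw [this, mul_assoc (c * c), h2, mul_assoc c, ← mul_assoc c 2, ← hcc 2, hhalf, one_mul]
  refine ⟨c * (1 + q), hp, ?_⟩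
  have hp' : φ (c * (1 + q)) * φ (c * (1 + q)) = φ (c * (1 + q)) := by rw [← map_mul, hp]
  have hp2 : 2 * φ (c * (1 + q)) = 1 + φ q := by
    rw [← map_ofNat φ 2, ← map_mul, ← mul_assoc, hhalf, one_mul, map_add, map_one]
  set p := φ (c * (1 + q)) with hpd
  -- The standard intertwiner: `v * e` and `p * v` are both `p * e`.
  set v : B := p * e + (1 - p) * (1 - e) with hv
  -- `v` is invertible
  have hD : ‖φ d‖ ≤ 2 * ‖T‖ := by
    have h1 : HasSum (fun n => (catalan n : ℂ) • T ^ (n + 1)) (φ d) := by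
      have := hd.map φ hφ.continuous
      convert this using 2 with n
      simp [map_smul, map_pow, hφt]
    have hg : HasSum (fun n : ℕ => ‖T‖ * (1 / 2 : ℝ) ^ n) (‖T‖ * 2) :=
      hasSum_geometric_two.mul_left _
    rw [mul_comm, ← h1.tsum_eq]
    refine tsum_of_norm_bounded hg fun n => ?_
    have h2 : (catalan n : ℝ) ≤ 4 ^ n := by exact_mod_cast catalan_le n
    rw [norm_smul, Complex.norm_natCast]
    calc (catalan n : ℝ) * ‖T ^ (n + 1)‖ ≤ 4 ^ n * ‖T‖ ^ (n + 1) :=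
          mul_le_mul h2 (norm_pow_le' _ n.succ_pos) (norm_nonneg _) (by positivity)
      _ = ‖T‖ * (4 * ‖T‖) ^ n := by rw [pow_succ, mul_pow]; ring
      _ ≤ ‖T‖ * (1 / 2) ^ n := by
          gcongr
          linarith
  have hw : IsUnit (φ r + (2 * y - 1) * (2 * e - 1)) := by
    refine hball _ ?_
    have h1 : (2 * y - 1) * (2 * e - 1) = 1 + 2 * ((y - e) * (2 * e - 1)) := by
      have : (2 * y - 1) * (2 * e - 1) = 1 + 2 * ((y - e) * (2 * e - 1)) + 4 * (e * e) - 4 * e := by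
        noncomm_ring
      rw [this, he]
      abel
    have h2 : φ r + (2 * y - 1) * (2 * e - 1) - 2 = 2 * ((y - e) * (2 * e - 1)) - 2 * φ d := by
      rw [h1, hrd, map_sub, map_one, map_mul, map_ofNat, ← one_add_one_eq_two]
      noncomm_ring
    rw [Metric.mem_ball, dist_eq_norm, IsUnit.unit_spec, h2]
    refine (norm_sub_le _ _).trans_lt ?_
    have h3 : ‖2 * φ d‖ ≤ 2 * ‖φ d‖ := by
      rw [two_mul, two_mul]
      exact norm_add_le _ _
    linarith
  have hvu : IsUnit v := by
    have h1 : (2 * p - 1) = φ (↑r⁻¹ : A) * (2 * y - 1) := by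
      have : (2 * x - 1) * (↑r⁻¹ : A) = ↑r⁻¹ * (2 * x - 1) :=
        (((Commute.ofNat_left 2 _).mul_left hxi).sub_left (Commute.one_left _)).eq
      rw [hp2, hq, this, map_mul, map_sub, map_mul, map_ofNat, map_one]
      abel
    -- `2v = 1 + (2p - 1)(2e - 1)`; taking out the invertible factor `φ r⁻¹` leaves an element close
    -- to `2`, invertible by `hw`.
    have h2 : 2 * v = φ (↑r⁻¹ : A) * (φ r + (2 * y - 1) * (2 * e - 1)) := by
      have : 2 * v = 1 + (2 * p - 1) * (2 * e - 1) := by rw [hv]; noncomm_ring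
      rw [this, h1, mul_add, ← map_mul, Units.inv_mul, map_one, mul_assoc]
    have h3 : IsUnit (2 * v) := by
      rw [h2]
      exact (r⁻¹.isUnit.map φ).mul hw
    exact ((Commute.ofNat_left 2 v).isUnit_mul_iff.1 h3).2
  refine ⟨hvu.unit, ?_⟩
  change v * e = p * v
  have e1 : v * e = p * (e * e) + (1 - p) * (e - e * e) := by rw [hv]; noncomm_ring
  have e2 : p * v = (p * p) * e + (p - p * p) * (1 - e) := by rw [hv]; noncomm_ring
  rw [e1, e2, he, hp']
  simp

end Idempotents

end DenseSpectral

/-! ### Matrices over a dense subalgebra which is closed under inversion -/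

section MatrixSpectral

open Matrix
open scoped Matrix.Norms.Operator

variable {R : Type*} {S : Type*} [NormedRing R] [NormedRing S] [CompleteSpace R] [CompleteSpace S]
  {ι κ : Type*} [Fintype ι] [Fintype κ] [DecidableEq ι] [DecidableEq κ]

instance completeSpace_linftyOp : @CompleteSpace (Matrix ι ι R)
    Matrix.linftyOpNormedRing.toMetricSpace.toPseudoMetricSpace.toUniformSpace :=
  inferInstanceAs (CompleteSpace (ι → ι → R))

/-- Gauss elimination with the pivot `a`: the matrix is a lower unitriangular one times `a ⊕ s`
times an upper unitriangular one, with `s` the Schur complement. -/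
lemma isUnit_fromBlocks {R : Type*} [Ring R] {a : Matrix ι ι R} (ha : IsUnit a) {b : Matrix ι κ R}
    {c : Matrix κ ι R} {d : Matrix κ κ R} (hs : IsUnit (d - c * Ring.inverse a * b)) :
    IsUnit (fromBlocks a b c d) := by
  obtain ⟨a, rfl⟩ := ha
  rw [Ring.inverse_unit] at hs
  obtain ⟨s, hs⟩ := hs
  let l : (Matrix (ι ⊕ κ) (ι ⊕ κ) R)ˣ := ⟨fromBlocks 1 0 (c * a.2) 1, fromBlocks 1 0 (-(c * a.2)) 1,
    by simp [fromBlocks_multiply], by simp [fromBlocks_multiply]⟩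
  let r : (Matrix (ι ⊕ κ) (ι ⊕ κ) R)ˣ := ⟨fromBlocks 1 (a.2 * b) 0 1, fromBlocks 1 (-(a.2 * b)) 0 1,
    by simp [fromBlocks_multiply], by simp [fromBlocks_multiply]⟩
  refine ⟨l * blockUnit a s * r, ?_⟩
  change fromBlocks 1 0 (c * a.2) 1 * fromBlocks a.1 0 0 s.1 * fromBlocks 1 (a.2 * b) 0 1 = _
  have h1 : a.1 * (a.2 * b) = b := by rw [← Matrix.mul_assoc, a.3, Matrix.one_mul]
  have h2 : c * a.2 * a.1 = c := by rw [Matrix.mul_assoc, a.4, Matrix.mul_one]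
  have h3 : c * (a.2 * b) + s.1 = d := by
    rw [hs, ← Matrix.mul_assoc]
    exact add_sub_cancel _ _
  simp only [fromBlocks_multiply, Matrix.one_mul, Matrix.mul_one, Matrix.zero_mul, Matrix.mul_zero,
    add_zero, zero_add, h1, h2, h3]

/-- Close to the identity, the upper left block and its Schur complement are close to identities of
smaller size, so both can be tested separately. The blocks of a general invertible matrix need not
be invertible, whence the restriction to a neighbourhood of `1`. -/
lemma eventually_isUnit_fromBlocks {φ : R →+* S}
    (hι : ∀ᶠ M in 𝓝 (1 : Matrix ι ι S), ∀ W : Matrix ι ι R, W.map φ = M → IsUnit W)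
    (hκ : ∀ᶠ M in 𝓝 (1 : Matrix κ κ S), ∀ W : Matrix κ κ R, W.map φ = M → IsUnit W) :
    ∀ᶠ M in 𝓝 (1 : Matrix (ι ⊕ κ) (ι ⊕ κ) S), ∀ W : Matrix (ι ⊕ κ) (ι ⊕ κ) R,
      W.map φ = M → IsUnit W := by
  have c11 : Continuous fun M : Matrix (ι ⊕ κ) (ι ⊕ κ) S => M.toBlocks₁₁ :=
    continuous_id.matrix_submatrix _ _
  have c12 : Continuous fun M : Matrix (ι ⊕ κ) (ι ⊕ κ) S => M.toBlocks₁₂ :=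
    continuous_id.matrix_submatrix _ _
  have c21 : Continuous fun M : Matrix (ι ⊕ κ) (ι ⊕ κ) S => M.toBlocks₂₁ :=
    continuous_id.matrix_submatrix _ _
  have c22 : Continuous fun M : Matrix (ι ⊕ κ) (ι ⊕ κ) S => M.toBlocks₂₂ :=
    continuous_id.matrix_submatrix _ _
  have e1 : (1 : Matrix (ι ⊕ κ) (ι ⊕ κ) S).toBlocks₁₁ = 1 := by
    rw [← fromBlocks_one, toBlocks_fromBlocks₁₁]
  have e2 : (1 : Matrix (ι ⊕ κ) (ι ⊕ κ) S).toBlocks₁₂ = 0 := by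
    rw [← fromBlocks_one, toBlocks_fromBlocks₁₂]
  have e3 : (1 : Matrix (ι ⊕ κ) (ι ⊕ κ) S).toBlocks₂₂ = 1 := by
    rw [← fromBlocks_one, toBlocks_fromBlocks₂₂]
  have h1 : ∀ᶠ M in 𝓝 (1 : Matrix (ι ⊕ κ) (ι ⊕ κ) S), ∀ W : Matrix ι ι R,
      W.map φ = M.toBlocks₁₁ → IsUnit W := by
    have := c11.tendsto 1
    rw [e1] at this
    exact this.eventually hι
  have h2 : ∀ᶠ M in 𝓝 (1 : Matrix (ι ⊕ κ) (ι ⊕ κ) S), ∀ W : Matrix κ κ R,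
      W.map φ = M.toBlocks₂₂ - M.toBlocks₂₁ * Ring.inverse M.toBlocks₁₁ * M.toBlocks₁₂ →
        IsUnit W := by
    have c3 : Continuous fun z : Matrix κ κ S × Matrix κ ι S × Matrix ι ι S × Matrix ι κ S =>
        z.1 - z.2.1 * z.2.2.1 * z.2.2.2 :=
      continuous_fst.sub ((continuous_snd.fst.matrix_mul continuous_snd.snd.fst).matrix_mul
        continuous_snd.snd.snd)
    have ci : Tendsto (Ring.inverse : Matrix ι ι S → Matrix ι ι S) (𝓝 1) (𝓝 1) := by
      have := (NormedRing.inverse_continuousAt (1 : (Matrix ι ι S)ˣ)).tendsto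
      rwa [Units.val_one, Ring.inverse_one] at this
    have t11 := c11.tendsto 1
    have t12 := c12.tendsto 1
    have t21 := c21.tendsto 1
    have t22 := c22.tendsto 1
    rw [e1] at t11
    rw [e2] at t12
    rw [e3] at t22
    have := (c3.tendsto (1, (1 : Matrix (ι ⊕ κ) (ι ⊕ κ) S).toBlocks₂₁, 1, 0)).comp
      (t22.prodMk_nhds (t21.prodMk_nhds ((ci.comp t11).prodMk_nhds t12)))
    simp only [Matrix.mul_zero, sub_zero] at this
    exact this.eventually hκ
  filter_upwards [h1, h2] with M h1 h2 W hW
  subst hW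
  have ha := h1 W.toBlocks₁₁ rfl
  rw [← fromBlocks_toBlocks W]
  refine isUnit_fromBlocks ha (h2 _ ?_)
  have h3 : (Ring.inverse W.toBlocks₁₁).map φ = Ring.inverse (W.map φ).toBlocks₁₁ := by
    obtain ⟨a, ha⟩ := ha
    have h4 : (W.map φ).toBlocks₁₁ = ↑(mapUnit φ a) := by
      change W.toBlocks₁₁.map φ = a.1.map φ
      rw [ha]
    rw [h4, Ring.inverse_unit, ← ha, Ring.inverse_unit]
    rfl
  rw [Matrix.map_sub φ (map_sub φ), Matrix.map_mul, Matrix.map_mul, h3]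
  rfl

lemma eventually_isUnit_reindex {φ : R →+* S} (σ : ι ≃ κ)
    (h : ∀ᶠ M in 𝓝 (1 : Matrix ι ι S), ∀ W : Matrix ι ι R, W.map φ = M → IsUnit W) :
    ∀ᶠ M in 𝓝 (1 : Matrix κ κ S), ∀ W : Matrix κ κ R, W.map φ = M → IsUnit W := by
  have c : Continuous fun M : Matrix κ κ S => M.submatrix σ σ := continuous_id.matrix_submatrix _ _
  have := c.tendsto 1
  rw [Matrix.submatrix_one_equiv] at this
  filter_upwards [this.eventually h] with M hM W hW
  obtain ⟨u, hu⟩ := hM (W.submatrix σ σ) (hW ▸ rfl)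
  refine ⟨reindexUnit σ u, ?_⟩
  change u.1.submatrix _ _ = W
  rw [hu]
  ext i j
  simp

lemma IsDenseSpectral.eventually_isUnit {φ : R →+* S} (hφ : IsDenseSpectral φ) (n : ℕ) :
    ∀ᶠ M in 𝓝 (1 : Matrix (Fin n) (Fin n) S), ∀ W : Matrix (Fin n) (Fin n) R,
      W.map φ = M → IsUnit W := by
  induction n with
  | zero => exact Eventually.of_forall fun M W _ => ⟨1, Subsingleton.elim _ _⟩
  | succ n ih =>
    refine eventually_isUnit_reindex finSumFinEquiv (eventually_isUnit_fromBlocks ih ?_)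
    have c : Continuous fun M : Matrix (Fin 1) (Fin 1) S => M 0 0 := continuous_id.matrix_elem 0 0
    have hc := c.tendsto 1
    rw [Matrix.one_apply_eq] at hc
    filter_upwards [hc.eventually (Units.isOpen.mem_nhds isUnit_one)] with M hM W hW
    subst hW
    exact (MulEquiv.isUnit_map (Matrix.uniqueRingEquiv (m := Fin 1) (A := R))).1
      (hφ.isUnit_of_map _ hM)

lemma IsDenseSpectral.denseRange_map {φ : R →+* S} (hφ : IsDenseSpectral φ) :
    DenseRange fun M : Matrix ι κ R => M.map φ :=
  DenseRange.piMap fun _ => DenseRange.piMap fun _ => hφ.dense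

/-- Matrices over a dense subring which is closed under inversion are dense and closed under
inversion. -/
lemma IsDenseSpectral.mapMatrix {φ : R →+* S} (hφ : IsDenseSpectral φ) (n : ℕ) :
    IsDenseSpectral (φ.mapMatrix (m := Fin n)) where
  continuous := Continuous.matrix_map continuous_id hφ.continuous
  dense := hφ.denseRange_map
  isUnit_of_map x hx := by
    obtain ⟨y, hy⟩ := hx
    -- For `z` whose image is close to the inverse of the image of `x`, both `x z` and `z x` lie
    -- over a neighbourhood of `1`, where invertibility is detected; so `x` has inverses on both
    -- sides.
    have h1 : ∀ᶠ z in 𝓝 y.2, (∀ W : Matrix (Fin n) (Fin n) R, W.map φ = y.1 * z → IsUnit W) ∧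
        ∀ W : Matrix (Fin n) (Fin n) R, W.map φ = z * y.1 → IsUnit W := by
      have c1 := (continuous_const_mul y.1).tendsto y.2
      have c2 := (continuous_mul_const y.1).tendsto y.2
      rw [y.3] at c1
      rw [y.4] at c2
      exact (c1.eventually (hφ.eventually_isUnit n)).and (c2.eventually (hφ.eventually_isUnit n))
    obtain ⟨_, ⟨h2, h3⟩, z, rfl⟩ := mem_closure_iff_nhds.1 (hφ.denseRange_map y.2) _ h1
    have h4 : IsUnit (x * z) := h2 _ (by rw [hy, Matrix.map_mul]; rfl)
    have h5 : IsUnit (z * x) := h3 _ (by rw [hy, Matrix.map_mul]; rfl)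
    obtain ⟨u, hu⟩ := h4
    obtain ⟨w, hw⟩ := h5
    refine isUnit_iff_exists_and_exists.2 ⟨⟨z * u.2, ?_⟩, ⟨w.2 * z, ?_⟩⟩
    · rw [← mul_assoc, ← hu, u.3]
    · rw [mul_assoc, ← hw, w.4]

/-- Idempotent matrices over a dense subring which is closed under inversion are equivalent if they
are equivalent over the whole ring. -/
lemma IsDenseSpectral.mvN_of_map {φ : R →+* S} (hφ : IsDenseSpectral φ) {m n : ℕ}
    {e : Matrix (Fin m) (Fin m) R} {f : Matrix (Fin n) (Fin n) R} (he : e * e = e) (hf : f * f = f)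
    (h : MvN (e.map φ) (f.map φ)) : MvN e f := by
  obtain ⟨a, b, hab, hba⟩ := h
  have he' := map_idem he φ
  have hf' := map_idem hf φ
  -- At `(a, b)` both expressions equal `1`, so they stay invertible when `a` and `b` are replaced
  -- by nearby images of matrices over `R`. Adding `1 - e` and `1 - f` turns invertibility in a
  -- corner into ordinary invertibility.
  have hev : ∀ᶠ z in 𝓝 (a, b),
      IsUnit (e.map φ * z.1 * f.map φ * (f.map φ * z.2 * e.map φ) + (1 - e.map φ)) ∧
      IsUnit (f.map φ * z.2 * e.map φ * (e.map φ * z.1 * f.map φ) + (1 - f.map φ)) := by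
    have c1 : Continuous fun z : Matrix (Fin m) (Fin n) S × Matrix (Fin n) (Fin m) S =>
        e.map φ * z.1 * f.map φ * (f.map φ * z.2 * e.map φ) + (1 - e.map φ) :=
      (((continuous_const.matrix_mul continuous_fst).matrix_mul continuous_const).matrix_mul
        ((continuous_const.matrix_mul continuous_snd).matrix_mul continuous_const)).add
        continuous_const
    have c2 : Continuous fun z : Matrix (Fin m) (Fin n) S × Matrix (Fin n) (Fin m) S =>
        f.map φ * z.2 * e.map φ * (e.map φ * z.1 * f.map φ) + (1 - f.map φ) :=
      (((continuous_const.matrix_mul continuous_snd).matrix_mul continuous_const).matrix_mul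
        ((continuous_const.matrix_mul continuous_fst).matrix_mul continuous_const)).add
        continuous_const
    have e1 : e.map φ * a * f.map φ * (f.map φ * b * e.map φ) = e.map φ := by
      have : e.map φ * a * f.map φ * (f.map φ * b * e.map φ)
          = e.map φ * (a * (f.map φ * f.map φ) * b) * e.map φ := by simp only [Matrix.mul_assoc]
      rw [this, hf', ← hba]
      have : a * (b * a) * b = (a * b) * (a * b) := by simp only [Matrix.mul_assoc]
      rw [this, hab, he', he', he']
    have e2 : f.map φ * b * e.map φ * (e.map φ * a * f.map φ) = f.map φ := by
      have : f.map φ * b * e.map φ * (e.map φ * a * f.map φ)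
          = f.map φ * (b * (e.map φ * e.map φ) * a) * f.map φ := by simp only [Matrix.mul_assoc]
      rw [this, he', ← hab]
      have : b * (a * b) * a = (b * a) * (b * a) := by simp only [Matrix.mul_assoc]
      rw [this, hba, hf', hf', hf']
    have t1 := c1.tendsto (a, b)
    have t2 := c2.tendsto (a, b)
    simp only [e1, e2, add_sub_cancel] at t1 t2
    exact (t1.eventually (Units.isOpen.mem_nhds isUnit_one)).and
      (t2.eventually (Units.isOpen.mem_nhds isUnit_one))
  obtain ⟨_, ⟨hu, hv⟩, ⟨z, rfl⟩⟩ := mem_closure_iff_nhds.1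
    ((hφ.denseRange_map.prodMap hφ.denseRange_map) (a, b)) _ hev
  replace hu := (hφ.mapMatrix m).isUnit_of_map (e * z.1 * f * (f * z.2 * e) + (1 - e)) (by
    convert hu
    simp [Matrix.map_mul, Matrix.map_add φ (map_add φ), Matrix.map_sub φ (map_sub φ)])
  replace hv := (hφ.mapMatrix n).isUnit_of_map (f * z.2 * e * (e * z.1 * f) + (1 - f)) (by
    convert hv
    simp [Matrix.map_mul, Matrix.map_add φ (map_add φ), Matrix.map_sub φ (map_sub φ)])
  set α := e * z.1 * f with hα
  set β := f * z.2 * e with hβ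
  have eα : e * α = α := by rw [hα, ← Matrix.mul_assoc, ← Matrix.mul_assoc, he]
  have αf : α * f = α := by rw [hα, Matrix.mul_assoc, hf]
  have fβ : f * β = β := by rw [hβ, ← Matrix.mul_assoc, ← Matrix.mul_assoc, hf]
  have βe : β * e = β := by rw [hβ, Matrix.mul_assoc, he]
  clear_value α β
  obtain ⟨u, hu⟩ := hu
  have eu : e * u.1 = α * β := by
    rw [hu, mul_add, mul_sub, he, mul_one, sub_self, add_zero, ← Matrix.mul_assoc, eα]
  -- `β` is corrected by the inverse of `α * β` in the corner of `e`. The product `q` in the other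
  -- order equals `f`, because the invertible matrix `β * α + (1 - f)` annihilates `f - q`.
  refine ⟨α, β * (u.2 * e), ?_, ?_⟩
  · have : e * u.1 * (u.2 * e) = e := by
      rw [mul_assoc, ← mul_assoc u.1, u.3, one_mul, he]
    rw [← Matrix.mul_assoc, ← eu, this]
  · set q := β * (u.2 * e) * α with hq
    have h1 : α * q = α := by
      have : e * u.1 * (u.2 * e) = e := by
        rw [mul_assoc, ← mul_assoc u.1, u.3, one_mul, he]
      rw [hq, ← Matrix.mul_assoc, ← Matrix.mul_assoc, ← eu, this, eα]
    have h2 : f * q = q := by rw [hq, ← Matrix.mul_assoc, ← Matrix.mul_assoc, fβ]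
    have h3 : (β * α + (1 - f)) * (f - q) = 0 := by
      rw [add_mul, mul_sub (β * α), Matrix.mul_assoc, αf, Matrix.mul_assoc, h1, sub_self, zero_add,
        sub_mul, one_mul, mul_sub, hf, h2, sub_self]
    exact (sub_eq_zero.1 ((hv.mul_right_eq_zero).1 h3)).symm

variable [NormedAlgebra ℂ R] [NormedAlgebra ℂ S]

theorem IsDenseSpectral.bijective_ringK0 {φ : R →+* S} (hφ : IsDenseSpectral φ)
    (hφc : ∀ (c : ℂ) x, φ (c • x) = c • φ x) : Function.Bijective (RingK0.map φ) := by
  refine RingK0.map_bijective φ (fun n e he => ?_) fun m n e f he hf h => hφ.mvN_of_map he hf h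
  let ψ : Matrix (Fin n) (Fin n) R →ₐ[ℂ] Matrix (Fin n) (Fin n) S :=
    AlgHom.mk' (φ.mapMatrix (m := Fin n)) fun c x => by
      ext i j
      exact hφc c (x i j)
  obtain ⟨p, hp, v, hv⟩ := IsDenseSpectral.exists_idempotent (φ := ψ) (hφ.mapMatrix n) he
  refine ⟨p, hp, v.1 * e, v.2, ?_, ?_⟩
  · change v.1 * e * v.2 = ψ p
    rw [hv, mul_assoc, v.3, mul_one]
  · change v.2 * (v.1 * e) = e
    rw [← mul_assoc, v.4, one_mul]

theorem IsDenseSpectral.bijective_ringK1 {φ : R →+* S} (hφ : IsDenseSpectral φ)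
    (hφc : ∀ (c : ℂ) x, φ (c • x) = c • φ x) : Function.Bijective (RingK1.map φ hφ.continuous) :=
  RingK1.map_bijective φ hφ.continuous (fun n => inferInstance)
    (fun n g => (hφ.mapMatrix n).exists_joined g)
    fun n g h hgh => (hφ.mapMatrix n).joined_of_map (fun c x => by
      ext i j
      exact hφc c (x i j)) hgh

end MatrixSpectral

/-! ### Isoradial homomorphisms with dense range and K-theory -/

namespace BanachAlg

variable {A : BanachAlg.{v}} {B : BanachAlg.{w}}

/-- The element `c + a` of the unitalisation. -/
lemma plus_eq (x : A.Plus) : x = algebraMap ℂ A.Plus (A.aug x) + toPlus (WithLp.ofLp x).snd := by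
  refine (WithLp.ofLp_injective 1) ?_
  exact (Unitization.inl_fst_add_inr_snd_eq (WithLp.ofLp x)).symm

lemma eq_toPlus {x : A.Plus} (hx : A.aug x = 0) : x = toPlus (WithLp.ofLp x).snd := by
  nth_rewrite 1 [plus_eq x]
  rw [hx, map_zero, zero_add]

lemma toPlus_sub (a b : A) : toPlus (a - b) = toPlus a - toPlus b :=
  congrArg (WithLp.toLp 1) (Unitization.inr_sub ℂ a b)

lemma aug_toPlus (a : A) : A.aug (toPlus a) = 0 := rfl

lemma aug_algebraMap (c : ℂ) : A.aug (algebraMap ℂ A.Plus c) = c := rfl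

lemma Hom.aug_plus (φ : A.Hom B) (x : A.Plus) : B.aug (φ.plus x) = A.aug x :=
  RingHom.congr_fun φ.aug_comp_plus x

lemma Hom.plus_algebraMap (φ : A.Hom B) (c : ℂ) :
    φ.plus (algebraMap ℂ A.Plus c) = algebraMap ℂ B.Plus c :=
  AlgHom.commutes ((WithLp.unitizationAlgEquiv (𝕜 := ℂ) (A := B) ℂ).symm.toAlgHom.comp
    ((Unitization.lift ((Unitization.inrNonUnitalAlgHom ℂ B).comp φ.toHom)).comp
      (WithLp.unitizationAlgEquiv (𝕜 := ℂ) (A := A) ℂ).toAlgHom)) c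

lemma Hom.plus_smul (φ : A.Hom B) (c : ℂ) (x : A.Plus) : φ.plus (c • x) = c • φ.plus x := by
  rw [Algebra.smul_def, Algebra.smul_def, map_mul, φ.plus_algebraMap]

lemma continuous_toPlus : Continuous (toPlus : A → A.Plus) :=
  (AddMonoidHomClass.isometry_of_norm ({
    toFun := toPlus
    map_zero' := rfl
    map_add' := fun a b => congrArg (WithLp.toLp 1) (Unitization.inr_add ℂ a b) } :
      A →+ A.Plus) norm_toPlus).continuous

lemma isUnit_one_sub_toPlus {a : A} (ha : rho a < 1) : IsUnit (1 - toPlus a) := by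
  rw [rho_eq] at ha
  have := spectrum.mem_resolventSet_of_spectralRadius_lt (k := (1 : ℂ)) (a := toPlus a) (by simpa)
  rwa [spectrum.mem_resolventSet_iff, map_one] at this

/-- An element of augmentation `1` is `1 - c` with `c` in `A`. Smallness of the image of `c` bounds
its spectral radius, hence by isoradiality that of `c`. -/
lemma Hom.IsIsoradial.isUnit_of_near {φ : A.Hom B} (hφ : φ.IsIsoradial) {w : A.Plus}
    (hw : A.aug w = 1) (hn : ‖1 - φ.plus w‖ < 1) : IsUnit w := by
  have h0 : A.aug (1 - w) = 0 := by rw [map_sub, map_one, hw, sub_self]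
  set c : A := (WithLp.ofLp (1 - w)).snd with hc
  have hwc : 1 - w = toPlus c := eq_toPlus h0
  have h1 : rho (φ.toHom c) < ENNReal.ofReal 1 := by
    refine (rho_lt_iff one_pos).2 ⟨0, ?_⟩
    change ‖φ.toHom c‖ < 1 ^ 1
    rw [one_pow, ← norm_toPlus, ← φ.plus_toPlus, ← hwc, map_sub, map_one]
    exact hn
  rw [hφ.isoradial, ENNReal.ofReal_one] at h1
  have := isUnit_one_sub_toPlus h1
  rwa [← hwc, sub_sub_cancel] at this

/-- If `φ.plus x` is invertible, an approximate inverse can be taken from the dense range. The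
products of `x` with a preimage of it lie over a neighbourhood of `1` and are invertible by
`isUnit_of_near`. -/
lemma Hom.IsIsoradial.isDenseSpectral {φ : A.Hom B} (hφ : φ.IsIsoradial) :
    IsDenseSpectral φ.plus where
  continuous := φ.continuous_plus
  dense := by
    intro y
    refine Metric.mem_closure_iff.2 fun ε hε => ?_
    obtain ⟨a, ha⟩ := hφ.dense_range.exists_dist_lt (WithLp.ofLp y).snd hε
    refine ⟨_, ⟨algebraMap ℂ A.Plus (B.aug y) + toPlus a, rfl⟩, ?_⟩
    rw [map_add, φ.plus_algebraMap, φ.plus_toPlus, dist_eq_norm]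
    nth_rewrite 1 [plus_eq y]
    rw [add_sub_add_left_eq_sub]
    rw [dist_eq_norm, ← norm_toPlus] at ha
    rwa [← toPlus_sub]
  isUnit_of_map x hx := by
    obtain ⟨y, hy⟩ := hx
    have hl : A.aug x * B.aug y.2 = 1 := by
      rw [← φ.aug_plus, ← hy, ← map_mul, y.3, map_one]
    -- Only the component in `B` of the inverse is approximated; keeping its scalar part makes the
    -- augmentations of `x * z` and `z * x` exactly `1`.
    have hne : ∀ᶠ b in 𝓝 (WithLp.ofLp y.2).snd,
        ‖1 - φ.plus x * (algebraMap ℂ B.Plus (B.aug y.2) + toPlus b)‖ < 1 ∧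
        ‖1 - (algebraMap ℂ B.Plus (B.aug y.2) + toPlus b) * φ.plus x‖ < 1 := by
      have ct := continuous_toPlus (A := B)
      have c1 : Continuous fun b : B =>
          ‖1 - φ.plus x * (algebraMap ℂ B.Plus (B.aug y.2) + toPlus b)‖ := by fun_prop
      have c2 : Continuous fun b : B =>
          ‖1 - (algebraMap ℂ B.Plus (B.aug y.2) + toPlus b) * φ.plus x‖ := by fun_prop
      have t1 := c1.tendsto (WithLp.ofLp y.2).snd
      have t2 := c2.tendsto (WithLp.ofLp y.2).snd
      rw [← plus_eq y.2, ← hy, y.3, sub_self, norm_zero] at t1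
      rw [← plus_eq y.2, ← hy, y.4, sub_self, norm_zero] at t2
      rw [← hy]
      exact (t1.eventually_lt_const one_pos).and (t2.eventually_lt_const one_pos)
    obtain ⟨_, ⟨h1, h2⟩, a, rfl⟩ := mem_closure_iff_nhds.1
      (hφ.dense_range (WithLp.ofLp y.2).snd) _ hne
    rw [← φ.plus_toPlus, ← φ.plus_algebraMap, ← map_add, ← map_mul] at h1 h2
    set z := algebraMap ℂ A.Plus (B.aug y.2) + toPlus a with hz
    have haz : A.aug z = B.aug y.2 := by
      rw [hz, map_add, aug_toPlus, aug_algebraMap, add_zero]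
    obtain ⟨u, hu⟩ := hφ.isUnit_of_near (w := x * z) (by rw [map_mul, haz, hl]) h1
    obtain ⟨w, hw⟩ := hφ.isUnit_of_near (w := z * x) (by rw [map_mul, haz, mul_comm, hl]) h2
    refine isUnit_iff_exists_and_exists.2 ⟨⟨z * u.2, ?_⟩, ⟨w.2 * z, ?_⟩⟩
    · rw [← mul_assoc, ← hu, u.3]
    · rw [mul_assoc, ← hw, w.4]

lemma bijective_ker {G H L : Type*} [AddCommGroup G] [AddCommGroup H] [AddCommGroup L]
    {f : G →+ H} (hf : Function.Bijective f) (p : G →+ L) (q : H →+ L) (hpq : ∀ g, q (f g) = p g)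
    (F : p.ker →+ q.ker) (hF : ∀ g, (F g : H) = f g) : Function.Bijective F := by
  refine ⟨fun a b hab => Subtype.ext (hf.1 ?_), fun h => ?_⟩
  · rw [← hF, ← hF, hab]
  · obtain ⟨g, hg⟩ := hf.2 h
    refine ⟨⟨g, ?_⟩, Subtype.ext ?_⟩
    · rw [AddMonoidHom.mem_ker, ← hpq, hg]
      exact h.2
    · rw [hF, hg]

/-- Isoradial homomorphisms with dense range induce isomorphisms in K-theory. -/
theorem Hom.IsIsoradial.bijective_K (n : ℕ) :
    ∀ {A : BanachAlg.{v}} {B : BanachAlg.{w}} {φ : A.Hom B}, φ.IsIsoradial →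
      Function.Bijective (φ.K n) := by
  -- The induction follows the recursive definition of `K_n`, which is why the hypothesis must be
  -- stable under suspension.
  induction n using Nat.twoStepInduction with
  | zero =>
    intro A B φ hφ
    exact bijective_ker (hφ.isDenseSpectral.bijective_ringK0 φ.plus_smul) (RingK0.map A.aug)
      (RingK0.map B.aug) (fun z => by rw [RingK0.map_map, φ.aug_comp_plus]) φ.K0 fun _ => rfl
  | one =>
    intro A B φ hφ
    exact bijective_ker (hφ.isDenseSpectral.bijective_ringK1 φ.plus_smul)
      (RingK1.map A.aug A.continuous_aug) (RingK1.map B.aug B.continuous_aug)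
      (fun z => by simp only [RingK1.map_map, φ.aug_comp_plus]) φ.K1 fun _ => rfl
  | more n _ ih =>
    intro A B φ hφ
    exact ih hφ.suspension

lemma Hom.IsFull.isIsoradial {φ : A.Hom B} (hφ : φ.IsFull) : φ.IsIsoradial :=
  ⟨hφ.isoradial, hφ.dense_range⟩

end BanachAlg

/-! ### Transport of idempotent matrices along paths -/

section Transport

open Matrix unitInterval

section PathHoms

variable {R : Type*} [NormedRing R]

/-- Evaluation of paths. -/
def pathEval (t : I) : C(I, R) →+* R where
  toFun f := f t
  map_one' := rfl
  map_mul' _ _ := rfl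
  map_zero' := rfl
  map_add' _ _ := rfl

/-- Constant paths. -/
def pathConst : R →+* C(I, R) where
  toFun r := ContinuousMap.const I r
  map_one' := rfl
  map_mul' _ _ := rfl
  map_zero' := rfl
  map_add' _ _ := rfl

/-- The path `t ↦ f (s t)`. -/
def pathScale (s : I) : C(I, R) →+* C(I, R) where
  toFun f := f.comp ⟨fun t => s * t, by fun_prop⟩
  map_one' := rfl
  map_mul' _ _ := rfl
  map_zero' := rfl
  map_add' _ _ := rfl

/-- The map `(s, t) ↦ f (s * t)` is jointly continuous, and currying it gives continuity in `C(I,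
R)`. -/
lemma continuous_pathScale (f : C(I, R)) : Continuous fun s => pathScale s f :=
  (ContinuousMap.curry ⟨fun z : I × I => f (z.1 * z.2), by fun_prop⟩).continuous

variable {ι κ : Type*}

lemma matrix_path_ext {F G : Matrix ι κ C(I, R)}
    (h : ∀ t, F.map (pathEval t) = G.map (pathEval t)) : F = G := by
  ext i j t
  exact congrFun (congrFun (h t) i) j

end PathHoms

section MapUnit

variable {R S : Type*} [Ring R] [Ring S] {ι : Type*} [Fintype ι] [DecidableEq ι] (φ : R →+* S)

lemma mapUnit_one : mapUnit φ (1 : (Matrix ι ι R)ˣ) = 1 := map_one (Units.map _)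

lemma mapUnit_mul (g h : (Matrix ι ι R)ˣ) : mapUnit φ (g * h) = mapUnit φ g * mapUnit φ h :=
  map_mul (Units.map _) g h

lemma mapUnit_inv (g : (Matrix ι ι R)ˣ) : mapUnit φ g⁻¹ = (mapUnit φ g)⁻¹ := map_inv (Units.map _) g

lemma mapUnit_blockUnit {κ : Type*} [Fintype κ] [DecidableEq κ] (g : (Matrix ι ι R)ˣ)
    (h : (Matrix κ κ R)ˣ) :
    mapUnit φ (blockUnit g h) = blockUnit (mapUnit φ g) (mapUnit φ h) := Units.ext <| by
  change (fromBlocks g.1 0 0 h.1).map φ = fromBlocks (g.1.map φ) 0 0 (h.1.map φ)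
  rw [fromBlocks_map, Matrix.map_zero _ (map_zero φ), Matrix.map_zero _ (map_zero φ)]

end MapUnit

lemma blockUnit_one {R : Type*} [Ring R] {ι κ : Type*} [Fintype ι] [DecidableEq ι] [Fintype κ]
    [DecidableEq κ] : blockUnit (1 : (Matrix ι ι R)ˣ) (1 : (Matrix κ κ R)ˣ) = 1 :=
  Units.ext fromBlocks_one

lemma mul_unit_inv {M : Type*} [Monoid M] {v : Mˣ} {a b : M} (h : a * v = v * b) :
    b * v⁻¹.1 = v⁻¹.1 * a := by
  rw [Units.mul_inv_eq_iff_eq_mul, mul_assoc, h, Units.inv_mul_cancel_left]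

/-- The element `e * f + (1 - e) * (1 - f)` is close to `1` if `f` is close to `e`; it then is a
similarity between the two idempotents. -/
lemma idem_mul_similarity {M : Type*} [Ring M] {e f : M} (he : e * e = e) (hf : f * f = f) :
    e * (e * f + (1 - e) * (1 - f)) = (e * f + (1 - e) * (1 - f)) * f := by
  have e2 : e * (e * f + (1 - e) * (1 - f)) = e * e * f + (e - e * e) * (1 - f) := by noncomm_ring
  have e3 : (e * f + (1 - e) * (1 - f)) * f = e * (f * f) + (1 - e) * (f - f * f) := by noncomm_ring
  rw [e2, e3, he, hf, sub_self, sub_self, zero_mul, mul_zero]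

lemma mapUnit_mapUnit {R S T : Type*} [Ring R] [Ring S] [Ring T] {ι : Type*} [Fintype ι]
    [DecidableEq ι] (f : S →+* T) (g : R →+* S) (w : (Matrix ι ι R)ˣ) :
    mapUnit f (mapUnit g w) = mapUnit (f.comp g) w := Units.ext rfl

variable {R : Type*} [NormedRing R] [NormedAlgebra ℂ R] {T : Type*} [Ring T]
variable {ι κ μ : Type*} [Fintype ι] [DecidableEq ι] [Fintype κ] [DecidableEq κ]
  [Fintype μ] [DecidableEq μ]

/-- Constant scalar paths. -/
abbrev pathScal (R : Type*) [NormedRing R] [NormedAlgebra ℂ R] : ℂ →+* C(I, R) :=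
  pathConst.comp (algebraMap ℂ R)

variable (ε : R →+* ℂ)

/-- An invertible path of matrices which starts at `1` and is constant modulo the
augmentation. -/
structure IsNormalised (w : (Matrix ι ι C(I, R))ˣ) : Prop where
  zero : mapUnit (pathEval 0) w = 1
  aug : ∀ t, mapUnit (ε.comp (pathEval t)) w = 1

variable {ε}

namespace IsNormalised

lemma one : IsNormalised ε (1 : (Matrix ι ι C(I, R))ˣ) := ⟨mapUnit_one _, fun _ => mapUnit_one _⟩

lemma mul {v w : (Matrix ι ι C(I, R))ˣ} (hv : IsNormalised ε v) (hw : IsNormalised ε w) :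
    IsNormalised ε (v * w) :=
  ⟨by rw [mapUnit_mul, hv.zero, hw.zero, one_mul],
    fun t => by rw [mapUnit_mul, hv.aug, hw.aug, one_mul]⟩

lemma inv {w : (Matrix ι ι C(I, R))ˣ} (hw : IsNormalised ε w) : IsNormalised ε w⁻¹ :=
  ⟨by rw [mapUnit_inv, hw.zero, inv_one], fun t => by rw [mapUnit_inv, hw.aug, inv_one]⟩

lemma blockUnit {v : (Matrix ι ι C(I, R))ˣ} {w : (Matrix κ κ C(I, R))ˣ} (hv : IsNormalised ε v)
    (hw : IsNormalised ε w) : IsNormalised ε (blockUnit v w) :=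
  ⟨by rw [mapUnit_blockUnit, hv.zero, hw.zero, blockUnit_one],
    fun t => by rw [mapUnit_blockUnit, hv.aug, hw.aug, blockUnit_one]⟩

lemma val_aug {w : (Matrix ι ι C(I, R))ˣ} (hw : IsNormalised ε w) (t : I) :
    (w.1.map (pathEval t)).map ε = 1 := congrArg Units.val (hw.aug t)

end IsNormalised

/-- An idempotent path of matrices is a conjugate of its initial value. -/
lemma exists_conjugation [CompleteSpace R] {e : Matrix ι ι C(I, R)} (he : e * e = e) :
    ∃ w : (Matrix ι ι C(I, R))ˣ, mapUnit (pathEval 0) w = 1 ∧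
      e * w = w * (e.map (pathEval 0)).map pathConst := by
  open scoped Matrix.Norms.Operator in
  -- The rescaled paths `t ↦ e (s * t)` deform the constant path at `e 0` into `e`, through
  -- idempotents with a fixed initial value.
  let E : I → Matrix ι ι C(I, R) := fun s => e.map (pathScale s)
  have hE : Continuous E := continuous_matrix fun i j => continuous_pathScale (e i j)
  have hEE : ∀ s, E s * E s = E s := fun s => map_idem he _
  have hE0 : ∀ s, (E s).map (pathEval 0) = e.map (pathEval 0) := fun s => by
    ext i j
    change e i j (s * 0) = e i j 0
    rw [mul_zero]
  have key : ∀ s₀, ∀ᶠ s in 𝓝 s₀, ∃ v : (Matrix ι ι C(I, R))ˣ, mapUnit (pathEval 0) v = 1 ∧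
      E s * v = v * E s₀ := fun s₀ => by
    have c : Continuous fun s => E s * E s₀ + (1 - E s) * (1 - E s₀) :=
      (hE.mul continuous_const).add ((continuous_const.sub hE).mul continuous_const)
    have ht := c.tendsto s₀
    have e1 : E s₀ * E s₀ + (1 - E s₀) * (1 - E s₀) = 1 := by
      rw [mul_sub, mul_one, sub_mul, one_mul, hEE]
      abel
    rw [e1] at ht
    filter_upwards [ht.eventually (Units.isOpen.mem_nhds isUnit_one)] with s hs
    obtain ⟨v, hv⟩ := hs
    refine ⟨v, Units.ext ?_, ?_⟩
    · change v.1.map (pathEval 0) = 1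
      have i0 := map_idem he (pathEval 0)
      rw [hv, Matrix.map_add _ (map_add _), Matrix.map_mul, Matrix.map_mul,
        Matrix.map_sub _ (map_sub _), Matrix.map_sub _ (map_sub _),
        Matrix.map_one _ (map_zero _) (map_one _), hE0, hE0, i0, mul_sub, mul_one, sub_mul, one_mul,
        i0]
      abel
    · rw [hv]
      exact idem_mul_similarity (hEE s) (hEE s₀)
  -- Similarity to `E 0` by a unit with value `1` at time `0` is a locally constant condition on
  -- `s`; it holds at `0`, hence at `1`.
  let P : I → Prop := fun s => ∃ w : (Matrix ι ι C(I, R))ˣ, mapUnit (pathEval 0) w = 1 ∧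
    E s * w = w * E 0
  have hP : IsLocallyConstant P := (IsLocallyConstant.iff_eventually_eq P).2 fun s₀ => by
    filter_upwards [key s₀] with s hs
    obtain ⟨v, hv0, hv⟩ := hs
    refine propext ⟨?_, ?_⟩
    · rintro ⟨w, hw0, hw⟩
      refine ⟨v⁻¹ * w, (mapUnit_mul _ _ _).trans ?_, ?_⟩
      · rw [hw0, mul_one, mapUnit_inv, hv0, inv_one]
      · rw [Units.val_mul, ← mul_assoc, mul_unit_inv hv, mul_assoc, hw, mul_assoc]
    · rintro ⟨w, hw0, hw⟩
      refine ⟨v * w, (mapUnit_mul _ _ _).trans ?_, ?_⟩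
      · rw [hw0, hv0, mul_one]
      · rw [Units.val_mul, ← mul_assoc, hv, mul_assoc, hw, mul_assoc]
  have h1 : P 1 := (hP.apply_eq_of_preconnectedSpace 0 1).mp
    ⟨1, map_one _, by rw [Units.val_one, mul_one, one_mul]⟩
  have hE1 : E 1 = e := matrix_path_ext fun t => by
    ext i j
    change e i j (1 * t) = e i j t
    rw [one_mul]
  have hE00 : E 0 = (e.map (pathEval 0)).map pathConst := matrix_path_ext fun t => by
    ext i j
    change e i j (0 * t) = e i j 0
    rw [zero_mul]
  rwa [← hE00, ← hE1]

/-- An idempotent path of matrices which is constant modulo the augmentation is a conjugate of its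
initial value by a normalised path. -/
lemma exists_normalised_conjugation [CompleteSpace R] (hεc : Continuous ε)
    (hε : ∀ c, ε (algebraMap ℂ R c) = c) {e : Matrix ι ι C(I, R)} (he : e * e = e)
    {c : Matrix ι ι ℂ} (h0 : e.map (pathEval 0) = c.map (algebraMap ℂ R))
    (ht : ∀ t, (e.map (pathEval t)).map ε = c) :
    ∃ w : (Matrix ι ι C(I, R))ˣ, IsNormalised ε w ∧ e * w = w * c.map (pathScal R) := by
  obtain ⟨w, hw0, hw⟩ := exists_conjugation he
  have hc : (e.map (pathEval 0)).map pathConst = c.map (pathScal R) := by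
    rw [h0]
    rfl
  rw [hc] at hw
  -- `τ` replaces a path by the path of its scalar parts. Since the scalar part of `e` is constantly
  -- `c`, the scalar part of `w` commutes with `c`; dividing `w` by it keeps the conjugation and
  -- makes the augmentation trivial.
  let τ : C(I, R) →+* C(I, R) := RingHom.compLeftContinuous I ((algebraMap ℂ R).comp ε)
    ((algebraMapCLM ℂ R).continuous.comp hεc)
  have hετ : ∀ t, (ε.comp (pathEval t)).comp τ = ε.comp (pathEval t) := fun t =>
    RingHom.ext fun f => hε _
  have hτ0 : (pathEval 0).comp τ = ((algebraMap ℂ R).comp ε).comp (pathEval 0) := rfl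
  set s := mapUnit τ w with hs
  have hτe : e.map τ = c.map (pathScal R) := matrix_path_ext fun t => by
    rw [← ht t]
    rfl
  have hτc : (c.map (pathScal R)).map τ = c.map (pathScal R) := matrix_path_ext fun t => by
    ext i j
    exact congrArg (algebraMap ℂ R) (hε (c i j))
  have hcomm : c.map (pathScal R) * s.1 = s.1 * c.map (pathScal R) := by
    have := congrArg (fun M => M.map τ) hw
    simp only [Matrix.map_mul] at this
    rwa [hτe, hτc] at this
  refine ⟨w * s⁻¹, ⟨?_, fun t => ?_⟩, ?_⟩
  · rw [mapUnit_mul, hw0, mapUnit_inv, hs, mapUnit_mapUnit, hτ0, ← mapUnit_mapUnit, hw0,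
      mapUnit_one, inv_one, one_mul]
  · rw [mapUnit_mul, mapUnit_inv, hs, mapUnit_mapUnit, hετ, mul_inv_cancel]
  · rw [Units.val_mul, ← mul_assoc, hw, mul_assoc, mul_assoc, mul_unit_inv hcomm]

end Transport

/-! ### Idempotent matrices of loops and their monodromy. -/

section Loops

open Matrix unitInterval

section Corner

variable {M : Type*} [Ring M] {ι κ : Type*} [Fintype ι] [Fintype κ] [DecidableEq ι] [DecidableEq κ]

/-- The embedding of matrices as a corner, extended by `1`. -/
def cornerHom (x : Matrix ι κ M) (y : Matrix κ ι M) (h : x * y = 1) :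
    Matrix ι ι M →* Matrix κ κ M where
  toFun a := y * a * x + (1 - y * x)
  map_one' := by simp
  map_mul' a b := by
    have h1 : y * a * x * (y * b * x) = y * (a * b) * x := by
      calc y * a * x * (y * b * x) = y * a * (x * y) * b * x := by simp only [Matrix.mul_assoc]
        _ = _ := by rw [h, Matrix.mul_one]; simp only [Matrix.mul_assoc]
    have h2 : y * a * x * (y * x) = y * a * x := by
      calc y * a * x * (y * x) = y * a * (x * y) * x := by simp only [Matrix.mul_assoc]
        _ = _ := by rw [h, Matrix.mul_one]
    have h3 : y * x * (y * b * x) = y * b * x := by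
      calc y * x * (y * b * x) = y * (x * y) * b * x := by simp only [Matrix.mul_assoc]
        _ = _ := by rw [h, Matrix.mul_one]
    have h4 : y * x * (y * x) = y * x := by
      calc y * x * (y * x) = y * (x * y) * x := by simp only [Matrix.mul_assoc]
        _ = _ := by rw [h, Matrix.mul_one]
    rw [add_mul, mul_add, mul_add, mul_sub, mul_sub, sub_mul, sub_mul, h1, h2, h3, mul_one, one_mul,
      mul_one, sub_mul, h4]
    simp

lemma cornerHom_map {N : Type*} [Ring N] (φ : M →+* N) {x : Matrix ι κ M} {y : Matrix κ ι M}
    (h : x * y = 1) (h' : x.map φ * y.map φ = 1) (a : Matrix ι ι M) :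
    (cornerHom x y h a).map φ = cornerHom (x.map φ) (y.map φ) h' (a.map φ) := by
  change (y * a * x + (1 - y * x)).map φ = y.map φ * a.map φ * x.map φ + (1 - y.map φ * x.map φ)
  rw [Matrix.map_add _ (map_add φ), Matrix.map_sub _ (map_sub φ),
    Matrix.map_one _ (map_zero φ) (map_one φ)]
  simp only [Matrix.map_mul]

lemma mul_map_eq_one {N : Type*} [Ring N] (φ : M →+* N) {x : Matrix ι κ M} {y : Matrix κ ι M}
    (h : x * y = 1) : x.map φ * y.map φ = 1 := by
  rw [← Matrix.map_mul, h, Matrix.map_one _ (map_zero φ) (map_one φ)]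

end Corner

section Whitehead

variable {M : Type*} [Ring M] {ι : Type*} [Fintype ι] [DecidableEq ι]

/-- The product `E₁₂(a) E₂₁(-b) E₁₂(a)` of elementary matrices. -/
def elementaryProduct (a b : Matrix ι ι M) : (Matrix (ι ⊕ ι) (ι ⊕ ι) M)ˣ :=
  ⟨fromBlocks 1 a 0 1, fromBlocks 1 (-a) 0 1, by simp [fromBlocks_multiply],
    by simp [fromBlocks_multiply]⟩ *
  ⟨fromBlocks 1 0 (-b) 1, fromBlocks 1 0 b 1, by simp [fromBlocks_multiply],
    by simp [fromBlocks_multiply]⟩ *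
  ⟨fromBlocks 1 a 0 1, fromBlocks 1 (-a) 0 1, by simp [fromBlocks_multiply],
    by simp [fromBlocks_multiply]⟩

lemma elementaryProduct_val (a b : Matrix ι ι M) : (elementaryProduct a b).1 =
    fromBlocks 1 a 0 1 * fromBlocks 1 0 (-b) 1 * fromBlocks 1 a 0 1 := rfl

lemma mapUnit_elementaryProduct {N : Type*} [Ring N] (φ : M →+* N) (a b : Matrix ι ι M) :
    mapUnit φ (elementaryProduct a b) = elementaryProduct (a.map φ) (b.map φ) := Units.ext <| by
  change (elementaryProduct a b).1.map φ = _
  rw [elementaryProduct_val, elementaryProduct_val]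
  simp only [Matrix.map_mul, fromBlocks_map, Matrix.map_zero _ (map_zero φ),
    Matrix.map_one _ (map_zero φ) (map_one φ), Matrix.map_neg φ (map_neg φ)]

/-- Whitehead's lemma: `g ⊕ g⁻¹` is a product of elementary matrices. The second factor undoes the
block rotation contained in the first. -/
lemma elementaryProduct_unit (g : (Matrix ι ι M)ˣ) :
    elementaryProduct g.1 g⁻¹.1 * (elementaryProduct 1 1)⁻¹ = blockUnit g g⁻¹ := by
  rw [mul_inv_eq_iff_eq_mul]
  apply Units.ext
  rw [Units.val_mul, elementaryProduct_val, elementaryProduct_val]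
  change _ = fromBlocks g.1 0 0 g⁻¹.1 * _
  simp [fromBlocks_multiply]

end Whitehead

variable {R : Type*} [NormedRing R] [NormedAlgebra ℂ R] {T : Type*} [Ring T]

/-- The ring `T` is the ring of loops in `R` which are based at the scalars and constant modulo the
augmentation `ε`. -/
structure IsLoopAlgebra (ε : R →+* ℂ) (s : ℂ →+* T) (εT : T →+* ℂ) (j : T →+* C(I, R)) :
    Prop where
  continuous_aug : Continuous ε
  aug_algebraMap : ∀ c, ε (algebraMap ℂ R c) = c
  injective : Function.Injective j
  aug : ∀ x t, ε (j x t) = εT x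
  zero : ∀ x, j x 0 = algebraMap ℂ R (εT x)
  one : ∀ x, j x 1 = algebraMap ℂ R (εT x)
  scal : ∀ c, j (s c) = pathScal R c
  exists_eq : ∀ (f : C(I, R)) (c : ℂ), f 0 = algebraMap ℂ R c → f 1 = algebraMap ℂ R c →
    (∀ t, ε (f t) = c) → ∃ x, j x = f

variable {ι κ μ : Type*} [Fintype ι] [DecidableEq ι] [Fintype κ] [DecidableEq κ]
  [Fintype μ] [DecidableEq μ]
variable {ε : R →+* ℂ} {s : ℂ →+* T} {εT : T →+* ℂ} {j : T →+* C(I, R)}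

/-- The paths `t ↦ t a`. -/
def pathMul (a : Matrix ι ι R) : Matrix ι ι C(I, R) := fun i k =>
  ⟨fun t => ((t : ℝ) : ℂ) • a i k, by fun_prop⟩

/-- The elementary factors of `g ⊕ g⁻¹` are contracted to `1` by scaling their off-diagonal entries
with `t`. Since `g` and `1` have the same augmentation, the factors belonging to them cancel modulo
the augmentation at all times. -/
lemma exists_whitehead (hε : ∀ c, ε (algebraMap ℂ R c) = c) {g : (Matrix ι ι R)ˣ}
    (hg : mapUnit ε g = 1) : ∃ w : (Matrix (ι ⊕ ι) (ι ⊕ ι) C(I, R))ˣ, IsNormalised ε w ∧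
      mapUnit (pathEval 1) w = blockUnit g g⁻¹ := by
  have h0 : ∀ a : Matrix ι ι R, (pathMul a).map (pathEval 0) = 0 := fun a => by
    ext i k
    change (((0 : I) : ℝ) : ℂ) • a i k = 0
    simp
  have h1 : ∀ a : Matrix ι ι R, (pathMul a).map (pathEval 1) = a := fun a => by
    ext i k
    change (((1 : I) : ℝ) : ℂ) • a i k = a i k
    simp
  have ht : ∀ t, ∀ a : Matrix ι ι R, a.map ε = 1 →
      (pathMul a).map (ε.comp (pathEval t)) = (pathMul 1).map (ε.comp (pathEval t)) :=
    fun t a ha => by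
      have ha' : a.map ε = (1 : Matrix ι ι R).map ε := by
        rw [ha, Matrix.map_one _ (map_zero ε) (map_one ε)]
      ext i k
      change ε (((t : ℝ) : ℂ) • a i k) = ε (((t : ℝ) : ℂ) • (1 : Matrix ι ι R) i k)
      rw [Algebra.smul_def, Algebra.smul_def, map_mul, map_mul]
      exact congrArg _ (congrFun (congrFun ha' i) k)
  have hg1 : g.1.map ε = 1 := congrArg Units.val hg
  have hg2 : g⁻¹.1.map ε = 1 := congrArg Units.val
    (show mapUnit ε g⁻¹ = 1 by rw [mapUnit_inv, hg, inv_one])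
  refine ⟨elementaryProduct (pathMul g.1) (pathMul g⁻¹.1) *
    (elementaryProduct (pathMul 1) (pathMul 1))⁻¹, ⟨?_, fun t => ?_⟩, ?_⟩
  · rw [mapUnit_mul, mapUnit_inv, mapUnit_elementaryProduct, mapUnit_elementaryProduct, h0, h0, h0,
      mul_inv_cancel]
  · rw [mapUnit_mul, mapUnit_inv, mapUnit_elementaryProduct, mapUnit_elementaryProduct,
      ht t _ hg1, ht t _ hg2, mul_inv_cancel]
  · rw [mapUnit_mul, mapUnit_inv, mapUnit_elementaryProduct, mapUnit_elementaryProduct, h1, h1, h1,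
      elementaryProduct_unit]

namespace IsLoopAlgebra

variable (hj : IsLoopAlgebra ε s εT j)

lemma exists_matrix (hj : IsLoopAlgebra ε s εT j) {F : Matrix ι κ C(I, R)} {c : Matrix ι κ ℂ}
    (h0 : F.map (pathEval 0) = c.map (algebraMap ℂ R))
    (h1 : F.map (pathEval 1) = c.map (algebraMap ℂ R)) (ht : ∀ t, (F.map (pathEval t)).map ε = c) :
    ∃ X : Matrix ι κ T, X.map j = F ∧ X.map εT = c := by
  have h : ∀ i k, ∃ x, j x = F i k := fun i k => hj.exists_eq (F i k) (c i k)
    (congrFun (congrFun h0 i) k) (congrFun (congrFun h1 i) k)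
    fun t => congrFun (congrFun (ht t) i) k
  choose X hX using h
  refine ⟨X, Matrix.ext hX, Matrix.ext fun i k => ?_⟩
  change εT (X i k) = c i k
  rw [← hj.aug _ 0, hX]
  exact congrFun (congrFun (ht 0) i) k

lemma matrix_injective (hj : IsLoopAlgebra ε s εT j) {X Y : Matrix ι κ T}
    (h : X.map j = Y.map j) : X = Y :=
  Matrix.map_injective hj.injective h

lemma map_zero (hj : IsLoopAlgebra ε s εT j) (X : Matrix ι κ T) :
    (X.map j).map (pathEval 0) = (X.map εT).map (algebraMap ℂ R) := Matrix.ext fun _ _ => hj.zero _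

lemma map_one (hj : IsLoopAlgebra ε s εT j) (X : Matrix ι κ T) :
    (X.map j).map (pathEval 1) = (X.map εT).map (algebraMap ℂ R) := Matrix.ext fun _ _ => hj.one _

lemma map_aug (hj : IsLoopAlgebra ε s εT j) (X : Matrix ι κ T) (t : I) :
    ((X.map j).map (pathEval t)).map ε = X.map εT := Matrix.ext fun _ _ => hj.aug _ _

lemma aug_scal (hj : IsLoopAlgebra ε s εT j) (c : ℂ) : εT (s c) = c := by
  rw [← hj.aug _ 0, hj.scal]
  exact hj.aug_algebraMap c

end IsLoopAlgebra

lemma mat_aug_algebraMap (hj : IsLoopAlgebra ε s εT j) (c : Matrix ι κ ℂ) :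
    (c.map (algebraMap ℂ R)).map ε = c := Matrix.ext fun _ _ => hj.aug_algebraMap _

variable (ε εT j) in
/-- A path which conjugates the constant path with value the scalar part of `p` into `p`. -/
structure IsTransport (p : Matrix ι ι T) (w : (Matrix ι ι C(I, R))ˣ) : Prop where
  normalised : IsNormalised ε w
  conj : p.map j * w.1 = w.1 * (p.map εT).map (pathScal R)

/-- A loop has the same scalar value at both ends, so the end point of its transport commutes with
the scalar part. This allows restricting it to the range, where it is the monodromy. -/
lemma IsTransport.conj_one (hj : IsLoopAlgebra ε s εT j) {p : Matrix ι ι T}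
    {w : (Matrix ι ι C(I, R))ˣ} (h : IsTransport ε εT j p w) :
    (p.map εT).map (algebraMap ℂ R) * (mapUnit (pathEval 1) w).1
      = (mapUnit (pathEval 1) w).1 * (p.map εT).map (algebraMap ℂ R) := by
  have := congrArg (fun M => M.map (pathEval 1)) h.conj
  simp only [Matrix.map_mul] at this
  rw [hj.map_one] at this
  exact this

lemma IsLoopAlgebra.exists_transport [CompleteSpace R] (hj : IsLoopAlgebra ε s εT j)
    {p : Matrix ι ι T} (hp : p * p = p) : ∃ w, IsTransport ε εT j p w := by
  obtain ⟨w, h1, h2⟩ := exists_normalised_conjugation hj.continuous_aug hj.aug_algebraMap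
    (map_idem hp j) (hj.map_zero p) (hj.map_aug p)
  exact ⟨w, h1, h2⟩

/-- The path `w q w⁻¹` closes up to a loop because `w 1` commutes with `q`. -/
lemma IsLoopAlgebra.exists_idempotent (hj : IsLoopAlgebra ε s εT j) {w : (Matrix ι ι C(I, R))ˣ}
    (hw : IsNormalised ε w) {q : Matrix ι ι ℂ} (hq : q * q = q)
    (hqw : q.map (algebraMap ℂ R) * (mapUnit (pathEval 1) w).1
      = (mapUnit (pathEval 1) w).1 * q.map (algebraMap ℂ R)) :
    ∃ p : Matrix ι ι T, p * p = p ∧ p.map εT = q ∧ IsTransport ε εT j p w := by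
  have hF : ∀ t, (w.1 * q.map (pathScal R) * w⁻¹.1).map (pathEval t)
      = (mapUnit (pathEval t) w).1 * q.map (algebraMap ℂ R) * (mapUnit (pathEval t) w)⁻¹.1 :=
    fun t => by
      rw [Matrix.map_mul, Matrix.map_mul]
      rfl
  obtain ⟨p, hp1, hp2⟩ := hj.exists_matrix (F := w.1 * q.map (pathScal R) * w⁻¹.1) (c := q)
    (by rw [hF, hw.zero, inv_one, Units.val_one, mul_one, one_mul])
    (by rw [hF, ← hqw, Units.mul_inv_cancel_right])
    (fun t => by
      rw [hF, Matrix.map_mul, Matrix.map_mul, mat_aug_algebraMap hj]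
      have h1 : (mapUnit (pathEval t) w).1.map ε = 1 := hw.val_aug t
      have h2 : (mapUnit (pathEval t) w)⁻¹.1.map ε = 1 := hw.inv.val_aug t
      rw [h1, h2, mul_one, one_mul])
  refine ⟨p, hj.matrix_injective ?_, hp2, hw, ?_⟩
  · rw [Matrix.map_mul, hp1]
    have : w.1 * q.map (pathScal R) * w⁻¹.1 * (w.1 * q.map (pathScal R) * w⁻¹.1)
        = w.1 * (q.map (pathScal R) * (w⁻¹.1 * w.1) * q.map (pathScal R)) * w⁻¹.1 := by
      simp only [mul_assoc]
    rw [this, Units.inv_mul, mul_one, map_idem hq]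
  · rw [hp1, hp2, mul_assoc, Units.inv_mul, mul_one]

variable (ε εT j) in
/-- The idempotent matrix `p` of loops has the monodromy `g`, on its scalar part. -/
def Realizes (g : (Matrix ι ι R)ˣ) (p : Matrix κ κ T) : Prop :=
  p * p = p ∧ ∃ w, IsTransport ε εT j p w ∧ ∃ (x : Matrix ι κ ℂ) (y : Matrix κ ι ℂ), x * y = 1 ∧
    y * x = p.map εT ∧ (mapUnit (pathEval 1) w).1 * y.map (algebraMap ℂ R)
      = y.map (algebraMap ℂ R) * g.1

namespace Realizes

variable {g : (Matrix ι ι R)ˣ} {p : Matrix κ κ T}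

lemma one (hj : IsLoopAlgebra ε s εT j) :
    Realizes ε εT j (1 : (Matrix ι ι R)ˣ) (1 : Matrix ι ι T) := by
  have h1 : (1 : Matrix ι ι T).map j = 1 := Matrix.map_one _ (map_zero _) (map_one _)
  have h2 : (1 : Matrix ι ι T).map εT = 1 := Matrix.map_one _ (map_zero _) (map_one _)
  have h3 : (1 : Matrix ι ι ℂ).map (pathScal R) = 1 := Matrix.map_one _ (map_zero _) (map_one _)
  refine ⟨mul_one 1, 1, ⟨.one, ?_⟩, 1, 1, mul_one 1, ?_, ?_⟩
  · rw [h1, h2, h3, Units.val_one]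
  · rw [h2, mul_one]
  · rw [mapUnit_one, Units.val_one, one_mul, mul_one]

lemma blockSum {h : (Matrix μ μ R)ˣ} {ν : Type*} [Fintype ν] [DecidableEq ν] {q : Matrix ν ν T}
    (hg : Realizes ε εT j g p) (hh : Realizes ε εT j h q) :
    Realizes ε εT j (blockUnit g h) (fromBlocks p 0 0 q) := by
  obtain ⟨hp, w, hw, x, y, hxy, hyx, hwy⟩ := hg
  obtain ⟨hq, w', hw', x', y', hxy', hyx', hwy'⟩ := hh
  refine ⟨fromBlocks_idem hp hq, blockUnit w w', ⟨hw.normalised.blockUnit hw'.normalised, ?_⟩,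
    fromBlocks x 0 0 x', fromBlocks y 0 0 y', ?_, ?_, ?_⟩
  · change _ * fromBlocks w.1 0 0 w'.1 = fromBlocks w.1 0 0 w'.1 * _
    simp only [fromBlocks_map, Matrix.map_zero _ (map_zero _), fromBlocks_multiply,
      Matrix.mul_zero, Matrix.zero_mul, add_zero, zero_add, hw.conj, hw'.conj]
  · simp [fromBlocks_multiply, hxy, hxy', fromBlocks_one]
  · simp [fromBlocks_multiply, hyx, hyx', fromBlocks_map]
  · rw [mapUnit_blockUnit]
    change fromBlocks (mapUnit (pathEval 1) w).1 0 0 (mapUnit (pathEval 1) w').1 * _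
      = _ * fromBlocks g.1 0 0 h.1
    simp only [fromBlocks_map, Matrix.map_zero _ (map_zero _), fromBlocks_multiply,
      Matrix.mul_zero, Matrix.zero_mul, add_zero, zero_add, hwy, hwy']

/-- The monodromy can be conjugated by scalar matrices. -/
lemma of_similar {g' : (Matrix μ μ R)ˣ} (hg : Realizes ε εT j g p) {a : Matrix μ ι ℂ}
    {b : Matrix ι μ ℂ} (hab : a * b = 1) (hba : b * a = 1)
    (h : g.1 * b.map (algebraMap ℂ R) = b.map (algebraMap ℂ R) * g'.1) : Realizes ε εT j g' p := by
  obtain ⟨hp, w, hw, x, y, hxy, hyx, hwy⟩ := hg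
  refine ⟨hp, w, hw, a * x, y * b, ?_, ?_, ?_⟩
  · calc a * x * (y * b) = a * (x * y) * b := by simp only [Matrix.mul_assoc]
      _ = 1 := by rw [hxy, Matrix.mul_one, hab]
  · calc y * b * (a * x) = y * (b * a) * x := by simp only [Matrix.mul_assoc]
      _ = _ := by rw [hba, Matrix.mul_one, hyx]
  · rw [Matrix.map_mul, ← Matrix.mul_assoc, hwy, Matrix.mul_assoc, h, Matrix.mul_assoc]

/-- The monodromy can be changed by the endpoints of normalised paths. -/
lemma homotopy (hg : Realizes ε εT j g p) {g' : (Matrix ι ι R)ˣ}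
    {h : (Matrix ι ι C(I, R))ˣ} (hh : IsNormalised ε h) (h1 : g * mapUnit (pathEval 1) h = g') :
    Realizes ε εT j g' p := by
  obtain ⟨hp, w, hw, x, y, hxy, hyx, hwy⟩ := hg
  have hE := mul_map_eq_one (pathScal R) hxy
  -- `h` is carried to the range of the scalar part by the corner embedding and extended by `1`. It
  -- commutes with the scalar part, so `w * H` is again a transport of `p`.
  let H := Units.map (cornerHom _ _ hE) h
  have hH : ∀ {S : Type _} [Ring S] (φ : C(I, R) →+* S), mapUnit φ H
      = Units.map (cornerHom _ _ (mul_map_eq_one φ hE)) (mapUnit φ h) := fun φ =>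
    Units.ext (cornerHom_map φ _ _ _)
  have hH' : ∀ φ : C(I, R) →+* ℂ, mapUnit φ H
      = Units.map (cornerHom _ _ (mul_map_eq_one φ hE)) (mapUnit φ h) := fun φ =>
    Units.ext (cornerHom_map φ _ _ _)
  refine ⟨hp, w * H, ⟨hw.normalised.mul ⟨?_, fun t => ?_⟩, ?_⟩, x, y, hxy, hyx, ?_⟩
  · rw [hH, hh.zero, map_one]
  · rw [hH', hh.aug, map_one]
  · have : (p.map εT).map (pathScal R) * H.1 = H.1 * (p.map εT).map (pathScal R) := by
      rw [← hyx, Matrix.map_mul]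
      set X := x.map (pathScal R)
      set Y := y.map (pathScal R)
      have e1 : Y * X * (Y * h.1 * X) = Y * (X * Y) * h.1 * X := by simp only [Matrix.mul_assoc]
      have e2 : Y * h.1 * X * (Y * X) = Y * h.1 * (X * Y) * X := by simp only [Matrix.mul_assoc]
      have e3 : Y * X * (Y * X) = Y * (X * Y) * X := by simp only [Matrix.mul_assoc]
      rw [hE, Matrix.mul_one] at e1 e2 e3
      change Y * X * (Y * h.1 * X + (1 - Y * X)) = (Y * h.1 * X + (1 - Y * X)) * (Y * X)
      rw [mul_add, add_mul, e1, e2, mul_sub, sub_mul, mul_one, one_mul]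
    rw [Units.val_mul, ← mul_assoc, hw.conj, mul_assoc, this, mul_assoc]
  · have e : (mapUnit (pathEval 1) H).1 * y.map (algebraMap ℂ R)
        = y.map (algebraMap ℂ R) * (mapUnit (pathEval 1) h).1 := by
      rw [hH]
      set X := x.map (algebraMap ℂ R)
      set Y := y.map (algebraMap ℂ R)
      have hXY : X * Y = 1 := mul_map_eq_one (algebraMap ℂ R) hxy
      change (Y * (mapUnit (pathEval 1) h).1 * X + (1 - Y * X)) * Y = _
      rw [Matrix.add_mul, Matrix.sub_mul, Matrix.mul_assoc, hXY, Matrix.mul_one, Matrix.one_mul,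
        Matrix.mul_assoc, hXY, Matrix.mul_one, sub_self, add_zero]
    rw [mapUnit_mul, Units.val_mul, Matrix.mul_assoc, e, ← Matrix.mul_assoc, hwy, ← h1,
      Units.val_mul, Matrix.mul_assoc]

/-- Since `w 1` commutes with `y * x`, the matrix `x` intertwines it with `g` just as `y` does. -/
lemma comm_left (hj : IsLoopAlgebra ε s εT j) {w : (Matrix κ κ C(I, R))ˣ}
    (hw : IsTransport ε εT j p w) {x : Matrix ι κ ℂ} {y : Matrix κ ι ℂ} (hxy : x * y = 1)
    (hyx : y * x = p.map εT) (hwy : (mapUnit (pathEval 1) w).1 * y.map (algebraMap ℂ R)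
      = y.map (algebraMap ℂ R) * g.1) :
    x.map (algebraMap ℂ R) * (mapUnit (pathEval 1) w).1 = g.1 * x.map (algebraMap ℂ R) := by
  have h1 := hw.conj_one hj
  rw [← hyx, Matrix.map_mul] at h1
  have hXY := mul_map_eq_one (algebraMap ℂ R) hxy
  set X := x.map (algebraMap ℂ R)
  set Y := y.map (algebraMap ℂ R)
  set m := (mapUnit (pathEval 1) w).1
  calc X * m = (X * Y) * X * m := by rw [hXY, Matrix.one_mul]
    _ = X * (Y * X * m) := by simp only [Matrix.mul_assoc]
    _ = X * (m * Y) * X := by rw [h1]; simp only [Matrix.mul_assoc]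
    _ = (X * Y) * g.1 * X := by rw [hwy]; simp only [Matrix.mul_assoc]
    _ = g.1 * X := by rw [hXY, Matrix.one_mul]

/-- The path `w z w'⁻¹` starts at `z` and, because `z` intertwines the end points of `w` and `w'`,
also ends there; so it comes from a matrix over `T`. -/
lemma exists_intertwiner (hj : IsLoopAlgebra ε s εT j) {w : (Matrix κ κ C(I, R))ˣ}
    {w' : (Matrix μ μ C(I, R))ˣ} (hw : IsNormalised ε w) (hw' : IsNormalised ε w')
    {z : Matrix κ μ ℂ} (hz : (mapUnit (pathEval 1) w).1 * z.map (algebraMap ℂ R)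
      = z.map (algebraMap ℂ R) * (mapUnit (pathEval 1) w').1) :
    ∃ X : Matrix κ μ T, X.map j = w.1 * z.map (pathScal R) * w'⁻¹.1 := by
  have hF : ∀ t, (w.1 * z.map (pathScal R) * w'⁻¹.1).map (pathEval t)
      = (mapUnit (pathEval t) w).1 * z.map (algebraMap ℂ R) * (mapUnit (pathEval t) w')⁻¹.1 :=
    fun t => by
      rw [Matrix.map_mul, Matrix.map_mul]
      rfl
  obtain ⟨X, hX, -⟩ := hj.exists_matrix (F := w.1 * z.map (pathScal R) * w'⁻¹.1) (c := z)
    (by rw [hF, hw.zero, hw'.zero, inv_one, Units.val_one, Units.val_one, Matrix.mul_one,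
      Matrix.one_mul])
    (by rw [hF, hz, Matrix.mul_assoc, Units.mul_inv, Matrix.mul_one])
    (fun t => by
      rw [hF, Matrix.map_mul, Matrix.map_mul, mat_aug_algebraMap hj]
      have h1 : (mapUnit (pathEval t) w).1.map ε = 1 := hw.val_aug t
      have h2 : (mapUnit (pathEval t) w')⁻¹.1.map ε = 1 := hw'.inv.val_aug t
      rw [h1, h2, Matrix.mul_one, Matrix.one_mul])
  exact ⟨X, hX⟩

/-- The monodromy determines an idempotent matrix of loops up to equivalence. -/
lemma mvN (hj : IsLoopAlgebra ε s εT j) {q : Matrix μ μ T} (hp : Realizes ε εT j g p)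
    (hq : Realizes ε εT j g q) : MvN p q := by
  obtain ⟨hp, w, hw, x, y, hxy, hyx, hwy⟩ := hp
  obtain ⟨hq, w', hw', x', y', hxy', hyx', hwy'⟩ := hq
  obtain ⟨X, hX⟩ := exists_intertwiner hj hw.normalised hw'.normalised (z := y * x') (by
    rw [Matrix.map_mul, ← Matrix.mul_assoc, hwy, Matrix.mul_assoc,
      ← comm_left hj hw' hxy' hyx' hwy', Matrix.mul_assoc])
  obtain ⟨Y, hY⟩ := exists_intertwiner hj hw'.normalised hw.normalised (z := y' * x) (by
    rw [Matrix.map_mul, ← Matrix.mul_assoc, hwy', Matrix.mul_assoc,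
      ← comm_left hj hw hxy hyx hwy, Matrix.mul_assoc])
  have e1 : (y * x') * (y' * x) = y * x := by
    calc (y * x') * (y' * x) = y * (x' * y') * x := by simp only [Matrix.mul_assoc]
      _ = _ := by rw [hxy', Matrix.mul_one]
  have e2 : (y' * x) * (y * x') = y' * x' := by
    calc (y' * x) * (y * x') = y' * (x * y) * x' := by simp only [Matrix.mul_assoc]
      _ = _ := by rw [hxy, Matrix.mul_one]
  refine ⟨X, Y, hj.matrix_injective ?_, hj.matrix_injective ?_⟩
  · rw [Matrix.map_mul, hX, hY]
    calc w.1 * (y * x').map (pathScal R) * w'⁻¹.1 * (w'.1 * (y' * x).map (pathScal R) * w⁻¹.1)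
        = w.1 * ((y * x').map (pathScal R) * (w'⁻¹.1 * w'.1) * (y' * x).map (pathScal R)) *
          w⁻¹.1 := by simp only [Matrix.mul_assoc]
      _ = p.map j := by
        rw [Units.inv_mul, Matrix.mul_one, ← Matrix.map_mul, e1, hyx, ← hw.conj,
          Units.mul_inv_cancel_right]
  · rw [Matrix.map_mul, hX, hY]
    calc w'.1 * (y' * x).map (pathScal R) * w⁻¹.1 * (w.1 * (y * x').map (pathScal R) * w'⁻¹.1)
        = w'.1 * ((y' * x).map (pathScal R) * (w⁻¹.1 * w.1) * (y * x').map (pathScal R)) *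
          w'⁻¹.1 := by simp only [Matrix.mul_assoc]
      _ = q.map j := by
        rw [Units.inv_mul, Matrix.mul_one, ← Matrix.map_mul, e2, hyx', ← hw'.conj,
          Units.mul_inv_cancel_right]

/-- Every invertible matrix with trivial augmentation is the monodromy of an idempotent matrix of
loops. -/
lemma exists_idempotent (hj : IsLoopAlgebra ε s εT j) {g : (Matrix ι ι R)ˣ}
    (hg : mapUnit ε g = 1) : ∃ p : Matrix (ι ⊕ ι) (ι ⊕ ι) T, Realizes ε εT j g p := by
  -- The path from `1` to `g ⊕ g⁻¹` has a block diagonal end point, so it conjugates `1 ⊕ 0` into a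
  -- loop, whose monodromy is the first block `g`.
  obtain ⟨w, hw, hw1⟩ := exists_whitehead hj.aug_algebraMap hg
  obtain ⟨p, hp, hp0, hpw⟩ := hj.exists_idempotent hw (q := fromBlocks 1 0 0 0)
    (by simp [fromBlocks_multiply]) (by
      rw [hw1]
      change _ * fromBlocks g.1 0 0 g⁻¹.1 = fromBlocks g.1 0 0 g⁻¹.1 * _
      simp [fromBlocks_map, fromBlocks_multiply])
  refine ⟨p, hp, w, hpw, fromCols 1 0, fromRows 1 0, ?_, ?_, ?_⟩
  · simp [fromCols_mul_fromRows]
  · rw [hp0, fromRows_mul_fromCols]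
    simp
  · have : (blockUnit g g⁻¹).1 = fromBlocks g.1 0 0 g⁻¹.1 := rfl
    rw [hw1, this, fromRows_map, fromBlocks_mul_fromRows, fromRows_mul]
    simp

/-- `(g ⊕ h)(h ⊕ h⁻¹) = g h ⊕ 1`, and `h ⊕ h⁻¹` is the end point of a normalised path; so both block
sums realise `g h ⊕ 1`. -/
lemma mul (hj : IsLoopAlgebra ε s εT j) {g h : (Matrix ι ι R)ˣ} (hh : mapUnit ε h = 1)
    {ν : Type*} [Fintype ν] [DecidableEq ν] {p : Matrix κ κ T} {q : Matrix μ μ T}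
    {r : Matrix ν ν T} (hp : Realizes ε εT j g p)
    (hq : Realizes ε εT j h q) (hr : Realizes ε εT j (g * h) r) :
    MvN (fromBlocks p 0 0 q) (fromBlocks r 0 0 (1 : Matrix ι ι T)) := by
  obtain ⟨w, hw, hw1⟩ := exists_whitehead hj.aug_algebraMap hh
  refine ((hp.blockSum hq).homotopy hw ?_).mvN hj (hr.blockSum (one hj))
  rw [hw1]
  apply Units.ext
  change fromBlocks g.1 0 0 h.1 * fromBlocks h.1 0 0 h⁻¹.1 = fromBlocks (g * h).1 0 0 1
  simp [fromBlocks_multiply]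

end Realizes

end Loops

/-! ### The map from `K₁` to `K₀` of the loop algebra. -/

section LoopK0

open Matrix unitInterval

section CornerUnit

/-- The extension of an invertible element of a corner by `1`. -/
def cornerUnit {M : Type*} [Ring M] {e a b : M} (hab : a * b = e) (hba : b * a = e)
    (ha : e * a = a) (ha' : a * e = a) (hb : e * b = b) (hb' : b * e = b) : Mˣ where
  val := a + (1 - e)
  inv := b + (1 - e)
  val_inv := by
    have he : e * e = e := by rw [← hab, ← mul_assoc, mul_assoc a, hba, ha']
    rw [add_mul, mul_add, mul_add, mul_sub, mul_sub, sub_mul, hab, ha', hb, mul_one,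
      one_mul, mul_one, sub_mul, he]
    simp
  inv_val := by
    have he : e * e = e := by rw [← hab, ← mul_assoc, mul_assoc a, hba, ha']
    rw [add_mul, mul_add, mul_add, mul_sub, mul_sub, sub_mul, hba, hb', ha, mul_one,
      one_mul, mul_one, sub_mul, he]
    simp

/-- The restriction of an invertible element to the range of an idempotent which commutes with it,
extended by `1`. -/
def cutUnit {M : Type*} [Ring M] {e : M} (he : e * e = e) (m : Mˣ) (hm : e * m = m * e) : Mˣ :=
  cornerUnit (e := e) (a := m.1 * e) (b := m⁻¹.1 * e)
    (by rw [mul_assoc, ← mul_assoc e, mul_unit_inv hm, mul_assoc, he, ← mul_assoc, Units.mul_inv,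
      one_mul])
    (by rw [mul_assoc, ← mul_assoc e, hm, mul_assoc, he, ← mul_assoc, Units.inv_mul, one_mul])
    (by rw [← mul_assoc, hm, mul_assoc, he]) (by rw [mul_assoc, he])
    (by rw [← mul_assoc, mul_unit_inv hm, mul_assoc, he]) (by rw [mul_assoc, he])

lemma cutUnit_val {M : Type*} [Ring M] {e : M} (he : e * e = e) (m : Mˣ) (hm : e * m = m * e) :
    (cutUnit he m hm).1 = m.1 * e + (1 - e) := rfl

variable {R : Type*} [Ring R] [TopologicalSpace R] {ι κ : Type*} [Fintype ι] [DecidableEq ι]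
  [Fintype κ] [DecidableEq κ]

/-- Isomorphic automorphisms of idempotent matrices have the same class in `K₁`. -/
lemma k1_corner {x : Matrix ι κ R} {y : Matrix κ ι R} {e : Matrix ι ι R} {f : Matrix κ κ R}
    (hxy : x * y = e) (hyx : y * x = f) (hx : x * f = x) (hy : f * y = y) {g : (Matrix ι ι R)ˣ}
    {u : (Matrix κ κ R)ˣ} {a : Matrix κ κ R} (ha : f * a = a) (ha' : a * f = a)
    (hu : u.1 = a + (1 - f)) (hg : g.1 = x * a * y + (1 - e)) : k1 g = k1 u := by
  have hex : e * x = x := by rw [← hxy, Matrix.mul_assoc, hyx, hx]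
  have hye : y * e = y := by rw [← hxy, ← Matrix.mul_assoc, hyx, hy]
  have he : e * e = e := by rw [← hxy, Matrix.mul_assoc, ← Matrix.mul_assoc y, hyx, hy]
  have hf : f * f = f := by rw [← hyx, Matrix.mul_assoc, ← Matrix.mul_assoc x, hxy, hex]
  have he' : (1 - e) * (1 - e) = 1 - e := IsIdempotentElem.one_sub he
  have hf' : (1 - f) * (1 - f) = 1 - f := IsIdempotentElem.one_sub hf
  have hs : fromBlocks (1 - e) x y (1 - f) * fromBlocks (1 - e) x y (1 - f)
      = (1 : Matrix (ι ⊕ κ) (ι ⊕ κ) R) := by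
    have h1 : (1 - e) * x + x * (1 - f) = 0 := by
      rw [Matrix.sub_mul, Matrix.mul_sub, hex, hx, Matrix.mul_one, Matrix.one_mul, sub_self,
        add_zero]
    have h2 : y * (1 - e) + (1 - f) * y = 0 := by
      rw [Matrix.sub_mul, Matrix.mul_sub, hye, hy, Matrix.mul_one, Matrix.one_mul, sub_self,
        add_zero]
    rw [fromBlocks_multiply, hxy, hyx, h1, h2, he', hf', sub_add_cancel, add_sub_cancel,
      fromBlocks_one]
  -- A symmetry exchanging the ranges of `e` and `f` by means of `x` and `y`; conjugation by it
  -- carries `g ⊕ 1` to `1 ⊕ u`.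
  let s : (Matrix (ι ⊕ κ) (ι ⊕ κ) R)ˣ := ⟨_, _, hs, hs⟩
  rw [← k1_blockUnit_one (κ := κ) g, ← k1_blockUnit_one_left (ι := ι) u, ← k1_conj s]
  congr 1
  rw [mul_inv_eq_iff_eq_mul]
  apply Units.ext
  change fromBlocks (1 - e) x y (1 - f) * fromBlocks g.1 0 0 1
    = fromBlocks 1 0 0 u.1 * fromBlocks (1 - e) x y (1 - f)
  have h1 : y * (x * a * y + (1 - e)) = a * y := by
    rw [Matrix.mul_add, ← Matrix.mul_assoc, ← Matrix.mul_assoc, hyx, ha, Matrix.mul_sub, hye,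
      Matrix.mul_one, sub_self, add_zero]
  have h2 : (1 - e) * (x * a * y + (1 - e)) = 1 - e := by
    have : e * (x * a * y) = x * a * y := by
      rw [← Matrix.mul_assoc, ← Matrix.mul_assoc, hex]
    rw [Matrix.mul_add, Matrix.sub_mul, this, Matrix.one_mul, sub_self, zero_add, he']
  have h3 : (a + (1 - f)) * y = a * y := by
    rw [Matrix.add_mul, Matrix.sub_mul, hy, Matrix.one_mul, sub_self, add_zero]
  have h4 : (a + (1 - f)) * (1 - f) = 1 - f := by
    rw [Matrix.add_mul, Matrix.mul_sub a, ha', Matrix.mul_one, sub_self, zero_add, hf']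
  rw [fromBlocks_multiply, fromBlocks_multiply, hg, hu]
  simp only [Matrix.mul_zero, Matrix.zero_mul, add_zero, zero_add, Matrix.mul_one, Matrix.one_mul,
    h1, h2, h3, h4]

end CornerUnit

variable {R : Type u} [NormedRing R] [NormedAlgebra ℂ R] {T : Type v} [Ring T]
variable {ι κ μ : Type*} [Fintype ι] [DecidableEq ι] [Fintype κ] [DecidableEq κ]
  [Fintype μ] [DecidableEq μ]
variable {ε : R →+* ℂ} {s : ℂ →+* T} {εT : T →+* ℂ} {j : T →+* C(I, R)}

/-- A path of invertible matrices, as an invertible matrix of paths. -/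
def pathUnit (f : C(I, (Matrix ι ι R)ˣ)) : (Matrix ι ι C(I, R))ˣ where
  val := Matrix.of fun i k =>
    ⟨fun t => (f t).1 i k, (Units.continuous_val.comp f.continuous).matrix_elem i k⟩
  inv := Matrix.of fun i k =>
    ⟨fun t => (f t)⁻¹.1 i k, (Units.continuous_coe_inv.comp f.continuous).matrix_elem i k⟩
  val_inv := matrix_path_ext fun t => by
    rw [Matrix.map_mul, Matrix.map_one _ (map_zero _) (map_one _)]
    exact (f t).3
  inv_val := matrix_path_ext fun t => by
    rw [Matrix.map_mul, Matrix.map_one _ (map_zero _) (map_one _)]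
    exact (f t).4

lemma mapUnit_pathUnit (f : C(I, (Matrix ι ι R)ˣ)) (t : I) :
    mapUnit (pathEval t) (pathUnit f) = f t := Units.ext rfl

lemma joined_mapUnit_pathEval (w : (Matrix ι ι C(I, R))ˣ) :
    Joined (mapUnit (pathEval 0) w) (mapUnit (pathEval 1) w) := by
  refine ⟨⟨⟨fun t => mapUnit (pathEval t) w, Units.continuous_iff.2 ⟨?_, ?_⟩⟩, rfl, rfl⟩⟩
  · exact continuous_matrix fun i k => (w.1 i k).continuous
  · exact continuous_matrix fun i k => (w.2 i k).continuous

variable (ε) in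
/-- An invertible matrix, divided by its scalar part. -/
def normUnit (g : (Matrix ι ι R)ˣ) : (Matrix ι ι R)ˣ :=
  g * (mapUnit ((algebraMap ℂ R).comp ε) g)⁻¹

lemma mapUnit_aug_scal (hj : IsLoopAlgebra ε s εT j) (g : (Matrix ι ι R)ˣ) :
    mapUnit ε (mapUnit ((algebraMap ℂ R).comp ε) g) = mapUnit ε g := by
  rw [mapUnit_mapUnit, ← RingHom.comp_assoc]
  congr 1
  exact RingHom.ext fun x => hj.aug_algebraMap _

lemma mapUnit_normUnit (hj : IsLoopAlgebra ε s εT j) (g : (Matrix ι ι R)ˣ) :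
    mapUnit ε (normUnit ε g) = 1 := by
  rw [normUnit, mapUnit_mul, mapUnit_inv, mapUnit_aug_scal hj, mul_inv_cancel]

lemma normUnit_eq {g : (Matrix ι ι R)ˣ} (hg : mapUnit ε g = 1) : normUnit ε g = g := by
  rw [normUnit, ← mapUnit_mapUnit, hg, mapUnit_one, inv_one, mul_one]

/-- `g⁻¹ f` is a normalised path from `1` to `g⁻¹ g'`. -/
lemma Realizes.of_path {g g' : (Matrix ι ι R)ˣ} {p : Matrix κ κ T} (hg : Realizes ε εT j g p)
    (f : C(I, (Matrix ι ι R)ˣ)) (h0 : f 0 = g) (h1 : f 1 = g') (ht : ∀ t, mapUnit ε (f t) = 1) :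
    Realizes ε εT j g' p := by
  refine hg.homotopy (h := mapUnit pathConst g⁻¹ * pathUnit f) ⟨?_, fun t => ?_⟩ ?_
  · rw [mapUnit_mul, mapUnit_pathUnit, h0]
    change g⁻¹ * g = 1
    rw [inv_mul_cancel]
  · rw [mapUnit_mul, ← mapUnit_mapUnit, ← mapUnit_mapUnit, mapUnit_pathUnit, ht, mul_one]
    change mapUnit ε g⁻¹ = 1
    rw [mapUnit_inv, ← h0, ht, inv_one]
  · rw [mapUnit_mul, mapUnit_pathUnit, h1]
    change g * (g⁻¹ * g') = g'
    rw [mul_inv_cancel_left]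

lemma Realizes.reindex {g : (Matrix ι ι R)ˣ} {p : Matrix κ κ T} (hg : Realizes ε εT j g p)
    (τ : ι ≃ μ) : Realizes ε εT j (reindexUnit τ g) p := by
  refine hg.of_similar (a := (1 : Matrix ι ι ℂ).submatrix τ.symm id)
    (b := (1 : Matrix ι ι ℂ).submatrix id τ.symm) ?_ ?_ ?_
  · rw [← Matrix.submatrix_mul _ _ _ _ _ Function.bijective_id, one_mul,
      Matrix.submatrix_one_equiv]
  · rw [Matrix.submatrix_mul_equiv, one_mul, Matrix.submatrix_id_id]
  · have : ((1 : Matrix ι ι ℂ).submatrix id τ.symm).map (algebraMap ℂ R)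
        = (1 : Matrix ι ι R).submatrix id τ.symm := by
      rw [← Matrix.submatrix_map, Matrix.map_one _ (map_zero _) (map_one _)]
    rw [this]
    change _ = (1 : Matrix ι ι R).submatrix id τ.symm * g.1.submatrix τ.symm τ.symm
    rw [Matrix.submatrix_mul_equiv, one_mul, ← Matrix.submatrix_id_id g.1,
      ← Matrix.submatrix_mul _ _ _ _ _ Function.bijective_id, mul_one]
    rfl

lemma Realizes.exists_normUnit (hj : IsLoopAlgebra ε s εT j) (g : (Matrix ι ι R)ˣ) :
    ∃ p : Matrix (ι ⊕ ι) (ι ⊕ ι) T, Realizes ε εT j (normUnit ε g) p :=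
  Realizes.exists_idempotent hj (mapUnit_normUnit hj g)

/-- The class of loops attached to an invertible matrix. -/
def loopClass (hj : IsLoopAlgebra ε s εT j) (g : (Matrix ι ι R)ˣ) : RingK0 T :=
  k0 _ (Realizes.exists_normUnit hj g).choose_spec.1 - k0 (1 : Matrix ι ι T) (mul_one 1)

lemma loopClass_eq (hj : IsLoopAlgebra ε s εT j) {g : (Matrix ι ι R)ˣ} {p : Matrix κ κ T}
    (h : Realizes ε εT j (normUnit ε g) p) :
    loopClass hj g = k0 p h.1 - k0 (1 : Matrix ι ι T) (mul_one 1) := by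
  rw [loopClass]
  congr 1
  exact k0_eq_of_mvn _ _ ((Realizes.exists_normUnit hj g).choose_spec.mvN hj h)

lemma k0_one_sum : k0 (1 : Matrix (ι ⊕ κ) (ι ⊕ κ) T) (mul_one 1)
    = k0 (1 : Matrix ι ι T) (mul_one 1) + k0 (1 : Matrix κ κ T) (mul_one 1) := by
  rw [← k0_fromBlocks]
  simp only [fromBlocks_one]

lemma k0_one_equiv (τ : ι ≃ κ) : k0 (1 : Matrix κ κ T) (mul_one 1)
    = k0 (1 : Matrix ι ι T) (mul_one 1) :=
  k0_eq_of_mvn _ _ (by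
    have := MvN.submatrix (mul_one (1 : Matrix ι ι T)) τ.symm
    rwa [Matrix.submatrix_one_equiv] at this)

/-- Normalisation is multiplicative only up to conjugating the second factor by the scalar part `c`
of `g`. Such a conjugation does not change which idempotents realise it, so `Realizes.mul` applies.
-/
lemma loopClass_mul (hj : IsLoopAlgebra ε s εT j) (g h : (Matrix ι ι R)ˣ) :
    loopClass hj (g * h) = loopClass hj g + loopClass hj h := by
  obtain ⟨p, hp⟩ := Realizes.exists_normUnit hj g
  obtain ⟨q, hq⟩ := Realizes.exists_normUnit hj h
  obtain ⟨r, hr⟩ := Realizes.exists_normUnit hj (g * h)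
  rw [loopClass_eq hj hp, loopClass_eq hj hq, loopClass_eq hj hr]
  set c := mapUnit ((algebraMap ℂ R).comp ε) g with hc
  have hq' : Realizes ε εT j (c * normUnit ε h * c⁻¹) q := by
    refine hq.of_similar (a := (mapUnit ε g).1) (b := (mapUnit ε g)⁻¹.1) (Units.mul_inv _)
      (Units.inv_mul _) ?_
    change (normUnit ε h).1 * c⁻¹.1 = c⁻¹.1 * (c * normUnit ε h * c⁻¹).1
    rw [← Units.val_mul, ← Units.val_mul]
    congr 1
    group
  have e1 : normUnit ε (g * h) = normUnit ε g * (c * normUnit ε h * c⁻¹) := by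
    rw [normUnit, normUnit, normUnit, mapUnit_mul, ← hc]
    group
  have e2 : mapUnit ε (c * normUnit ε h * c⁻¹) = 1 := by
    rw [mapUnit_mul, mapUnit_mul, mapUnit_normUnit hj, mapUnit_inv, mul_one, mul_inv_cancel]
  rw [e1] at hr
  have key := k0_eq_of_mvn (fromBlocks_idem hp.1 hq'.1) (fromBlocks_idem hr.1 (mul_one 1))
    (Realizes.mul hj e2 hp hq' hr)
  rw [k0_fromBlocks hp.1 hq'.1, k0_fromBlocks hr.1 (mul_one 1)] at key
  rw [eq_sub_of_add_eq key.symm]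
  abel

/-- Normalisation is continuous and turns the path of units into one of trivial augmentation, along
which the same idempotent realises every point. -/
lemma loopClass_joined (hj : IsLoopAlgebra ε s εT j) {g h : (Matrix ι ι R)ˣ} (hgh : Joined g h) :
    loopClass hj g = loopClass hj h := by
  obtain ⟨γ⟩ := hgh
  obtain ⟨p, hp⟩ := Realizes.exists_normUnit hj g
  have hc : Continuous fun u : (Matrix ι ι R)ˣ => normUnit ε u := by
    have : Continuous (mapUnit ((algebraMap ℂ R).comp ε) : (Matrix ι ι R)ˣ → (Matrix ι ι R)ˣ) :=
      Continuous.units_map _ (Continuous.matrix_map continuous_id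
        ((algebraMapCLM ℂ R).continuous.comp hj.continuous_aug))
    exact continuous_id.mul this.inv
  rw [loopClass_eq hj hp, loopClass_eq hj (hp.of_path (g' := normUnit ε h)
    ⟨fun t => normUnit ε (γ t), hc.comp γ.continuous⟩ ?_ ?_ fun t => mapUnit_normUnit hj _)]
  · change normUnit ε (γ 0) = _
    rw [γ.source]
  · change normUnit ε (γ 1) = _
    rw [γ.target]

/-- A block `1` adds an identity matrix to the realising idempotent, and the subtracted term grows
by the same class. -/
lemma loopClass_stab (hj : IsLoopAlgebra ε s εT j) (g : (Matrix ι ι R)ˣ) (τ : ι ⊕ κ ≃ μ) :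
    loopClass hj (reindexUnit τ (blockUnit g (1 : (Matrix κ κ R)ˣ))) = loopClass hj g := by
  obtain ⟨p, hp⟩ := Realizes.exists_normUnit hj g
  have e1 : normUnit ε (reindexUnit τ (blockUnit g (1 : (Matrix κ κ R)ˣ)))
      = reindexUnit τ (blockUnit (normUnit ε g) 1) := by
    rw [normUnit, normUnit, mul_inv_eq_iff_eq_mul]
    have h1 : mapUnit ((algebraMap ℂ R).comp ε) (reindexUnit τ (blockUnit g (1 : (Matrix κ κ R)ˣ)))
        = reindexUnit τ (blockUnit (mapUnit ((algebraMap ℂ R).comp ε) g) 1) := by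
      have := mapUnit_blockUnit ((algebraMap ℂ R).comp ε) g (1 : (Matrix κ κ R)ˣ)
      rw [mapUnit_one] at this
      rw [← this]
      exact Units.ext rfl
    rw [h1]
    apply Units.ext
    change (fromBlocks g.1 0 0 1).submatrix τ.symm τ.symm = (fromBlocks (g * _).1 0 0 1).submatrix
      τ.symm τ.symm * (fromBlocks _ 0 0 1).submatrix τ.symm τ.symm
    rw [Matrix.submatrix_mul_equiv, fromBlocks_multiply]
    simp only [Matrix.mul_zero, Matrix.zero_mul, add_zero, zero_add, Matrix.mul_one]
    congr 2
    rw [← Units.val_mul, inv_mul_cancel_right]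
  have h2 := (hp.blockSum (Realizes.one (ι := κ) hj)).reindex τ
  rw [← e1] at h2
  rw [loopClass_eq hj hp, loopClass_eq hj h2, k0_fromBlocks hp.1 (mul_one 1), k0_one_equiv τ,
    k0_one_sum]
  abel

/-- The homomorphism `K₁(R) → K₀(T)` which maps `[g]` to the class of a projection with monodromy
`g`. -/
def loopMap (hj : IsLoopAlgebra ε s εT j) : RingK1 R →+ RingK0 T :=
  RingK1.lift (fun {n} g => loopClass hj g) (fun g h => loopClass_mul hj g h)
    (fun {m n} g g' h => by
      obtain rfl : g' = reindexUnit finSumFinEquiv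
        (blockUnit g (1 : (Matrix (Fin n) (Fin n) R)ˣ)) := Units.ext h
      exact loopClass_stab hj g _)
    (fun g h hgh => loopClass_joined hj hgh)

lemma loopMap_k1 (hj : IsLoopAlgebra ε s εT j) (g : (Matrix ι ι R)ˣ) :
    loopMap hj (k1 g) = loopClass hj g := by
  change loopClass hj (reindexUnit (Fintype.equivFin ι) g) = _
  -- With an empty second block, invariance under stabilisation becomes invariance under renaming
  -- the indices.
  let τ : ι ⊕ Fin 0 ≃ Fin (Fintype.card ι) := (Equiv.sumEmpty ι (Fin 0)).trans (Fintype.equivFin ι)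
  rw [← loopClass_stab (κ := Fin 0) hj g τ]
  congr 1

end LoopK0

/-! ### The monodromy map and the suspension isomorphism for loop algebras. -/

section Monodromy

open Matrix unitInterval

variable {R : Type u} [NormedRing R] [NormedAlgebra ℂ R] {T : Type v} [Ring T]
variable {ι κ μ : Type*} [Fintype ι] [DecidableEq ι] [Fintype κ] [DecidableEq κ]
  [Fintype μ] [DecidableEq μ]
variable {ε : R →+* ℂ} {s : ℂ →+* T} {εT : T →+* ℂ} {j : T →+* C(I, R)}

/-- The equivalence of idempotent matrices can be implemented by matrices in the corner. -/
lemma MvN.exists_corner {S : Type*} [Ring S] {p : Matrix ι ι S} {q : Matrix κ κ S}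
    (hp : p * p = p) (hq : q * q = q) (h : MvN p q) : ∃ (x : Matrix ι κ S) (y : Matrix κ ι S),
      x * y = p ∧ y * x = q ∧ x * q = x ∧ y * p = y := by
  obtain ⟨x, y, hxy, hyx⟩ := h
  have e1 : p * x = x * q := by rw [← hxy, ← hyx, Matrix.mul_assoc]
  have e2 : q * y = y * p := by rw [← hxy, ← hyx, Matrix.mul_assoc]
  refine ⟨x * q, y * p, ?_, ?_, by rw [Matrix.mul_assoc, hq], by rw [Matrix.mul_assoc, hp]⟩
  · rw [← e1, Matrix.mul_assoc, ← Matrix.mul_assoc x, hxy, hp, hp]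
  · rw [← e2, Matrix.mul_assoc, ← Matrix.mul_assoc y, hyx, hq, hq]

variable {p : Matrix ι ι T} {q : Matrix κ κ T} {w : (Matrix ι ι C(I, R))ˣ}
  {w' : (Matrix κ κ C(I, R))ˣ}

/-- The monodromy of an idempotent matrix of loops. -/
def monodromy (hj : IsLoopAlgebra ε s εT j) (hp : p * p = p) (hw : IsTransport ε εT j p w) :
    (Matrix ι ι R)ˣ :=
  cutUnit (map_idem (map_idem hp εT) (algebraMap ℂ R)) (mapUnit (pathEval 1) w) (hw.conj_one hj)

/-- Read through the two transports, the equivalence `X` gives an invertible path `d` starting at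
`1`, whose end point has trivial class. Multiplied by this end point, the monodromy of `p` becomes
that of `q`, carried over by the scalar part of `X`. -/
lemma k1_monodromy_eq (hj : IsLoopAlgebra ε s εT j) (hp : p * p = p) (hq : q * q = q)
    (h : MvN p q) (hw : IsTransport ε εT j p w) (hw' : IsTransport ε εT j q w') :
    k1 (monodromy hj hp hw) = k1 (monodromy hj hq hw') := by
  obtain ⟨X, Y, hXY, hYX, hXq, hYp⟩ := h.exists_corner hp hq
  have hpX : p * X = X := by rw [← hXY, Matrix.mul_assoc, hYX, hXq]
  have hqY : q * Y = Y := by rw [← hYX, Matrix.mul_assoc, hXY, hYp]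
  have mm : ∀ {S : Type _} [Ring S] (φ : T →+* S), X.map φ * Y.map φ = p.map φ ∧
      Y.map φ * X.map φ = q.map φ ∧ X.map φ * q.map φ = X.map φ ∧ Y.map φ * p.map φ = Y.map φ ∧
      p.map φ * X.map φ = X.map φ ∧ q.map φ * Y.map φ = Y.map φ := fun φ => by
    simp only [← Matrix.map_mul, hXY, hYX, hXq, hYp, hpX, hqY, and_self]
  have hE := mm ((pathScal R).comp εT)
  have hr := mm ((algebraMap ℂ R).comp εT)
  have hh := mm j
  set x := X.map ((pathScal R).comp εT) with hx
  set y := Y.map ((pathScal R).comp εT) with hy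
  set e := p.map ((pathScal R).comp εT) with he
  set f := q.map ((pathScal R).comp εT) with hf
  obtain ⟨hxy, hyx, hxf, hye, hex, hfy⟩ := hE
  have c1 : p.map j * w.1 = w.1 * e := hw.conj
  have c2 : q.map j * w'.1 = w'.1 * f := hw'.conj
  -- In the frames moved by `w` and `w'`, the loops `X` and `Y` become paths of mutually inverse
  -- maps between the constant ranges of `e` and `f`.
  let A := w⁻¹.1 * X.map j * w'.1
  let B := w'⁻¹.1 * Y.map j * w.1
  have hAB : A * B = e := by
    calc A * B = w⁻¹.1 * (X.map j * (w'.1 * w'⁻¹.1) * Y.map j) * w.1 := by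
          simp only [A, B, Matrix.mul_assoc]
      _ = e := by
        rw [Units.mul_inv, Matrix.mul_one, hh.1, mul_assoc, c1, Units.inv_mul_cancel_left]
  have hBA : B * A = f := by
    calc B * A = w'⁻¹.1 * (Y.map j * (w.1 * w⁻¹.1) * X.map j) * w'.1 := by
          simp only [A, B, Matrix.mul_assoc]
      _ = f := by
        rw [Units.mul_inv, Matrix.mul_one, hh.2.1, mul_assoc, c2, Units.inv_mul_cancel_left]
  have heA : e * A = A := by
    rw [← Matrix.mul_assoc, ← Matrix.mul_assoc, mul_unit_inv c1, Matrix.mul_assoc w⁻¹.1,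
      hh.2.2.2.2.1]
  have hAf : A * f = A := by
    rw [Matrix.mul_assoc, ← c2, ← Matrix.mul_assoc, Matrix.mul_assoc w⁻¹.1, hh.2.2.1]
  have hBe : B * e = B := by
    rw [Matrix.mul_assoc, ← c1, ← Matrix.mul_assoc, Matrix.mul_assoc w'⁻¹.1, hh.2.2.2.1]
  -- Composition with the constant equivalence `y` turns `A` into an automorphism of the range of
  -- `e`, equal to the identity at time `0`.
  let d : (Matrix ι ι C(I, R))ˣ := cornerUnit (e := e) (a := A * y) (b := x * B)
    (by rw [Matrix.mul_assoc, ← Matrix.mul_assoc y, hyx, ← Matrix.mul_assoc, hAf, hAB])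
    (by rw [Matrix.mul_assoc, ← Matrix.mul_assoc B, hBA, ← Matrix.mul_assoc, hxf, hxy])
    (by rw [← Matrix.mul_assoc, heA]) (by rw [Matrix.mul_assoc, hye])
    (by rw [← Matrix.mul_assoc, hex]) (by rw [Matrix.mul_assoc, hBe])
  have hd : ∀ t, (mapUnit (pathEval t) d).1 = (mapUnit (pathEval t) w)⁻¹.1 *
      (X.map j).map (pathEval t) * (mapUnit (pathEval t) w').1 *
      Y.map ((algebraMap ℂ R).comp εT) + (1 - p.map ((algebraMap ℂ R).comp εT)) := fun t => by
    change (w⁻¹.1 * X.map j * w'.1 * y + (1 - e)).map (pathEval t) = _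
    rw [Matrix.map_add _ (map_add _), Matrix.map_sub _ (map_sub _),
      Matrix.map_one _ (map_zero _) (map_one _), Matrix.map_mul, Matrix.map_mul, Matrix.map_mul]
    rfl
  have hd0 : mapUnit (pathEval 0) d = 1 := Units.ext <| by
    rw [hd, hw.normalised.zero, hw'.normalised.zero, hj.map_zero, inv_one, Units.val_one,
      Units.val_one, Matrix.one_mul, Matrix.mul_one]
    have hX0 : (X.map εT).map (algebraMap ℂ R) = X.map ((algebraMap ℂ R).comp εT) := rfl
    rw [hX0, hr.1, add_sub_cancel]
  have hd1 : k1 (mapUnit (pathEval 1) d) = 0 := by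
    rw [← k1_eq_of_joined (joined_mapUnit_pathEval d), hd0, k1_one]
  have hm := hw.conj_one hj
  have hm' := hw'.conj_one hj
  rw [← add_zero (k1 _), ← hd1, ← k1_mul]
  have hp0 := map_idem hp ((algebraMap ℂ R).comp εT)
  have hq0 := map_idem hq ((algebraMap ℂ R).comp εT)
  change p.map ((algebraMap ℂ R).comp εT) * _ = _ * p.map ((algebraMap ℂ R).comp εT) at hm
  change q.map ((algebraMap ℂ R).comp εT) * _ = _ * q.map ((algebraMap ℂ R).comp εT) at hm'
  refine k1_corner (x := X.map ((algebraMap ℂ R).comp εT)) (y := Y.map ((algebraMap ℂ R).comp εT))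
    (e := p.map ((algebraMap ℂ R).comp εT)) (f := q.map ((algebraMap ℂ R).comp εT))
    (a := (mapUnit (pathEval 1) w').1 * q.map ((algebraMap ℂ R).comp εT))
    hr.1 hr.2.1 hr.2.2.1 hr.2.2.2.2.2 ?_ ?_ rfl ?_
  · rw [← mul_assoc, hm', mul_assoc, hq0]
  · rw [mul_assoc, hq0]
  · have hX1 : (X.map j).map (pathEval 1) = X.map ((algebraMap ℂ R).comp εT) := hj.map_one X
    rw [Units.val_mul, hd, hX1]
    change ((mapUnit (pathEval 1) w).1 * p.map ((algebraMap ℂ R).comp εT) +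
      (1 - p.map ((algebraMap ℂ R).comp εT))) * _ = _
    set m := mapUnit (pathEval 1) w
    set m' := mapUnit (pathEval 1) w'
    set x0 := X.map ((algebraMap ℂ R).comp εT)
    set y0 := Y.map ((algebraMap ℂ R).comp εT)
    set p0 := p.map ((algebraMap ℂ R).comp εT)
    set q0 := q.map ((algebraMap ℂ R).comp εT)
    have i1 : p0 * (m⁻¹.1 * x0 * m'.1 * y0) = m⁻¹.1 * x0 * m'.1 * y0 := by
      rw [← Matrix.mul_assoc, ← Matrix.mul_assoc, ← Matrix.mul_assoc, mul_unit_inv hm,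
        Matrix.mul_assoc m⁻¹.1, hr.2.2.2.2.1]
    have i2 : m.1 * (m⁻¹.1 * x0 * m'.1 * y0) = x0 * m'.1 * y0 := by
      rw [← Matrix.mul_assoc, ← Matrix.mul_assoc, ← Matrix.mul_assoc, Units.mul_inv,
        Matrix.one_mul]
    have i3 : x0 * (m'.1 * q0) * y0 = x0 * m'.1 * y0 := by
      rw [Matrix.mul_assoc, Matrix.mul_assoc m'.1, hr.2.2.2.2.2, Matrix.mul_assoc]
    rw [i3, add_mul, mul_assoc, mul_add, i1, mul_sub, mul_one, hp0, sub_self, add_zero, i2,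
      sub_mul, one_mul, mul_add, i1, mul_sub, mul_one, hp0, sub_self, add_zero, add_sub_cancel_left]

lemma IsTransport.fromBlocks (hw : IsTransport ε εT j p w) (hw' : IsTransport ε εT j q w') :
    IsTransport ε εT j (Matrix.fromBlocks p 0 0 q) (blockUnit w w') := by
  refine ⟨hw.normalised.blockUnit hw'.normalised, ?_⟩
  change _ * Matrix.fromBlocks w.1 0 0 w'.1 = Matrix.fromBlocks w.1 0 0 w'.1 * _
  simp only [fromBlocks_map, Matrix.map_zero _ (map_zero _), fromBlocks_multiply,
    Matrix.mul_zero, Matrix.zero_mul, add_zero, zero_add, hw.conj, hw'.conj]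

lemma k1_monodromy_fromBlocks (hj : IsLoopAlgebra ε s εT j) (hp : p * p = p) (hq : q * q = q)
    (hw : IsTransport ε εT j p w) (hw' : IsTransport ε εT j q w') :
    k1 (monodromy hj (fromBlocks_idem hp hq) (hw.fromBlocks hw'))
      = k1 (monodromy hj hp hw) + k1 (monodromy hj hq hw') := by
  rw [← k1_blockUnit]
  congr 1
  apply Units.ext
  change (mapUnit (pathEval 1) (blockUnit w w')).1 * ((Matrix.fromBlocks p 0 0 q).map εT).map
    (algebraMap ℂ R) + (1 - ((Matrix.fromBlocks p 0 0 q).map εT).map (algebraMap ℂ R))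
    = Matrix.fromBlocks ((mapUnit (pathEval 1) w).1 * (p.map εT).map (algebraMap ℂ R) +
      (1 - (p.map εT).map (algebraMap ℂ R))) 0 0 ((mapUnit (pathEval 1) w').1 *
      (q.map εT).map (algebraMap ℂ R) + (1 - (q.map εT).map (algebraMap ℂ R)))
  rw [mapUnit_blockUnit]
  change Matrix.fromBlocks (mapUnit (pathEval 1) w).1 0 0 (mapUnit (pathEval 1) w').1 * _ + _ = _
  rw [← fromBlocks_one]
  simp only [fromBlocks_map, Matrix.map_zero _ (map_zero _), fromBlocks_multiply,
    Matrix.mul_zero, Matrix.zero_mul, add_zero, zero_add, sub_eq_add_neg, fromBlocks_neg,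
    fromBlocks_add, neg_zero]

/-- The homomorphism `K₀(T) → K₁(R)` which maps the class of an idempotent matrix of loops to the
class of its monodromy. -/
def monodromyMap [CompleteSpace R] (hj : IsLoopAlgebra ε s εT j) : RingK0 T →+ RingK1 R :=
  RingK0.lift (fun {_} _ he => k1 (monodromy hj he (hj.exists_transport he).choose_spec))
    (fun he hf hef => k1_monodromy_eq hj he hf hef _ _)
    (fun he hf h => by
      rw [← k1_monodromy_fromBlocks]
      exact k1_monodromy_eq hj h (fromBlocks_idem he hf) (mvn_blockSum he hf) _ _)

lemma monodromyMap_k0 [CompleteSpace R] (hj : IsLoopAlgebra ε s εT j) (hp : p * p = p)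
    (hw : IsTransport ε εT j p w) : monodromyMap hj (k0 p hp) = k1 (monodromy hj hp hw) :=
  k1_monodromy_eq hj (submatrix_idem hp _) hp (MvN.submatrix hp _) _ hw

lemma IsTransport.scal (hj : IsLoopAlgebra ε s εT j) (c : Matrix ι ι ℂ) :
    IsTransport ε εT j (c.map s) 1 := by
  refine ⟨.one, ?_⟩
  rw [Units.val_one, one_mul, mul_one]
  refine Matrix.ext fun i k => ?_
  change j (s (c i k)) = pathScal R (εT (s (c i k)))
  rw [hj.scal, hj.aug_scal]

lemma monodromyMap_scal [CompleteSpace R] (hj : IsLoopAlgebra ε s εT j) {c : Matrix ι ι ℂ}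
    (hc : c * c = c) : monodromyMap hj (k0 (c.map s) (map_idem hc s)) = 0 := by
  rw [monodromyMap_k0 hj _ (IsTransport.scal hj c), ← k1_one (ι := ι)]
  congr 1
  apply Units.ext
  rw [monodromy, cutUnit_val, mapUnit_one, Units.val_one, one_mul, add_sub_cancel]

lemma mapUnit_monodromy (hj : IsLoopAlgebra ε s εT j) (hp : p * p = p)
    (hw : IsTransport ε εT j p w) : mapUnit ε (monodromy hj hp hw) = 1 := Units.ext <| by
  change ((mapUnit (pathEval 1) w).1 * (p.map εT).map (algebraMap ℂ R) +
      (1 - (p.map εT).map (algebraMap ℂ R))).map ε = 1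
  rw [Matrix.map_add _ (map_add _), Matrix.map_sub _ (map_sub _), Matrix.map_mul,
    Matrix.map_one _ (map_zero _) (map_one _), mat_aug_algebraMap hj]
  have : (mapUnit (pathEval 1) w).1.map ε = 1 := hw.normalised.val_aug 1
  rw [this, one_mul, add_sub_cancel]

/-- The class does not depend on the transport, and for the transport in `Realizes` the matrices `x`
and `y` identify the monodromy with `g`. -/
lemma Realizes.k1_monodromy (hj : IsLoopAlgebra ε s εT j) {g : (Matrix μ μ R)ˣ}
    (h : Realizes ε εT j g p) (hw : IsTransport ε εT j p w) :
    k1 (monodromy hj h.1 hw) = k1 g := by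
  obtain ⟨hp, w', hw', x, y, hxy, hyx, hwy⟩ := h
  rw [k1_monodromy_eq hj hp hp (MvN.refl hp) hw hw']
  have hXY := mul_map_eq_one (algebraMap ℂ R) hxy
  have hYX : y.map (algebraMap ℂ R) * x.map (algebraMap ℂ R) = (p.map εT).map (algebraMap ℂ R) := by
    rw [← Matrix.map_mul, hyx]
  refine k1_corner (x := y.map (algebraMap ℂ R)) (y := x.map (algebraMap ℂ R))
    (f := 1) (a := g.1) hYX hXY (Matrix.mul_one _) (Matrix.one_mul _) (one_mul _) (mul_one _)
    (by rw [sub_self, add_zero]) ?_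
  rw [monodromy, cutUnit_val, ← hwy, Matrix.mul_assoc, hYX]

/-- The idempotent attached to `g` has as its monodromy `g` divided by its scalar part, and the
subtracted identity matrix has trivial monodromy. -/
lemma monodromyMap_loopMap [CompleteSpace R] (hj : IsLoopAlgebra ε s εT j) (g : (Matrix ι ι R)ˣ) :
    monodromyMap hj (loopMap hj (k1 g))
      = k1 g - k1 (mapUnit ((algebraMap ℂ R).comp ε) g) := by
  obtain ⟨p, hp⟩ := Realizes.exists_normUnit hj g
  obtain ⟨w, hw⟩ := hj.exists_transport hp.1
  have h1 : monodromyMap hj (k0 (1 : Matrix ι ι T) (mul_one 1)) = 0 := by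
    have := monodromyMap_scal hj (mul_one (1 : Matrix ι ι ℂ))
    simpa only [Matrix.map_one _ (map_zero s) (map_one s)] using this
  rw [loopMap_k1, loopClass_eq hj hp, map_sub, h1, sub_zero, monodromyMap_k0 hj hp.1 hw,
    hp.k1_monodromy hj hw, normUnit, k1_mul, k1_inv, sub_eq_add_neg]

/-- Adding the constant complement of the scalar part, with trivial monodromy, fills the scalar part
up to something equivalent to `1`. On this full model the total monodromy is the cut-down matrix
extended by `1`. -/
lemma Realizes.monodromy (hj : IsLoopAlgebra ε s εT j) (hp : p * p = p)
    (hw : IsTransport ε εT j p w) : Realizes ε εT j (monodromy hj hp hw)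
      (fromBlocks p 0 0 ((1 - p.map εT).map s)) := by
  have hp0 := map_idem hp εT
  have hp1 : (1 - p.map εT) * (1 - p.map εT) = 1 - p.map εT := IsIdempotentElem.one_sub hp0
  have hs : ∀ c : Matrix ι ι ℂ, (c.map s).map εT = c := fun c =>
    Matrix.ext fun _ _ => hj.aug_scal _
  have h1 : p.map εT * (1 - p.map εT) = 0 := by rw [mul_sub, mul_one, hp0, sub_self]
  have h2 : (1 - p.map εT) * p.map εT = 0 := by rw [sub_mul, one_mul, hp0, sub_self]
  refine ⟨fromBlocks_idem hp (map_idem hp1 s), _, hw.fromBlocks (IsTransport.scal hj _),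
    fromCols (p.map εT) (1 - p.map εT), fromRows (p.map εT) (1 - p.map εT), ?_, ?_, ?_⟩
  · rw [fromCols_mul_fromRows, hp0, hp1, add_sub_cancel]
  · rw [fromRows_mul_fromCols, hp0, hp1, h1, h2, fromBlocks_map, hs]
    simp
  · rw [mapUnit_blockUnit, mapUnit_one]
    change Matrix.fromBlocks (mapUnit (pathEval 1) w).1 0 0 1 * _ = _ *
      ((mapUnit (pathEval 1) w).1 * (p.map εT).map (algebraMap ℂ R) +
        (1 - (p.map εT).map (algebraMap ℂ R)))
    have hr0 := map_idem hp0 (algebraMap ℂ R)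
    have hm := hw.conj_one hj
    rw [fromRows_map, fromBlocks_mul_fromRows, fromRows_mul, Matrix.map_sub _ (map_sub _),
      Matrix.map_one _ (map_zero _) (map_one _)]
    set r := (p.map εT).map (algebraMap ℂ R)
    set m := (mapUnit (pathEval 1) w).1
    congr 1
    · have : r * (1 - r) = 0 := by rw [mul_sub, mul_one, hr0, sub_self]
      rw [mul_add, ← mul_assoc, hm, mul_assoc, hr0, this]
      simp
    · have h3 : (1 - r) * (1 - r) = 1 - r := IsIdempotentElem.one_sub hr0
      have h4 : (1 - r) * r = 0 := by rw [sub_mul, one_mul, hr0, sub_self]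
      rw [mul_add, h3, ← hm, ← mul_assoc, h4]
      simp

/-- With `p₀` the scalar part of `p`, regarded as constant, `Realizes.monodromy` gives `[p] + [1 -
p₀] - [1] = [p] - [p₀]`. -/
lemma loopMap_monodromyMap [CompleteSpace R] (hj : IsLoopAlgebra ε s εT j) (hp : p * p = p) :
    loopMap hj (monodromyMap hj (k0 p hp))
      = k0 p hp - k0 ((p.map εT).map s) (map_idem (map_idem hp εT) s) := by
  obtain ⟨w, hw⟩ := hj.exists_transport hp
  have hp0 := map_idem hp εT
  have hp1 : (1 - p.map εT) * (1 - p.map εT) = 1 - p.map εT := IsIdempotentElem.one_sub hp0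
  have h := Realizes.monodromy hj hp hw
  rw [← normUnit_eq (mapUnit_monodromy hj hp hw)] at h
  have key : k0 (1 : Matrix ι ι T) (mul_one 1)
      = k0 ((p.map εT).map s) (map_idem hp0 s) + k0 ((1 - p.map εT).map s) (map_idem hp1 s) := by
    rw [← k0_fromBlocks]
    refine k0_eq_of_mvn _ _ ⟨fromCols ((p.map εT).map s) ((1 - p.map εT).map s),
      fromRows ((p.map εT).map s) ((1 - p.map εT).map s), ?_, ?_⟩
    · rw [fromCols_mul_fromRows, map_idem hp0 s, map_idem hp1 s, ← Matrix.map_add _ (map_add s),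
        add_sub_cancel, Matrix.map_one _ (map_zero s) (map_one s)]
    · rw [fromRows_mul_fromCols, map_idem hp0 s, map_idem hp1 s, ← Matrix.map_mul,
        ← Matrix.map_mul, mul_sub, sub_mul, mul_one, one_mul, hp0, sub_self,
        Matrix.map_zero _ (map_zero s)]
  rw [monodromyMap_k0 hj hp hw, loopMap_k1, loopClass_eq hj h, k0_fromBlocks hp (map_idem hp1 s),
    key]
  abel

/-- Suspension isomorphism: the reduced `K₀`-group of the loop algebra is the reduced
`K₁`-group. -/
def loopEquiv [CompleteSpace R] (hj : IsLoopAlgebra ε s εT j) :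
    (RingK0.map εT).ker ≃+ (RingK1.map ε hj.continuous_aug).ker := by
  have h1 : ∀ z, RingK1.map ε hj.continuous_aug (monodromyMap hj z) = 0 := by
    refine DFunLike.congr_fun (f := (RingK1.map ε hj.continuous_aug).comp (monodromyMap hj))
      (g := 0) (RingK0.hom_ext fun n e he => ?_)
    obtain ⟨w, hw⟩ := hj.exists_transport he
    rw [← k0_fin he]
    change RingK1.map ε hj.continuous_aug (monodromyMap hj (k0 e he)) = 0
    rw [monodromyMap_k0 hj he hw, RingK1.map_k1, mapUnit_monodromy, k1_one]
  -- The two maps are inverse up to the classes of scalar parts, which vanish on the kernels of the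
  -- augmentations.
  have h2 : ∀ z, loopMap hj (monodromyMap hj z) = z - RingK0.map s (RingK0.map εT z) := by
    refine DFunLike.congr_fun (f := (loopMap hj).comp (monodromyMap hj))
      (g := AddMonoidHom.id _ - (RingK0.map s).comp (RingK0.map εT))
      (RingK0.hom_ext fun n e he => ?_)
    rw [← k0_fin he]
    exact loopMap_monodromyMap hj he
  have h3 : ∀ z, monodromyMap hj (loopMap hj z) = z - RingK1.map (algebraMap ℂ R)
      (continuous_algebraMap ℂ R) (RingK1.map ε hj.continuous_aug z) := by
    refine DFunLike.congr_fun (f := (monodromyMap hj).comp (loopMap hj))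
      (g := AddMonoidHom.id _ - (RingK1.map (algebraMap ℂ R)
      (continuous_algebraMap ℂ R)).comp (RingK1.map ε hj.continuous_aug))
      (RingK1.hom_ext fun n g => ?_)
    rw [← k1_fin g]
    change monodromyMap hj (loopMap hj (k1 g)) = k1 g - RingK1.map (algebraMap ℂ R)
      (continuous_algebraMap ℂ R) (RingK1.map ε hj.continuous_aug (k1 g))
    rw [monodromyMap_loopMap, RingK1.map_k1, RingK1.map_k1, mapUnit_mapUnit]
  have h4 : ∀ z, RingK0.map εT (loopMap hj z) = 0 := by
    refine DFunLike.congr_fun (f := (RingK0.map εT).comp (loopMap hj))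
      (g := 0) (RingK1.hom_ext fun n g => ?_)
    obtain ⟨p, hp⟩ := Realizes.exists_normUnit hj g
    rw [← k1_fin g]
    change RingK0.map εT (loopMap hj (k1 g)) = 0
    obtain ⟨hp', w, hw, x, y, hxy, hyx, hwy⟩ := id hp
    rw [loopMap_k1, loopClass_eq hj hp, map_sub, RingK0.map_k0, RingK0.map_k0, sub_eq_zero]
    refine k0_eq_of_mvn _ _ ⟨y, x, hyx, ?_⟩
    rw [hxy, Matrix.map_one _ (map_zero εT) (map_one εT)]
  exact
    { toFun := fun z => ⟨monodromyMap hj z.1, h1 _⟩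
      invFun := fun z => ⟨loopMap hj z.1, h4 _⟩
      left_inv := fun z => Subtype.ext <| by
        have hz : RingK0.map εT z.1 = 0 := z.2
        change loopMap hj (monodromyMap hj z.1) = z.1
        rw [h2, hz, map_zero, sub_zero]
      right_inv := fun z => Subtype.ext <| by
        have hz : RingK1.map ε hj.continuous_aug z.1 = 0 := z.2
        change monodromyMap hj (loopMap hj z.1) = z.1
        rw [h3, hz, map_zero, sub_zero]
      map_add' := fun y z => Subtype.ext (map_add (monodromyMap hj) y.1 z.1) }

end Monodromy

/-! ### The unitalised suspension as a loop algebra. -/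

section Suspension

open unitInterval

namespace BanachAlg

variable {A : BanachAlg.{v}}

/-- The sigmoid identifies `ℝ` with the open unit interval, so functions in `C₀(ℝ, A)` become paths
in `A` that vanish at both ends. -/
lemma isOpenEmbedding_sigmoid : IsOpenEmbedding unitInterval.sigmoid :=
  ⟨Topology.isEmbedding_sigmoid, by rw [unitInterval.range_sigmoid]; exact isOpen_Ioo⟩

lemma sigmoid_or (t : I) : (∃ x, unitInterval.sigmoid x = t) ∨ t = 0 ∨ t = 1 := by
  by_cases ht : t ∈ Set.range unitInterval.sigmoid
  · exact Or.inl ht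
  · rw [unitInterval.range_sigmoid, Set.mem_Ioo, not_and_or, not_lt, not_lt] at ht
    exact Or.inr (ht.imp (fun h => le_antisymm h t.2.1) fun h => le_antisymm t.2.2 h)

/-- The extension of a function on `ℝ` by zero to the compactification `[0, 1]`. -/
def sigmoidExtend (h : ℝ → A) (t : I) : A := Function.extend unitInterval.sigmoid h 0 t

lemma sigmoidExtend_sigmoid (h : ℝ → A) (x : ℝ) : sigmoidExtend h (unitInterval.sigmoid x) = h x :=
  unitInterval.sigmoid_injective.extend_apply _ _ _

lemma sigmoidExtend_of_not_mem (h : ℝ → A) {t : I} (ht : ¬ ∃ x, unitInterval.sigmoid x = t) :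
    sigmoidExtend h t = 0 :=
  Function.extend_apply' _ _ _ ht

lemma sigmoidExtend_zero (h : ℝ → A) : sigmoidExtend h 0 = 0 :=
  sigmoidExtend_of_not_mem h fun ⟨x, hx⟩ => (unitInterval.sigmoid_pos x).ne' hx

lemma sigmoidExtend_one (h : ℝ → A) : sigmoidExtend h 1 = 0 :=
  sigmoidExtend_of_not_mem h fun ⟨x, hx⟩ => (unitInterval.sigmoid_lt_one x).ne hx

/-- At the end points, continuity is vanishing at infinity: the extension is small off the image of
a compact set, which is closed and avoids the ends. -/
lemma continuous_sigmoidExtend (h : C₀(ℝ, A)) : Continuous (sigmoidExtend h) := by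
  refine continuous_iff_continuousAt.2 fun t => ?_
  by_cases ht : ∃ x, unitInterval.sigmoid x = t
  · obtain ⟨x, rfl⟩ := ht
    refine isOpenEmbedding_sigmoid.continuousAt_iff.1 ?_
    rw [show sigmoidExtend h ∘ unitInterval.sigmoid = h from funext (sigmoidExtend_sigmoid h)]
    exact h.continuous.continuousAt
  · rw [ContinuousAt, sigmoidExtend_of_not_mem h ht, Metric.tendsto_nhds]
    intro ε hε
    obtain ⟨K, hK, hK'⟩ := c0_exists_compact h hε
    have hc := (hK.image unitInterval.continuous_sigmoid).isClosed
    filter_upwards [hc.isOpen_compl.mem_nhds fun ⟨x, _, hx⟩ => ht ⟨x, hx⟩] with u hu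
    rw [dist_zero_right]
    by_cases hu' : ∃ x, unitInterval.sigmoid x = u
    · obtain ⟨x, rfl⟩ := hu'
      rw [sigmoidExtend_sigmoid]
      exact hK' x fun hx => hu ⟨x, hx, rfl⟩
    · rwa [sigmoidExtend_of_not_mem h hu', norm_zero]

variable (A) in
/-- The evaluation of loops in `A` at a point of the circle `[0, 1] / {0, 1}`. -/
def loopEval (t : I) : A.S.Hom A where
  toHom :=
    { toFun := fun h : C₀(ℝ, A) => sigmoidExtend h t
      map_smul' := fun c h => by
        by_cases ht : ∃ x, unitInterval.sigmoid x = t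
        · obtain ⟨x, rfl⟩ := ht
          exact (sigmoidExtend_sigmoid _ x).trans (congrArg (fun z : A => c • z)
            (sigmoidExtend_sigmoid (show C₀(ℝ, A) from h) x).symm)
        · change sigmoidExtend _ t = c • sigmoidExtend _ t
          rw [sigmoidExtend_of_not_mem _ ht, sigmoidExtend_of_not_mem _ ht, smul_zero]
      map_zero' := by
        by_cases ht : ∃ x, unitInterval.sigmoid x = t
        · obtain ⟨x, rfl⟩ := ht
          exact sigmoidExtend_sigmoid _ x
        · exact sigmoidExtend_of_not_mem _ ht
      map_add' := fun h k => by
        by_cases ht : ∃ x, unitInterval.sigmoid x = t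
        · obtain ⟨x, rfl⟩ := ht
          exact (sigmoidExtend_sigmoid _ x).trans (congrArg₂ (· + ·)
            (sigmoidExtend_sigmoid _ x).symm (sigmoidExtend_sigmoid _ x).symm)
        · change sigmoidExtend _ t = sigmoidExtend _ t + sigmoidExtend _ t
          rw [sigmoidExtend_of_not_mem _ ht, sigmoidExtend_of_not_mem _ ht,
            sigmoidExtend_of_not_mem _ ht, add_zero]
      map_mul' := fun h k => by
        by_cases ht : ∃ x, unitInterval.sigmoid x = t
        · obtain ⟨x, rfl⟩ := ht
          exact (sigmoidExtend_sigmoid _ x).trans (congrArg₂ (· * ·)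
            (sigmoidExtend_sigmoid _ x).symm (sigmoidExtend_sigmoid _ x).symm)
        · change sigmoidExtend _ t = sigmoidExtend _ t * sigmoidExtend _ t
          rw [sigmoidExtend_of_not_mem _ ht, sigmoidExtend_of_not_mem _ ht,
            sigmoidExtend_of_not_mem _ ht, mul_zero] }
  cont := by
    refine AddMonoidHomClass.continuous_of_bound _ 1 fun f => ?_
    rw [one_mul]
    change ‖sigmoidExtend (show C₀(ℝ, A) from f) t‖ ≤ _
    by_cases ht : ∃ x, unitInterval.sigmoid x = t
    · obtain ⟨x, rfl⟩ := ht
      rw [sigmoidExtend_sigmoid]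
      exact c0_norm_apply_le (show C₀(ℝ, A) from f) x
    · rw [sigmoidExtend_of_not_mem _ ht, norm_zero]
      exact norm_nonneg _

lemma Hom.plus_eq {B : BanachAlg.{w}} (φ : A.Hom B) (x : A.Plus) :
    φ.plus x = algebraMap ℂ B.Plus (A.aug x) + toPlus (φ.toHom (WithLp.ofLp x).snd) := by
  nth_rewrite 1 [BanachAlg.plus_eq x]
  rw [map_add, φ.plus_algebraMap, φ.plus_toPlus]

lemma continuous_plus_snd : Continuous fun x : A.Plus => (WithLp.ofLp x).snd :=
  AddMonoidHomClass.continuous_of_bound ({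
    toFun := fun x => (WithLp.ofLp x).snd
    map_zero' := rfl
    map_add' := fun _ _ => rfl } : A.Plus →+ A) 1 fun x => by
      rw [one_mul, WithLp.unitization_norm_def]
      exact le_add_of_nonneg_left (norm_nonneg _)

variable (A) in
/-- The unitalisation of the suspension of `A`, as an algebra of loops. -/
def loopHom : A.S.Plus →+* C(I, A.Plus) where
  toFun x := ⟨fun t => (A.loopEval t).plus x, by
    simp only [Hom.plus_eq]
    exact continuous_const.add (continuous_toPlus.comp
      (continuous_sigmoidExtend (show C₀(ℝ, A) from (WithLp.ofLp x).snd)))⟩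
  map_one' := ContinuousMap.ext fun t => map_one (A.loopEval t).plus
  map_mul' _ _ := ContinuousMap.ext fun t => map_mul (A.loopEval t).plus _ _
  map_zero' := ContinuousMap.ext fun t => map_zero (A.loopEval t).plus
  map_add' _ _ := ContinuousMap.ext fun t => map_add (A.loopEval t).plus _ _

lemma loopHom_apply (x : A.S.Plus) (t : I) : A.loopHom x t = algebraMap ℂ A.Plus (A.S.aug x) +
    toPlus (sigmoidExtend (show C₀(ℝ, A) from (WithLp.ofLp x).snd) t) :=
  (A.loopEval t).plus_eq x

-- Adjoining a unit to the suspension adds the constant scalar paths, so exactly the paths with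
-- constant scalar part and scalar end points arise.
variable (A) in
lemma isLoopAlgebra_suspension :
    IsLoopAlgebra A.aug (algebraMap ℂ A.S.Plus) A.S.aug A.loopHom where
  continuous_aug := A.continuous_aug
  aug_algebraMap := aug_algebraMap
  injective x y h := by
    have haug : ∀ z t, A.aug (A.loopHom z t) = A.S.aug z := fun z t => (A.loopEval t).aug_plus z
    have h1 : A.S.aug x = A.S.aug y := by rw [← haug x 0, h, haug]
    rw [plus_eq x, plus_eq y, h1]
    congr 2
    refine ZeroAtInftyContinuousMap.ext fun r => ?_
    have h2 := DFunLike.congr_fun h (unitInterval.sigmoid r)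
    rw [loopHom_apply, loopHom_apply, h1, add_right_inj, sigmoidExtend_sigmoid,
      sigmoidExtend_sigmoid] at h2
    exact congrArg (fun z : A.Plus => (WithLp.ofLp z).snd) h2
  aug x t := (A.loopEval t).aug_plus x
  zero x := by
    rw [loopHom_apply, sigmoidExtend_zero]
    exact add_zero _
  one x := by
    rw [loopHom_apply, sigmoidExtend_one]
    exact add_zero _
  scal c := ContinuousMap.ext fun t => (A.loopEval t).plus_algebraMap c
  exists_eq f c h0 h1 hc := by
    -- The component of the path in `A`, pulled back along the sigmoid; it vanishes at infinity
    -- because both ends are scalar.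
    let h : C₀(ℝ, A) :=
      { toFun := fun x => (WithLp.ofLp (f (unitInterval.sigmoid x))).snd
        continuous_toFun := continuous_plus_snd.comp
          (f.continuous.comp unitInterval.continuous_sigmoid)
        zero_at_infty' := by
          have hf := continuous_plus_snd.comp f.continuous
          rw [cocompact_eq_atBot_atTop, tendsto_sup]
          have t0 := (hf.tendsto 0).comp unitInterval.tendsto_sigmoid_atBot
          have t1 := (hf.tendsto 1).comp unitInterval.tendsto_sigmoid_atTop
          rw [Function.comp_apply, h0] at t0
          rw [Function.comp_apply, h1] at t1
          exact ⟨t0, t1⟩ }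
    refine ⟨algebraMap ℂ A.S.Plus c + toPlus (show A.S from h), ContinuousMap.ext fun t => ?_⟩
    rw [map_add]
    change (A.loopEval t).plus (algebraMap ℂ A.S.Plus c) + (A.loopEval t).plus (toPlus _) = f t
    rw [Hom.plus_algebraMap, Hom.plus_toPlus]
    change _ + toPlus (sigmoidExtend h t) = f t
    rcases sigmoid_or t with ⟨x, rfl⟩ | rfl | rfl
    · rw [sigmoidExtend_sigmoid, plus_eq (f _), hc]
      rfl
    · rw [sigmoidExtend_zero, h0]
      exact add_zero _
    · rw [sigmoidExtend_one, h1]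
      exact add_zero _

variable (A) in
/-- The suspension isomorphism in K-theory. -/
theorem nonempty_suspension_equiv : ∀ n, Nonempty (BanachAlg.K n A.S ≃+ BanachAlg.K (n + 1) A)
  -- Only the passage from `K₀` to `K₁` has content; beyond it the isomorphism is the definition of
  -- `K_n`.
  | 0 => ⟨loopEquiv A.isLoopAlgebra_suspension⟩
  | _ + 1 => ⟨AddEquiv.refl _⟩

end BanachAlg

end Suspension

end BanachGroupoid

end

open BanachGroupoid

theorem mainTheorem9 :
    -- groupoids
    (∀ (U : Type*) [Groupoid U] [TopologicalSpace U] [TopologicalSpace (Arr U)]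
      [IsTopologicalGroupoid U] [T2Space (Arr U)] [LocallyCompactSpace (Arr U)]
      (lam : HaarSystem U) (N : UnconditionalNorm lam) (B : GBanachAlgebra U),
      -- the canonical homomorphism for a general space `X`
      (∀ (X : Type*) [TopologicalSpace X] [T2Space X] [LocallyCompactSpace X],
        IsC0BanachAlgebra X (N.algebra (B.extC0 X)) N.c0Act ∧
        IsC0BanachAlgebra X ((N.algebra B).C0 X) (BanachAlg.C0.act X (N.algebra B)) ∧
        ∃ ι : (N.algebra (B.extC0 X)).Hom ((N.algebra B).C0 X),
          N.IsCanonical ι ∧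
          ι.IsC0Hom N.c0Act (BanachAlg.C0.act X (N.algebra B)) ∧
          IsIsometricOnFibres N.c0Act (BanachAlg.C0.act X (N.algebra B)) ι ∧
          (SecondCountableTopology X → ι.IsFull ∧ ∀ n, Function.Bijective (ι.K n))) ∧
      -- the suspension
      (∃ ι : (N.algebra (B.extC0 ℝ)).Hom (N.algebra B).S,
        N.IsCanonical ι ∧ ∀ n, Function.Bijective (ι.K n)) ∧
      (∀ n, Nonempty (BanachAlg.K n (N.algebra B).S ≃+ BanachAlg.K (n + 1) (N.algebra B)))) ∧
    -- groups
    (∀ (G : Type*) [Group G] [TopologicalSpace G] [IsTopologicalGroup G] [T2Space G]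
      [LocallyCompactSpace G] [MeasurableSpace G] [BorelSpace G]
      (μ : MeasureTheory.Measure G) [μ.IsHaarMeasure] [μ.Regular]
      (N : GroupUnconditionalNorm μ) (B : GroupBanachAlgebra G),
      (∀ (X : Type*) [TopologicalSpace X] [T2Space X] [LocallyCompactSpace X],
        IsC0BanachAlgebra X (N.toGroupoid.algebra (B.toGroupoid.extC0 X)) N.toGroupoid.c0Act ∧
        IsC0BanachAlgebra X ((N.toGroupoid.algebra B.toGroupoid).C0 X)
          (BanachAlg.C0.act X (N.toGroupoid.algebra B.toGroupoid)) ∧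
        ∃ ι : (N.toGroupoid.algebra (B.toGroupoid.extC0 X)).Hom
            ((N.toGroupoid.algebra B.toGroupoid).C0 X),
          N.toGroupoid.IsCanonical ι ∧
          ι.IsC0Hom N.toGroupoid.c0Act
            (BanachAlg.C0.act X (N.toGroupoid.algebra B.toGroupoid)) ∧
          IsIsometricOnFibres N.toGroupoid.c0Act
            (BanachAlg.C0.act X (N.toGroupoid.algebra B.toGroupoid)) ι ∧
          (SecondCountableTopology X → ι.IsFull ∧ ∀ n, Function.Bijective (ι.K n))) ∧
      (∃ ι : (N.toGroupoid.algebra (B.toGroupoid.extC0 ℝ)).Hom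
          (N.toGroupoid.algebra B.toGroupoid).S,
        N.toGroupoid.IsCanonical ι ∧ ∀ n, Function.Bijective (ι.K n)) ∧
      (∀ n, Nonempty (BanachAlg.K n (N.toGroupoid.algebra B.toGroupoid).S ≃+
        BanachAlg.K (n + 1) (N.toGroupoid.algebra B.toGroupoid)))) := by
  -- The group case is the groupoid case for the one-object groupoid of `G`, and for `X = ℝ` the
  -- target of `ι` is the suspension by definition.
  refine ⟨fun U _ _ _ _ _ _ lam N B => ⟨fun X _ _ _ => ⟨N.isC0BanachAlgebra B X,
      BanachAlg.isC0BanachAlgebra_C0 X _, N.canonicalHom B X, N.isCanonical_canonicalHom,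
      N.isC0Hom_canonicalHom B X, N.isIsometricOnFibres_canonicalHom X B, fun _ =>
      ⟨N.isFull_canonicalHom B X, (N.isFull_canonicalHom B X).isIsoradial.bijective_K⟩⟩,
      ⟨N.canonicalHom B ℝ, N.isCanonical_canonicalHom,
        (N.isFull_canonicalHom B ℝ).isIsoradial.bijective_K⟩,
      BanachAlg.nonempty_suspension_equiv _⟩,
    fun G _ _ _ _ _ _ _ μ _ _ N B => ⟨fun X _ _ _ => ⟨N.toGroupoid.isC0BanachAlgebra B.toGroupoid X,
      BanachAlg.isC0BanachAlgebra_C0 X _, N.toGroupoid.canonicalHom B.toGroupoid X,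
      N.toGroupoid.isCanonical_canonicalHom, N.toGroupoid.isC0Hom_canonicalHom B.toGroupoid X,
      N.toGroupoid.isIsometricOnFibres_canonicalHom X B.toGroupoid, fun _ =>
      ⟨N.toGroupoid.isFull_canonicalHom B.toGroupoid X,
        (N.toGroupoid.isFull_canonicalHom B.toGroupoid X).isIsoradial.bijective_K⟩⟩,
      ⟨N.toGroupoid.canonicalHom B.toGroupoid ℝ, N.toGroupoid.isCanonical_canonicalHom,
        (N.toGroupoid.isFull_canonicalHom B.toGroupoid ℝ).isIsoradial.bijective_K⟩,
      BanachAlg.nonempty_suspension_equiv _⟩⟩
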